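/- **Notation.** Let $N\ge 1$ be an integer, $p$ a prime with $p\nmid N$, and $k$ an integer. For an integer $M\ge1$ let $\Gamma_0^{(2)}(M)=\{\left(\begin{smallmatrix}A&B\\C&D\end{smallmatrix}\right)\in \mathrm{Sp}_2(\mathbf Z): C\equiv 0 \bmod M\}$ (matrices of size $4$), and let $S_k^{(2)}(M)$ be the space of Siegel cusp forms of degree $2$ and weight $k$ for $\Gamma_0^{(2)}(M)$ on Siegel's upper half space $\mathbf H_2$. Put $\mu(p)=[\Gamma_0^{(2)}(N):\Gamma_0^{(2)}(Np)]$. For $M=\left(\begin{smallmatrix}A&B\\C&D\end{smallmatrix}\right)\in \mathrm{GSp}_2^+(\mathbf R)$ with $MJM^t=r(M)J$ let $(F|_kM)(Z)=r(M)^k\det(CZ+D)^{-k}F((AZ+B)(CZ+D)^{-1})$. For subgroups $\Gamma_1,\Gamma_2$ of the above kind and an integral $g$ with $\Gamma_1g\Gamma_2=\bigsqcup_i\Gamma_1\alpha_i$, let $F|(\Gamma_1g\Gamma_2)=r(g)^{k-3}\sum_iF|_k\alpha_i$. Define * $T_S(p^a,p^b,p^c,p^d)=\Gamma_0^{(2)}(N)\,\mathrm{diag}(p^a,p^b,p^c,p^d)\,\Gamma_0^{(2)}(N)$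 for $a+c=b+d$, $T_S(p)=T_S(1,1,p,p)$, $T_S(p^2)=T_S(1,1,p^2,p^2)+T_S(1,p,p^2,p)+T_S(p,p,p,p)$ and $T_S'(p)=T_S(p)^2-T_S(p^2)$; * $U_S(p)=\Gamma_0^{(2)}(Np)\,\mathrm{diag}(1,1,p,p)\,\Gamma_0^{(2)}(Np)$ and $U_S(p)^*=\Gamma_0^{(2)}(Np)\,\mathrm{diag}(p,p,1,1)\,\Gamma_0^{(2)}(Np)$; * $\mathrm{Tr}\colon H\mapsto\sum_{\gamma\in\Gamma_0^{(2)}(Np)\backslash\Gamma_0^{(2)}(N)}H|_k\gamma$; * $F|W_p=F|_k\left(\begin{smallmatrix}p\alpha 1_2&1_2\\Np\beta 1_2&p1_2\end{smallmatrix}\right)$, where $\alpha,\beta$ are any integers with $p\alpha-N\beta=1$. Let $\langle F,G\rangle_{Np}=\int_{\Gamma_0^{(2)}(Np)\backslash\mathbf H_2}F(Z)\overline{G(Z)}\det(Y)^{k-3}\,dX\,dY$ be the non-normalised Petersson product of level $Np$ (the integral may be taken over any fundamental domain). **Theorem.** Let $F,F'\in S_k^{(2)}(N)$. 1. If $F'|T_S(p)=\lambda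 F'$, then $$\langle F|U_S(p),F'|U_S(p)\rangle_{Np}=\mu(p)^{-1}\left(p^2(p-1)\lambda^2+p^{2k-4}\mu(p)\right)\langle F,F'\rangle_{Np}.$$ 2. If $F|T_S(p)=\lambda F$, then $$\langle F',F|W_p\rangle_{Np}=p^{3-k}\lambda\,\mu(p)^{-1}\langle F',F\rangle_{Np}.$$ 3. If $F|T_S(p)=\lambda F$, then $$\langle F|U_S(p),F'\rangle_{Np}=p^{3}\lambda\,\mu(p)^{-1}\langle F,F'\rangle_{Np}.$$ 4. If $F|T_S(p)=\lambda F$ and $F|T_S'(p)=\lambda'F$, then $$\langle F|U_S(p),F'|W_p\rangle_{Np}=p^{3-k}\mu(p)^{-1}\left(\lambda^2-\left(1+\tfrac1p\right)\lambda'+p^{2k-5}(p+1)\right)\langle F,F'\rangle_{Np}.$$ 5. If $F|T_S(p)=\lambda F$ and $F|T_S'(p)=\lambda'F$, then $$\langle F|U_S(p)|W_p,F'|U_S(p)\rangle_{Np}=\frac{\lambda}{p^{k-3}\mu(p)}\left(\lambda^2-\left(2+\tfrac1p\right)\lambda'+p^{2k-5}(p+1)(p+2)\right)\langle F,F'\rangle_{Np}.$$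 6. As operators on $S_k^{(2)}(N)$ (acting from the right, in the order written), $$\begin{aligned}U_S(p)\,U_S(p)^*\,\mathrm{Tr}&=p^2(p^2-1)\,T_S(1,p,p^2,p)+p^2(p-1)\,T_S(1,1,p^2,p^2)+p^3\mu(p)\,T_S(p,p,p,p)\\&=p^2(p-1)\,T_S(p)^2+\left(-p^2(p^4-1)+p^3\mu(p)\right)T_S(p,p,p,p).\end{aligned}$$ -/

import Mathlib

namespace SiegelTwo

open Matrix MeasureTheory
open scoped Pointwise

noncomputable section

/-- Index type of the rows and columns of a `4 × 4` matrix in `2 × 2` block form. -/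
abbrev I4 : Type := Fin 2 ⊕ Fin 2

/-- The matrix `J` of the standard symplectic form over `R`. -/
abbrev J4 (R : Type) [CommRing R] : Matrix I4 I4 R := Matrix.J (Fin 2) R

/-- Siegel's upper half space of degree `2`: symmetric complex `2 × 2` matrices with positive
definite imaginary part. -/
def H2 : Type :=
  {Z : Matrix (Fin 2) (Fin 2) ℂ // Z.IsSymm ∧ (Z.map Complex.im).PosDef}

namespace H2

/-- The underlying complex matrix. -/
def mat (Z : H2) : Matrix (Fin 2) (Fin 2) ℂ := Z.1

/-- The imaginary part `Y` of `Z = X + iY`. -/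
def im (Z : H2) : Matrix (Fin 2) (Fin 2) ℝ := Z.mat.map Complex.im

theorem ext {Z W : H2} (h : Z.mat = W.mat) : Z = W := Subtype.ext h

theorem symm (Z : H2) : Z.matᵀ = Z.mat := Z.2.1

theorem im_posDef (Z : H2) : Z.im.PosDef := Z.2.2

end H2

/-- The group `GSp_2⁺(ℝ)` of real symplectic similitudes with positive multiplier, as a subgroup
of the general linear group. -/
def GSpSubgroup : Subgroup (GL I4 ℝ) where
  carrier := {M | ∃ r : ℝ, 0 < r ∧ M.val * J4 ℝ * M.valᵀ = r • J4 ℝ}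
  mul_mem' := by
    rintro M M' ⟨r, hr, h⟩ ⟨r', hr', h'⟩
    refine ⟨r * r', mul_pos hr hr', ?_⟩
    calc (M * M').val * J4 ℝ * (M * M').valᵀ
        = M.val * (M'.val * J4 ℝ * M'.valᵀ) * M.valᵀ := by
          simp only [Units.val_mul, transpose_mul, Matrix.mul_assoc]
      _ = (r * r') • J4 ℝ := by
          rw [h', Matrix.mul_smul, Matrix.smul_mul, h, smul_smul, mul_comm]
  one_mem' := ⟨1, one_pos, by simp⟩
  inv_mem' := by
    rintro M ⟨r, hr, h⟩
    refine ⟨r⁻¹, inv_pos.mpr hr, ?_⟩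
    have h1 : M⁻¹.val * M.val = 1 := M.inv_mul
    have h2 : M.valᵀ * M⁻¹.valᵀ = 1 := by rw [← transpose_mul, h1, transpose_one]
    have h3 : J4 ℝ = r⁻¹ • (M.val * J4 ℝ * M.valᵀ) := by
      rw [h, smul_smul, inv_mul_cancel₀ hr.ne', one_smul]
    calc M⁻¹.val * J4 ℝ * M⁻¹.valᵀ
        = M⁻¹.val * (r⁻¹ • (M.val * J4 ℝ * M.valᵀ)) * M⁻¹.valᵀ := by rw [← h3]
      _ = r⁻¹ • ((M⁻¹.val * M.val) * J4 ℝ * (M.valᵀ * M⁻¹.valᵀ)) := by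
          simp only [Matrix.mul_smul, Matrix.smul_mul, Matrix.mul_assoc]
      _ = r⁻¹ • J4 ℝ := by rw [h1, h2, Matrix.one_mul, Matrix.mul_one]

/-- The group `GSp_2⁺(ℝ)`. -/
abbrev GSp : Type := GSpSubgroup

/-- A matrix `M` with `M J Mᵀ = r J`, `r > 0`, as an element of `GSp_2⁺(ℝ)`. -/
def GSp.mk (M : Matrix I4 I4 ℝ) (r : ℝ) (hr : 0 < r) (h : M * J4 ℝ * Mᵀ = r • J4 ℝ) : GSp :=
  ⟨GeneralLinearGroup.mkOfDetNeZero M (by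
    intro h0
    have h1 := congrArg Matrix.det h
    rw [det_mul, det_mul, h0, zero_mul, zero_mul, det_smul] at h1
    have h2 : (J4 ℝ).det ≠ 0 := (isUnit_det_J (Fin 2) ℝ).ne_zero
    exact mul_ne_zero (pow_ne_zero _ hr.ne') h2 h1.symm), r, hr, h⟩

namespace GSp

/-- The underlying real `4 × 4` matrix. -/
def mat (M : GSp) : Matrix I4 I4 ℝ := M.1.val

/-- The multiplier `r(M)`, read off from `M J Mᵀ = r(M) J` as the lower left entry. -/
def simil (M : GSp) : ℝ := (M.mat * J4 ℝ * M.matᵀ) (Sum.inr 0) (Sum.inl 0)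

theorem simil_of_eq (M : GSp) (r : ℝ) (h : M.mat * J4 ℝ * M.matᵀ = r • J4 ℝ) :
    M.simil = r := by
  rw [simil, h]
  simp [Matrix.J]

theorem simil_pos (M : GSp) : 0 < M.simil := by
  obtain ⟨r, hr, h⟩ := M.2
  rw [simil_of_eq M r h]
  exact hr

theorem mul_J_mul (M : GSp) : M.mat * J4 ℝ * M.matᵀ = M.simil • J4 ℝ := by
  obtain ⟨r, hr, h⟩ := M.2
  rw [simil_of_eq M r h]
  exact h

theorem transpose_mul_J_mul (M : GSp) : M.matᵀ * J4 ℝ * M.mat = M.simil • J4 ℝ := by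
  set A := M.mat
  have hr := M.simil_pos
  have h := M.mul_J_mul
  have hJ : J4 ℝ * J4 ℝ = -1 := J_squared (Fin 2) ℝ
  have h1 : A * (-(M.simil⁻¹ • (J4 ℝ * Aᵀ * J4 ℝ))) = 1 := by
    calc A * (-(M.simil⁻¹ • (J4 ℝ * Aᵀ * J4 ℝ)))
        = -(M.simil⁻¹ • ((A * J4 ℝ * Aᵀ) * J4 ℝ)) := by
          simp only [Matrix.mul_neg, Matrix.mul_smul, Matrix.mul_assoc]
      _ = 1 := by
          rw [h, Matrix.smul_mul, smul_smul, inv_mul_cancel₀ hr.ne', one_smul, hJ, neg_neg]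
  have h2 := mul_eq_one_comm.mp h1
  have h3 : J4 ℝ * (Aᵀ * J4 ℝ * A) = -(M.simil • (1 : Matrix I4 I4 ℝ)) := by
    rw [← h2]
    simp only [Matrix.neg_mul, Matrix.smul_mul, smul_neg, smul_smul, mul_inv_cancel₀ hr.ne',
      one_smul, neg_neg, Matrix.mul_assoc]
  calc Aᵀ * J4 ℝ * A = -(J4 ℝ * (J4 ℝ * (Aᵀ * J4 ℝ * A))) := by
        rw [← Matrix.mul_assoc (J4 ℝ) (J4 ℝ), hJ, Matrix.neg_mul, Matrix.one_mul, neg_neg]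
    _ = M.simil • J4 ℝ := by
        rw [h3, Matrix.mul_neg, neg_neg, Matrix.mul_smul, Matrix.mul_one]

/-- The block `A` of `M = (A B; C D)`, with complex entries. -/
def blkA (M : GSp) : Matrix (Fin 2) (Fin 2) ℂ := M.mat.toBlocks₁₁.map (Complex.ofRealHom)
/-- The block `B` of `M = (A B; C D)`, with complex entries. -/
def blkB (M : GSp) : Matrix (Fin 2) (Fin 2) ℂ := M.mat.toBlocks₁₂.map (Complex.ofRealHom)
/-- The block `C` of `M = (A B; C D)`, with complex entries. -/
def blkC (M : GSp) : Matrix (Fin 2) (Fin 2) ℂ := M.mat.toBlocks₂₁.map (Complex.ofRealHom)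
/-- The block `D` of `M = (A B; C D)`, with complex entries. -/
def blkD (M : GSp) : Matrix (Fin 2) (Fin 2) ℂ := M.mat.toBlocks₂₂.map (Complex.ofRealHom)

/-- `AZ + B`. -/
def num (M : GSp) (Z : Matrix (Fin 2) (Fin 2) ℂ) : Matrix (Fin 2) (Fin 2) ℂ :=
  M.blkA * Z + M.blkB

/-- `CZ + D`. -/
def den (M : GSp) (Z : Matrix (Fin 2) (Fin 2) ℂ) : Matrix (Fin 2) (Fin 2) ℂ :=
  M.blkC * Z + M.blkD

theorem map_mat (M : GSp) :
    M.mat.map Complex.ofRealHom = fromBlocks M.blkA M.blkB M.blkC M.blkD := by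
  conv_lhs => rw [← fromBlocks_toBlocks M.mat, fromBlocks_map]
  rfl

theorem block_relations (M : GSp) :
    M.blkAᵀ * M.blkC = M.blkCᵀ * M.blkA ∧ M.blkBᵀ * M.blkD = M.blkDᵀ * M.blkB ∧
    M.blkAᵀ * M.blkD - M.blkCᵀ * M.blkB = (M.simil : ℂ) • 1 ∧
    M.blkDᵀ * M.blkA - M.blkBᵀ * M.blkC = (M.simil : ℂ) • 1 := by
  have h := congrArg (fun X : Matrix I4 I4 ℝ => X.map Complex.ofRealHom) M.transpose_mul_J_mul
  have h' : (fromBlocks M.blkA M.blkB M.blkC M.blkD)ᵀ * J4 ℂ *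
      fromBlocks M.blkA M.blkB M.blkC M.blkD = (M.simil : ℂ) • J4 ℂ := by
    have hJ : (J4 ℝ).map Complex.ofRealHom = J4 ℂ := map_J (Fin 2) Complex.ofRealHom
    rw [← map_mat, ← transpose_map, ← hJ, ← Matrix.map_mul,
      ← Matrix.map_mul]
    refine h.trans ?_
    ext i j
    exact Complex.ofReal_mul _ _
  rw [J4, Matrix.J, fromBlocks_transpose, fromBlocks_multiply, fromBlocks_multiply,
    fromBlocks_smul, fromBlocks_inj] at h'
  obtain ⟨h1, h2, h3, h4⟩ := h'
  simp only [Matrix.mul_zero, Matrix.mul_one, zero_add, add_zero, Matrix.mul_neg,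
    Matrix.neg_mul, smul_zero, smul_neg] at h1 h2 h3 h4
  refine ⟨?_, ?_, ?_, ?_⟩
  · rw [← sub_eq_zero, ← neg_eq_zero, ← h1]; abel
  · rw [← sub_eq_zero, ← neg_eq_zero, ← h4]; abel
  · rw [← neg_inj, ← h2]; abel
  · rw [← h3]; abel

theorem key_identity (M : GSp) (X Z : Matrix (Fin 2) (Fin 2) ℂ) :
    (X * M.blkCᵀ + M.blkDᵀ) * M.num Z - (X * M.blkAᵀ + M.blkBᵀ) * M.den Z =
      (M.simil : ℂ) • (Z - X) := by
  obtain ⟨h1, h2, h3, h4⟩ := M.block_relations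
  calc (X * M.blkCᵀ + M.blkDᵀ) * M.num Z - (X * M.blkAᵀ + M.blkBᵀ) * M.den Z
      = X * (M.blkCᵀ * M.blkA - M.blkAᵀ * M.blkC) * Z
        - X * (M.blkAᵀ * M.blkD - M.blkCᵀ * M.blkB)
        + (M.blkDᵀ * M.blkA - M.blkBᵀ * M.blkC) * Z
        + (M.blkDᵀ * M.blkB - M.blkBᵀ * M.blkD) := by
        simp only [num, den]
        noncomm_ring
    _ = (M.simil : ℂ) • (Z - X) := by
        rw [h1, h2, h3, h4]
        simp [smul_sub]
        abel

theorem conj_blk (R : Matrix (Fin 2) (Fin 2) ℝ) :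
    (R.map Complex.ofRealHom)ᴴ = (R.map Complex.ofRealHom)ᵀ := by
  ext i j
  simp [conjTranspose_apply]

theorem den_conjTranspose (M : GSp) (Z : Matrix (Fin 2) (Fin 2) ℂ) :
    (M.den Z)ᴴ = Zᴴ * M.blkCᵀ + M.blkDᵀ := by
  rw [den, conjTranspose_add, conjTranspose_mul, blkC, blkD, conj_blk, conj_blk]

theorem num_conjTranspose (M : GSp) (Z : Matrix (Fin 2) (Fin 2) ℂ) :
    (M.num Z)ᴴ = Zᴴ * M.blkAᵀ + M.blkBᵀ := by
  rw [num, conjTranspose_add, conjTranspose_mul, blkA, blkB, conj_blk, conj_blk]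

theorem sub_conj (Z : H2) :
    Z.mat - Z.matᴴ = (2 * Complex.I) • Z.im.map Complex.ofRealHom := by
  ext i j
  have h : Z.mat j i = Z.mat i j := congrFun (congrFun Z.symm i) j
  rw [Matrix.sub_apply, conjTranspose_apply, h]
  apply Complex.ext <;> simp [H2.im]
  ring

/-- The hermitian form of a real positive definite matrix is positive on complex vectors. -/
theorem quad_pos (Y : Matrix (Fin 2) (Fin 2) ℝ) (hY : Y.PosDef) (v : Fin 2 → ℂ) (hv : v ≠ 0) :
    0 < (star v ⬝ᵥ (Y.map Complex.ofRealHom *ᵥ v)).re := by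
  have hs : Y 1 0 = Y 0 1 := by
    have := congrFun (congrFun hY.isHermitian 0) 1
    simpa using this
  have hq := fun x (hx : x ≠ 0) => hY.dotProduct_mulVec_pos (x := x) hx
  have hq0 := hY.posSemidef.dotProduct_mulVec_nonneg
  have hsum : (star v ⬝ᵥ (Y.map Complex.ofRealHom *ᵥ v)).re =
      star (fun i => (v i).re) ⬝ᵥ (Y *ᵥ (fun i => (v i).re)) +
      star (fun i => (v i).im) ⬝ᵥ (Y *ᵥ (fun i => (v i).im)) := by
    simp [dotProduct, Matrix.mulVec, Fin.sum_univ_two]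
    ring
  rw [hsum]
  by_cases h : (fun i => (v i).re) = 0
  · have h' : (fun i => (v i).im) ≠ 0 := by
      intro h'
      apply hv
      funext i
      exact Complex.ext (congrFun h i) (congrFun h' i)
    exact add_pos_of_nonneg_of_pos (hq0 _) (hq _ h')
  · exact add_pos_of_pos_of_nonneg (hq _ h) (hq0 _)

theorem den_form (M : GSp) (Z : H2) :
    (M.den Z.mat)ᴴ * M.num Z.mat - (M.num Z.mat)ᴴ * M.den Z.mat =
      (2 * Complex.I * M.simil) • Z.im.map Complex.ofRealHom := by
  rw [den_conjTranspose, num_conjTranspose, key_identity, sub_conj, smul_smul]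
  congr 1
  ring

theorem den_det_ne_zero (M : GSp) (Z : H2) : (M.den Z.mat).det ≠ 0 := by
  intro h0
  obtain ⟨v, hv, hv0⟩ := exists_mulVec_eq_zero_iff.mpr h0
  have h := congrArg (fun X => star v ⬝ᵥ (X *ᵥ v)) (den_form M Z)
  have hv0' : star v ᵥ* (M.den Z.mat)ᴴ = 0 := by
    rw [← star_mulVec, hv0, star_zero]
  simp only [sub_mulVec, ← mulVec_mulVec, hv0, mulVec_zero, sub_zero, smul_mulVec,
    dotProduct_smul, dotProduct_mulVec (star v) (M.den Z.mat)ᴴ, hv0', zero_dotProduct] at h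
  have h1 := quad_pos _ Z.im_posDef v hv
  have h2 : (2 * Complex.I * M.simil : ℂ) ≠ 0 := by
    have := M.simil_pos.ne'
    simp [Complex.I_ne_zero, this]
  have h3 : star v ⬝ᵥ (Z.im.map Complex.ofRealHom *ᵥ v) = 0 := by
    have := h.symm
    rw [smul_eq_mul] at this
    exact (mul_eq_zero.mp this).resolve_left h2
  rw [h3] at h1
  simp at h1

theorem smul_isSymm (M : GSp) (Z : H2) : (M.num Z.mat * (M.den Z.mat)⁻¹).IsSymm := by
  have hW := (M.den_det_ne_zero Z).isUnit
  have hT : (M.den Z.mat)ᵀ * M.num Z.mat = (M.num Z.mat)ᵀ * M.den Z.mat := by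
    have h := key_identity M Z.mat Z.mat
    rw [sub_self, smul_zero, sub_eq_zero] at h
    have h1 : (M.den Z.mat)ᵀ = Z.mat * M.blkCᵀ + M.blkDᵀ := by
      rw [den, transpose_add, transpose_mul, Z.symm]
    have h2 : (M.num Z.mat)ᵀ = Z.mat * M.blkAᵀ + M.blkBᵀ := by
      rw [num, transpose_add, transpose_mul, Z.symm]
    rw [h1, h2, h]
  set V := M.num Z.mat
  set W := M.den Z.mat
  have hWT : IsUnit (Wᵀ).det := by rwa [det_transpose]
  rw [IsSymm, transpose_mul, transpose_nonsing_inv]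
  calc (Wᵀ)⁻¹ * Vᵀ = (Wᵀ)⁻¹ * (Vᵀ * W) * W⁻¹ := by
        rw [Matrix.mul_assoc, Matrix.mul_assoc, mul_nonsing_inv _ hW, Matrix.mul_one]
    _ = V * W⁻¹ := by
        rw [← hT, ← Matrix.mul_assoc, nonsing_inv_mul _ hWT, Matrix.one_mul]

theorem smul_im_posDef (M : GSp) (Z : H2) :
    ((M.num Z.mat * (M.den Z.mat)⁻¹).map Complex.im).PosDef := by
  have hW := (M.den_det_ne_zero Z).isUnit
  have hsymm := M.smul_isSymm Z
  have hform := den_form M Z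
  set V := M.num Z.mat
  set W := M.den Z.mat
  set Z' := V * W⁻¹ with hZ'
  have hV : V = Z' * W := by
    rw [hZ', Matrix.mul_assoc, nonsing_inv_mul _ hW, Matrix.mul_one]
  have hsub : Z' - Z'ᴴ = (2 * Complex.I) • (Z'.map Complex.im).map Complex.ofRealHom := by
    ext i j
    have h : Z' j i = Z' i j := congrFun (congrFun hsymm i) j
    rw [Matrix.sub_apply, conjTranspose_apply, h]
    apply Complex.ext <;> simp
    ring
  have hform2 : Wᴴ * (Z' - Z'ᴴ) * W = (2 * Complex.I * M.simil) • Z.im.map Complex.ofRealHom := by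
    rw [← hform]
    clear_value Z'
    rw [hV, conjTranspose_mul]
    noncomm_ring
  have hform3 : Wᴴ * (Z'.map Complex.im).map Complex.ofRealHom * W =
      (M.simil : ℂ) • Z.im.map Complex.ofRealHom := by
    rw [hsub, Matrix.mul_smul, Matrix.smul_mul, mul_smul (2 * Complex.I) (M.simil : ℂ)] at hform2
    have hI : (2 * Complex.I : ℂ) ≠ 0 := by simp [Complex.I_ne_zero]
    exact smul_right_injective _ hI hform2
  refine PosDef.of_dotProduct_mulVec_pos ?_ ?_
  · ext i j
    have h : Z' j i = Z' i j := congrFun (congrFun hsymm i) j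
    simp [conjTranspose_apply, h]
  · intro x hx
    set u : Fin 2 → ℂ := W⁻¹ *ᵥ (fun i => (x i : ℂ)) with hu
    have hWu : W *ᵥ u = fun i => (x i : ℂ) := by
      rw [hu, mulVec_mulVec, mul_nonsing_inv _ hW, one_mulVec]
    have hu0 : u ≠ 0 := by
      intro h
      rw [h, mulVec_zero] at hWu
      apply hx
      funext i
      have := congrFun hWu i
      simpa using this.symm
    have h1 := quad_pos _ Z.im_posDef u hu0
    have h2 := congrArg (fun X => (star u ⬝ᵥ (X *ᵥ u)).re) hform3
    simp only [← mulVec_mulVec, hWu, smul_mulVec, dotProduct_smul,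
      dotProduct_mulVec (star u) Wᴴ, ← star_mulVec] at h2
    have h3 : (star (fun i => (x i : ℂ)) ⬝ᵥ
        ((Z'.map Complex.im).map Complex.ofRealHom *ᵥ (fun i => (x i : ℂ)))).re =
        star x ⬝ᵥ (Z'.map Complex.im *ᵥ x) := by
      simp [dotProduct, Matrix.mulVec, Fin.sum_univ_two]
    rw [h3] at h2
    rw [h2, smul_eq_mul, Complex.re_ofReal_mul]
    exact mul_pos M.simil_pos h1

/-- The action `M⟨Z⟩ = (AZ + B)(CZ + D)⁻¹` of `GSp_2⁺(ℝ)` on Siegel's upper half space. -/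
def act (M : GSp) (Z : H2) : H2 :=
  ⟨M.num Z.mat * (M.den Z.mat)⁻¹, M.smul_isSymm Z, M.smul_im_posDef Z⟩

theorem num_mul (M M' : GSp) (Z : H2) :
    (M * M').num Z.mat = M.num (M'.act Z).mat * M'.den Z.mat ∧
    (M * M').den Z.mat = M.den (M'.act Z).mat * M'.den Z.mat := by
  have hb : fromBlocks (M * M').blkA (M * M').blkB (M * M').blkC (M * M').blkD =
      fromBlocks M.blkA M.blkB M.blkC M.blkD * fromBlocks M'.blkA M'.blkB M'.blkC M'.blkD := by
    rw [← map_mat, ← map_mat, ← map_mat, ← Matrix.map_mul]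
    rfl
  rw [fromBlocks_multiply, fromBlocks_inj] at hb
  obtain ⟨h1, h2, h3, h4⟩ := hb
  have hact : (M'.act Z).mat * M'.den Z.mat = M'.num Z.mat := by
    change M'.num Z.mat * (M'.den Z.mat)⁻¹ * M'.den Z.mat = _
    rw [Matrix.mul_assoc, nonsing_inv_mul _ (M'.den_det_ne_zero Z).isUnit, Matrix.mul_one]
  constructor
  · rw [num, num, Matrix.add_mul, Matrix.mul_assoc, hact, h1, h2, num, den]
    noncomm_ring
  · rw [den, den, Matrix.add_mul, Matrix.mul_assoc, hact, h3, h4, num, den]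
    noncomm_ring

theorem one_num_den (Z : H2) : (1 : GSp).num Z.mat = Z.mat ∧ (1 : GSp).den Z.mat = 1 := by
  have hb : fromBlocks (1 : GSp).blkA (1 : GSp).blkB (1 : GSp).blkC (1 : GSp).blkD =
      fromBlocks 1 0 0 1 := by
    rw [← map_mat, fromBlocks_one]
    change (1 : Matrix I4 I4 ℝ).map _ = 1
    simp
  rw [fromBlocks_inj] at hb
  obtain ⟨h1, h2, h3, h4⟩ := hb
  simp [num, den, h1, h2, h3, h4]

instance : MulAction GSp H2 where
  smul := act
  one_smul Z := by
    apply H2.ext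
    change (1 : GSp).num Z.mat * ((1 : GSp).den Z.mat)⁻¹ = Z.mat
    rw [(one_num_den Z).1, (one_num_den Z).2, inv_one, Matrix.mul_one]
  mul_smul M M' Z := by
    apply H2.ext
    change (M * M').num Z.mat * ((M * M').den Z.mat)⁻¹ =
      M.num (M'.act Z).mat * (M.den (M'.act Z).mat)⁻¹
    rw [(num_mul M M' Z).1, (num_mul M M' Z).2, Matrix.mul_inv_rev, Matrix.mul_assoc,
      ← Matrix.mul_assoc (M'.den Z.mat),
      mul_nonsing_inv _ (M'.den_det_ne_zero Z).isUnit, Matrix.one_mul]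

end GSp

/-! ### Congruence subgroups -/

/-- The inclusion of the integral symplectic group `Sp_2(ℤ)` (matrices of size `4`) into
`GSp_2⁺(ℝ)`. -/
def ofSp : symplecticGroup (Fin 2) ℤ →* GSp where
  toFun γ := GSp.mk (γ.1.map (Int.castRingHom ℝ)) 1 one_pos (by
    rw [one_smul]
    exact SymplecticGroup.mem_iff.mp (SymplecticGroup.map_mem γ.2 (Int.castRingHom ℝ)))
  map_one' := by
    apply Subtype.ext
    apply Units.ext
    change (1 : Matrix I4 I4 ℤ).map _ = 1
    simp
  map_mul' γ γ' := by
    apply Subtype.ext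
    apply Units.ext
    change (γ.1 * γ'.1).map _ = γ.1.map _ * γ'.1.map _
    rw [Matrix.map_mul]

/-- `Γ_0^{(2)}(N)` as a subgroup of `Sp_2(ℤ)`: the lower left block is divisible by `N`. -/
def Gamma0Int (N : ℕ) : Subgroup (symplecticGroup (Fin 2) ℤ) where
  carrier := {γ | ∀ i j, (N : ℤ) ∣ γ.1.toBlocks₂₁ i j}
  one_mem' := by
    intro i j
    change (N : ℤ) ∣ (1 : Matrix I4 I4 ℤ) (Sum.inr i) (Sum.inl j)
    simp
  mul_mem' := by
    intro γ γ' h h' i j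
    change (N : ℤ) ∣ (γ.1 * γ'.1) (Sum.inr i) (Sum.inl j)
    rw [Matrix.mul_apply, Fintype.sum_sum_type]
    exact dvd_add (Finset.dvd_sum fun l _ => Dvd.dvd.mul_right (h i l) _)
      (Finset.dvd_sum fun l _ => Dvd.dvd.mul_left (h' l j) _)
  inv_mem' := by
    intro γ h i j
    have hinv : (γ⁻¹).1.toBlocks₂₁ = -(γ.1.toBlocks₂₁)ᵀ := by
      rw [SymplecticGroup.coe_inv]
      conv_lhs => rw [← fromBlocks_toBlocks γ.1]
      rw [Matrix.J, fromBlocks_transpose, ← neg_one_smul ℤ (fromBlocks _ _ _ _), fromBlocks_smul,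
        fromBlocks_multiply, fromBlocks_multiply, toBlocks_fromBlocks₂₁]
      simp
    rw [hinv]
    simpa using h j i

/-- `Γ_0^{(2)}(N)` as a subgroup of `GSp_2⁺(ℝ)`. -/
def Gamma0 (N : ℕ) : Subgroup GSp := (Gamma0Int N).map ofSp

/-! ### Slash action, cusp forms and the Petersson product -/

/-- `(F |_k M)(Z) = r(M)^k det(CZ + D)^{-k} F(M⟨Z⟩)`. -/
def slash (k : ℤ) (M : GSp) (F : H2 → ℂ) : H2 → ℂ := fun Z =>
  (M.simil : ℂ) ^ k * (M.den Z.mat).det ^ (-k) * F (M • Z)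

/-- The coordinates `(τ, z, τ')` of `Z = (τ z; z τ')`. -/
def coords (Z : H2) : ℂ × ℂ × ℂ := (Z.mat 0 0, Z.mat 0 1, Z.mat 1 1)

/-- The symmetric matrix `(τ z; z τ')`. -/
def ofCoords (w : ℂ × ℂ × ℂ) : Matrix (Fin 2) (Fin 2) ℂ := !![w.1, w.2.1; w.2.1, w.2.2]

/-- `F` is holomorphic, as a function of `(τ, z, τ')`. -/
def IsHolomorphic (F : H2 → ℂ) : Prop :=
  ∃ f : ℂ × ℂ × ℂ → ℂ, DifferentiableOn ℂ f (Set.range coords) ∧ ∀ Z, f (coords Z) = F Z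

/-- `S_k^{(2)}(N)`: holomorphic functions on Siegel's upper half space of degree `2`, invariant
under the weight `k` action of `Γ_0^{(2)}(N)`, which vanish at all cusps: for every
`γ ∈ Sp_2(ℤ) = Γ_0^{(2)}(1)` the Fourier expansion `∑_T a_γ(T) e(tr(TZ)/N)` of `F |_k γ`
over half-integral `T = (n r/2; r/2 m)` is supported on positive definite `T`. -/
structure IsCuspForm (N : ℕ) (k : ℤ) (F : H2 → ℂ) : Prop where
  holo : IsHolomorphic F
  slash_eq : ∀ γ ∈ Gamma0 N, slash k γ F = F
  cusp : ∀ γ ∈ Gamma0 1, ∃ a : ℤ × ℤ × ℤ → ℂ,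
    (∀ n r m : ℤ, a (n, r, m) ≠ 0 → 0 < n ∧ 0 < 4 * n * m - r ^ 2) ∧
    ∀ Z : H2, HasSum (fun T : ℤ × ℤ × ℤ => a T * Complex.exp (2 * Real.pi * Complex.I *
      (T.1 * Z.mat 0 0 + T.2.1 * Z.mat 0 1 + T.2.2 * Z.mat 1 1) / N)) (slash k γ F Z)

instance : MeasurableSpace H2 := MeasurableSpace.comap coords inferInstance

/-- The invariant measure `dμ(Z) = det(Y)^{-3} dX dY`. -/
def muH2 : Measure H2 :=
  (Measure.comap coords volume).withDensity fun Z => ENNReal.ofReal (Z.im.det ^ (-3 : ℤ))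

/-- The group of transformations of Siegel's upper half space induced by `Γ` (so `Γ` modulo the
elements that act trivially, such as `-1`). -/
def transformations (Γ : Subgroup GSp) : Subgroup (Equiv.Perm H2) :=
  Γ.map (MulAction.toPermHom GSp H2)

/-- `D` is a fundamental domain for the action of `Γ_0^{(2)}(N)`: almost every point has a
translate in `D`, and translates of `D` under different transformations overlap in null sets. -/
def IsFundDomain (N : ℕ) (D : Set H2) : Prop :=
  IsFundamentalDomain (transformations (Gamma0 N)) D muH2

/-- The (non-normalised) Petersson product `∫_D F(Z) conj(G(Z)) det(Y)^k dμ(Z)`. When `D` is a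
fundamental domain of `Γ_0^{(2)}(N)` this is the integral over the quotient by
`Γ_0^{(2)}(N)`. -/
def petersson (D : Set H2) (k : ℤ) (F G : H2 → ℂ) : ℂ :=
  ∫ Z in D, F Z * (starRingEnd ℂ) (G Z) * ((Z.im.det : ℝ) : ℂ) ^ k ∂muH2

/-! ### Double coset operators -/

/-- The operator `F |_k (Γ₁ g Γ₂) = r(g)^{k-3} ∑_i F |_k α_i`, where `Γ₁ g Γ₂ = ⋃ Γ₁ α_i`
(disjoint). The sum runs over the classes `Γ₁ α ⊆ Γ₁ g Γ₂` in `Γ₁ \ GSp_2⁺(ℝ)`; for `F` invariant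
under `Γ₁` it does not depend on the representatives. -/
def dcOp (k : ℤ) (Γ₁ : Subgroup GSp) (g : GSp) (Γ₂ : Subgroup GSp) (F : H2 → ℂ) : H2 → ℂ := fun Z =>
  (g.simil : ℂ) ^ (k - 3) *
    ∑ᶠ c ∈ (Quotient.mk (QuotientGroup.rightRel Γ₁)) '' DoubleCoset.doubleCoset g Γ₁ Γ₂,
      slash k (Quotient.out c) F Z

/-- The matrix `diag(p^a, p^b, p^c, p^d)`, where `a + c = b + d`. -/
def diagP (p : ℕ) [Fact p.Prime] (a b c d : ℕ) (h : a + c = b + d) : GSp :=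
  GSp.mk (fromBlocks (diagonal ![(p : ℝ) ^ a, (p : ℝ) ^ b]) 0 0 (diagonal ![(p : ℝ) ^ c, (p : ℝ) ^ d]))
    ((p : ℝ) ^ (a + c)) (pow_pos (Nat.cast_pos.mpr (Fact.out : p.Prime).pos) _) (by
      have h1 : (p : ℝ) ^ a * (p : ℝ) ^ c = (p : ℝ) ^ (a + c) := (pow_add _ _ _).symm
      have h2 : (p : ℝ) ^ b * (p : ℝ) ^ d = (p : ℝ) ^ (a + c) := by rw [h, pow_add]
      have h3 : (p : ℝ) ^ c * (p : ℝ) ^ a = (p : ℝ) ^ (a + c) := by rw [mul_comm, h1]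
      have h4 : (p : ℝ) ^ d * (p : ℝ) ^ b = (p : ℝ) ^ (a + c) := by rw [mul_comm, h2]
      rw [J4, Matrix.J, fromBlocks_transpose, fromBlocks_multiply, fromBlocks_multiply,
        fromBlocks_smul, fromBlocks_inj]
      refine ⟨?_, ?_, ?_, ?_⟩ <;> ext i j <;> fin_cases i <;> fin_cases j <;>
        simp [h1, h2, h3, h4])

section Operators

variable (N p : ℕ) [Fact p.Prime] (k : ℤ)

/-- `T_S(p^a, p^b, p^c, p^d) = Γ_0^{(2)}(N) diag(p^a, p^b, p^c, p^d) Γ_0^{(2)}(N)`. -/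
def TSdiag (a b c d : ℕ) (h : a + c = b + d) : (H2 → ℂ) → (H2 → ℂ) :=
  dcOp k (Gamma0 N) (diagP p a b c d h) (Gamma0 N)

/-- `T_S(p) = T_S(1, 1, p, p)`. -/
def TS : (H2 → ℂ) → (H2 → ℂ) := TSdiag N p k 0 0 1 1 rfl

/-- `T_S(p²)`, the sum of the three double cosets of multiplier `p²`. -/
def TSsq (F : H2 → ℂ) : H2 → ℂ :=
  TSdiag N p k 0 0 2 2 rfl F + TSdiag N p k 0 1 2 1 rfl F + TSdiag N p k 1 1 1 1 rfl F

/-- `T'_S(p) = T_S(p)² - T_S(p²)`. -/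
def TS' (F : H2 → ℂ) : H2 → ℂ := TS N p k (TS N p k F) - TSsq N p k F

/-- `U_S(p) = Γ_0^{(2)}(Np) diag(1, 1, p, p) Γ_0^{(2)}(Np)`. -/
def US : (H2 → ℂ) → (H2 → ℂ) :=
  dcOp k (Gamma0 (N * p)) (diagP p 0 0 1 1 rfl) (Gamma0 (N * p))

/-- `U_S(p)^* = Γ_0^{(2)}(Np) diag(p, p, 1, 1) Γ_0^{(2)}(Np)`. -/
def USstar : (H2 → ℂ) → (H2 → ℂ) :=
  dcOp k (Gamma0 (N * p)) (diagP p 1 1 0 0 rfl) (Gamma0 (N * p))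

/-- The trace from level `Np` to level `N`: the sum of `F |_k γ` over
`γ ∈ Γ_0^{(2)}(Np) \ Γ_0^{(2)}(N)`. -/
def Tr : (H2 → ℂ) → (H2 → ℂ) := dcOp k (Gamma0 (N * p)) 1 (Gamma0 N)

/-- The index `μ(p) = [Γ_0^{(2)}(N) : Γ_0^{(2)}(Np)]`. -/
def muIndex : ℕ := (Gamma0 (N * p)).relIndex (Gamma0 N)

end Operators

/-- The Atkin-Lehner matrix `W_p = (pα 1₂, 1₂; Npβ 1₂, p 1₂)` of level `Np`, where
`pα - Nβ = 1`. -/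
def Wp (N p : ℕ) [Fact p.Prime] (α β : ℤ) (h : p * α - N * β = 1) : GSp :=
  GSp.mk (fromBlocks (((p : ℝ) * α) • 1) 1 (((N : ℝ) * p * β) • 1) ((p : ℝ) • 1))
    (p : ℝ) (Nat.cast_pos.mpr (Fact.out : p.Prime).pos) (by
      have h' : (p : ℝ) * α - N * β = 1 := by exact_mod_cast h
      rw [J4, Matrix.J, fromBlocks_transpose, fromBlocks_multiply, fromBlocks_multiply,
        fromBlocks_smul, fromBlocks_inj]
      refine ⟨?_, ?_, ?_, ?_⟩ <;> ext i j <;> fin_cases i <;> fin_cases j <;>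
        simp <;> first
          | ring1
          | linear_combination (p : ℝ) * h'
          | linear_combination (-(p : ℝ)) * h')

end

end SiegelTwo

open SiegelTwo

namespace SiegelTwo

open Matrix MeasureTheory
open scoped Pointwise

noncomputable section

set_option linter.unusedSectionVars false

/-! The Petersson integral is traded for a mean value: `normPet` is the mean of A·conj(B)·det(Y)^k
over a fundamental domain of any group commensurable with Γ₀(Np) that leaves the integrand
invariant. It does not depend on that group, and since the measure is GSp-invariant it is unchanged
when A and B are both slashed by an element of the commensurator (`normPet_slash`). Write d =
diag(1,1,p,p) and d' = diag(p,p,1,1). As d d' is scalar and scalars act trivially, slashing by d and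
by d' are adjoint operations.

The operator U_S(p) is p^(k-3) times a sum of p³ terms F|d n(S); all of them have the same product
with a function fixed by integral translations. On forms of level N, W_p acts as d', and d W_p lies
in Γ₀(N) diag(p²,p²,1,1) Γ₀(Np). So the second to fifth products reduce to ⟨F|diag(1,1,p^j,p^j), F'⟩
with j = 1, 2, 3. Because F' is fixed by Γ₀(N), F|g may be replaced there by `avg`, its average over
the cosets in the double coset of g (`normPet_slash_eq_avg`).

For a Hecke eigenform these averages are multiples of F. The cosets of Γ₀(Np) in Γ₀(N) are the
Lagrangian planes of 𝔽_p⁴, with 1 + p(p+1) + p³ = μ(p) of them (`isTransversal_lagRep`). Expanding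
T_S(p) over them gives linear recursions between averages (`avg_TS_lower`, `avg_TS_delta`), which
`avg_of_TS'_eigen` solves.

For the operator identity, U_S(p) U_S(p)^* Tr is an average of the sum over S of F|d n(S) d'
(`Tr_USstar_US`). That sum is found by expanding the average of F|T_S(p) at d and at d', which lie
in one double coset (`sum_avg_unip`). The first product follows by adjointness, using that the
eigenvalue is real as soon as F' has nonzero norm (`conj_mul_normPet`).

Convergence rests on reduction theory: a Siegel set meets every Sp₂(ℤ)-orbit, has finite volume, and
on it cusp forms decay exponentially. Hence fundamental domains have finite volume and |F|² det(Y)^k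
is bounded. -/

section

/-! ### Similitudes in block form, the slash action and membership in Γ₀(N) -/

namespace GSp

theorem ext_mat {M M' : GSp} (h : M.mat = M'.mat) : M = M' := Subtype.ext (Units.ext h)

theorem mat_mul (M M' : GSp) : (M * M').mat = M.mat * M'.mat := rfl

theorem mat_one : (1 : GSp).mat = 1 := rfl

@[simp] theorem mat_mk (M : Matrix I4 I4 ℝ) (r : ℝ) (hr : 0 < r)
    (h : M * J4 ℝ * Mᵀ = r • J4 ℝ) : (GSp.mk M r hr h).mat = M := rfl

theorem simil_mk (M : Matrix I4 I4 ℝ) (r : ℝ) (hr : 0 < r)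
    (h : M * J4 ℝ * Mᵀ = r • J4 ℝ) : (GSp.mk M r hr h).simil = r := simil_of_eq _ _ h

theorem simil_mul (M M' : GSp) : (M * M').simil = M.simil * M'.simil := by
  apply simil_of_eq
  rw [mat_mul, transpose_mul]
  calc M.mat * M'.mat * J4 ℝ * (M'.matᵀ * M.matᵀ)
      = M.mat * (M'.mat * J4 ℝ * M'.matᵀ) * M.matᵀ := by simp only [Matrix.mul_assoc]
    _ = _ := by
      rw [M'.mul_J_mul, Matrix.mul_smul, Matrix.smul_mul, M.mul_J_mul, smul_smul, mul_comm]

theorem simil_one : (1 : GSp).simil = 1 := by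
  apply simil_of_eq
  simp [mat_one]

theorem simil_inv (M : GSp) : (M⁻¹).simil = M.simil⁻¹ := by
  have h := simil_mul M M⁻¹
  rw [mul_inv_cancel, simil_one] at h
  exact eq_inv_of_mul_eq_one_right h.symm

/-- The element of `GSp_2⁺(ℝ)` with given blocks. -/
def ofBlocks (A B C D : Matrix (Fin 2) (Fin 2) ℝ) (r : ℝ) (hr : 0 < r)
    (h1 : A * Bᵀ = B * Aᵀ) (h2 : C * Dᵀ = D * Cᵀ) (h3 : A * Dᵀ - B * Cᵀ = r • 1) : GSp :=
  GSp.mk (fromBlocks A B C D) r hr (by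
    have h4 : D * Aᵀ - C * Bᵀ = r • 1 := by
      have := congrArg Matrix.transpose h3
      simpa [transpose_sub, transpose_mul] using this
    rw [J4, Matrix.J, fromBlocks_transpose, fromBlocks_multiply, fromBlocks_multiply,
      fromBlocks_smul, fromBlocks_inj]
    simp only [Matrix.mul_zero, Matrix.mul_one, zero_add, add_zero, Matrix.mul_neg,
      Matrix.neg_mul, smul_zero, smul_neg]
    refine ⟨?_, ?_, ?_, ?_⟩
    · rw [h1]; abel
    · rw [← h3]; abel
    · rw [← h4]; abel
    · rw [h2]; abel)

theorem mat_ofBlocks (A B C D : Matrix (Fin 2) (Fin 2) ℝ) (r : ℝ) (hr : 0 < r)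
    (h1 : A * Bᵀ = B * Aᵀ) (h2 : C * Dᵀ = D * Cᵀ) (h3 : A * Dᵀ - B * Cᵀ = r • 1) :
    (ofBlocks A B C D r hr h1 h2 h3).mat = fromBlocks A B C D := rfl

theorem simil_ofBlocks (A B C D : Matrix (Fin 2) (Fin 2) ℝ) (r : ℝ) (hr : 0 < r)
    (h1 : A * Bᵀ = B * Aᵀ) (h2 : C * Dᵀ = D * Cᵀ) (h3 : A * Dᵀ - B * Cᵀ = r • 1) :
    (ofBlocks A B C D r hr h1 h2 h3).simil = r := by
  unfold ofBlocks
  exact simil_mk _ _ _ _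

/-- Relations between the blocks of an element of `GSp_2⁺(ℝ)`. -/
theorem blocks_rel {M : GSp} {A B C D : Matrix (Fin 2) (Fin 2) ℝ}
    (h : M.mat = fromBlocks A B C D) :
    A * Bᵀ = B * Aᵀ ∧ C * Dᵀ = D * Cᵀ ∧ A * Dᵀ - B * Cᵀ = M.simil • 1 := by
  have h' := M.mul_J_mul
  rw [h, J4, Matrix.J, fromBlocks_transpose, fromBlocks_multiply, fromBlocks_multiply,
    fromBlocks_smul, fromBlocks_inj] at h'
  obtain ⟨h1, h2, h3, h4⟩ := h'
  simp only [Matrix.mul_zero, Matrix.mul_one, zero_add, add_zero, Matrix.mul_neg,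
    Matrix.neg_mul, smul_zero, smul_neg] at h1 h2 h3 h4
  refine ⟨?_, ?_, ?_⟩
  · rw [← sub_eq_zero, ← neg_eq_zero, ← h1]; abel
  · rw [← sub_eq_zero, ← neg_eq_zero, ← h4]; abel
  · rw [← neg_inj, ← h2]; abel

theorem blocks_rel' {M : GSp} {A B C D : Matrix (Fin 2) (Fin 2) ℝ}
    (h : M.mat = fromBlocks A B C D) :
    Aᵀ * C = Cᵀ * A ∧ Bᵀ * D = Dᵀ * B ∧ Aᵀ * D - Cᵀ * B = M.simil • 1 := by
  have h' := M.transpose_mul_J_mul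
  rw [h, J4, Matrix.J, fromBlocks_transpose, fromBlocks_multiply, fromBlocks_multiply,
    fromBlocks_smul, fromBlocks_inj] at h'
  obtain ⟨h1, h2, h3, h4⟩ := h'
  simp only [Matrix.mul_zero, Matrix.mul_one, zero_add, add_zero, Matrix.mul_neg,
    Matrix.neg_mul, smul_zero, smul_neg] at h1 h2 h3 h4
  refine ⟨?_, ?_, ?_⟩
  · rw [← sub_eq_zero, ← neg_eq_zero, ← h1]; abel
  · rw [← sub_eq_zero, ← neg_eq_zero, ← h4]; abel
  · rw [← neg_inj, ← h2]; abel

/-- `M⁻¹ = r⁻¹ (Dᵀ, -Bᵀ; -Cᵀ, Aᵀ)`. -/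
theorem mat_inv {M : GSp} {A B C D : Matrix (Fin 2) (Fin 2) ℝ}
    (h : M.mat = fromBlocks A B C D) :
    (M⁻¹).mat = M.simil⁻¹ • fromBlocks Dᵀ (-Bᵀ) (-Cᵀ) Aᵀ := by
  obtain ⟨h1, h2, h3⟩ := blocks_rel h
  have h4 : D * Aᵀ - C * Bᵀ = M.simil • 1 := by
    have := congrArg Matrix.transpose h3
    simpa [transpose_sub, transpose_mul] using this
  have hr := M.simil_pos.ne'
  have h5 : M.mat * (M.simil⁻¹ • fromBlocks Dᵀ (-Bᵀ) (-Cᵀ) Aᵀ) = 1 := by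
    rw [h, Matrix.mul_smul, fromBlocks_multiply]
    simp only [Matrix.mul_neg, ← sub_eq_add_neg]
    rw [h3, h2, neg_add_eq_sub, neg_add_eq_sub, h4, ← h1, sub_self, sub_self, fromBlocks_smul,
      smul_smul, inv_mul_cancel₀ hr, one_smul, smul_zero, fromBlocks_one]
  have h6 : (M⁻¹).mat * M.mat = 1 := by rw [← mat_mul, inv_mul_cancel, mat_one]
  calc (M⁻¹).mat = (M⁻¹).mat * (M.mat * (M.simil⁻¹ • fromBlocks Dᵀ (-Bᵀ) (-Cᵀ) Aᵀ)) := by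
        rw [h5, Matrix.mul_one]
    _ = _ := by rw [← Matrix.mul_assoc, h6, Matrix.one_mul]

end GSp

/-! ### The slash action -/

theorem slash_one (k : ℤ) (F : H2 → ℂ) : slash k 1 F = F := by
  funext Z
  simp [slash, GSp.simil_one, (GSp.one_num_den Z).2]

theorem slash_mul (k : ℤ) (M M' : GSp) (F : H2 → ℂ) :
    slash k (M * M') F = slash k M' (slash k M F) := by
  funext Z
  simp only [slash]
  rw [GSp.simil_mul, (GSp.num_mul M M' Z).2, det_mul, mul_smul, Complex.ofReal_mul, mul_zpow,
    mul_zpow]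
  change _ = _ * (_ * (M.den (M'.act Z).mat).det ^ (-k) * _)
  ring

theorem slash_add (k : ℤ) (M : GSp) (F F' : H2 → ℂ) :
    slash k M (F + F') = slash k M F + slash k M F' := by
  funext Z
  simp only [slash, Pi.add_apply]
  ring

theorem slash_smul (k : ℤ) (M : GSp) (c : ℂ) (F : H2 → ℂ) :
    slash k M (c • F) = c • slash k M F := by
  funext Z
  simp only [slash, Pi.smul_apply, smul_eq_mul]
  ring

/-- `F ↦ F |_k M` as a linear map. -/
def slashLin (k : ℤ) (M : GSp) : (H2 → ℂ) →ₗ[ℂ] (H2 → ℂ) where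
  toFun := slash k M
  map_add' := slash_add k M
  map_smul' := slash_smul k M

theorem slash_sum (k : ℤ) (M : GSp) {ι : Type*} (s : Finset ι) (F : ι → H2 → ℂ) :
    slash k M (∑ i ∈ s, F i) = ∑ i ∈ s, slash k M (F i) :=
  map_sum (slashLin k M) F s

/-- The scalar matrix `t`. -/
def scal (t : ℝ) (ht : t ≠ 0) : GSp :=
  GSp.ofBlocks (t • 1) 0 0 (t • 1) (t ^ 2) (by positivity) (by simp) (by simp)
    (by simp [smul_smul, sq])

theorem mat_scal (t : ℝ) (ht : t ≠ 0) : (scal t ht).mat = t • 1 := by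
  rw [scal, GSp.ofBlocks, GSp.mat_mk, ← fromBlocks_one, fromBlocks_smul, smul_zero]

theorem scal_comm (t : ℝ) (ht : t ≠ 0) (g : GSp) : scal t ht * g = g * scal t ht := by
  apply GSp.ext_mat
  rw [GSp.mat_mul, GSp.mat_mul, mat_scal, Matrix.smul_mul, Matrix.mul_smul, Matrix.one_mul,
    Matrix.mul_one]

/-- The multiplier t², raised to the power k, cancels det(t·1₂)^(-k), so this holds in every weight.
It makes diag(p,p,1,1) act as the inverse of diag(1,1,p,p). -/
theorem slash_scal (k : ℤ) (t : ℝ) (ht : t ≠ 0) (F : H2 → ℂ) : slash k (scal t ht) F = F := by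
  have hb : fromBlocks (scal t ht).blkA (scal t ht).blkB (scal t ht).blkC (scal t ht).blkD =
      fromBlocks ((t : ℂ) • 1) 0 0 ((t : ℂ) • 1) := by
    rw [← GSp.map_mat, mat_scal, ← smul_zero (t : ℂ), ← fromBlocks_smul, fromBlocks_one]
    ext i j
    by_cases h : i = j <;> simp [h]
  rw [fromBlocks_inj] at hb
  obtain ⟨h1, h2, h3, h4⟩ := hb
  have ht' : (t : ℂ) ≠ 0 := by exact_mod_cast ht
  funext Z
  have hden : (scal t ht).den Z.mat = (t : ℂ) • 1 := by simp [GSp.den, h3, h4]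
  have hnum : (scal t ht).num Z.mat = (t : ℂ) • Z.mat := by simp [GSp.num, h1, h2]
  have hZ : scal t ht • Z = Z := by
    apply H2.ext
    change (scal t ht).num Z.mat * ((scal t ht).den Z.mat)⁻¹ = Z.mat
    have : (t : ℂ) • (1 : Matrix (Fin 2) (Fin 2) ℂ) * ((t : ℂ)⁻¹ • 1) = 1 := by
      rw [Matrix.smul_mul, Matrix.one_mul, smul_smul, mul_inv_cancel₀ ht', one_smul]
    rw [hden, hnum, Matrix.inv_eq_right_inv this, Matrix.mul_smul, Matrix.mul_one, smul_smul,
      inv_mul_cancel₀ ht', one_smul]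
  have hs : (scal t ht).simil = t ^ 2 := by
    unfold scal
    exact GSp.simil_ofBlocks _ _ _ _ _ _ _ _ _
  simp only [slash]
  rw [hZ, hden, hs, det_smul, det_one, mul_one, Fintype.card_fin, Complex.ofReal_pow,
    _root_.zpow_neg, mul_inv_cancel₀ (zpow_ne_zero _ (pow_ne_zero _ ht')), one_mul]

/-! ### Membership in `Γ_0(N)` -/

/-- Multiplier 1 over ℝ already contains the symplectic relation over ℤ, since ℤ embeds in ℝ; only
integrality of the entries and the divisibility of C remain. -/
theorem mem_Gamma0_iff {N : ℕ} {g : GSp} : g ∈ Gamma0 N ↔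
    ∃ A B C D : Matrix (Fin 2) (Fin 2) ℤ, g.mat = fromBlocks (A.map (Int.cast : ℤ → ℝ))
      (B.map Int.cast) (C.map Int.cast) (D.map Int.cast) ∧ g.simil = 1 ∧
      ∀ i j, (N : ℤ) ∣ C i j := by
  constructor
  · rintro ⟨γ, hγ, rfl⟩
    refine ⟨γ.1.toBlocks₁₁, γ.1.toBlocks₁₂, γ.1.toBlocks₂₁, γ.1.toBlocks₂₂, ?_,
      GSp.simil_of_eq _ _ ?_, hγ⟩
    swap
    · rw [one_smul]
      exact SymplecticGroup.mem_iff.mp (SymplecticGroup.map_mem γ.2 (Int.castRingHom ℝ))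
    change γ.1.map _ = _
    conv_lhs => rw [← fromBlocks_toBlocks γ.1, fromBlocks_map]
    rfl
  · rintro ⟨A, B, C, D, hm, hs, hC⟩
    have hmap : g.mat = (fromBlocks A B C D).map (Int.castRingHom ℝ) := by
      rw [hm, fromBlocks_map]
      rfl
    have hγ : fromBlocks A B C D ∈ symplecticGroup (Fin 2) ℤ := by
      rw [SymplecticGroup.mem_iff]
      have h := g.mul_J_mul
      rw [hs, one_smul, hmap] at h
      have hJ : J4 ℝ = (J4 ℤ).map (Int.castRingHom ℝ) := (map_J (Fin 2) _).symm
      rw [hJ, ← Matrix.map_mul, ← transpose_map, ← Matrix.map_mul] at h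
      exact Matrix.map_injective (Int.cast_injective) h
    refine ⟨⟨_, hγ⟩, ?_, ?_⟩
    · intro i j
      simpa using hC i j
    · apply GSp.ext_mat
      rw [hmap]
      rfl

theorem simil_of_mem_Gamma0 {N : ℕ} {g : GSp} (h : g ∈ Gamma0 N) : g.simil = 1 := by
  obtain ⟨A, B, C, D, hm, hs, hC⟩ := mem_Gamma0_iff.mp h
  exact hs

theorem Gamma0_le {M N : ℕ} (h : N ∣ M) : Gamma0 M ≤ Gamma0 N := by
  intro g hg
  obtain ⟨A, B, C, D, hm, hs, hC⟩ := mem_Gamma0_iff.mp hg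
  exact mem_Gamma0_iff.mpr ⟨A, B, C, D, hm, hs, fun i j =>
    (Int.natCast_dvd_natCast.mpr h).trans (hC i j)⟩

end

section

/-! ### Transversals of right cosets -/

section Transversal

variable {𝒢 : Type} [Group 𝒢]

/-- `S` is the disjoint union of pieces of the right cosets `Γ (a i)`, with `a i ∈ S`. -/
structure IsTransversal (Γ : Subgroup 𝒢) (S : Set 𝒢) {ι : Type} (a : ι → 𝒢) : Prop where
  mem : ∀ i, a i ∈ S
  cover : ∀ s ∈ S, ∃ i, s * (a i)⁻¹ ∈ Γ
  inj : ∀ i j, a i * (a j)⁻¹ ∈ Γ → i = j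

/-- The classes in `Γ \ 𝒢` that meet `S`. -/
def cosetsOf (Γ : Subgroup 𝒢) (S : Set 𝒢) : Set (Quotient (QuotientGroup.rightRel Γ)) :=
  Quotient.mk (QuotientGroup.rightRel Γ) '' S

theorem IsTransversal.injective {Γ : Subgroup 𝒢} {S : Set 𝒢} {ι : Type} {a : ι → 𝒢}
    (h : IsTransversal Γ S a) :
    Function.Injective fun i => (Quotient.mk (QuotientGroup.rightRel Γ) (a i)) := by
  intro i j hij
  exact (h.inj j i (QuotientGroup.rightRel_apply.mp (Quotient.exact hij))).symm

theorem IsTransversal.range {Γ : Subgroup 𝒢} {S : Set 𝒢} {ι : Type} {a : ι → 𝒢}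
    (h : IsTransversal Γ S a) :
    Set.range (fun i => (Quotient.mk (QuotientGroup.rightRel Γ) (a i))) = cosetsOf Γ S := by
  ext c
  constructor
  · rintro ⟨i, rfl⟩
    exact ⟨a i, h.mem i, rfl⟩
  · rintro ⟨s, hs, rfl⟩
    obtain ⟨i, hi⟩ := h.cover s hs
    exact ⟨i, Quotient.sound (QuotientGroup.rightRel_apply.mpr hi)⟩

theorem IsTransversal.finsum_eq {M : Type} [AddCommMonoid M] {Γ : Subgroup 𝒢} {S : Set 𝒢}
    {ι : Type} [Fintype ι] {a : ι → 𝒢} (h : IsTransversal Γ S a) (φ : 𝒢 → M)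
    (hφ : ∀ γ ∈ Γ, ∀ g, φ (γ * g) = φ g) :
    ∑ᶠ c ∈ cosetsOf Γ S, φ (Quotient.out c) = ∑ i, φ (a i) := by
  rw [← h.range, finsum_mem_range h.injective, finsum_eq_sum_of_fintype]
  refine Finset.sum_congr rfl fun i _ => ?_
  have h1 : QuotientGroup.rightRel Γ (Quotient.mk (QuotientGroup.rightRel Γ) (a i)).out (a i) :=
    Quotient.mk_out (a i)
  have h2 := hφ _ (QuotientGroup.rightRel_apply.mp h1)
    (Quotient.mk (QuotientGroup.rightRel Γ) (a i)).out
  rw [inv_mul_cancel_right] at h2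
  exact h2.symm

theorem IsTransversal.sum_eq {M : Type} [AddCommMonoid M] {Γ : Subgroup 𝒢} {S : Set 𝒢}
    {ι κ : Type} [Fintype ι] [Fintype κ] {a : ι → 𝒢} {b : κ → 𝒢} (ha : IsTransversal Γ S a)
    (hb : IsTransversal Γ S b) (φ : 𝒢 → M) (hφ : ∀ γ ∈ Γ, ∀ g, φ (γ * g) = φ g) :
    ∑ i, φ (a i) = ∑ j, φ (b j) := by
  rw [← ha.finsum_eq φ hφ, hb.finsum_eq φ hφ]

theorem IsTransversal.ncard_eq {Γ : Subgroup 𝒢} {S : Set 𝒢}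
    {ι : Type} [Fintype ι] {a : ι → 𝒢} (h : IsTransversal Γ S a) :
    (cosetsOf Γ S).ncard = Fintype.card ι := by
  rw [← h.range, ← Set.image_univ, Set.ncard_image_of_injective _ h.injective,
    Set.ncard_univ, Nat.card_eq_fintype_card]

theorem IsTransversal.card_eq {Γ : Subgroup 𝒢} {S : Set 𝒢}
    {ι κ : Type} [Fintype ι] [Fintype κ] {a : ι → 𝒢} {b : κ → 𝒢} (ha : IsTransversal Γ S a)
    (hb : IsTransversal Γ S b) : Fintype.card ι = Fintype.card κ := by
  rw [← ha.ncard_eq, hb.ncard_eq]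

/-- Representatives multiply along a chain L ≤ M: the element of M that carries s to its
representative `b j` is itself decomposed modulo L. -/
theorem IsTransversal.mul {L M : Subgroup 𝒢} {S : Set 𝒢} {ι κ : Type} {a : ι → 𝒢} {b : κ → 𝒢}
    (hLM : L ≤ M) (hMS : ∀ m ∈ M, ∀ s ∈ S, m * s ∈ S)
    (ha : IsTransversal L (M : Set 𝒢) a) (hb : IsTransversal M S b) :
    IsTransversal L S (fun x : ι × κ => a x.1 * b x.2) where
  mem x := hMS _ (ha.mem _) _ (hb.mem _)
  cover s hs := by
    obtain ⟨j, hj⟩ := hb.cover s hs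
    obtain ⟨i, hi⟩ := ha.cover _ hj
    refine ⟨(i, j), ?_⟩
    rwa [_root_.mul_inv_rev, ← mul_assoc]
  inj := by
    rintro ⟨i, j⟩ ⟨i', j'⟩ h
    dsimp only at h
    have h1 : b j * (b j')⁻¹ ∈ M := by
      have h2 : (a i)⁻¹ * (a i * b j * (a i' * b j')⁻¹) * a i' ∈ M :=
        M.mul_mem (M.mul_mem (M.inv_mem (ha.mem i)) (hLM h)) (ha.mem i')
      convert h2 using 1
      group
    obtain rfl := hb.inj _ _ h1
    rw [_root_.mul_inv_rev, ← mul_assoc, mul_inv_cancel_right] at h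
    rw [ha.inj _ _ h]

theorem exists_isTransversal {L Γ : Subgroup 𝒢} (h : L.relIndex Γ ≠ 0) :
    ∃ a : Fin (L.relIndex Γ) → 𝒢, IsTransversal L (Γ : Set 𝒢) a := by
  have hfin : Finite (Γ ⧸ L.subgroupOf Γ) := by
    have : (L.subgroupOf Γ).index ≠ 0 := h
    exact Nat.finite_of_card_ne_zero this
  let e : Fin (L.relIndex Γ) ≃ (Γ ⧸ L.subgroupOf Γ) :=
    (Finite.equivFinOfCardEq (n := L.relIndex Γ) rfl).symm
  have key : ∀ x y : Γ, (x : Γ ⧸ L.subgroupOf Γ) = y ↔ (x : 𝒢)⁻¹ * y ∈ L := by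
    intro x y
    rw [QuotientGroup.eq, Subgroup.mem_subgroupOf]
    rfl
  -- The quotient `Γ ⧸ L` consists of left cosets; inversion turns their representatives into
  -- representatives of right cosets.
  refine ⟨fun i => ((e i).out : 𝒢)⁻¹, ?_, ?_, ?_⟩
  · intro i
    exact Γ.inv_mem (e i).out.2
  · intro s hs
    let x : Γ := ⟨s, hs⟩⁻¹
    refine ⟨e.symm x, ?_⟩
    have h1 : ((x : Γ) : Γ ⧸ L.subgroupOf Γ) = ((e (e.symm x)).out : Γ) := by simp
    rw [inv_inv]
    have := (key _ _).mp h1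
    simpa [x] using this
  · intro i j hij
    rw [inv_inv] at hij
    have := (key _ _).mpr hij
    simpa using this

theorem IsTransversal.relIndex_eq {L Γ : Subgroup 𝒢} {ι : Type} [Fintype ι] {a : ι → 𝒢}
    (h : IsTransversal L (Γ : Set 𝒢) a) : L.relIndex Γ = Fintype.card ι := by
  have hfin : L.relIndex Γ ≠ 0 := by
    have : Finite (Γ ⧸ L.subgroupOf Γ) := by
      refine Finite.of_surjective
        (fun i : ι => ((⟨(a i)⁻¹, Γ.inv_mem (h.mem i)⟩ : Γ) : Γ ⧸ L.subgroupOf Γ)) ?_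
      intro q
      obtain ⟨x, rfl⟩ := QuotientGroup.mk_surjective q
      obtain ⟨i, hi⟩ := h.cover (x : 𝒢)⁻¹ (Γ.inv_mem x.2)
      refine ⟨i, ?_⟩
      rw [QuotientGroup.eq, Subgroup.mem_subgroupOf]
      have := L.inv_mem hi
      simpa using this
    exact Nat.card_pos.ne'
  obtain ⟨b, hb⟩ := exists_isTransversal hfin
  rw [h.card_eq hb, Fintype.card_fin]

/-- The elements `γ` of `Γ₂` with `g γ g⁻¹ ∈ Γ₁`. -/
def stabIn (Γ₁ : Subgroup 𝒢) (g : 𝒢) (Γ₂ : Subgroup 𝒢) : Subgroup 𝒢 :=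
  Γ₂ ⊓ Γ₁.comap (MulAut.conj g).toMonoidHom

theorem mem_stabIn {Γ₁ : Subgroup 𝒢} {g : 𝒢} {Γ₂ : Subgroup 𝒢} {γ : 𝒢} :
    γ ∈ stabIn Γ₁ g Γ₂ ↔ γ ∈ Γ₂ ∧ g * γ * g⁻¹ ∈ Γ₁ := Iff.rfl

theorem stabIn_le (Γ₁ : Subgroup 𝒢) (g : 𝒢) (Γ₂ : Subgroup 𝒢) : stabIn Γ₁ g Γ₂ ≤ Γ₂ := inf_le_left

/-- Two elements g a and g b lie in one coset of Γ₁ exactly when a b⁻¹ lies in g⁻¹Γ₁g, which reduces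
the double coset to a coset problem inside Γ₂. -/
theorem IsTransversal.doubleCoset {Γ₁ : Subgroup 𝒢} {g : 𝒢} {Γ₂ : Subgroup 𝒢} {ι : Type}
    {a : ι → 𝒢} (h : IsTransversal (stabIn Γ₁ g Γ₂) (Γ₂ : Set 𝒢) a) :
    IsTransversal Γ₁ (DoubleCoset.doubleCoset g Γ₁ Γ₂) (fun i => g * a i) where
  mem i := DoubleCoset.mem_doubleCoset.mpr ⟨1, Γ₁.one_mem, a i, h.mem i, by rw [one_mul]⟩
  cover s hs := by
    obtain ⟨x, hx, y, hy, rfl⟩ := DoubleCoset.mem_doubleCoset.mp hs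
    obtain ⟨i, hi⟩ := h.cover y hy
    refine ⟨i, ?_⟩
    have := Γ₁.mul_mem hx (mem_stabIn.mp hi).2
    convert this using 1
    group
  inj i j hij := by
    refine h.inj i j (mem_stabIn.mpr ⟨Γ₂.mul_mem (h.mem i) (Γ₂.inv_mem (h.mem j)), ?_⟩)
    convert hij using 1
    group

theorem mem_commensurator_iff {Γ : Subgroup 𝒢} {g : 𝒢} :
    g ∈ Subgroup.Commensurable.commensurator Γ ↔
      (stabIn Γ g Γ).relIndex Γ ≠ 0 ∧ (stabIn Γ g⁻¹ Γ).relIndex Γ ≠ 0 := by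
  have h1 : ∀ x : 𝒢, stabIn Γ x Γ = ConjAct.toConjAct x⁻¹ • Γ ⊓ Γ := by
    intro x
    rw [inf_comm]
    ext γ
    rw [mem_stabIn, Subgroup.mem_inf, Subgroup.mem_pointwise_smul_iff_inv_smul_mem]
    simp [ConjAct.smul_def]
  rw [Subgroup.Commensurable.commensurator_mem_iff, Subgroup.Commensurable, h1, h1,
    Subgroup.inf_relIndex_right, Subgroup.inf_relIndex_right, inv_inv, and_comm]
  -- Conjugation by g turns the index of g⁻¹Γg in Γ into that of Γ in gΓg⁻¹, the second half of
  -- commensurability.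
  have h2 := Subgroup.relIndex_pointwise_smul (ConjAct.toConjAct g) (ConjAct.toConjAct g⁻¹ • Γ) Γ
  rw [smul_smul, ← map_mul, mul_inv_cancel, map_one, one_smul] at h2
  rw [h2]

end Transversal

/-! ### Double coset operators and averages -/

theorem dcOp_eq {k : ℤ} {Γ₁ Γ₂ : Subgroup GSp} {g : GSp} {F : H2 → ℂ}
    (hF : ∀ γ ∈ Γ₁, slash k γ F = F) {ι : Type} [Fintype ι] {a : ι → GSp}
    (h : IsTransversal Γ₁ (DoubleCoset.doubleCoset g Γ₁ Γ₂) a) :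
    dcOp k Γ₁ g Γ₂ F = (g.simil : ℂ) ^ (k - 3) • ∑ i, slash k (a i) F := by
  funext Z
  rw [Pi.smul_apply, Finset.sum_apply, smul_eq_mul, dcOp]
  congr 1
  exact h.finsum_eq (fun x => slash k x F Z) fun γ hγ x => by rw [slash_mul, hF γ hγ]

/-- The average of `F |_k α` over the classes `Γ α ⊆ Γ g Γ`. -/
def avg (k : ℤ) (Γ : Subgroup GSp) (F : H2 → ℂ) (g : GSp) : H2 → ℂ :=
  ((cosetsOf Γ (DoubleCoset.doubleCoset g Γ Γ)).ncard : ℂ)⁻¹ •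
    ∑ᶠ c ∈ cosetsOf Γ (DoubleCoset.doubleCoset g Γ Γ), slash k (Quotient.out c) F

section Avg

variable {k : ℤ} {Γ : Subgroup GSp} {F : H2 → ℂ}

theorem slash_mul_left (hF : ∀ γ ∈ Γ, slash k γ F = F) {γ : GSp} (hγ : γ ∈ Γ) (g : GSp) :
    slash k (γ * g) F = slash k g F := by rw [slash_mul, hF γ hγ]

theorem slash_stabIn (hF : ∀ γ ∈ Γ, slash k γ F = F) {Γ₂ : Subgroup GSp} {g γ : GSp}
    (hγ : γ ∈ stabIn Γ g Γ₂) : slash k γ (slash k g F) = slash k g F := by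
  have h : g * γ = g * γ * g⁻¹ * g := by group
  rw [← slash_mul, h, slash_mul_left hF (mem_stabIn.mp hγ).2]

/-- The average may be taken over the cosets of any finite-index subgroup of Γ contained in `stabIn
Γ g Γ`, because the terms are constant on the finer cosets. This freedom allows one subgroup to
serve several g at once. -/
theorem avg_eq (hF : ∀ γ ∈ Γ, slash k γ F = F) {g : GSp} {L : Subgroup GSp}
    (hL : L ≤ stabIn Γ g Γ) {ι : Type} [Fintype ι] {a : ι → GSp}
    (ha : IsTransversal L (Γ : Set GSp) a) :
    avg k Γ F g = (Fintype.card ι : ℂ)⁻¹ • ∑ i, slash k (g * a i) F := by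
  have hLΓ : L.relIndex Γ ≠ 0 := by
    rw [ha.relIndex_eq]
    have : Nonempty ι := let ⟨i, _⟩ := ha.cover 1 Γ.one_mem; ⟨i⟩
    exact Fintype.card_ne_zero
  have hmul := Subgroup.relIndex_mul_relIndex L (stabIn Γ g Γ) Γ hL (stabIn_le _ _ _)
  have h1 : L.relIndex (stabIn Γ g Γ) ≠ 0 := fun h => hLΓ (by rw [← hmul, h, zero_mul])
  have h2 : (stabIn Γ g Γ).relIndex Γ ≠ 0 := fun h => hLΓ (by rw [← hmul, h, mul_zero])
  obtain ⟨b, hb⟩ := exists_isTransversal h1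
  obtain ⟨c, hc⟩ := exists_isTransversal h2
  have hbc := hb.mul hL (fun m hm s hs => Γ.mul_mem (stabIn_le _ _ _ hm) hs) hc
  have hφ : ∀ γ ∈ L, ∀ x, slash k (g * (γ * x)) F = slash k (g * x) F := by
    intro γ hγ x
    rw [← mul_assoc, slash_mul, slash_mul k g γ, slash_stabIn hF (hL hγ), ← slash_mul]
  rw [ha.sum_eq hbc (fun x => slash k (g * x) F) hφ, ha.card_eq hbc, Fintype.sum_prod_type,
    Finset.sum_comm]
  have h3 : ∀ y, ∑ x, slash k (g * (b x * c y)) F =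
      (L.relIndex (stabIn Γ g Γ) : ℂ) • slash k (g * c y) F := by
    intro y
    have : ∀ x, slash k (g * (b x * c y)) F = slash k (g * c y) F := fun x => by
      rw [← mul_assoc, slash_mul, slash_mul k g (b x), slash_stabIn hF (hb.mem x), ← slash_mul]
    simp only [this, Finset.sum_const, Finset.card_univ, Fintype.card_fin, Nat.cast_smul_eq_nsmul]
  simp only [h3, ← Finset.smul_sum]
  rw [avg, hc.doubleCoset.ncard_eq, hc.doubleCoset.finsum_eq (fun x => slash k x F)
    (fun γ hγ x => slash_mul_left hF hγ x), smul_smul, Fintype.card_prod, Fintype.card_fin,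
    Fintype.card_fin]
  congr 1
  have : (L.relIndex (stabIn Γ g Γ) : ℂ) ≠ 0 := by exact_mod_cast h1
  push_cast
  rw [mul_inv, mul_comm, ← mul_assoc, mul_inv_cancel₀ this, one_mul]

theorem avg_doubleCoset {g γ γ' : GSp} (hγ : γ ∈ Γ) (hγ' : γ' ∈ Γ) :
    avg k Γ F (γ * g * γ') = avg k Γ F g := by
  have h : DoubleCoset.doubleCoset (γ * g * γ') (Γ : Set GSp) Γ = DoubleCoset.doubleCoset g Γ Γ :=
    DoubleCoset.doubleCoset_eq_of_mem (DoubleCoset.mem_doubleCoset.mpr ⟨γ, hγ, γ', hγ', rfl⟩)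
  rw [avg, avg, h]

theorem avg_scal (hF : ∀ γ ∈ Γ, slash k γ F = F) {g : GSp}
    (hg : g ∈ Subgroup.Commensurable.commensurator Γ) (t : ℝ) (ht : t ≠ 0) :
    avg k Γ F (scal t ht * g) = avg k Γ F g := by
  obtain ⟨a, ha⟩ := exists_isTransversal (mem_commensurator_iff.mp hg).1
  have hst : stabIn Γ g Γ ≤ stabIn Γ (scal t ht * g) Γ := by
    intro γ hγ
    refine mem_stabIn.mpr ⟨(mem_stabIn.mp hγ).1, ?_⟩
    have h := (mem_stabIn.mp hγ).2
    have h2 : scal t ht * g * γ * (scal t ht * g)⁻¹ = g * γ * g⁻¹ := by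
      have := scal_comm t ht (g * γ * g⁻¹)
      rw [_root_.mul_inv_rev]
      calc scal t ht * g * γ * (g⁻¹ * (scal t ht)⁻¹) = scal t ht * (g * γ * g⁻¹) * (scal t ht)⁻¹ := by
            group
        _ = _ := by rw [this, mul_inv_cancel_right]
    rwa [h2]
  rw [avg_eq hF hst ha, avg_eq hF le_rfl ha]
  congr 1
  refine Finset.sum_congr rfl fun i _ => ?_
  rw [mul_assoc, slash_mul, slash_scal]

theorem avg_one (hF : ∀ γ ∈ Γ, slash k γ F = F) : avg k Γ F 1 = F := by
  have h : IsTransversal Γ (Γ : Set GSp) (fun _ : Unit => (1 : GSp)) :=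
    ⟨fun _ => Γ.one_mem, fun s hs => ⟨(), by simpa using hs⟩, fun _ _ _ => rfl⟩
  rw [avg_eq hF (L := Γ) (fun γ hγ => mem_stabIn.mpr ⟨hγ, by simpa using hγ⟩) h]
  simp [slash_one]

theorem dcOp_eq_avg (hF : ∀ γ ∈ Γ, slash k γ F = F) {g : GSp}
    (hg : (stabIn Γ g Γ).relIndex Γ ≠ 0) :
    dcOp k Γ g Γ F = ((g.simil : ℂ) ^ (k - 3) * (stabIn Γ g Γ).relIndex Γ) • avg k Γ F g := by
  obtain ⟨a, ha⟩ := exists_isTransversal hg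
  have h : ((stabIn Γ g Γ).relIndex Γ : ℂ) ≠ 0 := by exact_mod_cast hg
  rw [dcOp_eq hF ha.doubleCoset, avg_eq hF le_rfl ha, Fintype.card_fin, smul_smul, mul_assoc,
    mul_inv_cancel₀ h, mul_one]

theorem avg_smul (hF : ∀ γ ∈ Γ, slash k γ F = F) {g : GSp}
    (hg : g ∈ Subgroup.Commensurable.commensurator Γ) (c : ℂ) :
    avg k Γ (c • F) g = c • avg k Γ F g := by
  obtain ⟨a, ha⟩ := exists_isTransversal (mem_commensurator_iff.mp hg).1
  rw [avg_eq hF le_rfl ha, avg_eq (fun γ hγ => by rw [slash_smul, hF γ hγ]) le_rfl ha]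
  simp only [slash_smul, ← Finset.smul_sum]
  rw [smul_comm]

theorem sum_slash_transversal_eq {L K : Subgroup GSp} {F : H2 → ℂ} (hLK : L ≤ K) (hKΓ : K ≤ Γ)
    (hF : ∀ γ ∈ K, slash k γ F = F) {ι κ : Type} [Fintype ι] [Fintype κ] {a : ι → GSp}
    {b : κ → GSp} (ha : IsTransversal L (Γ : Set GSp) a) (hb : IsTransversal K (Γ : Set GSp) b) :
    (Fintype.card κ : ℂ)⁻¹ • ∑ j, slash k (b j) F =
      (Fintype.card ι : ℂ)⁻¹ • ∑ i, slash k (a i) F := by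
  have hLΓ : L.relIndex Γ ≠ 0 := by
    rw [ha.relIndex_eq]
    have : Nonempty ι := let ⟨i, _⟩ := ha.cover 1 Γ.one_mem; ⟨i⟩
    exact Fintype.card_ne_zero
  have hmul := Subgroup.relIndex_mul_relIndex L K Γ hLK hKΓ
  have h1 : L.relIndex K ≠ 0 := fun h => hLΓ (by rw [← hmul, h, zero_mul])
  obtain ⟨c, hc⟩ := exists_isTransversal h1
  have hcb := hc.mul hLK (fun m hm s hs => Γ.mul_mem (hKΓ hm) hs) hb
  rw [ha.sum_eq hcb (fun x => slash k x F) (fun γ hγ x => slash_mul_left hF (hLK hγ) x),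
    ha.card_eq hcb, Fintype.sum_prod_type, Finset.sum_comm]
  have h3 : ∀ y, ∑ x, slash k (c x * b y) F = (L.relIndex K : ℂ) • slash k (b y) F := by
    intro y
    simp only [fun x => slash_mul_left hF (hc.mem x) (b y), Finset.sum_const, Finset.card_univ,
      Fintype.card_fin, Nat.cast_smul_eq_nsmul]
  simp only [h3, ← Finset.smul_sum]
  rw [smul_smul, Fintype.card_prod, Fintype.card_fin]
  congr 1
  have : (L.relIndex K : ℂ) ≠ 0 := by exact_mod_cast h1
  push_cast
  rw [mul_inv, mul_comm (L.relIndex K : ℂ)⁻¹, mul_assoc, inv_mul_cancel₀ this, mul_one]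

theorem iInf_stabIn_relIndex_ne_zero {κ : Type} [Finite κ] {c : κ → GSp}
    (hc : ∀ j, c j ∈ Subgroup.Commensurable.commensurator Γ) :
    (⨅ j, stabIn Γ (c j) Γ).relIndex Γ ≠ 0 :=
  Subgroup.relIndex_iInf_ne_zero fun j => (mem_commensurator_iff.mp (hc j)).1

/-- The average over `K \ Γ` of a `K`-invariant function `∑ F |_k c_j` is the sum of the averages
attached to the `c_j`. -/
theorem sum_slash_eq_sum_avg (hF : ∀ γ ∈ Γ, slash k γ F = F) {κ : Type} [Fintype κ]
    {c : κ → GSp} (hc : ∀ j, c j ∈ Subgroup.Commensurable.commensurator Γ)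
    {K : Subgroup GSp} (hKΓ : K ≤ Γ)
    (hK : ∀ γ ∈ K, slash k γ (∑ j, slash k (c j) F) = ∑ j, slash k (c j) F)
    {ι : Type} [Fintype ι] {b : ι → GSp} (hb : IsTransversal K (Γ : Set GSp) b) :
    ∑ i, slash k (b i) (∑ j, slash k (c j) F) =
      (Fintype.card ι : ℂ) • ∑ j, avg k Γ F (c j) := by
  have hne : Nonempty ι := let ⟨i, _⟩ := hb.cover 1 Γ.one_mem; ⟨i⟩
  have hcard : (Fintype.card ι : ℂ) ≠ 0 := by exact_mod_cast Fintype.card_ne_zero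
  have hKi : K.relIndex Γ ≠ 0 := by rw [hb.relIndex_eq]; exact Fintype.card_ne_zero
  -- K fixes only the sum, whereas L fixes every F|c_j separately and still has finite index in Γ.
  set L := K ⊓ ⨅ j, stabIn Γ (c j) Γ with hL
  have hLi : L.relIndex Γ ≠ 0 :=
    Subgroup.relIndex_inf_ne_zero hKi (iInf_stabIn_relIndex_ne_zero hc)
  obtain ⟨a, ha⟩ := exists_isTransversal hLi
  have h1 := sum_slash_transversal_eq inf_le_left hKΓ hK ha hb
  have h2 : ∀ j, avg k Γ F (c j) =
      (Fintype.card (Fin (L.relIndex Γ)) : ℂ)⁻¹ • ∑ i, slash k (c j * a i) F := fun j =>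
    avg_eq hF (inf_le_right.trans (iInf_le _ j)) ha
  rw [inv_smul_eq_iff₀ hcard] at h1
  rw [h1, Finset.sum_congr rfl fun j _ => h2 j, ← Finset.smul_sum, Finset.sum_comm]
  congr 2
  refine Finset.sum_congr rfl fun i _ => ?_
  rw [slash_sum]
  exact Finset.sum_congr rfl fun j _ => (slash_mul k _ _ _).symm

/-- This is multiplication of double cosets in averaged form. The function ∑ F|c_j g is fixed by
`stabIn Γ g Γ` although its terms need not be, which is the situation of `sum_slash_eq_sum_avg`. -/
theorem avg_sum_slash (hF : ∀ γ ∈ Γ, slash k γ F = F) {κ : Type} [Fintype κ]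
    {c : κ → GSp} (hc : ∀ j, c j ∈ Subgroup.Commensurable.commensurator Γ)
    (hT : ∀ γ ∈ Γ, slash k γ (∑ j, slash k (c j) F) = ∑ j, slash k (c j) F) {g : GSp}
    (hg : g ∈ Subgroup.Commensurable.commensurator Γ) :
    avg k Γ (∑ j, slash k (c j) F) g = ∑ j, avg k Γ F (c j * g) := by
  obtain ⟨a, ha⟩ := exists_isTransversal (mem_commensurator_iff.mp hg).1
  have hne : Nonempty (Fin ((stabIn Γ g Γ).relIndex Γ)) :=
    let ⟨i, _⟩ := ha.cover 1 Γ.one_mem; ⟨i⟩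
  have hcard : (Fintype.card (Fin ((stabIn Γ g Γ).relIndex Γ)) : ℂ) ≠ 0 := by
    exact_mod_cast Fintype.card_ne_zero
  have hsum : slash k g (∑ j, slash k (c j) F) = ∑ j, slash k (c j * g) F := by
    rw [slash_sum]
    exact Finset.sum_congr rfl fun j _ => (slash_mul k _ _ _).symm
  rw [avg_eq hT le_rfl ha]
  have h := sum_slash_eq_sum_avg hF (c := fun j => c j * g)
    (fun j => mul_mem (hc j) hg) (stabIn_le Γ g Γ)
    (fun γ hγ => by rw [← hsum, slash_stabIn hT hγ]) ha
  rw [← hsum] at h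
  simp only [slash_mul k g]
  rw [h, smul_smul, inv_mul_cancel₀ hcard, one_smul]

end Avg

end

section

/-! ### Special elements -/

theorem transpose_fin_two {R : Type} (a b c d : R) :
    !![a, b; c, d]ᵀ = !![a, c; b, d] := by
  ext i j
  fin_cases i <;> fin_cases j <;> rfl

/-- The translation `(1, S; 0, 1)`, `S = (x y; y z)`. -/
def nU (x y z : ℝ) : GSp :=
  GSp.ofBlocks 1 !![x, y; y, z] 0 1 1 one_pos (by simp [transpose_fin_two])
    (by simp) (by simp)

/-- The lower unipotent element `(1, 0; S, 1)`, `S = (x y; y z)`. -/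
def nL (x y z : ℝ) : GSp :=
  GSp.ofBlocks 1 0 !![x, y; y, z] 1 1 one_pos (by simp) (by simp [transpose_fin_two])
    (by simp)

/-- The Levi element `(U, 0; 0, U⁻ᵀ)`, `U = (a b; c d)`. -/
def mU (a b c d : ℝ) (h : a * d - b * c = 1) : GSp :=
  GSp.ofBlocks !![a, b; c, d] 0 0 !![d, -c; -b, a] 1 one_pos (by simp) (by simp) (by
    rw [transpose_fin_two, Matrix.mul_fin_two, Matrix.one_fin_two]
    ext i j
    fin_cases i <;> fin_cases j <;> simp <;> linarith)

/-- The element of `GSp_2` given by two `2 × 2` matrices of the same determinant. -/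
def pr (a b c d a' b' c' d' r : ℝ) (hr : 0 < r) (h : a * d - b * c = r)
    (h' : a' * d' - b' * c' = r) : GSp :=
  GSp.ofBlocks !![a, 0; 0, a'] !![b, 0; 0, b'] !![c, 0; 0, c'] !![d, 0; 0, d'] r hr
    (by simp [transpose_fin_two, mul_comm]) (by simp [transpose_fin_two, mul_comm])
    (by
      rw [transpose_fin_two, transpose_fin_two, Matrix.one_fin_two]
      ext i j
      fin_cases i <;> fin_cases j <;> simp <;> linarith)

theorem mat_nU (x y z : ℝ) :
    (nU x y z).mat = fromBlocks !![1, 0; 0, 1] !![x, y; y, z] !![0, 0; 0, 0] !![1, 0; 0, 1] := by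
  rw [nU, GSp.mat_ofBlocks, Matrix.one_fin_two]
  congr 1
  ext i j
  fin_cases i <;> fin_cases j <;> rfl

theorem mat_nL (x y z : ℝ) :
    (nL x y z).mat = fromBlocks !![1, 0; 0, 1] !![0, 0; 0, 0] !![x, y; y, z] !![1, 0; 0, 1] := by
  rw [nL, GSp.mat_ofBlocks, Matrix.one_fin_two]
  congr 1
  ext i j
  fin_cases i <;> fin_cases j <;> rfl

theorem mat_mU (a b c d : ℝ) (h : a * d - b * c = 1) :
    (mU a b c d h).mat =
      fromBlocks !![a, b; c, d] !![0, 0; 0, 0] !![0, 0; 0, 0] !![d, -c; -b, a] := by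
  rw [mU, GSp.mat_ofBlocks]
  congr 1 <;> ext i j <;> fin_cases i <;> fin_cases j <;> rfl

theorem mat_pr (a b c d a' b' c' d' r : ℝ) (hr : 0 < r) (h : a * d - b * c = r)
    (h' : a' * d' - b' * c' = r) :
    (pr a b c d a' b' c' d' r hr h h').mat =
      fromBlocks !![a, 0; 0, a'] !![b, 0; 0, b'] !![c, 0; 0, c'] !![d, 0; 0, d'] := rfl

theorem simil_nU (x y z : ℝ) : (nU x y z).simil = 1 := by
  unfold nU
  exact GSp.simil_ofBlocks _ _ _ _ _ _ _ _ _

theorem simil_nL (x y z : ℝ) : (nL x y z).simil = 1 := by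
  unfold nL
  exact GSp.simil_ofBlocks _ _ _ _ _ _ _ _ _

theorem simil_mU (a b c d : ℝ) (h : a * d - b * c = 1) : (mU a b c d h).simil = 1 := by
  unfold mU
  exact GSp.simil_ofBlocks _ _ _ _ _ _ _ _ _

theorem simil_pr (a b c d a' b' c' d' r : ℝ) (hr : 0 < r) (h : a * d - b * c = r)
    (h' : a' * d' - b' * c' = r) : (pr a b c d a' b' c' d' r hr h h').simil = r := by
  unfold pr
  exact GSp.simil_ofBlocks _ _ _ _ _ _ _ _ _

theorem mat_scal' (t : ℝ) (ht : t ≠ 0) :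
    (scal t ht).mat = fromBlocks !![t, 0; 0, t] !![0, 0; 0, 0] !![0, 0; 0, 0] !![t, 0; 0, t] := by
  rw [mat_scal, ← fromBlocks_one, fromBlocks_smul]
  congr 1 <;> ext i j <;> fin_cases i <;> fin_cases j <;> simp

theorem simil_diagP (p : ℕ) [Fact p.Prime] (a b c d : ℕ) (h : a + c = b + d) :
    (diagP p a b c d h).simil = (p : ℝ) ^ (a + c) := by
  unfold diagP
  exact GSp.simil_mk _ _ _ _

theorem mat_diagP (p : ℕ) [Fact p.Prime] (a b c d : ℕ) (h : a + c = b + d) :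
    (diagP p a b c d h).mat = fromBlocks !![(p : ℝ) ^ a, 0; 0, (p : ℝ) ^ b] !![0, 0; 0, 0]
      !![0, 0; 0, 0] !![(p : ℝ) ^ c, 0; 0, (p : ℝ) ^ d] := by
  unfold diagP
  rw [GSp.mat_mk]
  congr 1 <;> ext i j <;> fin_cases i <;> fin_cases j <;> simp

theorem mat_Wp (N p : ℕ) [Fact p.Prime] (α β : ℤ) (h : p * α - N * β = 1) :
    (Wp N p α β h).mat = fromBlocks !![(p : ℝ) * α, 0; 0, (p : ℝ) * α] !![1, 0; 0, 1]
      !![(N : ℝ) * p * β, 0; 0, (N : ℝ) * p * β] !![(p : ℝ), 0; 0, (p : ℝ)] := by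
  unfold Wp
  rw [GSp.mat_mk]
  congr 1 <;> ext i j <;> fin_cases i <;> fin_cases j <;> simp

theorem fromBlocks_fin_two_eq {R : Type} {a b c d e f g h i j k l m n o q
    a' b' c' d' e' f' g' h' i' j' k' l' m' n' o' q' : R}
    (h1 : a = a' ∧ b = b' ∧ c = c' ∧ d = d') (h2 : e = e' ∧ f = f' ∧ g = g' ∧ h = h')
    (h3 : i = i' ∧ j = j' ∧ k = k' ∧ l = l') (h4 : m = m' ∧ n = n' ∧ o = o' ∧ q = q') :
    fromBlocks !![a, b; c, d] !![e, f; g, h] !![i, j; k, l] !![m, n; o, q] =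
      fromBlocks !![a', b'; c', d'] !![e', f'; g', h'] !![i', j'; k', l'] !![m', n'; o', q'] := by
  obtain ⟨rfl, rfl, rfl, rfl⟩ := h1
  obtain ⟨rfl, rfl, rfl, rfl⟩ := h2
  obtain ⟨rfl, rfl, rfl, rfl⟩ := h3
  obtain ⟨rfl, rfl, rfl, rfl⟩ := h4
  rfl

theorem add_fin_two {R : Type} [Add R] (a b c d a' b' c' d' : R) :
    !![a, b; c, d] + !![a', b'; c', d'] = !![a + a', b + b'; c + c', d + d'] := by
  ext i j
  fin_cases i <;> fin_cases j <;> rfl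

theorem mul_fromBlocks_fin_two {R : Type} [Semiring R] (a b c d e f g h i j k l m n o q
    a' b' c' d' e' f' g' h' i' j' k' l' m' n' o' q' : R) :
    fromBlocks !![a, b; c, d] !![e, f; g, h] !![i, j; k, l] !![m, n; o, q] *
      fromBlocks !![a', b'; c', d'] !![e', f'; g', h'] !![i', j'; k', l'] !![m', n'; o', q'] =
    fromBlocks
      !![a * a' + b * c' + (e * i' + f * k'), a * b' + b * d' + (e * j' + f * l');
        c * a' + d * c' + (g * i' + h * k'), c * b' + d * d' + (g * j' + h * l')]
      !![a * e' + b * g' + (e * m' + f * o'), a * f' + b * h' + (e * n' + f * q');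
        c * e' + d * g' + (g * m' + h * o'), c * f' + d * h' + (g * n' + h * q')]
      !![i * a' + j * c' + (m * i' + n * k'), i * b' + j * d' + (m * j' + n * l');
        k * a' + l * c' + (o * i' + q * k'), k * b' + l * d' + (o * j' + q * l')]
      !![i * e' + j * g' + (m * m' + n * o'), i * f' + j * h' + (m * n' + n * q');
        k * e' + l * g' + (o * m' + q * o'), k * f' + l * h' + (o * n' + q * q')] := by
  simp only [fromBlocks_multiply, Matrix.mul_fin_two, add_fin_two]

/-! ### Coordinates of elements of `Γ_0(N)` -/

theorem mat_eq_of_mem {N : ℕ} {g : GSp} (hg : g ∈ Gamma0 N) :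
    ∃ a b c d e f g' h i j k l m n o q : ℤ,
      g.mat = fromBlocks !![(a : ℝ), b; c, d] !![(e : ℝ), f; g', h] !![(i : ℝ), j; k, l]
        !![(m : ℝ), n; o, q] ∧ ((N : ℤ) ∣ i ∧ (N : ℤ) ∣ j ∧ (N : ℤ) ∣ k ∧ (N : ℤ) ∣ l) := by
  obtain ⟨A, B, C, D, hm, -, hC⟩ := mem_Gamma0_iff.mp hg
  refine ⟨A 0 0, A 0 1, A 1 0, A 1 1, B 0 0, B 0 1, B 1 0, B 1 1, C 0 0, C 0 1, C 1 0, C 1 1,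
    D 0 0, D 0 1, D 1 0, D 1 1, ?_, hC _ _, hC _ _, hC _ _, hC _ _⟩
  rw [hm]
  congr 1 <;> ext i j <;> fin_cases i <;> fin_cases j <;> rfl

theorem mem_of_mat_eq {N : ℕ} {g : GSp} (hs : g.simil = 1)
    (a b c d e f g' h i j k l m n o q : ℤ)
    (hm : g.mat = fromBlocks !![(a : ℝ), b; c, d] !![(e : ℝ), f; g', h] !![(i : ℝ), j; k, l]
        !![(m : ℝ), n; o, q])
    (hC : (N : ℤ) ∣ i ∧ (N : ℤ) ∣ j ∧ (N : ℤ) ∣ k ∧ (N : ℤ) ∣ l) : g ∈ Gamma0 N := by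
  refine mem_Gamma0_iff.mpr ⟨!![a, b; c, d], !![e, f; g', h], !![i, j; k, l], !![m, n; o, q],
    ?_, hs, ?_⟩
  · rw [hm]
    congr 1 <;> ext i j <;> fin_cases i <;> fin_cases j <;> rfl
  · obtain ⟨h1, h2, h3, h4⟩ := hC
    intro i j
    fin_cases i <;> fin_cases j <;> assumption

theorem nU_mem (N : ℕ) (x y z : ℤ) : nU x y z ∈ Gamma0 N :=
  mem_of_mat_eq (simil_nU _ _ _) 1 0 0 1 x y y z 0 0 0 0 1 0 0 1 (by simp [mat_nU]) (by simp)

theorem nL_mem {N : ℕ} {x y z : ℤ} (hx : (N : ℤ) ∣ x) (hy : (N : ℤ) ∣ y) (hz : (N : ℤ) ∣ z) :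
    nL x y z ∈ Gamma0 N :=
  mem_of_mat_eq (simil_nL _ _ _) 1 0 0 1 0 0 0 0 x y y z 1 0 0 1 (by simp [mat_nL])
    ⟨hx, hy, hy, hz⟩

theorem mU_mem (N : ℕ) (a b c d : ℤ) (h : (a : ℝ) * d - b * c = 1) :
    mU a b c d h ∈ Gamma0 N :=
  mem_of_mat_eq (simil_mU _ _ _ _ _) a b c d 0 0 0 0 0 0 0 0 d (-c) (-b) a (by simp [mat_mU])
    (by simp)

theorem pr_mem {N : ℕ} {a b c d a' b' c' d' : ℤ} (h : (a : ℝ) * d - b * c = 1)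
    (h' : (a' : ℝ) * d' - b' * c' = 1) (hc : (N : ℤ) ∣ c) (hc' : (N : ℤ) ∣ c') :
    pr a b c d a' b' c' d' 1 one_pos h h' ∈ Gamma0 N :=
  mem_of_mat_eq (simil_pr _ _ _ _ _ _ _ _ _ _ _ _) a 0 0 a' b 0 0 b' c 0 0 c' d 0 0 d'
    (by simp [mat_pr]) ⟨hc, dvd_zero _, dvd_zero _, hc'⟩

theorem nU_mul (x y z x' y' z' : ℝ) :
    nU x y z * nU x' y' z' = nU (x + x') (y + y') (z + z') := by
  apply GSp.ext_mat
  rw [GSp.mat_mul, mat_nU, mat_nU, mat_nU, mul_fromBlocks_fin_two]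
  apply fromBlocks_fin_two_eq <;> simp [add_comm]

theorem nU_zero : nU 0 0 0 = 1 := by
  apply GSp.ext_mat
  rw [mat_nU, GSp.mat_one, ← fromBlocks_one, Matrix.one_fin_two]
  congr 1 <;> ext i j <;> fin_cases i <;> fin_cases j <;> rfl

theorem nU_inv (x y z : ℝ) : (nU x y z)⁻¹ = nU (-x) (-y) (-z) := by
  rw [inv_eq_iff_mul_eq_one, nU_mul]
  simp [nU_zero]

end

section

/-! ### Coset representatives -/

/-- The lower half of an element of `GSp_2⁺(ℝ)` consists of the given integers. -/
def Lower (g : GSp) (i j k l m n o q : ℤ) : Prop :=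
  ∃ A B : Matrix (Fin 2) (Fin 2) ℝ,
    g.mat = fromBlocks A B !![(i : ℝ), j; k, l] !![(m : ℝ), n; o, q]

theorem Lower.of_mat_eq {g : GSp} {A B : Matrix (Fin 2) (Fin 2) ℝ} {i' j' k' l' m' n' o' q' : ℝ}
    {i j k l m n o q : ℤ} (hm : g.mat = fromBlocks A B !![i', j'; k', l'] !![m', n'; o', q'])
    (h : i' = i ∧ j' = j ∧ k' = k ∧ l' = l) (h' : m' = m ∧ n' = n ∧ o' = o ∧ q' = q) :
    Lower g i j k l m n o q := by
  obtain ⟨rfl, rfl, rfl, rfl⟩ := h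
  obtain ⟨rfl, rfl, rfl, rfl⟩ := h'
  exact ⟨A, B, hm⟩

theorem fin_two_inj {R : Type} {a b c d a' b' c' d' : R}
    (h : !![a, b; c, d] = !![a', b'; c', d']) : a = a' ∧ b = b' ∧ c = c' ∧ d = d' :=
  ⟨congrFun (congrFun h 0) 0, congrFun (congrFun h 0) 1, congrFun (congrFun h 1) 0,
    congrFun (congrFun h 1) 1⟩

/-- The lower left block of g r⁻¹ is C D'ᵀ - D C'ᵀ, the symplectic pairing of the lower rows of g
with those of r. The upper halves play no part. -/
theorem lower_mem_iff {M M' : ℕ} {g r : GSp} (hg : g ∈ Gamma0 M) (hr : r ∈ Gamma0 M)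
    {i j k l m n o q i' j' k' l' m' n' o' q' : ℤ} (hgl : Lower g i j k l m n o q)
    (hrl : Lower r i' j' k' l' m' n' o' q') :
    g * r⁻¹ ∈ Gamma0 M' ↔
      (M' : ℤ) ∣ i * m' + j * n' - (m * i' + n * j') ∧
      (M' : ℤ) ∣ i * o' + j * q' - (m * k' + n * l') ∧
      (M' : ℤ) ∣ k * m' + l * n' - (o * i' + q * j') ∧
      (M' : ℤ) ∣ k * o' + l * q' - (o * k' + q * l') := by
  obtain ⟨A, B, hm⟩ := hgl
  obtain ⟨A', B', hm'⟩ := hrl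
  have hmem : g * r⁻¹ ∈ Gamma0 M := mul_mem hg (inv_mem hr)
  obtain ⟨a, b, c, d, e, f, g', h, x, y, z, w, m1, n1, o1, q1, hmat, -⟩ := mat_eq_of_mem hmem
  have hlow := hmat
  rw [GSp.mat_mul, GSp.mat_inv hm', simil_of_mem_Gamma0 hr, inv_one, one_smul, hm,
    fromBlocks_multiply, fromBlocks_inj] at hlow
  have h21 := hlow.2.2.1
  rw [transpose_fin_two, transpose_fin_two, Matrix.mul_neg, Matrix.mul_fin_two,
    Matrix.mul_fin_two, ← sub_eq_add_neg] at h21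
  have hx : x = i * m' + j * n' - (m * i' + n * j') := by
    have := congrFun (congrFun h21 0) 0
    simp at this
    exact_mod_cast this.symm
  have hy : y = i * o' + j * q' - (m * k' + n * l') := by
    have := congrFun (congrFun h21 0) 1
    simp at this
    exact_mod_cast this.symm
  have hz : z = k * m' + l * n' - (o * i' + q * j') := by
    have := congrFun (congrFun h21 1) 0
    simp at this
    exact_mod_cast this.symm
  have hw : w = k * o' + l * q' - (o * k' + q * l') := by
    have := congrFun (congrFun h21 1) 1
    simp at this
    exact_mod_cast this.symm
  rw [← hx, ← hy, ← hz, ← hw]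
  constructor
  · intro hmem'
    obtain ⟨a', b', c', d', e', f', g'', h', x', y', z', w', m2, n2, o2, q2, hmat', hd⟩ :=
      mat_eq_of_mem hmem'
    rw [hmat, fromBlocks_inj] at hmat'
    obtain ⟨h1, h2, h3, h4⟩ := fin_two_inj hmat'.2.2.1
    rw [Int.cast_inj] at h1 h2 h3 h4
    rwa [h1, h2, h3, h4]
  · intro hd
    exact mem_of_mat_eq (simil_of_mem_Gamma0 hmem) _ _ _ _ _ _ _ _ _ _ _ _ _ _ _ _ hmat hd

/-- The symplectic relations A Dᵀ - B Cᵀ = 1, Aᵀ D - Cᵀ B = 1 and the symmetry of C Dᵀ, AᵀC, DᵀB,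
written in integral coordinates for later reduction modulo p. -/
theorem exists_lower {M : ℕ} {g : GSp} (hg : g ∈ Gamma0 M) :
    ∃ i j k l m n o q : ℤ, Lower g i j k l m n o q ∧
      ((M : ℤ) ∣ i ∧ (M : ℤ) ∣ j ∧ (M : ℤ) ∣ k ∧ (M : ℤ) ∣ l) ∧
      i * o + j * q = k * m + l * n ∧
      ∃ a b c d e f g' h : ℤ, g.mat = fromBlocks !![(a : ℝ), b; c, d] !![(e : ℝ), f; g', h]
        !![(i : ℝ), j; k, l] !![(m : ℝ), n; o, q] ∧
        (m * a + n * b - (i * e + j * f) = 1 ∧ m * c + n * d - (i * g' + j * h) = 0 ∧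
        o * a + q * b - (k * e + l * f) = 0 ∧ o * c + q * d - (k * g' + l * h) = 1) ∧
        (m * a + o * c - (e * i + g' * k) = 1 ∧ m * b + o * d - (e * j + g' * l) = 0 ∧
        n * a + q * c - (f * i + h * k) = 0 ∧ n * b + q * d - (f * j + h * l) = 1) ∧
        (a * j + c * l = b * i + d * k ∧ m * f + o * h = n * e + q * g') := by
  obtain ⟨a, b, c, d, e, f, g', h, i, j, k, l, m, n, o, q, hmat, hd⟩ := mat_eq_of_mem hg
  obtain ⟨h1, h2, h3⟩ := GSp.blocks_rel hmat
  obtain ⟨h5, h6, h4⟩ := GSp.blocks_rel' hmat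
  rw [simil_of_mem_Gamma0 hg, one_smul, Matrix.one_fin_two, transpose_fin_two, transpose_fin_two,
    Matrix.mul_fin_two, Matrix.mul_fin_two] at h3 h4
  rw [transpose_fin_two, transpose_fin_two, Matrix.mul_fin_two, Matrix.mul_fin_two] at h2 h5 h6
  have e2 := congrFun (congrFun h5 0) 1
  have e3 := congrFun (congrFun h6 0) 1
  have e1 := congrFun (congrFun h2 0) 1
  have a1 := congrFun (congrFun h3 0) 0
  have a2 := congrFun (congrFun h3 0) 1
  have a3 := congrFun (congrFun h3 1) 0
  have a4 := congrFun (congrFun h3 1) 1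
  have b1 := congrFun (congrFun h4 0) 0
  have b2 := congrFun (congrFun h4 0) 1
  have b3 := congrFun (congrFun h4 1) 0
  have b4 := congrFun (congrFun h4 1) 1
  simp only [Matrix.of_apply, Matrix.cons_val', Matrix.cons_val_zero, Matrix.cons_val_one,
    Matrix.sub_apply, Matrix.cons_val_fin_one] at e1 e2 e3 a1 a2 a3 a4 b1 b2 b3 b4
  norm_cast at e1 e2 e3 a1 a2 a3 a4 b1 b2 b3 b4
  refine ⟨i, j, k, l, m, n, o, q, ⟨_, _, hmat⟩, hd, by linarith, a, b, c, d, e, f, g', h, hmat,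
    ⟨by linarith, by linarith, by linarith, by linarith⟩,
    ⟨by linarith, by linarith, by linarith, by linarith⟩, by linarith, by linarith⟩

section Prime

variable {N p : ℕ} [Fact p.Prime]

theorem natCast_mul_dvd_iff (hpN : ¬ p ∣ N) {x : ℤ} (hx : (N : ℤ) ∣ x) :
    ((N * p : ℕ) : ℤ) ∣ x ↔ (x : ZMod p) = 0 := by
  rw [ZMod.intCast_zmod_eq_zero_iff_dvd]
  constructor
  · intro h
    refine dvd_trans ?_ h
    push_cast
    exact dvd_mul_left _ _
  · intro h
    push_cast
    refine IsCoprime.mul_dvd ?_ hx h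
    rw [Nat.isCoprime_iff_coprime]
    exact ((Nat.Prime.coprime_iff_not_dvd Fact.out).mpr hpN).symm

/-- Since p does not divide N, divisibility by N is automatic and only p matters: a coset of Γ₀(Np)
in Γ₀(N) is determined by the Lagrangian plane in 𝔽_p⁴ spanned by the lower rows. -/
theorem lower_mem_iff_zmod (hpN : ¬ p ∣ N) {g r : GSp} (hg : g ∈ Gamma0 N) (hr : r ∈ Gamma0 N)
    {i j k l m n o q i' j' k' l' m' n' o' q' : ℤ} (hgl : Lower g i j k l m n o q)
    (hrl : Lower r i' j' k' l' m' n' o' q') :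
    g * r⁻¹ ∈ Gamma0 (N * p) ↔
      (i * m' + j * n' : ZMod p) = m * i' + n * j' ∧
      (i * o' + j * q' : ZMod p) = m * k' + n * l' ∧
      (k * m' + l * n' : ZMod p) = o * i' + q * j' ∧
      (k * o' + l * q' : ZMod p) = o * k' + q * l' := by
  have h0 := (lower_mem_iff (M' := N) hg hr hgl hrl).mp (mul_mem hg (inv_mem hr))
  rw [lower_mem_iff (M' := N * p) hg hr hgl hrl, natCast_mul_dvd_iff hpN h0.1,
    natCast_mul_dvd_iff hpN h0.2.1, natCast_mul_dvd_iff hpN h0.2.2.1,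
    natCast_mul_dvd_iff hpN h0.2.2.2]
  push_cast
  rw [sub_eq_zero, sub_eq_zero, sub_eq_zero, sub_eq_zero]

/-- The entries `(a, b; c, d)` of representatives of the points `(1 : t)`, `(0 : 1)` of the
projective line over `𝔽_p`. -/
def lineRep (p : ℕ) : Option (ZMod p) → ℤ × ℤ × ℤ × ℤ
  | some t => (1, t.val, 0, 1)
  | none => (0, 1, -1, 0)

/-- The Levi element attached to a point of the projective line over `𝔽_p`. -/
def mLine (p : ℕ) (v : Option (ZMod p)) : GSp :=
  mU (lineRep p v).1 (lineRep p v).2.1 (lineRep p v).2.2.1 (lineRep p v).2.2.2 (by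
    cases v <;> simp [lineRep])

theorem mLine_mem (N : ℕ) (v : Option (ZMod p)) : mLine p v ∈ Gamma0 N := mU_mem N _ _ _ _ _

/-- The parameters of the representatives of `Γ_0(Np) \ Γ_0(N)`. -/
abbrev LagIdx (p : ℕ) : Type :=
  Unit ⊕ ((Option (ZMod p) × ZMod p) ⊕ (ZMod p × ZMod p × ZMod p))

instance : Fintype (ZMod p) := ZMod.fintype p

/-- The element `(α, 1; Nβ, p)` with scalar blocks, where `pα - Nβ = 1`. -/
def gOpp (N p : ℕ) (α β : ℤ) (h : (p : ℤ) * α - N * β = 1) : GSp :=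
  pr α 1 (N * β : ℤ) p α 1 (N * β : ℤ) p 1 one_pos
    (by have : (p : ℝ) * α - N * β = 1 := by exact_mod_cast h
        push_cast; linarith)
    (by have : (p : ℝ) * α - N * β = 1 := by exact_mod_cast h
        push_cast; linarith)

/-- The element `(α, 1; Nβ, p)` in the first coordinate. -/
def gLine (N p : ℕ) (α β : ℤ) (h : (p : ℤ) * α - N * β = 1) : GSp :=
  pr α 1 (N * β : ℤ) p 1 0 0 1 1 one_pos
    (by have : (p : ℝ) * α - N * β = 1 := by exact_mod_cast h
        push_cast; linarith)
    (by ring)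

/-- Representatives of `Γ_0(Np) \ Γ_0(N)`. -/
def lagRep (N p : ℕ) (α β : ℤ) (h : (p : ℤ) * α - N * β = 1) : LagIdx p → GSp
  | Sum.inl _ => 1
  | Sum.inr (Sum.inl (v, b)) => gLine N p α β h * nU b.val 0 0 * mLine p v
  | Sum.inr (Sum.inr (x, y, z)) => gOpp N p α β h * nU x.val y.val z.val

variable (α β : ℤ) (h : (p : ℤ) * α - N * β = 1)

theorem gOpp_mem : gOpp N p α β h ∈ Gamma0 N :=
  mem_of_mat_eq (simil_pr _ _ _ _ _ _ _ _ _ _ _ _) α 0 0 α 1 0 0 1 (N * β) 0 0 (N * β) p 0 0 p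
    (by simp [gOpp, mat_pr]) (by simp)

theorem gLine_mem : gLine N p α β h ∈ Gamma0 N :=
  mem_of_mat_eq (simil_pr _ _ _ _ _ _ _ _ _ _ _ _) α 0 0 1 1 0 0 0 (N * β) 0 0 0 p 0 0 1
    (by simp [gLine, mat_pr]) (by simp)

theorem nU_val_mem (N : ℕ) (x y z : ZMod p) : nU x.val y.val z.val ∈ Gamma0 N := by
  have := nU_mem N x.val y.val z.val
  push_cast at this
  exact this

theorem nU_val_mem' (N : ℕ) (x : ZMod p) : nU x.val 0 0 ∈ Gamma0 N := by
  have := nU_mem N x.val 0 0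
  push_cast at this
  exact this

theorem lagRep_mem (i : LagIdx p) : lagRep N p α β h i ∈ Gamma0 N := by
  rcases i with _ | ⟨v, b⟩ | ⟨x, y, z⟩
  · exact one_mem _
  · exact mul_mem (mul_mem (gLine_mem α β h) (nU_val_mem' N b)) (mLine_mem N v)
  · exact mul_mem (gOpp_mem α β h) (nU_val_mem N x y z)

theorem lower_one : Lower 1 0 0 0 0 1 0 0 1 := by
  refine ⟨1, 0, ?_⟩
  rw [GSp.mat_one, ← fromBlocks_one]
  congr 1 <;> ext i j <;> fin_cases i <;> fin_cases j <;> simp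

theorem lower_line (v : Option (ZMod p)) (b : ZMod p) :
    Lower (lagRep N p α β h (Sum.inr (Sum.inl (v, b))))
      (N * β * (lineRep p v).1) (N * β * (lineRep p v).2.1) 0 0
      ((N * β * b.val + p) * (lineRep p v).2.2.2) (-((N * β * b.val + p) * (lineRep p v).2.2.1))
      (-(lineRep p v).2.1) (lineRep p v).1 := by
  have hm : (lagRep N p α β h (Sum.inr (Sum.inl (v, b)))).mat =
      (gLine N p α β h).mat * (nU b.val 0 0).mat * (mLine p v).mat := rfl
  rw [gLine, mat_pr, mat_nU, mLine, mat_mU, mul_fromBlocks_fin_two,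
    mul_fromBlocks_fin_two] at hm
  refine Lower.of_mat_eq hm ?_ ?_ <;> · push_cast; simp

theorem lower_opp (x y z : ZMod p) :
    Lower (lagRep N p α β h (Sum.inr (Sum.inr (x, y, z))))
      (N * β) 0 0 (N * β) (N * β * x.val + p) (N * β * y.val) (N * β * y.val)
      (N * β * z.val + p) := by
  have hm := GSp.mat_mul (gOpp N p α β h) (nU x.val y.val z.val)
  rw [gOpp, mat_pr, mat_nU, mul_fromBlocks_fin_two] at hm
  refine Lower.of_mat_eq hm ?_ ?_ <;> · push_cast; simp

theorem cast_mul_eq_neg_one {N p : ℕ} {α β : ℤ} (h : (p : ℤ) * α - N * β = 1) :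
    (N * β : ZMod p) = -1 := by
  have := congrArg (Int.cast : ℤ → ZMod p) h
  push_cast at this
  rw [ZMod.natCast_self, zero_mul, zero_sub] at this
  rw [← this, neg_neg]

/-- Lagrangian planes are sorted by the rank of C modulo p. Rank 0 gives one plane; rank 1 gives a
point of the projective line and one parameter b; rank 2 gives the symmetric matrix C⁻¹D. The
representatives realise these planes because Nβ ≡ -1 modulo p. -/
theorem isTransversal_lagRep (hpN : ¬ p ∣ N) :
    IsTransversal (Gamma0 (N * p)) (Gamma0 N : Set GSp) (lagRep N p α β h) where
  mem := lagRep_mem α β h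
  cover γ hγ := by
    have hκ := cast_mul_eq_neg_one h
    obtain ⟨i, j, k, l, m, n, o, q, hlow, -, hrel, -⟩ := exists_lower hγ
    have hrel' := congrArg (Int.cast : ℤ → ZMod p) hrel
    push_cast at hrel'
    by_cases hdet : (i * l - j * k : ZMod p) = 0
    · by_cases h1 : (i : ZMod p) = 0 ∧ (k : ZMod p) = 0
      · by_cases h2 : (j : ZMod p) = 0 ∧ (l : ZMod p) = 0
        · refine ⟨Sum.inl (), (lower_mem_iff_zmod hpN hγ (one_mem _) hlow lower_one).mpr ?_⟩
          simp [h1, h2]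
        -- The first column of C vanishes, so C has rank one and its rows point along (0 : 1); the
        -- symmetry of C Dᵀ makes the second columns of D and C proportional.
        · have key : ∃ b : ZMod p, (n : ZMod p) = j * b ∧ (q : ZMod p) = l * b := by
            rw [h1.1, h1.2, zero_mul, zero_mul, zero_add, zero_add] at hrel'
            by_cases hj : (j : ZMod p) = 0
            · have hl : (l : ZMod p) ≠ 0 := fun hl => h2 ⟨hj, hl⟩
              refine ⟨q / l, ?_, (mul_div_cancel₀ _ hl).symm⟩
              rw [hj, zero_mul] at hrel' ⊢
              exact (mul_eq_zero.mp hrel'.symm).resolve_left hl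
            · refine ⟨n / j, (mul_div_cancel₀ _ hj).symm, ?_⟩
              field_simp
              linear_combination hrel'
          obtain ⟨b, hb1, hb2⟩ := key
          refine ⟨Sum.inr (Sum.inl (none, b)), (lower_mem_iff_zmod hpN hγ (lagRep_mem α β h _) hlow
            (lower_line α β h _ _)).mpr ?_⟩
          simp only [lineRep]
          push_cast
          simp [h1, hκ, hb1, hb2]
      -- The second column of C is t times the first, and the symmetry of C Dᵀ makes D(1,t)ᵀ a
      -- multiple b of the first column.
      · have key : ∃ t b : ZMod p, (j : ZMod p) = i * t ∧ (l : ZMod p) = k * t ∧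
            i * b = m + n * t ∧ k * b = o + q * t := by
          by_cases hi : (i : ZMod p) = 0
          · have hk : (k : ZMod p) ≠ 0 := fun hk => h1 ⟨hi, hk⟩
            have hj : (j : ZMod p) = 0 := by
              rw [hi, zero_mul, zero_sub, neg_eq_zero] at hdet
              exact (mul_eq_zero.mp hdet).resolve_right hk
            refine ⟨l / k, (o + q * (l / k)) / k, ?_, (mul_div_cancel₀ _ hk).symm, ?_,
              mul_div_cancel₀ _ hk⟩
            · rw [hi, hj, zero_mul]
            · rw [hi, hj] at hrel'
              have hlk : (k : ZMod p) * (l / k) = l := mul_div_cancel₀ _ hk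
              rw [hi]
              apply mul_left_cancel₀ hk
              linear_combination hrel' - n * hlk
          · refine ⟨j / i, (m + n * (j / i)) / i, (mul_div_cancel₀ _ hi).symm, ?_,
              mul_div_cancel₀ _ hi, ?_⟩
            · field_simp
              linear_combination hdet
            · field_simp
              linear_combination (-(i : ZMod p)) * hrel' - n * hdet
        obtain ⟨t, b, h3, h4, h5, h6⟩ := key
        refine ⟨Sum.inr (Sum.inl (some t, b)), (lower_mem_iff_zmod hpN hγ (lagRep_mem α β h _) hlow
            (lower_line α β h _ _)).mpr ?_⟩
        simp only [lineRep]
        push_cast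
        simp only [hκ, ZMod.natCast_self, ZMod.natCast_zmod_val]
        refine ⟨?_, ?_, ?_, ?_⟩
        · linear_combination -h5
        · linear_combination h3
        · linear_combination -h6
        · linear_combination h4
    -- With C invertible modulo p, (x y; y z) is C⁻¹D, computed with the adjugate of C.
    · obtain ⟨x, hx⟩ : ∃ x : ZMod p, (i * l - j * k) * x = l * m - j * o :=
        ⟨_, mul_div_cancel₀ _ hdet⟩
      obtain ⟨y, hy⟩ : ∃ y : ZMod p, (i * l - j * k) * y = l * n - j * q :=
        ⟨_, mul_div_cancel₀ _ hdet⟩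
      obtain ⟨z, hz⟩ : ∃ z : ZMod p, (i * l - j * k) * z = i * q - k * n :=
        ⟨_, mul_div_cancel₀ _ hdet⟩
      refine ⟨Sum.inr (Sum.inr (x, y, z)), (lower_mem_iff_zmod hpN hγ (lagRep_mem α β h _) hlow
            (lower_opp α β h _ _ _)).mpr ?_⟩
      push_cast
      simp only [hκ, ZMod.natCast_self, ZMod.natCast_zmod_val]
      refine ⟨mul_left_cancel₀ hdet ?_, mul_left_cancel₀ hdet ?_, mul_left_cancel₀ hdet ?_,
        mul_left_cancel₀ hdet ?_⟩
      · linear_combination -i * hx - j * hy + j * hrel'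
      · linear_combination -i * hy - j * hz
      · linear_combination -k * hx - l * hy + l * hrel'
      · linear_combination -k * hy - l * hz
  inj := by
    have hκ := cast_mul_eq_neg_one h
    have h1 : ∀ i, lagRep N p α β h i ∈ Gamma0 N := lagRep_mem α β h
    have hlow1 : Lower (lagRep N p α β h (Sum.inl ())) 0 0 0 0 1 0 0 1 := lower_one
    rintro (_ | ⟨v, b⟩ | ⟨x, y, z⟩) (_ | ⟨v', b'⟩ | ⟨x', y', z'⟩) hij
    · rfl
    · rw [lower_mem_iff_zmod hpN (h1 _) (h1 _) hlow1 (lower_line α β h _ _)] at hij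
      cases v' <;> simp [lineRep, hκ] at hij
    · rw [lower_mem_iff_zmod hpN (h1 _) (h1 _) hlow1 (lower_opp α β h _ _ _)] at hij
      simp [hκ] at hij
    · rw [lower_mem_iff_zmod hpN (h1 _) (h1 _) (lower_line α β h _ _) hlow1] at hij
      cases v <;> simp [lineRep, hκ] at hij
    · rw [lower_mem_iff_zmod hpN (h1 _) (h1 _) (lower_line α β h _ _)
        (lower_line α β h _ _)] at hij
      rcases v with _ | t <;> rcases v' with _ | t' <;> simp [lineRep, hκ] at hij ⊢
      · exact hij.symm
      · obtain ⟨h2, h3⟩ := hij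
        have : t = t' := by linear_combination -h3.1
        exact ⟨this, by linear_combination -h2⟩
    · rw [lower_mem_iff_zmod hpN (h1 _) (h1 _) (lower_line α β h _ _)
        (lower_opp α β h _ _ _)] at hij
      cases v <;> simp [lineRep, hκ] at hij
    · rw [lower_mem_iff_zmod hpN (h1 _) (h1 _) (lower_opp α β h _ _ _) hlow1] at hij
      simp [hκ] at hij
    · rw [lower_mem_iff_zmod hpN (h1 _) (h1 _) (lower_opp α β h _ _ _)
        (lower_line α β h _ _)] at hij
      cases v' <;> simp [lineRep, hκ] at hij
    · rw [lower_mem_iff_zmod hpN (h1 _) (h1 _) (lower_opp α β h _ _ _)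
        (lower_opp α β h _ _ _)] at hij
      simp [hκ] at hij
      simp [hij]

theorem card_lagIdx : Fintype.card (LagIdx p) = 1 + ((p + 1) * p + p ^ 3) := by
  simp only [Fintype.card_sum, Fintype.card_prod, Fintype.card_option, ZMod.card,
    Fintype.card_unit]
  ring

end Prime

end

/-! ### Conjugation by diagonal matrices and unipotent coset representatives -/

section

section Prime

variable {N p : ℕ} [Fact p.Prime]

theorem prime_cast_ne_zero (p : ℕ) [Fact p.Prime] : (p : ℝ) ≠ 0 :=
  Nat.cast_ne_zero.mpr (Fact.out : p.Prime).ne_zero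

/-- Conjugation by a diagonal matrix scales the entries. -/
theorem mat_conj_diagP (x₁ x₂ x₃ x₄ : ℕ) (hx : x₁ + x₃ = x₂ + x₄) {g : GSp}
    {a b c d e f g' h i j k l m n o q : ℝ}
    (hm : g.mat = fromBlocks !![a, b; c, d] !![e, f; g', h] !![i, j; k, l] !![m, n; o, q]) :
    (diagP p x₁ x₂ x₃ x₄ hx * g * (diagP p x₁ x₂ x₃ x₄ hx)⁻¹).mat = fromBlocks
      !![a, p ^ x₁ * b / p ^ x₂; p ^ x₂ * c / p ^ x₁, d]
      !![p ^ x₁ * e / p ^ x₃, p ^ x₁ * f / p ^ x₄; p ^ x₂ * g' / p ^ x₃, p ^ x₂ * h / p ^ x₄]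
      !![p ^ x₃ * i / p ^ x₁, p ^ x₃ * j / p ^ x₂; p ^ x₄ * k / p ^ x₁, p ^ x₄ * l / p ^ x₂]
      !![m, p ^ x₃ * n / p ^ x₄; p ^ x₄ * o / p ^ x₃, q] := by
  have hp := prime_cast_ne_zero p
  have h1 : (diagP p x₁ x₂ x₃ x₄ hx).mat * (diagP p x₁ x₂ x₃ x₄ hx)⁻¹.mat = 1 := by
    rw [← GSp.mat_mul, mul_inv_cancel, GSp.mat_one]
  rw [GSp.mat_mul, GSp.mat_mul, hm, mat_diagP, mul_fromBlocks_fin_two]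
  rw [mat_diagP] at h1
  have h2 : fromBlocks !![a, p ^ x₁ * b / p ^ x₂; p ^ x₂ * c / p ^ x₁, d]
      !![p ^ x₁ * e / p ^ x₃, p ^ x₁ * f / p ^ x₄; p ^ x₂ * g' / p ^ x₃, p ^ x₂ * h / p ^ x₄]
      !![p ^ x₃ * i / p ^ x₁, p ^ x₃ * j / p ^ x₂; p ^ x₄ * k / p ^ x₁, p ^ x₄ * l / p ^ x₂]
      !![m, p ^ x₃ * n / p ^ x₄; p ^ x₄ * o / p ^ x₃, q] *
      fromBlocks !![(p : ℝ) ^ x₁, 0; 0, (p : ℝ) ^ x₂] !![0, 0; 0, 0]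
      !![0, 0; 0, 0] !![(p : ℝ) ^ x₃, 0; 0, (p : ℝ) ^ x₄] = fromBlocks
      !![p ^ x₁ * a, p ^ x₁ * b; p ^ x₂ * c, p ^ x₂ * d]
      !![p ^ x₁ * e, p ^ x₁ * f; p ^ x₂ * g', p ^ x₂ * h]
      !![p ^ x₃ * i, p ^ x₃ * j; p ^ x₄ * k, p ^ x₄ * l]
      !![p ^ x₃ * m, p ^ x₃ * n; p ^ x₄ * o, p ^ x₄ * q] := by
    rw [mul_fromBlocks_fin_two]
    apply fromBlocks_fin_two_eq <;> refine ⟨?_, ?_, ?_, ?_⟩ <;> simp <;> field_simp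
  simp only [zero_mul, add_zero, zero_add]
  rw [← h2, Matrix.mul_assoc, h1, Matrix.mul_one]

theorem simil_conj (t g : GSp) : (t * g * t⁻¹).simil = g.simil := by
  have := t.simil_pos.ne'
  rw [GSp.simil_mul, GSp.simil_mul, GSp.simil_inv]
  field_simp

theorem intCast_zmod_of_dvd {x : ℤ} {M : ℕ} (hpM : p ∣ M) (hx : (M : ℤ) ∣ x) :
    (x : ZMod p) = 0 := by
  rw [ZMod.intCast_zmod_eq_zero_iff_dvd]
  exact (Int.natCast_dvd_natCast.mpr hpM).trans hx

theorem dvd_of_intCast_zmod {x : ℤ} (h : (x : ZMod p) = 0) : (p : ℤ) ∣ x :=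
  (ZMod.intCast_zmod_eq_zero_iff_dvd _ _).mp h

/-- `d H d⁻¹ ∩ H` for `d = diag(1, 1, p, p)` is cut out by `B ≡ 0 mod p`. -/
theorem mem_stabIn_diag_iff {M : ℕ} {g : GSp} (hg : g ∈ Gamma0 M)
    {a b c d e f g' h i j k l m n o q : ℤ}
    (hm : g.mat = fromBlocks !![(a : ℝ), b; c, d] !![(e : ℝ), f; g', h] !![(i : ℝ), j; k, l]
        !![(m : ℝ), n; o, q]) :
    g ∈ stabIn (Gamma0 M) (diagP p 0 0 1 1 rfl) (Gamma0 M) ↔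
      (p : ℤ) ∣ e ∧ (p : ℤ) ∣ f ∧ (p : ℤ) ∣ g' ∧ (p : ℤ) ∣ h := by
  have hp := prime_cast_ne_zero p
  have hconj := mat_conj_diagP (p := p) 0 0 1 1 rfl hm
  simp only [pow_zero, pow_one, one_mul, div_one] at hconj
  rw [mem_stabIn]
  constructor
  · rintro ⟨-, hmem⟩
    obtain ⟨a', b', c', d', e', f', g'', h', i', j', k', l', m', n', o', q', hm', -⟩ :=
      mat_eq_of_mem hmem
    rw [hconj, fromBlocks_inj] at hm'
    obtain ⟨h1, h2, h3, h4⟩ := fin_two_inj hm'.2.1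
    rw [div_eq_iff hp] at h1 h2 h3 h4
    norm_cast at h1 h2 h3 h4
    exact ⟨⟨e', by rw [h1, mul_comm]⟩, ⟨f', by rw [h2, mul_comm]⟩, ⟨g'', by rw [h3, mul_comm]⟩,
      ⟨h', by rw [h4, mul_comm]⟩⟩
  · rintro ⟨⟨e', rfl⟩, ⟨f', rfl⟩, ⟨g'', rfl⟩, ⟨h', rfl⟩⟩
    refine ⟨hg, ?_⟩
    obtain ⟨a1, b1, c1, d1, e1, f1, g1, h1, i1, j1, k1, l1, m1, n1, o1, q1, hm1, hd⟩ :=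
      mat_eq_of_mem hg
    rw [hm, fromBlocks_inj] at hm1
    obtain ⟨r1, r2, r3, r4⟩ := fin_two_inj hm1.2.2.1
    rw [Int.cast_inj] at r1 r2 r3 r4
    subst r1 r2 r3 r4
    refine mem_of_mat_eq ((simil_conj _ _).trans (simil_of_mem_Gamma0 hg)) a b c d e' f' g'' h'
      (p * i) (p * j) (p * k) (p * l) m n o q ?_
      ⟨hd.1.mul_left _, hd.2.1.mul_left _, hd.2.2.1.mul_left _, hd.2.2.2.mul_left _⟩
    rw [hconj]
    apply fromBlocks_fin_two_eq <;> refine ⟨?_, ?_, ?_, ?_⟩ <;> push_cast <;> field_simp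

theorem mat_mul_nU_inv {g : GSp} {a b c d e f g' h i j k l m n o q : ℤ}
    (hm : g.mat = fromBlocks !![(a : ℝ), b; c, d] !![(e : ℝ), f; g', h] !![(i : ℝ), j; k, l]
        !![(m : ℝ), n; o, q]) (x y z : ℕ) :
    (g * (nU x y z)⁻¹).mat = fromBlocks !![(a : ℝ), b; c, d]
      !![((e - (a * x + b * y) : ℤ) : ℝ), ((f - (a * y + b * z) : ℤ) : ℝ);
        ((g' - (c * x + d * y) : ℤ) : ℝ), ((h - (c * y + d * z) : ℤ) : ℝ)]
      !![(i : ℝ), j; k, l]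
      !![((m - (i * x + j * y) : ℤ) : ℝ), ((n - (i * y + j * z) : ℤ) : ℝ);
        ((o - (k * x + l * y) : ℤ) : ℝ), ((q - (k * y + l * z) : ℤ) : ℝ)] := by
  rw [nU_inv, GSp.mat_mul, hm, mat_nU, mul_fromBlocks_fin_two]
  push_cast
  apply fromBlocks_fin_two_eq <;> refine ⟨?_, ?_, ?_, ?_⟩ <;> ring

/-- Modulo p the matrix A is invertible because p divides C, and right multiplication by n(-S)
replaces B by B - A S. So exactly one symmetric S modulo p makes the upper right block vanish. -/
theorem isTransversal_nU {M : ℕ} (hpM : p ∣ M) :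
    IsTransversal (stabIn (Gamma0 M) (diagP p 0 0 1 1 rfl) (Gamma0 M)) (Gamma0 M : Set GSp)
      (fun x : ZMod p × ZMod p × ZMod p => nU x.1.val x.2.1.val x.2.2.val) where
  mem x := nU_val_mem M _ _ _
  cover γ hγ := by
    obtain ⟨i, j, k, l, m, n, o, q, -, ⟨di, dj, dk, dl⟩, -, a, b, c, d, e, f, g', h, hm,
      ⟨r1, r2, r3, r4⟩, -, -, hs⟩ := exists_lower hγ
    have zi := intCast_zmod_of_dvd hpM di
    have zj := intCast_zmod_of_dvd hpM dj
    have zk := intCast_zmod_of_dvd hpM dk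
    have zl := intCast_zmod_of_dvd hpM dl
    have c1 := congrArg (Int.cast : ℤ → ZMod p) r1
    have c2 := congrArg (Int.cast : ℤ → ZMod p) r2
    have c3 := congrArg (Int.cast : ℤ → ZMod p) r3
    have c4 := congrArg (Int.cast : ℤ → ZMod p) r4
    have hs' := congrArg (Int.cast : ℤ → ZMod p) hs
    push_cast at c1 c2 c3 c4 hs'
    rw [zi, zj] at c1 c2
    rw [zk, zl] at c3 c4
    -- These are the entries of DᵀB, which is symmetric and equals A⁻¹B modulo p.
    refine ⟨(m * e + o * g', n * e + q * g', n * f + q * h), ?_⟩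
    rw [mem_stabIn_diag_iff (mul_mem hγ (inv_mem (nU_val_mem M _ _ _))) (mat_mul_nU_inv hm _ _ _)]
    refine ⟨dvd_of_intCast_zmod ?_, dvd_of_intCast_zmod ?_, dvd_of_intCast_zmod ?_,
      dvd_of_intCast_zmod ?_⟩ <;> push_cast <;> simp only [ZMod.natCast_zmod_val]
    · linear_combination (-e : ZMod p) * c1 - g' * c3
    · linear_combination (-f : ZMod p) * c1 - h * c3 + a * hs'
    · linear_combination (-e : ZMod p) * c2 - g' * c4
    · linear_combination (-f : ZMod p) * c2 - h * c4 + c * hs'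
  inj := by
    rintro ⟨x, y, z⟩ ⟨x', y', z'⟩ hmem
    have h1 : (nU (x.val : ℝ) y.val z.val).mat = fromBlocks !![((1 : ℤ) : ℝ), (0 : ℤ); (0 : ℤ), (1 : ℤ)]
      !![((x.val : ℤ) : ℝ), ((y.val : ℤ) : ℝ); ((y.val : ℤ) : ℝ), ((z.val : ℤ) : ℝ)]
      !![((0 : ℤ) : ℝ), (0 : ℤ); (0 : ℤ), (0 : ℤ)]
      !![((1 : ℤ) : ℝ), (0 : ℤ); (0 : ℤ), (1 : ℤ)] := by
      rw [mat_nU]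
      push_cast
      rfl
    rw [mem_stabIn_diag_iff (mul_mem (nU_val_mem M _ _ _) (inv_mem (nU_val_mem M _ _ _)))
      (mat_mul_nU_inv h1 _ _ _)] at hmem
    obtain ⟨h2, h3, -, h5⟩ := hmem
    rw [← ZMod.intCast_zmod_eq_zero_iff_dvd] at h2 h3 h5
    push_cast at h2 h3 h5
    simp only [ZMod.natCast_zmod_val, one_mul, zero_mul, add_zero, zero_add, sub_eq_zero] at h2 h3 h5
    rw [h2, h3, h5]

theorem lower_nL (x y z : ℤ) : Lower (nL x y z) x y y z 1 0 0 1 :=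
  Lower.of_mat_eq (mat_nL x y z) (by simp) (by simp)

theorem nL_natCast_mem (M : ℕ) (x y z : ℕ) :
    nL ((M * x : ℤ) : ℝ) ((M * y : ℤ) : ℝ) ((M * z : ℤ) : ℝ) ∈ Gamma0 M :=
  nL_mem (dvd_mul_right _ _) (dvd_mul_right _ _) (dvd_mul_right _ _)

/-- The lower triangular counterpart: C = M·C₀, and D is invertible modulo p because p divides M, so
C₀ is removed modulo p by exactly one symmetric matrix. -/
theorem isTransversal_nL {M : ℕ} (hM : M ≠ 0) (hpM : p ∣ M) :
    IsTransversal (Gamma0 (M * p)) (Gamma0 M : Set GSp)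
      (fun x : ZMod p × ZMod p × ZMod p => nL ((M * x.1.val : ℤ) : ℝ) ((M * x.2.1.val : ℤ) : ℝ)
        ((M * x.2.2.val : ℤ) : ℝ)) where
  mem x := nL_natCast_mem M _ _ _
  cover γ hγ := by
    obtain ⟨i, j, k, l, m, n, o, q, hlow, ⟨⟨i0, rfl⟩, ⟨j0, rfl⟩, ⟨k0, rfl⟩, ⟨l0, rfl⟩⟩, -, a, b, c,
      d, e, f, g', h, hm, ⟨r1, r2, r3, r4⟩, -, hs, -⟩ := exists_lower hγ
    have hM' : (M : ℤ) ≠ 0 := by exact_mod_cast hM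
    have zM : (M : ZMod p) = 0 := (ZMod.natCast_eq_zero_iff _ _).mpr hpM
    have hs' : a * j0 + c * l0 = b * i0 + d * k0 := by
      apply mul_left_cancel₀ hM'
      linarith
    have c1 := congrArg (Int.cast : ℤ → ZMod p) r1
    have c2 := congrArg (Int.cast : ℤ → ZMod p) r2
    have c3 := congrArg (Int.cast : ℤ → ZMod p) r3
    have c4 := congrArg (Int.cast : ℤ → ZMod p) r4
    have hs'' := congrArg (Int.cast : ℤ → ZMod p) hs'
    push_cast at c1 c2 c3 c4 hs''
    simp only [zM, zero_mul, add_zero, sub_zero] at c1 c2 c3 c4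
    -- These are the entries of AᵀC₀, which is symmetric and equals D⁻¹C₀ modulo p.
    refine ⟨(a * i0 + c * k0, b * i0 + d * k0, b * j0 + d * l0), ?_⟩
    rw [lower_mem_iff hγ (nL_natCast_mem M _ _ _) hlow (lower_nL _ _ _)]
    have key : ∀ x y u s v t : ℤ, (x : ZMod p) = u * s + v * t →
        ((M * p : ℕ) : ℤ) ∣ M * x * 1 + M * y * 0 - (u * (M * s) + v * (M * t)) ∧
        ((M * p : ℕ) : ℤ) ∣ M * y * 0 + M * x * 1 - (u * (M * s) + v * (M * t)) := by
      intro x y u s v t hxy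
      have h1 : (p : ℤ) ∣ x - (u * s + v * t) :=
        dvd_of_intCast_zmod (by push_cast; rw [hxy, sub_self])
      have h2 := mul_dvd_mul_left (M : ℤ) h1
      rw [← Nat.cast_mul] at h2
      have h3 : (M : ℤ) * x * 1 + M * y * 0 - (u * (M * s) + v * (M * t)) =
        M * (x - (u * s + v * t)) := by ring
      have h4 : (M : ℤ) * y * 0 + M * x * 1 - (u * (M * s) + v * (M * t)) =
        M * (x - (u * s + v * t)) := by ring
      rw [h3, h4]
      exact ⟨h2, h2⟩
    refine ⟨(key _ _ _ _ _ _ ?_).1, (key _ _ _ _ _ _ ?_).2, (key _ _ _ _ _ _ ?_).1,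
      (key _ _ _ _ _ _ ?_).2⟩ <;> push_cast <;> simp only [ZMod.natCast_zmod_val]
    · linear_combination (-i0 : ZMod p) * c1 - k0 * c2
    · linear_combination (-j0 : ZMod p) * c1 - l0 * c2 + m * hs''
    · linear_combination (-i0 : ZMod p) * c3 - k0 * c4
    · linear_combination (-j0 : ZMod p) * c3 - l0 * c4 + o * hs''
  inj := by
    rintro ⟨x, y, z⟩ ⟨x', y', z'⟩ hmem
    rw [lower_mem_iff (nL_natCast_mem M _ _ _) (nL_natCast_mem M _ _ _) (lower_nL _ _ _)
      (lower_nL _ _ _)] at hmem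
    have key : ∀ x y : ZMod p, ((M * p : ℕ) : ℤ) ∣ M * x.val - M * y.val → x = y := by
      intro x y hxy
      rw [← mul_sub] at hxy
      push_cast at hxy
      have h1 := Int.dvd_of_mul_dvd_mul_left (by exact_mod_cast hM) hxy
      rw [← ZMod.intCast_zmod_eq_zero_iff_dvd] at h1
      push_cast at h1
      simpa [sub_eq_zero] using h1
    obtain ⟨h1, h2, -, h4⟩ := hmem
    rw [key x x' (by convert h1 using 1; ring), key y y' (by convert h2 using 1; ring),
      key z z' (by convert h4 using 1; ring)]

end Prime

end

/-! ### The index attached to diag(p², p, 1, p) -/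

section

section Prime

variable {N p : ℕ} [Fact p.Prime]

theorem isCoprime_pow_of_not_dvd (hpN : ¬ p ∣ N) (j : ℕ) : IsCoprime (N : ℤ) ((p : ℤ) ^ j) := by
  refine IsCoprime.pow_right ?_
  rw [Nat.isCoprime_iff_coprime]
  exact ((Nat.Prime.coprime_iff_not_dvd Fact.out).mpr hpN).symm

/-- The intersection `δ⁻¹ Γ_0(N) δ ∩ Γ_0(N)` for `δ = diag(p², p, 1, p)`. -/
theorem mem_stabIn_delta_iff (hpN : ¬ p ∣ N) {g : GSp} (hg : g ∈ Gamma0 N)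
    {a b c d e f g' h i j k l m n o q : ℤ}
    (hm : g.mat = fromBlocks !![(a : ℝ), b; c, d] !![(e : ℝ), f; g', h] !![(i : ℝ), j; k, l]
        !![(m : ℝ), n; o, q]) :
    g ∈ stabIn (Gamma0 N) (diagP p 2 1 0 1 rfl) (Gamma0 N) ↔
      (p : ℤ) ∣ c ∧ (p : ℤ) ^ 2 ∣ i ∧ (p : ℤ) ∣ j ∧ (p : ℤ) ∣ k ∧ (p : ℤ) ∣ n := by
  have hp := prime_cast_ne_zero p
  have hconj := mat_conj_diagP (p := p) 2 1 0 1 rfl hm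
  simp only [pow_zero, pow_one, one_mul, div_one] at hconj
  rw [mem_stabIn]
  constructor
  · rintro ⟨-, hmem⟩
    obtain ⟨a', b', c', d', e', f', g'', h', i', j', k', l', m', n', o', q', hm', -⟩ :=
      mat_eq_of_mem hmem
    rw [hconj, fromBlocks_inj] at hm'
    obtain ⟨-, -, h3, -⟩ := fin_two_inj hm'.1
    obtain ⟨h4, h5, h6, -⟩ := fin_two_inj hm'.2.2.1
    obtain ⟨-, h7, -, -⟩ := fin_two_inj hm'.2.2.2
    have hp2 : (p : ℝ) ^ 2 ≠ 0 := pow_ne_zero _ hp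
    rw [div_eq_iff hp2] at h3 h4 h6
    rw [div_eq_iff hp] at h5 h7
    have h3' : (c : ℝ) = c' * p := by
      apply mul_left_cancel₀ hp
      linarith
    have h6' : (k : ℝ) = k' * p := by
      apply mul_left_cancel₀ hp
      linarith
    norm_cast at h3' h4 h5 h6' h7
    refine ⟨⟨c', by rw [h3', mul_comm]⟩, ⟨i', by rw [h4, mul_comm]; push_cast; ring⟩,
      ⟨j', by rw [h5, mul_comm]⟩, ⟨k', by rw [h6', mul_comm]⟩, ⟨n', by rw [h7, mul_comm]⟩⟩
  · rintro ⟨⟨c', rfl⟩, ⟨i', rfl⟩, ⟨j', rfl⟩, ⟨k', rfl⟩, ⟨n', rfl⟩⟩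
    refine ⟨hg, ?_⟩
    obtain ⟨a1, b1, c1, d1, e1, f1, g1, h1, i1, j1, k1, l1, m1, n1, o1, q1, hm1, hd⟩ :=
      mat_eq_of_mem hg
    rw [hm, fromBlocks_inj] at hm1
    obtain ⟨r1, r2, r3, r4⟩ := fin_two_inj hm1.2.2.1
    rw [Int.cast_inj] at r1 r2 r3 r4
    subst r1 r2 r3 r4
    have hc1 := isCoprime_pow_of_not_dvd (p := p) hpN 1
    rw [pow_one] at hc1
    refine mem_of_mat_eq ((simil_conj _ _).trans (simil_of_mem_Gamma0 hg)) a (p * b) c' d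
      (p ^ 2 * e) (p * f) (p * g') h i' j' k' l m n' (p * o) q ?_
      ⟨(isCoprime_pow_of_not_dvd hpN 2).dvd_of_dvd_mul_left hd.1, hc1.dvd_of_dvd_mul_left hd.2.1,
        hc1.dvd_of_dvd_mul_left hd.2.2.1, hd.2.2.2⟩
    rw [hconj]
    apply fromBlocks_fin_two_eq <;> refine ⟨?_, ?_, ?_, ?_⟩ <;> push_cast <;> field_simp

/-- Inside Γ₀(Np) the conditions on j and k are automatic. Since A Dᵀ ≡ 1 modulo p, vanishing of the
upper right entry of D forces vanishing of the lower left entry of A. -/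
theorem mem_stabIn_delta_iff_of_mem (hpN : ¬ p ∣ N) {g : GSp} (hg : g ∈ Gamma0 (N * p))
    {i j k l m n o q : ℤ} (hlow : Lower g i j k l m n o q) :
    g ∈ stabIn (Gamma0 N) (diagP p 2 1 0 1 rfl) (Gamma0 N) ↔ (p : ℤ) ^ 2 ∣ i ∧ (p : ℤ) ∣ n := by
  obtain ⟨i1, j1, k1, l1, m1, n1, o1, q1, ⟨A1, B1, hl1⟩, hd, -, a, b, c, d, e, f, g', h, hm,
    ⟨r1, r2, r3, r4⟩, -, -⟩ := exists_lower hg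
  obtain ⟨A, B, hl⟩ := hlow
  rw [hl, fromBlocks_inj] at hl1
  obtain ⟨rfl, rfl, rfl, rfl⟩ : i = i1 ∧ j = j1 ∧ k = k1 ∧ l = l1 := by
    simpa only [Int.cast_inj] using fin_two_inj hl1.2.2.1
  obtain ⟨rfl, rfl, rfl, rfl⟩ : m = m1 ∧ n = n1 ∧ o = o1 ∧ q = q1 := by
    simpa only [Int.cast_inj] using fin_two_inj hl1.2.2.2
  rw [mem_stabIn_delta_iff hpN (Gamma0_le (dvd_mul_right N p) hg) hm]
  refine ⟨fun hh => ⟨hh.2.1, hh.2.2.2.2⟩, fun hh => ?_⟩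
  have hpd : ∀ x : ℤ, ((N * p : ℕ) : ℤ) ∣ x → (p : ℤ) ∣ x := fun x hx =>
    dvd_trans (by push_cast; exact dvd_mul_left _ _) hx
  refine ⟨?_, hh.1, hpd _ hd.2.1, hpd _ hd.2.2.1, hh.2⟩
  have zi := intCast_zmod_of_dvd (dvd_mul_left p N) hd.1
  have zj := intCast_zmod_of_dvd (dvd_mul_left p N) hd.2.1
  have zn : (n : ZMod p) = 0 := (ZMod.intCast_zmod_eq_zero_iff_dvd _ _).mpr hh.2
  have c1 := congrArg (Int.cast : ℤ → ZMod p) r1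
  have c2 := congrArg (Int.cast : ℤ → ZMod p) r2
  push_cast at c1 c2
  rw [zi, zj, zn] at c1 c2
  apply dvd_of_intCast_zmod
  linear_combination a * c2 - c * c1

/-- The entries of representatives of the points of the projective line, transposed. -/
def mLow (p : ℕ) : Option (ZMod p) → GSp
  | some s => mU 1 0 (s.val : ℤ) 1 (by simp)
  | none => mU 0 1 (-1) 0 (by simp)

theorem mLow_mem (N : ℕ) (v : Option (ZMod p)) : mLow p v ∈ Gamma0 N := by
  cases v with
  | none =>
    have := mU_mem N 0 1 (-1) 0 (by simp)
    push_cast at this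
    exact this
  | some s =>
    have := mU_mem N 1 0 s.val 1 (by simp)
    push_cast at this
    exact this

/-- Representatives of `Γ_0(Np) ∩ K \ Γ_0(Np)`, where `K = δ⁻¹ Γ_0(N) δ ∩ Γ_0(N)`. -/
def flagRep (N p : ℕ) (x : Option (ZMod p) × ZMod p) : GSp :=
  nL (((N * p : ℕ) * x.2.val : ℤ) : ℝ) 0 0 * mLow p x.1

theorem flagRep_mem (x : Option (ZMod p) × ZMod p) : flagRep N p x ∈ Gamma0 (N * p) := by
  refine mul_mem ?_ (mLow_mem _ _)
  have := nL_mem (N := N * p) (x := (N * p : ℕ) * x.2.val) (y := 0) (z := 0)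
    (dvd_mul_right _ _) (dvd_zero _) (dvd_zero _)
  simpa using this

theorem simil_flagRep (x : Option (ZMod p) × ZMod p) : (flagRep N p x).simil = 1 :=
  simil_of_mem_Gamma0 (flagRep_mem x)

theorem mat_flagRep_some (s b : ZMod p) : (flagRep N p (some s, b)).mat =
    fromBlocks !![((1 : ℤ) : ℝ), (0 : ℤ); (s.val : ℤ), (1 : ℤ)] !![((0 : ℤ) : ℝ), (0 : ℤ); (0 : ℤ), (0 : ℤ)]
      !![(((N * p : ℕ) * b.val : ℤ) : ℝ), (0 : ℤ); (0 : ℤ), (0 : ℤ)]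
      !![((1 : ℤ) : ℝ), (-s.val : ℤ); (0 : ℤ), (1 : ℤ)] := by
  rw [flagRep, GSp.mat_mul, mat_nL, mLow, mat_mU, mul_fromBlocks_fin_two]
  apply fromBlocks_fin_two_eq <;> refine ⟨?_, ?_, ?_, ?_⟩ <;> push_cast <;> ring

theorem mat_flagRep_none (b : ZMod p) : (flagRep N p (none, b)).mat =
    fromBlocks !![((0 : ℤ) : ℝ), (1 : ℤ); (-1 : ℤ), (0 : ℤ)] !![((0 : ℤ) : ℝ), (0 : ℤ); (0 : ℤ), (0 : ℤ)]
      !![((0 : ℤ) : ℝ), ((N * p : ℕ) * b.val : ℤ); (0 : ℤ), (0 : ℤ)]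
      !![((0 : ℤ) : ℝ), (1 : ℤ); (-1 : ℤ), (0 : ℤ)] := by
  rw [flagRep, GSp.mat_mul, mat_nL, mLow, mat_mU, mul_fromBlocks_fin_two]
  apply fromBlocks_fin_two_eq <;> refine ⟨?_, ?_, ?_, ?_⟩ <;> push_cast <;> ring

/-- The lower half of `g r⁻¹`. -/
theorem Lower.mul_inv {g r : GSp} {i j k l m n o q a' b' c' d' e' f' g'' h' i' j' k' l' m' n' o' q' : ℤ}
    (hg : Lower g i j k l m n o q) (hr : r.simil = 1)
    (hm : r.mat = fromBlocks !![(a' : ℝ), b'; c', d'] !![(e' : ℝ), f'; g'', h']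
      !![(i' : ℝ), j'; k', l'] !![(m' : ℝ), n'; o', q']) :
    Lower (g * r⁻¹)
      (i * m' + j * n' - (m * i' + n * j')) (i * o' + j * q' - (m * k' + n * l'))
      (k * m' + l * n' - (o * i' + q * j')) (k * o' + l * q' - (o * k' + q * l'))
      (m * a' + n * b' - (i * e' + j * f')) (m * c' + n * d' - (i * g'' + j * h'))
      (o * a' + q * b' - (k * e' + l * f')) (o * c' + q * d' - (k * g'' + l * h')) := by
  obtain ⟨A, B, hA⟩ := hg
  have h1 := GSp.mat_mul g r⁻¹
  rw [GSp.mat_inv hm, hr, inv_one, one_smul, hA, fromBlocks_multiply, transpose_fin_two,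
    transpose_fin_two, transpose_fin_two, transpose_fin_two] at h1
  simp only [Matrix.mul_neg, Matrix.mul_fin_two] at h1
  refine ⟨_, _, h1.trans (congrArg₂ (fromBlocks _ _) ?_ ?_)⟩
  · ext x y
    fin_cases x <;> fin_cases y <;> push_cast <;> simp <;> ring
  · ext x y
    fin_cases x <;> fin_cases y <;> push_cast <;> simp <;> ring

/-- The first row (m : n) of D modulo p is a point of the projective line, and the Levi factor moves
it to (1 : 0). The lower unipotent factor then clears the corner entry of C, divisible by Np, modulo
p²; this costs p further choices. -/
theorem isTransversal_flagRep (hpN : ¬ p ∣ N) :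
    IsTransversal (Gamma0 (N * p) ⊓ stabIn (Gamma0 N) (diagP p 2 1 0 1 rfl) (Gamma0 N))
      (Gamma0 (N * p) : Set GSp) (flagRep N p) where
  mem := flagRep_mem
  cover γ hγ := by
    have hp : p.Prime := Fact.out
    obtain ⟨i, j, k, l, m, n, o, q, hlow, ⟨⟨i0, rfl⟩, ⟨j0, rfl⟩, ⟨k0, rfl⟩, ⟨l0, rfl⟩⟩, -,
      a, b, c, d, e, f, g', h, hm, ⟨r1, r2, r3, r4⟩, -, -⟩ := exists_lower hγ
    have c1 := congrArg (Int.cast : ℤ → ZMod p) r1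
    push_cast at c1
    simp only [ZMod.natCast_self, mul_zero, zero_mul, add_zero, sub_zero] at c1
    have key : ∀ x y : ℤ, (y : ZMod p) = 0 → x = (N * p : ℕ) * y → (p : ℤ) ^ 2 ∣ x := by
      rintro x y hy rfl
      obtain ⟨z, rfl⟩ := dvd_of_intCast_zmod hy
      exact ⟨N * z, by push_cast; ring⟩
    by_cases hmz : (m : ZMod p) = 0
    · have hn : (n : ZMod p) ≠ 0 := by
        intro hn
        rw [hmz, hn] at c1
        simp at c1
      refine ⟨(none, j0 / n), Subgroup.mem_inf.mpr
        ⟨(Gamma0 _).mul_mem hγ ((Gamma0 _).inv_mem (flagRep_mem _)), ?_⟩⟩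
      rw [mem_stabIn_delta_iff_of_mem hpN ((Gamma0 _).mul_mem hγ
        ((Gamma0 _).inv_mem (flagRep_mem _)))
        (hlow.mul_inv (simil_flagRep _) (mat_flagRep_none _))]
      refine ⟨key _ (j0 - n * (j0 / n : ZMod p).val) ?_ (by ring), dvd_of_intCast_zmod ?_⟩
      · push_cast
        rw [ZMod.natCast_zmod_val, mul_div_cancel₀ _ hn, sub_self]
      · push_cast
        rw [hmz]
        simp
    · refine ⟨(some (-n / m), (i0 - j0 * (-n / m)) / m), Subgroup.mem_inf.mpr
        ⟨(Gamma0 _).mul_mem hγ ((Gamma0 _).inv_mem (flagRep_mem _)), ?_⟩⟩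
      rw [mem_stabIn_delta_iff_of_mem hpN ((Gamma0 _).mul_mem hγ
        ((Gamma0 _).inv_mem (flagRep_mem _)))
        (hlow.mul_inv (simil_flagRep _) (mat_flagRep_some _ _))]
      refine ⟨key _ (i0 - j0 * (-n / m : ZMod p).val -
        m * ((i0 - j0 * (-n / m)) / m : ZMod p).val) ?_ (by ring), dvd_of_intCast_zmod ?_⟩
      · push_cast
        rw [ZMod.natCast_zmod_val, ZMod.natCast_zmod_val, mul_div_cancel₀ _ hmz, sub_self]
      · push_cast
        rw [ZMod.natCast_zmod_val, mul_div_cancel₀ _ hmz]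
        ring
  inj := by
    have hp : (p : ℤ) ≠ 0 := by exact_mod_cast (Fact.out : p.Prime).ne_zero
    have hc := isCoprime_pow_of_not_dvd (p := p) hpN 1
    rw [pow_one] at hc
    have key : ∀ (b b' : ZMod p) (x : ℤ), (p : ℤ) ^ 2 ∣ x →
        x = (N * p : ℕ) * b.val - (N * p : ℕ) * b'.val → b = b' := by
      rintro b b' x ⟨z, hz⟩ rfl
      have h1 : (N : ℤ) * (b.val - b'.val) = p * z := by
        apply mul_left_cancel₀ hp
        push_cast at hz
        linear_combination hz
      have h2 := hc.symm.dvd_of_dvd_mul_left ⟨z, h1⟩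
      rw [← ZMod.intCast_zmod_eq_zero_iff_dvd] at h2
      push_cast at h2
      simpa [sub_eq_zero] using h2
    rintro ⟨v, b⟩ ⟨v', b'⟩ hmem
    have h1 := (Subgroup.mem_inf.mp hmem).2
    have h0 := (Subgroup.mem_inf.mp hmem).1
    rcases v with _ | s <;> rcases v' with _ | s'
    · rw [mem_stabIn_delta_iff_of_mem hpN h0 (Lower.mul_inv ⟨_, _, mat_flagRep_none _⟩
        (simil_flagRep _) (mat_flagRep_none _))] at h1
      rw [key b b' _ h1.1 (by ring)]
    · rw [mem_stabIn_delta_iff_of_mem hpN h0 (Lower.mul_inv ⟨_, _, mat_flagRep_none _⟩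
        (simil_flagRep _) (mat_flagRep_some _ _))] at h1
      have := (ZMod.intCast_zmod_eq_zero_iff_dvd _ _).mpr h1.2
      push_cast at this
      simp at this
    · rw [mem_stabIn_delta_iff_of_mem hpN h0 (Lower.mul_inv ⟨_, _, mat_flagRep_some _ _⟩
        (simil_flagRep _) (mat_flagRep_none _))] at h1
      have := (ZMod.intCast_zmod_eq_zero_iff_dvd _ _).mpr h1.2
      push_cast at this
      simp at this
    · rw [mem_stabIn_delta_iff_of_mem hpN h0 (Lower.mul_inv ⟨_, _, mat_flagRep_some _ _⟩
        (simil_flagRep _) (mat_flagRep_some _ _))] at h1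
      have := (ZMod.intCast_zmod_eq_zero_iff_dvd _ _).mpr h1.2
      push_cast at this
      simp only [ZMod.natCast_zmod_val] at this
      rw [key b b' _ h1.1 (by ring)]
      have hs : s = s' := by linear_combination -this
      rw [hs]

variable (α β : ℤ) (h : (p : ℤ) * α - N * β = 1)

/-- Representatives of `Γ_0(Np) ∩ K \ K`, where `K = δ⁻¹ Γ_0(N) δ ∩ Γ_0(N)`. -/
def flagRep' (N p : ℕ) (α β : ℤ) (h : (p : ℤ) * α - N * β = 1) : Option (ZMod p) → GSp
  | none => 1
  | some t => pr 1 0 0 1 α 1 (N * β : ℤ) p 1 one_pos (by ring)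
    (by have : (p : ℝ) * α - N * β = 1 := by exact_mod_cast h
        push_cast; linarith) * nU 0 0 t.val

theorem mat_flagRep'_some (t : ZMod p) : (flagRep' N p α β h (some t)).mat =
    fromBlocks !![((1 : ℤ) : ℝ), (0 : ℤ); (0 : ℤ), (α : ℤ)]
      !![((0 : ℤ) : ℝ), (0 : ℤ); (0 : ℤ), ((α * t.val + 1 : ℤ) : ℝ)]
      !![((0 : ℤ) : ℝ), (0 : ℤ); (0 : ℤ), (N * β : ℤ)]
      !![((1 : ℤ) : ℝ), (0 : ℤ); (0 : ℤ), (N * β * t.val + p : ℤ)] := by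
  rw [flagRep', GSp.mat_mul, mat_nU, mat_pr, mul_fromBlocks_fin_two]
  apply fromBlocks_fin_two_eq <;> refine ⟨?_, ?_, ?_, ?_⟩ <;> push_cast <;> ring

theorem flagRep'_mem_Gamma0 (x : Option (ZMod p)) : flagRep' N p α β h x ∈ Gamma0 N := by
  cases x with
  | none => exact one_mem _
  | some t =>
    refine mem_of_mat_eq ?_ _ _ _ _ _ _ _ _ _ _ _ _ _ _ _ _ (mat_flagRep'_some α β h t)
      ⟨dvd_zero _, dvd_zero _, dvd_zero _, dvd_mul_right _ _⟩
    rw [flagRep', GSp.simil_mul, simil_pr, simil_nU, one_mul]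

theorem flagRep'_mem (hpN : ¬ p ∣ N) (x : Option (ZMod p)) : flagRep' N p α β h x ∈
    stabIn (Gamma0 N) (diagP p 2 1 0 1 rfl) (Gamma0 N) := by
  cases x with
  | none => exact one_mem _
  | some t =>
    rw [mem_stabIn_delta_iff hpN (flagRep'_mem_Gamma0 α β h _) (mat_flagRep'_some α β h t)]
    simp

/-- On K the entries i, j, k, n vanish modulo p, so the Lagrangian plane is determined by the point
(l : q) of the projective line: p + 1 cosets. -/
theorem isTransversal_flagRep' (hpN : ¬ p ∣ N) :
    IsTransversal (Gamma0 (N * p) ⊓ stabIn (Gamma0 N) (diagP p 2 1 0 1 rfl) (Gamma0 N))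
      (stabIn (Gamma0 N) (diagP p 2 1 0 1 rfl) (Gamma0 N) : Set GSp) (flagRep' N p α β h) where
  mem := flagRep'_mem α β h hpN
  cover γ hγ := by
    have hκ := cast_mul_eq_neg_one h
    have hγ0 : γ ∈ Gamma0 N := hγ.1
    obtain ⟨i, j, k, l, m, n, o, q, hlow, -, -, a, b, c, d, e, f, g', h', hm, -, -, -⟩ :=
      exists_lower hγ0
    obtain ⟨-, hi, hj, hk, hn⟩ := (mem_stabIn_delta_iff hpN hγ0 hm).mp hγ
    have zi : (i : ZMod p) = 0 := (ZMod.intCast_zmod_eq_zero_iff_dvd _ _).mpr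
      ((dvd_pow_self _ two_ne_zero).trans hi)
    have zj : (j : ZMod p) = 0 := (ZMod.intCast_zmod_eq_zero_iff_dvd _ _).mpr hj
    have zk : (k : ZMod p) = 0 := (ZMod.intCast_zmod_eq_zero_iff_dvd _ _).mpr hk
    have zn : (n : ZMod p) = 0 := (ZMod.intCast_zmod_eq_zero_iff_dvd _ _).mpr hn
    have hK : ∀ x, γ * (flagRep' N p α β h x)⁻¹ ∈
        stabIn (Gamma0 N) (diagP p 2 1 0 1 rfl) (Gamma0 N) := fun x =>
      Subgroup.mul_mem _ hγ (Subgroup.inv_mem _ (flagRep'_mem α β h hpN x))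
    by_cases hl : (l : ZMod p) = 0
    · refine ⟨none, Subgroup.mem_inf.mpr ⟨?_, hK _⟩⟩
      refine (lower_mem_iff_zmod hpN hγ0 (one_mem _) hlow lower_one).mpr ?_
      simp [zi, zj, zk, hl]
    · refine ⟨some (q / l), Subgroup.mem_inf.mpr ⟨?_, hK _⟩⟩
      refine (lower_mem_iff_zmod hpN hγ0 (flagRep'_mem_Gamma0 α β h _) hlow
        ⟨_, _, mat_flagRep'_some α β h _⟩).mpr ?_
      push_cast
      simp only [ZMod.natCast_zmod_val, hκ, zi, zj, zk, zn, ZMod.natCast_self]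
      refine ⟨by ring, by ring, by ring, ?_⟩
      -- In the last coordinate the representative has lower row (Nβ, Nβt + p) ≡ (-1, -t), so it
      -- meets the point (l : q) when t = q/l.
      have : (l : ZMod p) * (q / l) = q := mul_div_cancel₀ _ hl
      linear_combination -this
  inj := by
    have hκ := cast_mul_eq_neg_one h
    rintro (_ | t) (_ | t') hmem
    · rfl
    · have h0 := (lower_mem_iff_zmod hpN (one_mem _) (flagRep'_mem_Gamma0 α β h _) lower_one
        ⟨_, _, mat_flagRep'_some α β h _⟩).mp (Subgroup.mem_inf.mp hmem).1
      push_cast at h0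
      simp [hκ] at h0
    · have h0 := (lower_mem_iff_zmod hpN (flagRep'_mem_Gamma0 α β h _) (one_mem _)
        ⟨_, _, mat_flagRep'_some α β h _⟩ lower_one).mp (Subgroup.mem_inf.mp hmem).1
      push_cast at h0
      simp [hκ] at h0
    · have h0 := (lower_mem_iff_zmod hpN (flagRep'_mem_Gamma0 α β h _)
        (flagRep'_mem_Gamma0 α β h _) ⟨_, _, mat_flagRep'_some α β h _⟩
        ⟨_, _, mat_flagRep'_some α β h _⟩).mp (Subgroup.mem_inf.mp hmem).1
      push_cast at h0
      simp [hκ] at h0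
      rw [h0]

theorem muIndex_eq (hpN : ¬ p ∣ N) : muIndex N p = 1 + ((p + 1) * p + p ^ 3) := by
  obtain ⟨α, β, h⟩ : ∃ α β : ℤ, (p : ℤ) * α - N * β = 1 := by
    obtain ⟨u, v, huv⟩ := isCoprime_pow_of_not_dvd (p := p) hpN 1
    exact ⟨v, -u, by rw [pow_one] at huv; linarith⟩
  rw [muIndex, (isTransversal_lagRep α β h hpN).relIndex_eq, card_lagIdx]

/-- The index of Γ₀(Np) ∩ K in Γ₀(N) is computed through K and through Γ₀(Np): (p+1)·[Γ₀(N) : K] =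
(p+1)·p·μ(p). This avoids listing the cosets of K. -/
theorem relIndex_stabIn_delta (hpN : ¬ p ∣ N) :
    (stabIn (Gamma0 N) (diagP p 2 1 0 1 rfl) (Gamma0 N)).relIndex (Gamma0 N) = p * muIndex N p := by
  obtain ⟨α, β, h⟩ : ∃ α β : ℤ, (p : ℤ) * α - N * β = 1 := by
    obtain ⟨u, v, huv⟩ := isCoprime_pow_of_not_dvd (p := p) hpN 1
    exact ⟨v, -u, by rw [pow_one] at huv; linarith⟩
  set K := stabIn (Gamma0 N) (diagP p 2 1 0 1 rfl) (Gamma0 N) with hK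
  have h1 := Subgroup.relIndex_mul_relIndex (Gamma0 (N * p) ⊓ K) K (Gamma0 N) inf_le_right
    (stabIn_le _ _ _)
  have h2 := Subgroup.relIndex_mul_relIndex (Gamma0 (N * p) ⊓ K) (Gamma0 (N * p)) (Gamma0 N)
    inf_le_left (Gamma0_le (dvd_mul_right N p))
  rw [(isTransversal_flagRep' α β h hpN).relIndex_eq] at h1
  rw [(isTransversal_flagRep hpN).relIndex_eq, ← h1] at h2
  rw [Fintype.card_prod, Fintype.card_option, ZMod.card, mul_assoc] at h2
  exact (Nat.eq_of_mul_eq_mul_left (Nat.succ_pos p) h2).symm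

end Prime

end

section

/-! ### Commensurability -/

/-- The commensurator of `Γ_0(N)`. -/
abbrev Comm (N : ℕ) : Subgroup GSp := Subgroup.Commensurable.commensurator (Gamma0 N)

theorem ofSp_injective : Function.Injective ofSp := by
  intro γ γ' h
  apply Subtype.ext
  have h1 := congrArg GSp.mat h
  change γ.1.map (Int.castRingHom ℝ) = γ'.1.map (Int.castRingHom ℝ) at h1
  exact Matrix.map_injective (Int.cast_injective (α := ℝ)) h1

/-- Reduction of integral symplectic matrices modulo `M`. -/
def redHom (M : ℕ) : symplecticGroup (Fin 2) ℤ →* (Matrix I4 I4 (ZMod M))ˣ :=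
  MonoidHom.toHomUnits
    ((Int.castRingHom (ZMod M)).mapMatrix.toMonoidHom.comp (symplecticGroup (Fin 2) ℤ).subtype)

/-- The principal congruence subgroup of level `M`. -/
def principalInt (M : ℕ) : Subgroup (symplecticGroup (Fin 2) ℤ) := (redHom M).ker

/-- The principal congruence subgroup is the kernel of a homomorphism to a finite group, hence
normal of finite index. -/
theorem principalInt_relIndex_ne_zero (M : ℕ) [NeZero M]
    (Γ : Subgroup (symplecticGroup (Fin 2) ℤ)) : (principalInt M).relIndex Γ ≠ 0 := by
  have : Finite (redHom M).range := inferInstance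
  have h : (principalInt M).index ≠ 0 := (Subgroup.finiteIndex_ker (redHom M)).index_ne_zero
  have hn : (principalInt M).Normal := MonoidHom.normal_ker _
  intro h0
  exact h (Nat.eq_zero_of_zero_dvd (h0 ▸ Subgroup.relIndex_dvd_index_of_normal _ _))

theorem map_principalInt_relIndex_ne_zero (M : ℕ) [NeZero M] (N : ℕ) :
    ((principalInt M).map ofSp).relIndex (Gamma0 N) ≠ 0 := by
  rw [Gamma0, Subgroup.relIndex_map_map_of_injective _ _ ofSp_injective]
  exact principalInt_relIndex_ne_zero M _

theorem Gamma0_relIndex_ne_zero {N : ℕ} [NeZero N] (N' : ℕ) :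
    (Gamma0 N).relIndex (Gamma0 N') ≠ 0 := by
  intro h0
  refine map_principalInt_relIndex_ne_zero N N' (Subgroup.relIndex_eq_zero_of_le_left ?_ h0)
  refine Subgroup.map_mono fun γ hγ i j => ?_
  have h1 : (γ.1).map (Int.castRingHom (ZMod N)) = 1 := congrArg Units.val (MonoidHom.mem_ker.mp hγ)
  have h2 := congrFun (congrFun h1 (Sum.inr i)) (Sum.inl j)
  rw [← ZMod.intCast_zmod_eq_zero_iff_dvd]
  change ((γ.1 (Sum.inr i) (Sum.inl j) : ℤ) : ZMod N) = 0
  simpa using h2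

theorem Comm_eq {M N : ℕ} [NeZero M] [NeZero N] : Comm M = Comm N :=
  Subgroup.Commensurable.eq ⟨Gamma0_relIndex_ne_zero N, Gamma0_relIndex_ne_zero M⟩

theorem Gamma0_le_Comm (N : ℕ) : Gamma0 N ≤ Comm N := fun γ hγ => by
  have h : ∀ γ ∈ Gamma0 N, stabIn (Gamma0 N) γ (Gamma0 N) = Gamma0 N := fun γ hγ =>
    le_antisymm (stabIn_le _ _ _) fun x hx =>
      mem_stabIn.mpr ⟨hx, mul_mem (mul_mem hγ hx) (inv_mem hγ)⟩
  rw [mem_commensurator_iff, h _ hγ, h _ (inv_mem hγ), Subgroup.relIndex_self]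
  simp

section Prime

variable (N p : ℕ) [NeZero N] [Fact p.Prime]

/-- Conjugation by a diagonal matrix leaves the diagonal entries alone and changes the others by
powers of p, so a principal congruence subgroup of large enough level stays inside Γ₀(N). -/
theorem stabIn_diagP_relIndex_ne_zero (x₁ x₂ x₃ x₄ : ℕ) (hx : x₁ + x₃ = x₂ + x₄) :
    (stabIn (Gamma0 N) (diagP p x₁ x₂ x₃ x₄ hx) (Gamma0 N)).relIndex (Gamma0 N) ≠ 0 := by
  have hp := prime_cast_ne_zero p
  -- This level absorbs every denominator p^(x_i) and leaves a factor N for the lower left block.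
  set M : ℕ := N * (p ^ x₁ * p ^ x₂ * p ^ x₃ * p ^ x₄) with hM
  have hp0 : p ≠ 0 := (Fact.out : p.Prime).ne_zero
  have : NeZero M := ⟨by
    rw [hM]
    have := NeZero.ne N
    positivity⟩
  intro h0
  refine map_principalInt_relIndex_ne_zero M N (Subgroup.relIndex_eq_zero_of_le_left ?_ h0)
  rintro _ ⟨γ, hγ, rfl⟩
  have h1 : (γ.1).map (Int.castRingHom (ZMod M)) = 1 := congrArg Units.val (MonoidHom.mem_ker.mp hγ)
  have h2 : ∀ x y : I4, x ≠ y → ∃ z : ℤ, (ofSp γ).mat x y = ((M * z : ℤ) : ℝ) := by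
    intro x y hxy
    have h2 := congrFun (congrFun h1 x) y
    rw [Matrix.one_apply_ne hxy] at h2
    obtain ⟨z, hz⟩ := (ZMod.intCast_zmod_eq_zero_iff_dvd (γ.1 x y) M).mp h2
    exact ⟨z, congrArg (Int.cast : ℤ → ℝ) hz⟩
  have h3 : ∀ x : I4, ∃ z : ℤ, (ofSp γ).mat x x = (z : ℝ) := fun x => ⟨γ.1 x x, rfl⟩
  obtain ⟨a, ha⟩ := h3 (Sum.inl 0)
  obtain ⟨d, hd⟩ := h3 (Sum.inl 1)
  obtain ⟨m, hm⟩ := h3 (Sum.inr 0)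
  obtain ⟨q, hq⟩ := h3 (Sum.inr 1)
  obtain ⟨b, hb⟩ := h2 (Sum.inl 0) (Sum.inl 1) (by simp)
  obtain ⟨c, hc⟩ := h2 (Sum.inl 1) (Sum.inl 0) (by simp)
  obtain ⟨e, he⟩ := h2 (Sum.inl 0) (Sum.inr 0) (by simp)
  obtain ⟨f, hf⟩ := h2 (Sum.inl 0) (Sum.inr 1) (by simp)
  obtain ⟨g, hg⟩ := h2 (Sum.inl 1) (Sum.inr 0) (by simp)
  obtain ⟨h, hh⟩ := h2 (Sum.inl 1) (Sum.inr 1) (by simp)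
  obtain ⟨i, hi⟩ := h2 (Sum.inr 0) (Sum.inl 0) (by simp)
  obtain ⟨j, hj⟩ := h2 (Sum.inr 0) (Sum.inl 1) (by simp)
  obtain ⟨k, hk⟩ := h2 (Sum.inr 1) (Sum.inl 0) (by simp)
  obtain ⟨l, hl⟩ := h2 (Sum.inr 1) (Sum.inl 1) (by simp)
  obtain ⟨n, hn⟩ := h2 (Sum.inr 0) (Sum.inr 1) (by simp)
  obtain ⟨o, ho⟩ := h2 (Sum.inr 1) (Sum.inr 0) (by simp)
  have hmat : (ofSp γ).mat = fromBlocks !![(a : ℝ), (M * b : ℤ); (M * c : ℤ), d]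
      !![((M * e : ℤ) : ℝ), (M * f : ℤ); (M * g : ℤ), (M * h : ℤ)]
      !![((M * i : ℤ) : ℝ), (M * j : ℤ); (M * k : ℤ), (M * l : ℤ)]
      !![(m : ℝ), (M * n : ℤ); (M * o : ℤ), q] := by
    ext x y
    rcases x with x | x <;> rcases y with y | y <;> fin_cases x <;> fin_cases y <;> assumption
  have hmem : ofSp γ ∈ Gamma0 N := by
    refine mem_of_mat_eq ?_ _ _ _ _ _ _ _ _ _ _ _ _ _ _ _ _ hmat ?_
    · exact simil_of_mem_Gamma0 (N := 1) ⟨γ, fun i j => by simp, rfl⟩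
    · have : (N : ℤ) ∣ M := Int.natCast_dvd_natCast.mpr (dvd_mul_right _ _)
      exact ⟨this.mul_right _, this.mul_right _, this.mul_right _, this.mul_right _⟩
  refine mem_stabIn.mpr ⟨hmem, ?_⟩
  have hconj := mat_conj_diagP (p := p) x₁ x₂ x₃ x₄ hx hmat
  have hs := (simil_conj (diagP p x₁ x₂ x₃ x₄ hx) (ofSp γ)).trans (simil_of_mem_Gamma0 hmem)
  set y₁ : ℤ := (p : ℤ) ^ x₁
  set y₂ : ℤ := (p : ℤ) ^ x₂
  set y₃ : ℤ := (p : ℤ) ^ x₃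
  set y₄ : ℤ := (p : ℤ) ^ x₄
  refine mem_of_mat_eq hs a (y₁ * (N * y₁ * y₃ * y₄) * b) (y₂ * (N * y₂ * y₃ * y₄) * c) d
    (y₁ * (N * y₁ * y₂ * y₄) * e) (y₁ * (N * y₁ * y₂ * y₃) * f)
    (y₂ * (N * y₁ * y₂ * y₄) * g) (y₂ * (N * y₁ * y₂ * y₃) * h)
    (N * (y₃ * (y₂ * y₃ * y₄) * i)) (N * (y₃ * (y₁ * y₃ * y₄) * j))
    (N * (y₄ * (y₂ * y₃ * y₄) * k)) (N * (y₄ * (y₁ * y₃ * y₄) * l))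
    m (y₃ * (N * y₁ * y₂ * y₃) * n) (y₄ * (N * y₁ * y₂ * y₄) * o) q
    ?_ ⟨dvd_mul_right _ _, dvd_mul_right _ _, dvd_mul_right _ _, dvd_mul_right _ _⟩
  rw [hconj, hM]
  apply fromBlocks_fin_two_eq <;> refine ⟨?_, ?_, ?_, ?_⟩ <;>
    simp only [y₁, y₂, y₃, y₄] <;> push_cast <;> field_simp

theorem diagP_mul_diagP (x₁ x₂ x₃ x₄ : ℕ) (hx : x₁ + x₃ = x₂ + x₄) (y₁ y₂ y₃ y₄ : ℕ)
    (hy : y₁ + y₃ = y₂ + y₄) :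
    diagP p x₁ x₂ x₃ x₄ hx * diagP p y₁ y₂ y₃ y₄ hy =
      diagP p (x₁ + y₁) (x₂ + y₂) (x₃ + y₃) (x₄ + y₄) (by omega) := by
  apply GSp.ext_mat
  rw [GSp.mat_mul, mat_diagP, mat_diagP, mat_diagP, mul_fromBlocks_fin_two]
  apply fromBlocks_fin_two_eq <;> refine ⟨?_, ?_, ?_, ?_⟩ <;> simp [pow_add]

theorem diagP_scal (x : ℕ) : diagP p x x x x rfl =
    scal ((p : ℝ) ^ x) (pow_ne_zero _ (prime_cast_ne_zero p)) := by
  apply GSp.ext_mat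
  rw [mat_diagP, mat_scal']

/-- The inverse of a diagonal similitude is, up to a scalar, the diagonal similitude with the two
halves exchanged, and a scalar does not affect conjugation. Thus both index conditions come from
`stabIn_diagP_relIndex_ne_zero`. -/
theorem diagP_mem_Comm (x₁ x₂ x₃ x₄ : ℕ) (hx : x₁ + x₃ = x₂ + x₄) :
    diagP p x₁ x₂ x₃ x₄ hx ∈ Comm N := by
  rw [mem_commensurator_iff]
  refine ⟨stabIn_diagP_relIndex_ne_zero N p x₁ x₂ x₃ x₄ hx, ?_⟩
  have h1 : diagP p x₁ x₂ x₃ x₄ hx * diagP p x₃ x₄ x₁ x₂ (by omega) =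
      scal ((p : ℝ) ^ (x₁ + x₃)) (pow_ne_zero _ (prime_cast_ne_zero p)) := by
    rw [diagP_mul_diagP, ← diagP_scal]
    congr 1 <;> omega
  have h2 : (diagP p x₁ x₂ x₃ x₄ hx)⁻¹ = diagP p x₃ x₄ x₁ x₂ (by omega) *
      (scal ((p : ℝ) ^ (x₁ + x₃)) (pow_ne_zero _ (prime_cast_ne_zero p)))⁻¹ := by
    rw [← h1, _root_.mul_inv_rev, mul_inv_cancel_left]
  have h3 : stabIn (Gamma0 N) (diagP p x₁ x₂ x₃ x₄ hx)⁻¹ (Gamma0 N) =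
      stabIn (Gamma0 N) (diagP p x₃ x₄ x₁ x₂ (by omega)) (Gamma0 N) := by
    ext γ
    rw [mem_stabIn, mem_stabIn, h2]
    set t := scal ((p : ℝ) ^ (x₁ + x₃)) (pow_ne_zero _ (prime_cast_ne_zero p)) with ht
    have h4 : t⁻¹ * γ * t = γ := by
      rw [mul_assoc, ← scal_comm, inv_mul_cancel_left]
    have h5 : ∀ y : GSp, y * t⁻¹ * γ * (y * t⁻¹)⁻¹ = y * (t⁻¹ * γ * t) * y⁻¹ := fun y => by group
    rw [h5, h4]
  rw [h3]
  exact stabIn_diagP_relIndex_ne_zero N p _ _ _ _ _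

end Prime

end

section

/-! ### Double cosets of diagonal matrices -/

section General

variable {k : ℤ} {Γ : Subgroup GSp} {F : H2 → ℂ}

theorem avg_congr {g g' γ γ' : GSp} (hγ : γ ∈ Γ) (hγ' : γ' ∈ Γ) (h : g * γ' = γ * g') :
    avg k Γ F g = avg k Γ F g' := by
  rw [← avg_doubleCoset Γ.one_mem hγ', one_mul, h, ← avg_doubleCoset (g := g') hγ Γ.one_mem,
    mul_one]

theorem doubleCoset_congr {g g' γ γ' : GSp} (hγ : γ ∈ Γ) (hγ' : γ' ∈ Γ) (h : g * γ' = γ * g') :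
    DoubleCoset.doubleCoset g (Γ : Set GSp) Γ = DoubleCoset.doubleCoset g' Γ Γ :=
  DoubleCoset.doubleCoset_eq_of_mem (DoubleCoset.mem_doubleCoset.mpr
    ⟨γ, hγ, γ'⁻¹, Γ.inv_mem hγ', by rw [← h, mul_inv_cancel_right]⟩)

theorem dcOp_congr {g g' : GSp} (hs : g.simil = g'.simil)
    (h : DoubleCoset.doubleCoset g (Γ : Set GSp) Γ = DoubleCoset.doubleCoset g' Γ Γ) :
    dcOp k Γ g Γ F = dcOp k Γ g' Γ F := by
  unfold dcOp
  rw [hs, h]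

theorem IsTransversal.mul_right {S : Set GSp} {ι : Type} {a : ι → GSp} (h : IsTransversal Γ S a)
    {γ : GSp} (h1 : ∀ s ∈ S, s * γ ∈ S) (h2 : ∀ s ∈ S, s * γ⁻¹ ∈ S) :
    IsTransversal Γ S (fun i => a i * γ) where
  mem i := h1 _ (h.mem i)
  cover s hs := by
    obtain ⟨i, hi⟩ := h.cover _ (h2 s hs)
    refine ⟨i, ?_⟩
    rwa [_root_.mul_inv_rev, ← mul_assoc]
  inj i j hij := h.inj i j (by rwa [_root_.mul_inv_rev, ← mul_assoc, mul_inv_cancel_right] at hij)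

theorem slash_sum_doubleCoset (hF : ∀ γ ∈ Γ, slash k γ F = F) {Γ₂ : Subgroup GSp} {g : GSp}
    {ι : Type} [Fintype ι] {a : ι → GSp}
    (h : IsTransversal Γ (DoubleCoset.doubleCoset g Γ Γ₂) a) {γ : GSp} (hγ : γ ∈ Γ₂) :
    slash k γ (∑ i, slash k (a i) F) = ∑ i, slash k (a i) F := by
  have key : ∀ γ ∈ Γ₂, ∀ s ∈ DoubleCoset.doubleCoset g (Γ : Set GSp) Γ₂,
      s * γ ∈ DoubleCoset.doubleCoset g (Γ : Set GSp) Γ₂ := by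
    intro γ hγ s hs
    obtain ⟨x, hx, y, hy, rfl⟩ := DoubleCoset.mem_doubleCoset.mp hs
    exact DoubleCoset.mem_doubleCoset.mpr ⟨x, hx, y * γ, Γ₂.mul_mem hy hγ, by group⟩
  have h2 := (h.mul_right (key γ hγ) (key _ (Γ₂.inv_mem hγ))).sum_eq h (fun x => slash k x F)
    fun γ hγ x => slash_mul_left hF hγ x
  rw [slash_sum, ← h2]
  exact Finset.sum_congr rfl fun i _ => (slash_mul k _ _ _).symm

/-- Right multiplication by an element of Γ₂ permutes the cosets Γα inside ΓgΓ₂. -/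
theorem slash_dcOp (hF : ∀ γ ∈ Γ, slash k γ F = F) {Γ₂ : Subgroup GSp} {g : GSp}
    (hg : (stabIn Γ g Γ₂).relIndex Γ₂ ≠ 0) {γ : GSp} (hγ : γ ∈ Γ₂) :
    slash k γ (dcOp k Γ g Γ₂ F) = dcOp k Γ g Γ₂ F := by
  obtain ⟨a, ha⟩ := exists_isTransversal hg
  rw [dcOp_eq hF ha.doubleCoset, slash_smul, slash_sum_doubleCoset hF ha.doubleCoset hγ]

end General

section Prime

variable {N p : ℕ} [NeZero N] [Fact p.Prime]

/-- Conjugation by diag(p^j, p^j, 1, 1) divides C by p^j and multiplies B by p^j. This identifies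
the cosets in the double coset with those of Γ₀(Mp^j) in Γ₀(M). -/
theorem stabIn_diagP_upper (M j : ℕ) :
    stabIn (Gamma0 M) (diagP p j j 0 0 rfl) (Gamma0 M) = Gamma0 (M * p ^ j) := by
  have hp := pow_ne_zero j (prime_cast_ne_zero p)
  ext g
  rw [mem_stabIn]
  constructor
  · rintro ⟨h1, h2⟩
    obtain ⟨a, b, c, d, e, f, g', h, i, j', k', l, m, n, o, q, hm, -⟩ := mat_eq_of_mem h1
    have hconj := mat_conj_diagP (p := p) j j 0 0 rfl hm
    obtain ⟨a1, b1, c1, d1, e1, f1, g1, h1', i1, j1, k1, l1, m1, n1, o1, q1, hm', hd⟩ :=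
      mat_eq_of_mem h2
    rw [hconj, fromBlocks_inj] at hm'
    obtain ⟨r1, r2, r3, r4⟩ := fin_two_inj hm'.2.2.1
    rw [pow_zero, one_mul, div_eq_iff hp] at r1 r2 r3 r4
    norm_cast at r1 r2 r3 r4
    refine mem_of_mat_eq (simil_of_mem_Gamma0 h1) _ _ _ _ _ _ _ _ _ _ _ _ _ _ _ _ hm ?_
    rw [r1, r2, r3, r4, Nat.cast_mul]
    exact ⟨mul_dvd_mul hd.1 dvd_rfl, mul_dvd_mul hd.2.1 dvd_rfl, mul_dvd_mul hd.2.2.1 dvd_rfl,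
      mul_dvd_mul hd.2.2.2 dvd_rfl⟩
  · intro hg
    have hg' := Gamma0_le (dvd_mul_right M (p ^ j)) hg
    refine ⟨hg', ?_⟩
    obtain ⟨a, b, c, d, e, f, g', h, i, j', k', l, m, n, o, q, hm,
      ⟨i0, rfl⟩, ⟨j0, rfl⟩, ⟨k0, rfl⟩, ⟨l0, rfl⟩⟩ := mat_eq_of_mem hg
    refine mem_of_mat_eq ((simil_conj _ _).trans (simil_of_mem_Gamma0 hg)) a b c d (p ^ j * e)
      (p ^ j * f) (p ^ j * g') (p ^ j * h) (M * i0) (M * j0) (M * k0) (M * l0) m n o q ?_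
      ⟨dvd_mul_right _ _, dvd_mul_right _ _, dvd_mul_right _ _, dvd_mul_right _ _⟩
    rw [mat_conj_diagP (p := p) j j 0 0 rfl hm]
    apply fromBlocks_fin_two_eq <;> refine ⟨?_, ?_, ?_, ?_⟩ <;> push_cast <;> field_simp

theorem exists_bezout (hpN : ¬ p ∣ N) (j : ℕ) : ∃ α β : ℤ, (p : ℤ) ^ j * α - N * β = 1 := by
  obtain ⟨u, v, huv⟩ := isCoprime_pow_of_not_dvd (p := p) hpN j
  exact ⟨v, -u, by linarith⟩

/-- Since p is prime to N, the matrices (p^jα, 1; Nβ, 1) and (α, 1; Nβ, p^j) lie in SL₂(ℤ) with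
lower left entry divisible by N. They carry diag(p^j, 1) to diag(1, p^j), so they replace a Weyl
element, which would not lie in Γ₀(N). -/
theorem diagP_flip_fst (hpN : ¬ p ∣ N) (j x a b : ℕ) (h : (j + x) + x = a + b) :
    ∃ γ ∈ Gamma0 N, ∃ γ' ∈ Gamma0 N,
      diagP p (j + x) a x b h * γ' = γ * diagP p x a (j + x) b (by omega) := by
  obtain ⟨α, β, hαβ⟩ := exists_bezout (p := p) hpN j
  have h1 : (p : ℝ) ^ j * α - N * β = 1 := by exact_mod_cast hαβ
  refine ⟨_, pr_mem (N := N) (a := p ^ j * α) (b := 1) (c := N * β) (d := 1) (a' := 1) (b' := 0)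
    (c' := 0) (d' := 1) (by push_cast; linarith) (by simp) (dvd_mul_right _ _) (dvd_zero _),
    _, pr_mem (N := N) (a := α) (b := 1) (c := N * β) (d := p ^ j) (a' := 1) (b' := 0)
    (c' := 0) (d' := 1) (by push_cast; linarith) (by simp) (dvd_mul_right _ _) (dvd_zero _), ?_⟩
  apply GSp.ext_mat
  rw [GSp.mat_mul, GSp.mat_mul, mat_diagP, mat_diagP, mat_pr, mat_pr, mul_fromBlocks_fin_two,
    mul_fromBlocks_fin_two]
  apply fromBlocks_fin_two_eq <;> refine ⟨?_, ?_, ?_, ?_⟩ <;> push_cast <;> ring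

theorem diagP_flip_snd (hpN : ¬ p ∣ N) (j x a b : ℕ) (h : a + b = (j + x) + x) :
    ∃ γ ∈ Gamma0 N, ∃ γ' ∈ Gamma0 N,
      diagP p a (j + x) b x h * γ' = γ * diagP p a x b (j + x) (by omega) := by
  obtain ⟨α, β, hαβ⟩ := exists_bezout (p := p) hpN j
  have h1 : (p : ℝ) ^ j * α - N * β = 1 := by exact_mod_cast hαβ
  refine ⟨_, pr_mem (N := N) (a' := p ^ j * α) (b' := 1) (c' := N * β) (d' := 1) (a := 1) (b := 0)
    (c := 0) (d := 1) (by simp) (by push_cast; linarith) (dvd_zero _) (dvd_mul_right _ _),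
    _, pr_mem (N := N) (a' := α) (b' := 1) (c' := N * β) (d' := p ^ j) (a := 1) (b := 0)
    (c := 0) (d := 1) (by simp) (by push_cast; linarith) (dvd_zero _) (dvd_mul_right _ _), ?_⟩
  apply GSp.ext_mat
  rw [GSp.mat_mul, GSp.mat_mul, mat_diagP, mat_diagP, mat_pr, mat_pr, mul_fromBlocks_fin_two,
    mul_fromBlocks_fin_two]
  apply fromBlocks_fin_two_eq <;> refine ⟨?_, ?_, ?_, ?_⟩ <;> push_cast <;> ring

theorem doubleCoset_flip_fst (hpN : ¬ p ∣ N) (j x a b : ℕ) (h : (j + x) + x = a + b) :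
    DoubleCoset.doubleCoset (diagP p (j + x) a x b h) (Gamma0 N : Set GSp) (Gamma0 N) =
      DoubleCoset.doubleCoset (diagP p x a (j + x) b (by omega)) (Gamma0 N) (Gamma0 N) := by
  obtain ⟨γ, hγ, γ', hγ', h⟩ := diagP_flip_fst hpN j x a b h
  exact doubleCoset_congr hγ hγ' h

theorem doubleCoset_flip_snd (hpN : ¬ p ∣ N) (j x a b : ℕ) (h : a + b = (j + x) + x) :
    DoubleCoset.doubleCoset (diagP p a (j + x) b x h) (Gamma0 N : Set GSp) (Gamma0 N) =
      DoubleCoset.doubleCoset (diagP p a x b (j + x) (by omega)) (Gamma0 N) (Gamma0 N) := by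
  obtain ⟨γ, hγ, γ', hγ', h⟩ := diagP_flip_snd hpN j x a b h
  exact doubleCoset_congr hγ hγ' h

theorem doubleCoset_upper (hpN : ¬ p ∣ N) (j : ℕ) :
    DoubleCoset.doubleCoset (diagP p j j 0 0 rfl) (Gamma0 N : Set GSp) (Gamma0 N) =
      DoubleCoset.doubleCoset (diagP p 0 0 j j rfl) (Gamma0 N) (Gamma0 N) :=
  (doubleCoset_flip_fst hpN j 0 j 0 rfl).trans (doubleCoset_flip_snd hpN j 0 0 j (by omega))

theorem avg_of_doubleCoset_eq {k : ℤ} {Γ : Subgroup GSp} {F : H2 → ℂ} {g g' : GSp}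
    (h : DoubleCoset.doubleCoset g (Γ : Set GSp) Γ = DoubleCoset.doubleCoset g' Γ Γ) :
    avg k Γ F g = avg k Γ F g' := by
  rw [avg, avg, h]

variable (α β : ℤ) (h : (p : ℤ) * α - N * β = 1)

/-- The element `(pα, 1; Nβ, 1)` with scalar blocks. -/
def gOpp' (N p : ℕ) (α β : ℤ) (h : (p : ℤ) * α - N * β = 1) : GSp :=
  pr ((p * α : ℤ) : ℝ) ((1 : ℤ) : ℝ) (N * β : ℤ) ((1 : ℤ) : ℝ)
    ((p * α : ℤ) : ℝ) ((1 : ℤ) : ℝ) (N * β : ℤ) ((1 : ℤ) : ℝ) 1 one_pos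
    (by have : (p : ℝ) * α - N * β = 1 := by exact_mod_cast h
        push_cast; linarith)
    (by have : (p : ℝ) * α - N * β = 1 := by exact_mod_cast h
        push_cast; linarith)

/-- The element `(pα, 1; Nβ, 1)` in the first coordinate. -/
def gLine' (N p : ℕ) (α β : ℤ) (h : (p : ℤ) * α - N * β = 1) : GSp :=
  pr ((p * α : ℤ) : ℝ) ((1 : ℤ) : ℝ) (N * β : ℤ) ((1 : ℤ) : ℝ)
    ((1 : ℤ) : ℝ) ((0 : ℤ) : ℝ) ((0 : ℤ) : ℝ) ((1 : ℤ) : ℝ) 1 one_pos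
    (by have : (p : ℝ) * α - N * β = 1 := by exact_mod_cast h
        push_cast; linarith)
    (by push_cast; ring)

theorem gOpp'_mem : gOpp' N p α β h ∈ Gamma0 N :=
  pr_mem _ _ (dvd_mul_right _ _) (dvd_mul_right _ _)

theorem gLine'_mem : gLine' N p α β h ∈ Gamma0 N :=
  pr_mem _ _ (dvd_mul_right _ _) (dvd_zero _)

/-- Moving diag(p,p,1,1) past the representative of the open cell turns it into diag(1,1,p,p), at
the price of a left factor in Γ₀(N) that F does not see. -/
theorem diagP_mul_gOpp : diagP p 1 1 0 0 rfl * gOpp N p α β h =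
    gOpp' N p α β h * diagP p 0 0 1 1 rfl := by
  apply GSp.ext_mat
  rw [GSp.mat_mul, GSp.mat_mul, mat_diagP, mat_diagP, gOpp, gOpp', mat_pr, mat_pr,
    mul_fromBlocks_fin_two, mul_fromBlocks_fin_two]
  apply fromBlocks_fin_two_eq <;> refine ⟨?_, ?_, ?_, ?_⟩ <;> push_cast <;> ring

theorem diagP_mul_gLine : diagP p 1 1 0 0 rfl * gLine N p α β h =
    gLine' N p α β h * diagP p 0 1 1 0 rfl := by
  apply GSp.ext_mat
  rw [GSp.mat_mul, GSp.mat_mul, mat_diagP, mat_diagP, gLine, gLine', mat_pr, mat_pr,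
    mul_fromBlocks_fin_two, mul_fromBlocks_fin_two]
  apply fromBlocks_fin_two_eq <;> refine ⟨?_, ?_, ?_, ?_⟩ <;> push_cast <;> ring

theorem mLine_comm (v : Option (ZMod p)) (x y : ℕ) :
    mLine p v * diagP p x x y y rfl = diagP p x x y y rfl * mLine p v := by
  apply GSp.ext_mat
  rw [GSp.mat_mul, GSp.mat_mul, mat_diagP, mLine, mat_mU, mul_fromBlocks_fin_two,
    mul_fromBlocks_fin_two]
  apply fromBlocks_fin_two_eq <;> refine ⟨?_, ?_, ?_, ?_⟩ <;> ring

theorem nU_mul_diagP (x y z : ℝ) (j : ℕ) : nU x y z * diagP p 0 0 j j rfl =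
    diagP p 0 0 j j rfl * nU (p ^ j * x) (p ^ j * y) (p ^ j * z) := by
  apply GSp.ext_mat
  rw [GSp.mat_mul, GSp.mat_mul, mat_diagP, mat_nU, mat_nU, mul_fromBlocks_fin_two,
    mul_fromBlocks_fin_two]
  apply fromBlocks_fin_two_eq <;> refine ⟨?_, ?_, ?_, ?_⟩ <;> ring

theorem nU_mul_delta (x y z : ℝ) : nU x y z * diagP p 0 1 2 1 rfl =
    diagP p 0 1 2 1 rfl * nU (p ^ 2 * x) (p * y) z := by
  apply GSp.ext_mat
  rw [GSp.mat_mul, GSp.mat_mul, mat_diagP, mat_nU, mat_nU, mul_fromBlocks_fin_two,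
    mul_fromBlocks_fin_two]
  apply fromBlocks_fin_two_eq <;> refine ⟨?_, ?_, ?_, ?_⟩ <;> ring

theorem nU_natCast_mem (M x y z : ℕ) : nU x y z ∈ Gamma0 M := by
  have := nU_mem M x y z
  push_cast at this
  exact this

end Prime

end

/-! ### Recursions for averages under T_S(p) -/

section

section Prime

variable {N p : ℕ} [NeZero N] [Fact p.Prime] {k : ℤ} {F : H2 → ℂ}

/-- With diag(p,p,1,1) as representative, the group to divide by is Γ₀(Np) itself, so the Lagrangian
planes index the cosets of T_S(p). -/
theorem isTransversal_diagP_lagRep (α β : ℤ) (h : (p : ℤ) * α - N * β = 1) (hpN : ¬ p ∣ N) :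
    IsTransversal (Gamma0 N)
      (DoubleCoset.doubleCoset (diagP p 0 0 1 1 rfl) (Gamma0 N : Set GSp) (Gamma0 N))
      (fun i => diagP p 1 1 0 0 rfl * lagRep N p α β h i) := by
  rw [← doubleCoset_upper hpN]
  apply IsTransversal.doubleCoset
  rw [stabIn_diagP_upper, pow_one]
  exact isTransversal_lagRep α β h hpN

theorem TS_eq_sum (hF : ∀ γ ∈ Gamma0 N, slash k γ F = F) (α β : ℤ)
    (h : (p : ℤ) * α - N * β = 1) (hpN : ¬ p ∣ N) :
    TS N p k F = (p : ℂ) ^ (k - 3) •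
      ∑ i, slash k (diagP p 1 1 0 0 rfl * lagRep N p α β h i) F := by
  rw [TS, TSdiag, dcOp_eq hF (isTransversal_diagP_lagRep α β h hpN), simil_diagP]
  simp

theorem slash_TSdiag (hF : ∀ γ ∈ Gamma0 N, slash k γ F = F) (a b c d : ℕ) (hx : a + c = b + d)
    {γ : GSp} (hγ : γ ∈ Gamma0 N) : slash k γ (TSdiag N p k a b c d hx F) =
      TSdiag N p k a b c d hx F :=
  slash_dcOp hF (stabIn_diagP_relIndex_ne_zero N p a b c d hx) hγ

theorem lagRep_sum {M : Type} [AddCommMonoid M] (f : LagIdx p → M) : ∑ i, f i =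
    f (Sum.inl ()) + (∑ v, ∑ b, f (Sum.inr (Sum.inl (v, b))) + ∑ S, f (Sum.inr (Sum.inr S))) := by
  rw [Fintype.sum_sum_type, Fintype.sum_sum_type, Fintype.sum_prod_type]
  simp

theorem avg_TS (hF : ∀ γ ∈ Gamma0 N, slash k γ F = F) (α β : ℤ)
    (h : (p : ℤ) * α - N * β = 1) (hpN : ¬ p ∣ N) {g : GSp} (hg : g ∈ Comm N) :
    avg k (Gamma0 N) (TS N p k F) g = (p : ℂ) ^ (k - 3) •
      ∑ i, avg k (Gamma0 N) F (diagP p 1 1 0 0 rfl * lagRep N p α β h i * g) := by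
  have hinv : ∀ γ ∈ Gamma0 N,
      slash k γ (∑ i, slash k (diagP p 1 1 0 0 rfl * lagRep N p α β h i) F) =
        ∑ i, slash k (diagP p 1 1 0 0 rfl * lagRep N p α β h i) F := fun γ hγ =>
    slash_sum_doubleCoset hF (isTransversal_diagP_lagRep α β h hpN) hγ
  rw [TS_eq_sum hF α β h hpN, avg_smul hinv hg, avg_sum_slash hF (fun j => mul_mem
    (diagP_mem_Comm N p _ _ _ _ _) (Gamma0_le_Comm N (lagRep_mem α β h j))) hinv hg]

theorem avg_diagP_scal (hF : ∀ γ ∈ Gamma0 N, slash k γ F = F) (x : ℕ) :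
    avg k (Gamma0 N) F (diagP p x x x x rfl) = F := by
  rw [diagP_scal, ← mul_one (scal _ _), avg_scal hF (one_mem _), avg_one hF]

theorem avg_diagP_add (hF : ∀ γ ∈ Gamma0 N, slash k γ F = F) (x a b c d : ℕ) (hx : a + c = b + d) :
    avg k (Gamma0 N) F (diagP p (x + a) (x + b) (x + c) (x + d) (by omega)) =
      avg k (Gamma0 N) F (diagP p a b c d hx) := by
  rw [← diagP_mul_diagP p x x x x rfl a b c d hx, diagP_scal,
    avg_scal hF (diagP_mem_Comm N p _ _ _ _ _)]

/-- A translation that passes through g to become an element of Γ₀(N) on the right leaves no trace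
in the average; only the diagonal product survives. The lemma `avg_line` is the rank one version. -/
theorem avg_opp (α β : ℤ) (h : (p : ℤ) * α - N * β = 1) {x y z : ZMod p} {g g' γ' : GSp}
    (hγ' : γ' ∈ Gamma0 N) (hg : nU x.val y.val z.val * g = g' * γ') :
    avg k (Gamma0 N) F (diagP p 1 1 0 0 rfl * lagRep N p α β h (Sum.inr (Sum.inr (x, y, z))) * g) =
      avg k (Gamma0 N) F (diagP p 0 0 1 1 rfl * g') := by
  rw [lagRep, ← mul_assoc, diagP_mul_gOpp, mul_assoc, mul_assoc, hg, ← mul_assoc, ← mul_assoc,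
    mul_assoc (gOpp' N p α β h), avg_doubleCoset (gOpp'_mem α β h) hγ']

theorem avg_line (α β : ℤ) (h : (p : ℤ) * α - N * β = 1) {v : Option (ZMod p)} {b : ZMod p}
    {g g' γ' : GSp} (hγ' : γ' ∈ Gamma0 N) (hg : nU b.val 0 0 * mLine p v * g = g' * γ') :
    avg k (Gamma0 N) F (diagP p 1 1 0 0 rfl * lagRep N p α β h (Sum.inr (Sum.inl (v, b))) * g) =
      avg k (Gamma0 N) F (diagP p 0 1 1 0 rfl * g') := by
  rw [lagRep, mul_assoc (gLine N p α β h), ← mul_assoc (diagP p 1 1 0 0 rfl), diagP_mul_gLine,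
    mul_assoc, hg, ← mul_assoc, mul_assoc (gLine' N p α β h), avg_doubleCoset (gLine'_mem α β h) hγ']

/-- The three terms are the three ranks of a Lagrangian plane. Rank 0 gives p·diag(1,1,p^j,p^j),
rank 1 gives diag(1,p,p,1)·diag(1,1,p^(j+1),p^(j+1)) for p(p+1) planes, and rank 2 gives
diag(1,1,p^(j+2),p^(j+2)) for p³ planes. -/
theorem avg_TS_lower (hF : ∀ γ ∈ Gamma0 N, slash k γ F = F) (hpN : ¬ p ∣ N) (j : ℕ) :
    avg k (Gamma0 N) (TS N p k F) (diagP p 0 0 (j + 1) (j + 1) rfl) = (p : ℂ) ^ (k - 3) •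
      (avg k (Gamma0 N) F (diagP p 0 0 j j rfl) +
        ((p * (p + 1) : ℕ) : ℂ) •
          avg k (Gamma0 N) F (diagP p 0 1 (j + 2) (j + 1) (by omega)) +
        ((p ^ 3 : ℕ) : ℂ) • avg k (Gamma0 N) F (diagP p 0 0 (j + 2) (j + 2) rfl)) := by
  obtain ⟨α, β, h⟩ := exists_bezout (p := p) hpN 1
  rw [pow_one] at h
  rw [avg_TS hF α β h hpN (diagP_mem_Comm N p _ _ _ _ _), lagRep_sum]
  have h1 : avg k (Gamma0 N) F (diagP p 1 1 0 0 rfl * lagRep N p α β h (Sum.inl ()) *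
      diagP p 0 0 (j + 1) (j + 1) rfl) = avg k (Gamma0 N) F (diagP p 0 0 j j rfl) := by
    rw [lagRep, mul_one, diagP_mul_diagP]
    refine Eq.trans ?_ (avg_diagP_add hF 1 0 0 j j rfl)
    congr 2 <;> omega
  have h2 : ∀ v b, avg k (Gamma0 N) F (diagP p 1 1 0 0 rfl *
      lagRep N p α β h (Sum.inr (Sum.inl (v, b))) * diagP p 0 0 (j + 1) (j + 1) rfl) =
      avg k (Gamma0 N) F (diagP p 0 1 (j + 2) (j + 1) (by omega)) := by
    intro v b
    rw [avg_line α β h (g' := diagP p 0 0 (j + 1) (j + 1) rfl)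
      (γ' := nU ((p ^ (j + 1) * b.val : ℕ) : ℝ) (0 : ℕ) (0 : ℕ) * mLine p v)
      (mul_mem (nU_natCast_mem _ _ _ _) (mLine_mem N v)), diagP_mul_diagP]
    · congr 2 <;> omega
    · rw [mul_assoc, mLine_comm, ← mul_assoc, nU_mul_diagP]
      push_cast
      simp only [mul_zero, mul_assoc]
  have h3 : ∀ S, avg k (Gamma0 N) F (diagP p 1 1 0 0 rfl *
      lagRep N p α β h (Sum.inr (Sum.inr S)) * diagP p 0 0 (j + 1) (j + 1) rfl) =
      avg k (Gamma0 N) F (diagP p 0 0 (j + 2) (j + 2) rfl) := by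
    rintro ⟨x, y, z⟩
    rw [avg_opp α β h (g' := diagP p 0 0 (j + 1) (j + 1) rfl)
      (γ' := nU ((p ^ (j + 1) * x.val : ℕ) : ℝ) ((p ^ (j + 1) * y.val : ℕ) : ℝ)
        ((p ^ (j + 1) * z.val : ℕ) : ℝ))
      (nU_natCast_mem _ _ _ _), diagP_mul_diagP]
    · congr 2 <;> omega
    · rw [nU_mul_diagP]
      push_cast
      rfl
  rw [h1]
  simp only [h2, h3, Finset.sum_const, Finset.card_univ, Fintype.card_option, Fintype.card_prod,
    ZMod.card, smul_smul, ← Nat.cast_smul_eq_nsmul ℂ]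
  rw [add_assoc]
  congr 4
  · push_cast; ring
  · push_cast; ring

theorem mLine_some_mul_delta (t : ZMod p) : mLine p (some t) * diagP p 0 1 2 1 rfl =
    diagP p 0 1 2 1 rfl * mU (1 : ℤ) (p * t.val : ℤ) (0 : ℤ) (1 : ℤ) (by simp) := by
  apply GSp.ext_mat
  rw [GSp.mat_mul, GSp.mat_mul, mat_diagP, mLine, mat_mU, mat_mU, mul_fromBlocks_fin_two,
    mul_fromBlocks_fin_two]
  apply fromBlocks_fin_two_eq <;> refine ⟨?_, ?_, ?_, ?_⟩ <;> simp [lineRep] <;> ring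

theorem mLine_none_mul_delta : mLine p none * diagP p 0 1 2 1 rfl =
    diagP p 1 0 1 2 rfl * mLine p none := by
  apply GSp.ext_mat
  rw [GSp.mat_mul, GSp.mat_mul, mat_diagP, mat_diagP, mLine, mat_mU, mul_fromBlocks_fin_two,
    mul_fromBlocks_fin_two]
  apply fromBlocks_fin_two_eq <;> refine ⟨?_, ?_, ?_, ?_⟩ <;> simp [lineRep]

theorem nU_mul_delta' (x : ℝ) : nU x 0 0 * diagP p 1 0 1 2 rfl =
    diagP p 1 0 1 2 rfl * nU x 0 0 := by
  apply GSp.ext_mat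
  rw [GSp.mat_mul, GSp.mat_mul, mat_diagP, mat_nU, mul_fromBlocks_fin_two,
    mul_fromBlocks_fin_two]
  apply fromBlocks_fin_two_eq <;> refine ⟨?_, ?_, ?_, ?_⟩ <;> ring

/-- Here the direction of a rank one plane matters. The p planes over (0 : 1) exchange the two
coordinates and give, with the plane of rank 0, p + 1 scalar multiples of elements in the double
coset of diag(1,1,p,p). The other p² planes of rank 1 and the p³ of rank 2 give diag(1,p,p³,p²). -/
theorem avg_TS_delta (hF : ∀ γ ∈ Gamma0 N, slash k γ F = F) (hpN : ¬ p ∣ N) :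
    avg k (Gamma0 N) (TS N p k F) (diagP p 0 1 2 1 rfl) = (p : ℂ) ^ (k - 3) •
      (((p + 1 : ℕ) : ℂ) • avg k (Gamma0 N) F (diagP p 0 0 1 1 rfl) +
        ((p ^ 3 + p ^ 2 : ℕ) : ℂ) • avg k (Gamma0 N) F (diagP p 0 1 3 2 rfl)) := by
  obtain ⟨α, β, h⟩ := exists_bezout (p := p) hpN 1
  rw [pow_one] at h
  rw [avg_TS hF α β h hpN (diagP_mem_Comm N p _ _ _ _ _), lagRep_sum, Fintype.sum_option]
  have h1 : avg k (Gamma0 N) F (diagP p 1 1 0 0 rfl * lagRep N p α β h (Sum.inl ()) *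
      diagP p 0 1 2 1 rfl) = avg k (Gamma0 N) F (diagP p 0 0 1 1 rfl) := by
    rw [lagRep, mul_one, diagP_mul_diagP]
    refine (avg_diagP_add hF 1 0 1 1 0 rfl).trans ?_
    exact avg_of_doubleCoset_eq (doubleCoset_flip_snd hpN 1 0 0 1 rfl)
  have h2 : ∀ b, avg k (Gamma0 N) F (diagP p 1 1 0 0 rfl *
      lagRep N p α β h (Sum.inr (Sum.inl (none, b))) * diagP p 0 1 2 1 rfl) =
      avg k (Gamma0 N) F (diagP p 0 0 1 1 rfl) := by
    intro b
    rw [avg_line α β h (g' := diagP p 1 0 1 2 rfl) (γ' := nU b.val 0 0 * mLine p none)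
      (mul_mem (nU_val_mem' N b) (mLine_mem N _)), diagP_mul_diagP]
    · exact avg_diagP_add hF 1 0 0 1 1 rfl
    · rw [mul_assoc, mLine_none_mul_delta, ← mul_assoc, nU_mul_delta', mul_assoc]
  have h2' : ∀ t b, avg k (Gamma0 N) F (diagP p 1 1 0 0 rfl *
      lagRep N p α β h (Sum.inr (Sum.inl (some t, b))) * diagP p 0 1 2 1 rfl) =
      avg k (Gamma0 N) F (diagP p 0 1 3 2 rfl) := by
    intro t b
    rw [avg_line α β h (g' := diagP p 0 1 2 1 rfl)
      (γ' := nU ((p ^ 2 * b.val : ℕ) : ℝ) (0 : ℕ) (0 : ℕ) *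
        mU (1 : ℤ) (p * t.val : ℤ) (0 : ℤ) (1 : ℤ) (by simp))
      (mul_mem (nU_natCast_mem _ _ _ _) ?_), diagP_mul_diagP]
    · exact avg_of_doubleCoset_eq (doubleCoset_flip_snd hpN 1 1 0 3 rfl)
    · rw [mul_assoc, mLine_some_mul_delta, ← mul_assoc, nU_mul_delta]
      push_cast
      simp only [mul_zero, mul_assoc]
    · have := mU_mem N 1 (p * t.val) 0 1 (by simp)
      push_cast at this ⊢
      exact this
  have h3 : ∀ S, avg k (Gamma0 N) F (diagP p 1 1 0 0 rfl *
      lagRep N p α β h (Sum.inr (Sum.inr S)) * diagP p 0 1 2 1 rfl) =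
      avg k (Gamma0 N) F (diagP p 0 1 3 2 rfl) := by
    rintro ⟨x, y, z⟩
    rw [avg_opp α β h (g' := diagP p 0 1 2 1 rfl)
      (γ' := nU ((p ^ 2 * x.val : ℕ) : ℝ) ((p * y.val : ℕ) : ℝ) ((z.val : ℕ) : ℝ))
      (nU_natCast_mem _ _ _ _), diagP_mul_diagP]
    rw [nU_mul_delta]
    push_cast
    rfl
  rw [h1]
  simp only [h2, h2', h3, Finset.sum_const, Finset.card_univ, Fintype.card_prod,
    ZMod.card, smul_smul, ← Nat.cast_smul_eq_nsmul ℂ]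
  push_cast
  module

/-- The average attached to `(p b; 0 p)` in the first coordinate and `(p², 1)` in the second. -/
theorem avg_unip (hpN : ¬ p ∣ N) (b : ZMod p) :
    avg k (Gamma0 N) F (diagP p 0 1 1 0 rfl * (nU b.val 0 0 * diagP p 1 1 0 0 rfl)) =
      if b = 0 then avg k (Gamma0 N) F (diagP p 0 1 2 1 rfl)
      else avg k (Gamma0 N) F (diagP p 0 0 2 2 rfl) := by
  split_ifs with hb
  · rw [hb]
    simp only [ZMod.val_zero, Nat.cast_zero]
    rw [nU_zero, one_mul, diagP_mul_diagP]
    -- For b = 0 the element is diag(p,p²,p,1). Flipping the second coordinate and exchanging the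
    -- coordinates by `mLine p none` gives diag(1,p,p²,p).
    refine (avg_of_doubleCoset_eq (doubleCoset_flip_snd hpN 2 0 1 1 rfl)).trans ?_
    exact (avg_doubleCoset (mLine_mem N none) (one_mem _)).symm.trans <| by
      have h1 : mLine p none * diagP p 1 0 1 2 rfl = diagP p 0 1 2 1 rfl * mLine p none := by
        apply GSp.ext_mat
        rw [GSp.mat_mul, GSp.mat_mul, mat_diagP, mat_diagP, mLine, mat_mU, mul_fromBlocks_fin_two,
          mul_fromBlocks_fin_two]
        apply fromBlocks_fin_two_eq <;> refine ⟨?_, ?_, ?_, ?_⟩ <;> simp [lineRep]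
      rw [mul_one]
      exact avg_congr (γ := 1) (γ' := (mLine p none)⁻¹) (one_mem _) (inv_mem (mLine_mem N none))
        (by rw [h1, mul_inv_cancel_right, one_mul])
  · have hN : (N : ZMod p) ≠ 0 := fun h0 => hpN ((ZMod.natCast_eq_zero_iff _ _).mp h0)
    -- The choice makes 1 + bNy divisible by p, say equal to up. Then (u, b; Ny, p) has determinant
    -- 1 and lower left entry divisible by N, and it carries (p, b; 0, p) to diag(p², 1).
    set y : ZMod p := -(b * N)⁻¹ with hy
    have h0 : (((1 + b.val * (N * y.val) : ℕ) : ℤ) : ZMod p) = 0 := by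
      push_cast
      rw [ZMod.natCast_zmod_val, ZMod.natCast_zmod_val, hy]
      field_simp
      ring
    obtain ⟨u, hu⟩ := dvd_of_intCast_zmod h0
    have hu' : (u : ℝ) * p - b.val * (N * y.val) = 1 := by
      have := congrArg (Int.cast : ℤ → ℝ) hu
      push_cast at this
      linarith
    rw [← avg_of_doubleCoset_eq (doubleCoset_upper hpN 2)]
    refine avg_congr (pr_mem (N := N) (a := u) (b := b.val) (c := N * y.val) (d := p) (a' := 1)
      (b' := 0) (c' := 0) (d' := 1) (by push_cast; exact hu') (by simp) (dvd_mul_right _ _)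
      (dvd_zero _)) (pr_mem (N := N) (a := 1) (b := 0) (c := N * (p * y.val)) (d := 1) (a' := 1)
      (b' := 0) (c' := 0) (d' := 1) (by simp) (by simp) (dvd_mul_right _ _)
      (dvd_zero _)) ?_
    apply GSp.ext_mat
    rw [GSp.mat_mul, GSp.mat_mul, GSp.mat_mul, GSp.mat_mul, mat_diagP, mat_diagP, mat_diagP,
      mat_nU, mat_pr, mat_pr]
    simp only [mul_fromBlocks_fin_two]
    apply fromBlocks_fin_two_eq <;> refine ⟨?_, ?_, ?_, ?_⟩ <;> push_cast <;>
      first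
        | ring1
        | linear_combination (-(p : ℝ)) * hu'

/-- The sum of the averages attached to `n(S/p)`, `S` modulo `p`. -/
theorem sum_avg_unip (hF : ∀ γ ∈ Gamma0 N, slash k γ F = F) (hpN : ¬ p ∣ N) :
    ∑ S : ZMod p × ZMod p × ZMod p, avg k (Gamma0 N) F (diagP p 0 0 1 1 rfl *
      (nU S.1.val S.2.1.val S.2.2.val * diagP p 1 1 0 0 rfl)) =
      F + ((p : ℂ) ^ 2 - 1) • avg k (Gamma0 N) F (diagP p 0 1 2 1 rfl) +
        ((p : ℂ) ^ 3 - (p : ℂ) ^ 2) • avg k (Gamma0 N) F (diagP p 0 0 2 2 rfl) := by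
  obtain ⟨α, β, h⟩ := exists_bezout (p := p) hpN 1
  rw [pow_one] at h
  -- The average of F|T_S(p) over one double coset is expanded twice: at diag(1,1,p,p), where
  -- `avg_TS_lower` applies, and at diag(p,p,1,1), where the planes of rank 2 contribute exactly the
  -- sum over S. The comparison avoids classifying the quadratic forms S modulo p.
  have h0 := avg_TS_lower hF hpN 0
  have hinv : ∀ γ ∈ Gamma0 N, slash k γ (TS N p k F) = TS N p k F := fun γ hγ =>
    slash_TSdiag hF _ _ _ _ _ hγ
  have h1 := avg_TS hF α β h hpN (diagP_mem_Comm N p 1 1 0 0 rfl)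
  rw [avg_of_doubleCoset_eq (doubleCoset_upper hpN 1), h0, lagRep_sum] at h1
  have hpk : (p : ℂ) ^ (k - 3) ≠ 0 :=
    zpow_ne_zero _ (Nat.cast_ne_zero.mpr (Fact.out : p.Prime).ne_zero)
  have h2 := smul_right_injective _ hpk h1
  have e1 : avg k (Gamma0 N) F (diagP p 1 1 0 0 rfl * lagRep N p α β h (Sum.inl ()) *
      diagP p 1 1 0 0 rfl) = avg k (Gamma0 N) F (diagP p 0 0 2 2 rfl) := by
    rw [lagRep, mul_one, diagP_mul_diagP]
    exact avg_of_doubleCoset_eq (doubleCoset_upper hpN 2)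
  have e2 : ∀ v b, avg k (Gamma0 N) F (diagP p 1 1 0 0 rfl *
      lagRep N p α β h (Sum.inr (Sum.inl (v, b))) * diagP p 1 1 0 0 rfl) =
      if b = 0 then avg k (Gamma0 N) F (diagP p 0 1 2 1 rfl)
      else avg k (Gamma0 N) F (diagP p 0 0 2 2 rfl) := by
    intro v b
    rw [avg_line α β h (g' := nU b.val 0 0 * diagP p 1 1 0 0 rfl) (γ' := mLine p v)
      (mLine_mem N v), avg_unip hpN]
    rw [mul_assoc, mLine_comm, mul_assoc]
  have e3 : ∀ S : ZMod p × ZMod p × ZMod p, avg k (Gamma0 N) F (diagP p 1 1 0 0 rfl *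
      lagRep N p α β h (Sum.inr (Sum.inr S)) * diagP p 1 1 0 0 rfl) =
      avg k (Gamma0 N) F (diagP p 0 0 1 1 rfl *
        (nU S.1.val S.2.1.val S.2.2.val * diagP p 1 1 0 0 rfl)) := by
    rintro ⟨x, y, z⟩
    rw [avg_opp α β h (g' := nU x.val y.val z.val * diagP p 1 1 0 0 rfl) (γ' := 1) (one_mem _)
      (by rw [mul_one])]
  have e4 : ∑ b : ZMod p, (if b = 0 then avg k (Gamma0 N) F (diagP p 0 1 2 1 rfl)
      else avg k (Gamma0 N) F (diagP p 0 0 2 2 rfl)) = avg k (Gamma0 N) F (diagP p 0 1 2 1 rfl) +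
        ((p : ℂ) - 1) • avg k (Gamma0 N) F (diagP p 0 0 2 2 rfl) := by
    rw [← Finset.add_sum_erase _ _ (Finset.mem_univ (0 : ZMod p)), if_pos rfl,
      Finset.sum_congr rfl (g := fun _ => avg k (Gamma0 N) F (diagP p 0 0 2 2 rfl))
        (fun b hb => if_neg (Finset.ne_of_mem_erase hb)),
      Finset.sum_const, Finset.card_erase_of_mem (Finset.mem_univ _), Finset.card_univ, ZMod.card,
      ← Nat.cast_smul_eq_nsmul ℂ, Nat.cast_sub (Fact.out : p.Prime).one_le, Nat.cast_one]
  simp only [e1, e2, e3, e4, Finset.sum_const, Finset.card_univ, Fintype.card_option, ZMod.card,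
    ← Nat.cast_smul_eq_nsmul ℂ] at h2
  rw [avg_diagP_scal hF 0] at h2
  push_cast at h2
  -- A, B and S stand for the averages at diag(1,p,p²,p) and diag(1,1,p²,p²) and for the unknown
  -- sum.
  have key : ∀ A B S : H2 → ℂ, F + ((p : ℂ) * (p + 1)) • A + (p : ℂ) ^ 3 • B =
      B + (((p : ℂ) + 1) • (A + ((p : ℂ) - 1) • B) + S) →
      S = F + ((p : ℂ) ^ 2 - 1) • A + ((p : ℂ) ^ 3 - (p : ℂ) ^ 2) • B := by
    intro A B S hS
    rw [← add_assoc, ← sub_eq_iff_eq_add'] at hS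
    rw [← hS]
    module
  exact key _ _ _ h2

end Prime

end

/-! ### Hecke operators as multiples of averages, and U_S(p) U_S(p)^* Tr -/

section

section Prime

variable {N p : ℕ} [NeZero N] [Fact p.Prime] {k : ℤ} {F : H2 → ℂ}

/-- The number of cosets is the index of Γ₀(Np^j), visible at the representative diag(p^j,p^j,1,1)
of the same double coset. -/
theorem TSdiag_lower (hF : ∀ γ ∈ Gamma0 N, slash k γ F = F) (hpN : ¬ p ∣ N) (j : ℕ) :
    TSdiag N p k 0 0 j j rfl F = (((p : ℂ) ^ (k - 3)) ^ j *
      (Gamma0 (N * p ^ j)).relIndex (Gamma0 N)) • avg k (Gamma0 N) F (diagP p 0 0 j j rfl) := by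
  have hs : (diagP p j j 0 0 rfl).simil = (diagP p 0 0 j j rfl).simil := by
    rw [simil_diagP, simil_diagP, add_comm]
  rw [TSdiag, ← dcOp_congr hs (doubleCoset_upper hpN j), dcOp_eq_avg hF
    (stabIn_diagP_relIndex_ne_zero N p _ _ _ _ _), stabIn_diagP_upper,
    avg_of_doubleCoset_eq (doubleCoset_upper hpN j), simil_diagP]
  congr 2
  push_cast
  rw [add_zero, ← zpow_natCast, ← zpow_natCast, ← _root_.zpow_mul, ← _root_.zpow_mul, mul_comm]

theorem relIndex_sq :
    (Gamma0 (N * p * p)).relIndex (Gamma0 N) = p ^ 3 * muIndex N p := by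
  rw [← Subgroup.relIndex_mul_relIndex (Gamma0 (N * p * p)) (Gamma0 (N * p)) (Gamma0 N)
    (Gamma0_le (dvd_mul_right _ _)) (Gamma0_le (dvd_mul_right _ _)), muIndex,
    (isTransversal_nL (p := p) (mul_ne_zero (NeZero.ne N) (Fact.out : p.Prime).ne_zero)
      (dvd_mul_left p N)).relIndex_eq]
  congr 1
  simp only [Fintype.card_prod, ZMod.card]
  ring

theorem TS_eq_avg (hF : ∀ γ ∈ Gamma0 N, slash k γ F = F) (hpN : ¬ p ∣ N) :
    TS N p k F = ((p : ℂ) ^ (k - 3) * muIndex N p) •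
      avg k (Gamma0 N) F (diagP p 0 0 1 1 rfl) := by
  rw [TS, TSdiag_lower hF hpN, pow_one, pow_one, muIndex]

theorem TSdiag_sq_eq_avg (hF : ∀ γ ∈ Gamma0 N, slash k γ F = F) (hpN : ¬ p ∣ N) :
    TSdiag N p k 0 0 2 2 rfl F = (((p : ℂ) ^ (k - 3)) ^ 2 * ((p : ℂ) ^ 3 * muIndex N p)) •
      avg k (Gamma0 N) F (diagP p 0 0 2 2 rfl) := by
  rw [TSdiag_lower hF hpN, pow_two p, ← mul_assoc, relIndex_sq]
  push_cast
  rfl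

theorem TSdiag_delta_eq_avg (hF : ∀ γ ∈ Gamma0 N, slash k γ F = F) (hpN : ¬ p ∣ N) :
    TSdiag N p k 0 1 2 1 rfl F = (((p : ℂ) ^ (k - 3)) ^ 2 * ((p : ℂ) * muIndex N p)) •
      avg k (Gamma0 N) F (diagP p 0 1 2 1 rfl) := by
  have hs : (diagP p 2 1 0 1 rfl).simil = (diagP p 0 1 2 1 rfl).simil := by
    rw [simil_diagP, simil_diagP]
  have hd := doubleCoset_flip_fst (p := p) hpN 2 0 1 1 rfl
  rw [TSdiag, ← dcOp_congr hs hd, dcOp_eq_avg hF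
    (stabIn_diagP_relIndex_ne_zero N p _ _ _ _ _), relIndex_stabIn_delta hpN,
    avg_of_doubleCoset_eq hd, simil_diagP]
  congr 2
  · push_cast
    rw [← zpow_natCast, ← zpow_natCast, ← _root_.zpow_mul, ← _root_.zpow_mul, mul_comm]
  · push_cast
    rfl

theorem TSdiag_scal_eq (hF : ∀ γ ∈ Gamma0 N, slash k γ F = F) :
    TSdiag N p k 1 1 1 1 rfl F = (((p : ℂ) ^ (k - 3)) ^ 2) • F := by
  have h1 : stabIn (Gamma0 N) (diagP p 1 1 1 1 rfl) (Gamma0 N) = Gamma0 N :=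
    le_antisymm (stabIn_le _ _ _) fun x hx => mem_stabIn.mpr
      ⟨hx, by rwa [diagP_scal, scal_comm, mul_inv_cancel_right]⟩
  rw [TSdiag, dcOp_eq_avg hF (stabIn_diagP_relIndex_ne_zero N p _ _ _ _ _), h1,
    Subgroup.relIndex_self, avg_diagP_scal hF, simil_diagP]
  congr 1
  push_cast
  rw [mul_one, ← zpow_natCast, ← zpow_natCast, ← _root_.zpow_mul, ← _root_.zpow_mul, mul_comm]

/-- The average of F|T_S(p) at diag(1,1,p,p) is the case j = 0 of `avg_TS_lower`; no composition of
double cosets is needed. -/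
theorem TS_TS_eq (hF : ∀ γ ∈ Gamma0 N, slash k γ F = F) (hpN : ¬ p ∣ N) :
    TS N p k (TS N p k F) = (((p : ℂ) ^ (k - 3)) ^ 2 * muIndex N p) •
      (F + ((p : ℂ) * (p + 1)) • avg k (Gamma0 N) F (diagP p 0 1 2 1 rfl) +
        (p : ℂ) ^ 3 • avg k (Gamma0 N) F (diagP p 0 0 2 2 rfl)) := by
  have h0 := avg_TS_lower hF hpN 0
  rw [avg_diagP_scal hF 0] at h0
  have hinv : ∀ γ ∈ Gamma0 N, slash k γ (TS N p k F) = TS N p k F := fun γ hγ =>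
    slash_TSdiag hF _ _ _ _ _ hγ
  rw [TS_eq_avg hinv hpN]
  refine (congrArg _ h0).trans ?_
  rw [smul_smul]
  push_cast
  congr 1
  ring

theorem US_eq_sum {M : ℕ} (hpM : p ∣ M) (hF : ∀ γ ∈ Gamma0 M, slash k γ F = F) :
    dcOp k (Gamma0 M) (diagP p 0 0 1 1 rfl) (Gamma0 M) F = (p : ℂ) ^ (k - 3) •
      ∑ S : ZMod p × ZMod p × ZMod p,
        slash k (diagP p 0 0 1 1 rfl * nU S.1.val S.2.1.val S.2.2.val) F := by
  rw [dcOp_eq hF (isTransversal_nU hpM).doubleCoset, simil_diagP]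
  simp

theorem slash_US_sum {M : ℕ} (hpM : p ∣ M) (hF : ∀ γ ∈ Gamma0 M, slash k γ F = F) {γ : GSp}
    (hγ : γ ∈ Gamma0 M) : slash k γ (∑ S : ZMod p × ZMod p × ZMod p,
        slash k (diagP p 0 0 1 1 rfl * nU S.1.val S.2.1.val S.2.2.val) F) =
      ∑ S : ZMod p × ZMod p × ZMod p,
        slash k (diagP p 0 0 1 1 rfl * nU S.1.val S.2.1.val S.2.2.val) F :=
  slash_sum_doubleCoset hF (isTransversal_nU hpM).doubleCoset hγ

theorem isTransversal_USstar (M : ℕ) [NeZero M] (hpM : p ∣ M) :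
    IsTransversal (Gamma0 M)
      (DoubleCoset.doubleCoset (diagP p 1 1 0 0 rfl) (Gamma0 M : Set GSp) (Gamma0 M))
      (fun x : ZMod p × ZMod p × ZMod p => diagP p 1 1 0 0 rfl * nL ((M * x.1.val : ℤ) : ℝ)
        ((M * x.2.1.val : ℤ) : ℝ) ((M * x.2.2.val : ℤ) : ℝ)) := by
  apply IsTransversal.doubleCoset
  rw [stabIn_diagP_upper, pow_one]
  exact isTransversal_nL (NeZero.ne M) hpM

theorem dcOp_one_eq_sum (hF : ∀ γ ∈ Gamma0 (N * p), slash k γ F = F) (α β : ℤ)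
    (h : (p : ℤ) * α - N * β = 1) (hpN : ¬ p ∣ N) :
    Tr N p k F = ∑ i, slash k (lagRep N p α β h i) F := by
  have h1 : DoubleCoset.doubleCoset (1 : GSp) (Gamma0 (N * p) : Set GSp) (Gamma0 N) = Gamma0 N := by
    ext x
    rw [DoubleCoset.mem_doubleCoset]
    constructor
    · rintro ⟨a, ha, b, hb, rfl⟩
      rw [mul_one]
      exact mul_mem (Gamma0_le (dvd_mul_right N p) ha) hb
    · intro hx
      exact ⟨1, one_mem _, x, hx, by simp⟩
  have h2 := isTransversal_lagRep α β h hpN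
  rw [← h1] at h2
  rw [Tr, dcOp_eq hF h2, GSp.simil_one]
  simp

/-- Unfolded, the left side sums F|d n(S) d' over S and over products of representatives of Γ₀(Np²)
in Γ₀(Np) and of Γ₀(Np) in Γ₀(N). These products represent Γ₀(Np²) in Γ₀(N), of index p³μ(p), so the
sum is that index times a sum of averages, known from `sum_avg_unip`. -/
theorem Tr_USstar_US (hF : ∀ γ ∈ Gamma0 N, slash k γ F = F) (hpN : ¬ p ∣ N) :
    Tr N p k (USstar N p k (US N p k F)) =
      (((p : ℂ) ^ (k - 3)) ^ 2 * ((p : ℂ) ^ 3 * muIndex N p)) •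
      (F + ((p : ℂ) ^ 2 - 1) • avg k (Gamma0 N) F (diagP p 0 1 2 1 rfl) +
        ((p : ℂ) ^ 3 - (p : ℂ) ^ 2) • avg k (Gamma0 N) F (diagP p 0 0 2 2 rfl)) := by
  obtain ⟨α, β, h⟩ := exists_bezout (p := p) hpN 1
  rw [pow_one] at h
  have hp0 : p ≠ 0 := (Fact.out : p.Prime).ne_zero
  have : NeZero p := ⟨hp0⟩
  have hpM : p ∣ N * p := dvd_mul_left p N
  have hle : Gamma0 (N * p) ≤ Gamma0 N := Gamma0_le (dvd_mul_right _ _)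
  have hFH : ∀ γ ∈ Gamma0 (N * p), slash k γ F = F := fun γ hγ => hF γ (hle hγ)
  have hinv := fun γ hγ => slash_US_sum hpM hFH (γ := γ) hγ
  have hinv1 : ∀ γ ∈ Gamma0 (N * p), slash k γ (US N p k F) = US N p k F := by
    intro γ hγ
    rw [US, US_eq_sum hpM hFH, slash_smul, hinv γ hγ]
  have h1 := isTransversal_USstar (p := p) (N * p) hpM
  have hinv2 : ∀ γ ∈ Gamma0 (N * p), slash k γ (USstar N p k (US N p k F)) =
      USstar N p k (US N p k F) := by
    intro γ hγ
    rw [USstar, dcOp_eq hinv1 h1, slash_smul, slash_sum_doubleCoset hinv1 h1 hγ]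
  rw [dcOp_one_eq_sum hinv2 α β h hpN, USstar, dcOp_eq hinv1 h1, US, US_eq_sum hpM hFH, simil_diagP]
  set X := ∑ S : ZMod p × ZMod p × ZMod p,
        slash k (diagP p 0 0 1 1 rfl * nU S.1.val S.2.1.val S.2.2.val) F with hX
  have hc : ∀ S : ZMod p × ZMod p × ZMod p, diagP p 0 0 1 1 rfl *
      (nU S.1.val S.2.1.val S.2.2.val * diagP p 1 1 0 0 rfl) ∈ Comm N := fun S =>
    mul_mem (diagP_mem_Comm N p _ _ _ _ _) (mul_mem (Gamma0_le_Comm N (nU_val_mem N _ _ _))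
      (diagP_mem_Comm N p _ _ _ _ _))
  have hsum : ∑ S : ZMod p × ZMod p × ZMod p, slash k (diagP p 0 0 1 1 rfl *
      (nU S.1.val S.2.1.val S.2.2.val * diagP p 1 1 0 0 rfl)) F =
      slash k (diagP p 1 1 0 0 rfl) X := by
    rw [hX, slash_sum]
    refine Finset.sum_congr rfl fun S _ => ?_
    rw [← mul_assoc, slash_mul k (diagP p 0 0 1 1 rfl * _)]
  -- The inner sum over S is the unnormalised F|U_S(p) slashed by diag(p,p,1,1). Since F|U_S(p) is
  -- fixed by Γ₀(Np), the sum is fixed by Γ₀(Np²).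
  have h3 := sum_slash_eq_sum_avg hF hc (K := Gamma0 (N * p * p))
    (Gamma0_le (mul_assoc N p p ▸ dvd_mul_right _ _)) (fun γ hγ => by
      rw [hsum]
      refine slash_stabIn hinv (Γ₂ := Gamma0 (N * p)) ?_
      rwa [stabIn_diagP_upper, pow_one]) (isTransversal_nL (p := p) (mul_ne_zero (NeZero.ne N) hp0) hpM |>.mul
        (Gamma0_le (dvd_mul_right _ _)) (fun m hm s hs => mul_mem (hle hm) hs)
        (isTransversal_lagRep α β h hpN))
  rw [Fintype.sum_prod_type_right, hsum, sum_avg_unip hF hpN, Fintype.card_prod, card_lagIdx, ← muIndex_eq hpN] at h3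
  rw [mul_smul, pow_two, mul_smul]
  have h4 : ((p : ℂ) ^ 3 * muIndex N p) = ((Fintype.card (ZMod p × ZMod p × ZMod p) *
      muIndex N p : ℕ) : ℂ) := by
    simp only [Fintype.card_prod, ZMod.card]
    push_cast
    ring
  rw [h4, ← h3]
  simp only [slash_smul, slash_sum, Finset.smul_sum, ← slash_mul]
  simp only [mul_assoc, add_zero, pow_one, Complex.ofReal_natCast]

theorem Tr_USstar_US_eq_TSdiag (hF : ∀ γ ∈ Gamma0 N, slash k γ F = F) (hpN : ¬ p ∣ N) :
    Tr N p k (USstar N p k (US N p k F)) =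
      ((p : ℂ) ^ 2 * ((p : ℂ) ^ 2 - 1)) • TSdiag N p k 0 1 2 1 rfl F +
      ((p : ℂ) ^ 2 * ((p : ℂ) - 1)) • TSdiag N p k 0 0 2 2 rfl F +
      ((p : ℂ) ^ 3 * muIndex N p) • TSdiag N p k 1 1 1 1 rfl F := by
  rw [Tr_USstar_US hF hpN, TSdiag_scal_eq hF, TSdiag_sq_eq_avg hF hpN, TSdiag_delta_eq_avg hF hpN]
  module

/-- In p²(p-1)·T_S(p)² the averages at diag(1,p,p²,p) and diag(1,1,p²,p²) already carry the right
coefficients. Only a multiple of F is left over, and (p-1)μ(p) = p⁴ - 1 gives it the stated form. -/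
theorem Tr_USstar_US_eq_TS (hF : ∀ γ ∈ Gamma0 N, slash k γ F = F) (hpN : ¬ p ∣ N) :
    Tr N p k (USstar N p k (US N p k F)) =
      ((p : ℂ) ^ 2 * ((p : ℂ) - 1)) • TS N p k (TS N p k F) +
      (-((p : ℂ) ^ 2 * ((p : ℂ) ^ 4 - 1)) + (p : ℂ) ^ 3 * muIndex N p) •
        TSdiag N p k 1 1 1 1 rfl F := by
  have hμ : (muIndex N p : ℂ) = 1 + ((p + 1) * p + p ^ 3) := by
    rw [muIndex_eq hpN]
    push_cast
    ring
  rw [Tr_USstar_US hF hpN, TSdiag_scal_eq hF, TS_TS_eq hF hpN, hμ]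
  module

/-- The averages attached to `diag(1, 1, p^j, p^j)` for an eigenfunction of `T_S(p)`. -/
theorem avg_of_TS_eigen (hF : ∀ γ ∈ Gamma0 N, slash k γ F = F) (hpN : ¬ p ∣ N) {lam : ℂ}
    (hl : TS N p k F = lam • F) : avg k (Gamma0 N) F (diagP p 0 0 1 1 rfl) =
      (lam / ((p : ℂ) ^ (k - 3) * muIndex N p)) • F := by
  have hp : (p : ℂ) ≠ 0 := Nat.cast_ne_zero.mpr (Fact.out : p.Prime).ne_zero
  have hq : (p : ℂ) ^ (k - 3) ≠ 0 := zpow_ne_zero _ hp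
  have hμ : (muIndex N p : ℂ) ≠ 0 := by
    rw [muIndex_eq hpN]
    exact_mod_cast (by positivity : 1 + ((p + 1) * p + p ^ 3) ≠ 0)
  have h1 := TS_eq_avg hF hpN
  rw [hl] at h1
  rw [div_eq_inv_mul, mul_smul, h1, inv_smul_smul₀ (mul_ne_zero hq hμ)]

/-- Five linear relations determine the averages: T_S(p) itself, the recursions at diag(1,1,p,p),
diag(1,1,p²,p²) and diag(1,p,p²,p), and the eigenvalue of T'_S(p). -/
theorem avg_of_TS'_eigen (hF : ∀ γ ∈ Gamma0 N, slash k γ F = F) (hpN : ¬ p ∣ N) {lam lam' : ℂ}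
    (hl : TS N p k F = lam • F) (hl' : TS' N p k F = lam' • F) :
    avg k (Gamma0 N) F (diagP p 0 0 2 2 rfl) =
      ((lam ^ 2 - (1 + 1 / (p : ℂ)) * lam' + ((p : ℂ) ^ (k - 3)) ^ 2 * (p * (p + 1))) /
        ((p : ℂ) ^ 3 * ((p : ℂ) ^ (k - 3)) ^ 2 * muIndex N p)) • F ∧
    avg k (Gamma0 N) F (diagP p 0 0 3 3 rfl) =
      (lam * (lam ^ 2 - (2 + 1 / (p : ℂ)) * lam' +
        ((p : ℂ) ^ (k - 3)) ^ 2 * (p * (p + 1) * (p + 2))) /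
        ((p : ℂ) ^ 6 * ((p : ℂ) ^ (k - 3)) ^ 3 * muIndex N p)) • F := by
  have hp : (p : ℂ) ≠ 0 := Nat.cast_ne_zero.mpr (Fact.out : p.Prime).ne_zero
  have hp1 : (p : ℂ) + 1 ≠ 0 := by exact_mod_cast Nat.succ_ne_zero p
  have hq : (p : ℂ) ^ (k - 3) ≠ 0 := zpow_ne_zero _ hp
  have hμ0 : (muIndex N p : ℂ) = 1 + ((p + 1) * p + p ^ 3) := by
    rw [muIndex_eq hpN]
    push_cast
    ring
  have hμ : (muIndex N p : ℂ) ≠ 0 := by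
    rw [muIndex_eq hpN]
    exact_mod_cast (by positivity : 1 + ((p + 1) * p + p ^ 3) ≠ 0)
  have h1 := TS_eq_avg hF hpN
  have h2 := avg_TS_lower hF hpN 0
  have h3 := avg_TS_lower hF hpN 1
  have h4 := avg_TS_delta hF hpN
  have h5 := TS_TS_eq hF hpN
  rw [TS', TSsq, h5, TSdiag_scal_eq hF, TSdiag_sq_eq_avg hF hpN, TSdiag_delta_eq_avg hF hpN] at hl'
  rw [avg_diagP_scal hF 0] at h2
  rw [hl] at h1 h2 h3 h4
  rw [avg_smul hF (diagP_mem_Comm N p _ _ _ _ _)] at h2 h3 h4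
  generalize (p : ℂ) ^ (k - 3) = q at *
  -- At a fixed point, f is the value of F, a_j that of the average at diag(1,1,p^j,p^j), b that at
  -- diag(1,p,p²,p), e that at diag(1,p,p³,p²), and q = p^(k-3).
  have key : ∀ f a1 a2 a3 b e : ℂ, lam * f = q * muIndex N p * a1 →
      lam * a1 = q * (f + ((p : ℂ) * (p + 1)) * b + (p : ℂ) ^ 3 * a2) →
      lam * a2 = q * (a1 + ((p : ℂ) * (p + 1)) * e + (p : ℂ) ^ 3 * a3) →
      lam * b = q * (((p : ℂ) + 1) * a1 + ((p : ℂ) ^ 3 + (p : ℂ) ^ 2) * e) →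
      q ^ 2 * muIndex N p * (f + ((p : ℂ) * (p + 1)) * b + (p : ℂ) ^ 3 * a2) -
        (q ^ 2 * ((p : ℂ) ^ 3 * muIndex N p) * a2 + q ^ 2 * ((p : ℂ) * muIndex N p) * b +
          q ^ 2 * f) = lam' * f →
      a2 = ((lam ^ 2 - (1 + 1 / (p : ℂ)) * lam' + q ^ 2 * (p * (p + 1))) /
        ((p : ℂ) ^ 3 * q ^ 2 * muIndex N p)) * f ∧
      a3 = (lam * (lam ^ 2 - (2 + 1 / (p : ℂ)) * lam' + q ^ 2 * (p * (p + 1) * (p + 2))) /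
        ((p : ℂ) ^ 6 * q ^ 3 * muIndex N p)) * f := by
    intro f a1 a2 a3 b e e1 e2 e3 e4 e5
    -- The average at diag(1,1,p²,p²) cancels in T_S(p)² - T_S(p²), so the eigenvalue of T'_S(p)
    -- alone determines b.
    have hb : b = (lam' - q ^ 2 * (muIndex N p - 1)) / (q ^ 2 * p ^ 2 * muIndex N p) * f := by
      field_simp
      linear_combination e5
    have ha1 : a1 = lam / (q * muIndex N p) * f := by
      field_simp
      linear_combination -e1
    have ha2 : a2 = ((lam ^ 2 - (1 + 1 / (p : ℂ)) * lam' + q ^ 2 * (p * (p + 1))) /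
        ((p : ℂ) ^ 3 * q ^ 2 * muIndex N p)) * f := by
      rw [ha1, hb] at e2
      have : a2 = (lam * (lam / (q * muIndex N p) * f) / q - f - ((p : ℂ) * (p + 1)) *
          ((lam' - q ^ 2 * (muIndex N p - 1)) / (q ^ 2 * p ^ 2 * muIndex N p) * f)) / p ^ 3 := by
        rw [e2]
        field_simp
        ring
      rw [this]
      field_simp
      rw [hμ0]
      ring
    refine ⟨ha2, ?_⟩
    -- The relation at diag(1,p,p²,p) eliminates e, the only other unknown in the recursion for a3.
    have he : e = (lam * b / q - (p + 1) * a1) / ((p : ℂ) ^ 2 * (p + 1)) := by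
      rw [e4]
      field_simp
      ring
    have : a3 = (lam * a2 / q - a1 - ((p : ℂ) * (p + 1)) * e) / p ^ 3 := by
      rw [e3]
      field_simp
      ring
    rw [this, he, ha2, hb, ha1]
    field_simp
    rw [hμ0]
    ring
  push_cast at h2 h3 h4
  have key' := fun Z => key (F Z) (avg k (Gamma0 N) F (diagP p 0 0 1 1 rfl) Z)
    (avg k (Gamma0 N) F (diagP p 0 0 2 2 rfl) Z) (avg k (Gamma0 N) F (diagP p 0 0 3 3 rfl) Z)
    (avg k (Gamma0 N) F (diagP p 0 1 2 1 rfl) Z) (avg k (Gamma0 N) F (diagP p 0 1 3 2 rfl) Z)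
    (congrFun h1 Z) (congrFun h2 Z) (congrFun h3 Z) (congrFun h4 Z) (congrFun hl' Z)
  exact ⟨funext fun Z => (key' Z).1, funext fun Z => (key' Z).2⟩

end Prime

end

section

/-! ### Coordinates and the invariant measure -/

theorem ofCoords_coords (Z : H2) : ofCoords (coords Z) = Z.mat := by
  have h : Z.mat 1 0 = Z.mat 0 1 := congrFun (congrFun Z.symm 0) 1
  ext i j
  fin_cases i <;> fin_cases j <;> simp [ofCoords, coords, h]

theorem coords_injective : Function.Injective coords := fun Z W h =>
  H2.ext (by rw [← ofCoords_coords, ← ofCoords_coords, h])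

/-- The determinant of the imaginary part, in coordinates. -/
def detIm (w : ℂ × ℂ × ℂ) : ℝ := w.1.im * w.2.2.im - w.2.1.im ^ 2

theorem im_det (Z : H2) : Z.im.det = detIm (coords Z) := by
  have h : Z.mat 1 0 = Z.mat 0 1 := congrFun (congrFun Z.symm 0) 1
  rw [Matrix.det_fin_two]
  simp only [H2.im, detIm, coords, Matrix.map_apply, h]
  ring

theorem posDef_fin_two {Y : Matrix (Fin 2) (Fin 2) ℝ} (hs : Y 1 0 = Y 0 1) (h0 : 0 < Y 0 0)
    (h1 : 0 < Y 0 0 * Y 1 1 - Y 0 1 ^ 2) : Y.PosDef := by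
  refine PosDef.of_dotProduct_mulVec_pos ?_ ?_
  · ext i j
    fin_cases i <;> fin_cases j <;> simp [conjTranspose_apply, hs]
  · intro x hx
    have hq : star x ⬝ᵥ (Y *ᵥ x) = Y 0 0 * x 0 ^ 2 + 2 * Y 0 1 * x 0 * x 1 + Y 1 1 * x 1 ^ 2 := by
      simp [dotProduct, Matrix.mulVec, Fin.sum_univ_two, hs]
      ring
    rw [hq]
    have h2 : 0 < Y 0 0 * (Y 0 0 * x 0 ^ 2 + 2 * Y 0 1 * x 0 * x 1 + Y 1 1 * x 1 ^ 2) := by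
      have h3 : Y 0 0 * (Y 0 0 * x 0 ^ 2 + 2 * Y 0 1 * x 0 * x 1 + Y 1 1 * x 1 ^ 2) =
          (Y 0 0 * x 0 + Y 0 1 * x 1) ^ 2 + (Y 0 0 * Y 1 1 - Y 0 1 ^ 2) * x 1 ^ 2 := by ring
      rw [h3]
      by_cases hx1 : x 1 = 0
      · have hx0 : x 0 ≠ 0 := by
          intro hx0
          apply hx
          ext i
          fin_cases i <;> assumption
        rw [hx1]
        have := mul_ne_zero h0.ne' hx0
        have : 0 < (Y 0 0 * x 0) ^ 2 := by positivity
        simpa using this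
      · positivity
    exact pos_of_mul_pos_right h2 h0.le

theorem H2.im_zero_zero_pos (Z : H2) : 0 < (Z.mat 0 0).im := Z.im_posDef.diag_pos (i := 0)

theorem H2.im_one_one_pos (Z : H2) : 0 < (Z.mat 1 1).im := Z.im_posDef.diag_pos (i := 1)

theorem detIm_pos (Z : H2) : 0 < detIm (coords Z) := by
  rw [← im_det]
  exact Z.im_posDef.det_pos

theorem range_coords : Set.range coords = {w | 0 < w.1.im ∧ 0 < detIm w} := by
  ext w
  constructor
  · rintro ⟨Z, rfl⟩
    exact ⟨Z.im_zero_zero_pos, detIm_pos Z⟩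
  · rintro ⟨h0, h1⟩
    refine ⟨⟨ofCoords w, ?_, ?_⟩, ?_⟩
    · ext i j
      fin_cases i <;> fin_cases j <;> simp [ofCoords]
    · refine posDef_fin_two ?_ ?_ ?_
      · simp [ofCoords]
      · simpa [ofCoords] using h0
      · simpa [ofCoords, detIm] using h1
    · simp [coords, ofCoords, H2.mat]

theorem continuous_detIm : Continuous detIm := by
  unfold detIm
  fun_prop

theorem isOpen_range_coords : IsOpen (Set.range coords) := by
  rw [range_coords]
  exact (isOpen_lt continuous_const (Complex.continuous_im.comp continuous_fst)).inter
    (isOpen_lt continuous_const continuous_detIm)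

/-- The image of `coords` is open in ℂ³, so measure theory on `H2` is that of an open set with
Lebesgue measure. -/
theorem measurableEmbedding_coords : MeasurableEmbedding coords where
  injective := coords_injective
  measurable := comap_measurable coords
  measurableSet_image' := by
    rintro s ⟨t, ht, rfl⟩
    rw [Set.image_preimage_eq_inter_range]
    exact ht.inter isOpen_range_coords.measurableSet

instance : (volume : Measure (ℂ × ℂ)).IsAddHaarMeasure :=
  inferInstanceAs ((volume : Measure ℂ).prod (volume : Measure ℂ)).IsAddHaarMeasure

instance : (volume : Measure (ℂ × ℂ × ℂ)).IsAddHaarMeasure :=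
  inferInstanceAs ((volume : Measure ℂ).prod (volume : Measure (ℂ × ℂ))).IsAddHaarMeasure

/-- The density of the invariant measure, in coordinates. -/
def muDensity (w : ℂ × ℂ × ℂ) : ENNReal := ENNReal.ofReal (detIm w ^ (-3 : ℤ))

theorem muH2_apply {s : Set H2} (hs : MeasurableSet s) :
    muH2 s = ∫⁻ w in coords '' s, muDensity w := by
  rw [muH2, withDensity_apply _ hs]
  have h1 : (fun Z : H2 => ENNReal.ofReal (Z.im.det ^ (-3 : ℤ))) = muDensity ∘ coords := by
    funext Z
    rw [im_det]
    rfl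
  have h2 : Measure.map coords ((Measure.comap coords volume).restrict s) =
      volume.restrict (coords '' s) := by
    have h3 := measurableEmbedding_coords.restrict_map (Measure.comap coords volume) (coords '' s)
    rw [Set.preimage_image_eq _ coords_injective, measurableEmbedding_coords.map_comap,
      Measure.restrict_restrict (measurableEmbedding_coords.measurableSet_image.mpr hs),
      Set.inter_eq_left.mpr (Set.image_subset_range _ _)] at h3
    exact h3.symm
  rw [h1, ← h2, measurableEmbedding_coords.lintegral_map]
  rfl

theorem measurable_comp_coords {X : Type} [TopologicalSpace X] [MeasurableSpace X] [BorelSpace X]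
    {f : ℂ × ℂ × ℂ → X} (hf : ContinuousOn f (Set.range coords)) :
    Measurable (f ∘ coords) := by
  have h1 : Measurable ((Set.range coords).domRestrict f) :=
    (continuousOn_iff_continuous_domRestrict.mp hf).measurable
  exact h1.comp ((comap_measurable coords).subtype_mk (h := fun Z => Set.mem_range_self Z))

/-! ### The derivative of the action -/

theorem num_den_transpose (g : GSp) (Z : H2) :
    Z.mat * g.blkCᵀ + g.blkDᵀ = (g.den Z.mat)ᵀ ∧ Z.mat * g.blkAᵀ + g.blkBᵀ = (g.num Z.mat)ᵀ := by
  constructor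
  · rw [GSp.den, transpose_add, transpose_mul, Z.symm]
  · rw [GSp.num, transpose_add, transpose_mul, Z.symm]

theorem smul_mat (g : GSp) (Z : H2) : (g • Z).mat = g.num Z.mat * (g.den Z.mat)⁻¹ := rfl

/-- An exact difference formula, obtained from `key_identity` with the transposed denominator at Z
on the left. It gives the derivative of the action by continuity, without differentiating a matrix
quotient. -/
theorem smul_sub_smul (g : GSp) (Z W : H2) : (g • W).mat - (g • Z).mat =
    (g.simil : ℂ) • ((g.den Z.mat)⁻¹ᵀ * (W.mat - Z.mat) * (g.den W.mat)⁻¹) := by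
  have hZ := (g.den_det_ne_zero Z).isUnit
  have hW := (g.den_det_ne_zero W).isUnit
  have hZT : IsUnit ((g.den Z.mat)ᵀ).det := by rwa [det_transpose]
  have h1 := GSp.key_identity g Z.mat W.mat
  rw [(num_den_transpose g Z).1, (num_den_transpose g Z).2] at h1
  have h2 : (g • Z).mat = (g.den Z.mat)ᵀ⁻¹ * (g.num Z.mat)ᵀ := by
    rw [← (g • Z).symm, smul_mat, transpose_mul, transpose_nonsing_inv]
  rw [h2, smul_mat, transpose_nonsing_inv, ← Matrix.smul_mul, ← Matrix.mul_smul, ← h1,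
    Matrix.mul_sub, Matrix.sub_mul, ← Matrix.mul_assoc, nonsing_inv_mul _ hZT, Matrix.one_mul,
    Matrix.mul_assoc, Matrix.mul_assoc, mul_nonsing_inv _ hW, Matrix.mul_one]

/-- The coordinates of `ℂ³` as an indexed family. -/
def coordEquiv : (ℂ × ℂ × ℂ) ≃ₗ[ℂ] (Fin 3 → ℂ) where
  toFun w := ![w.1, w.2.1, w.2.2]
  invFun v := (v 0, v 1, v 2)
  map_add' w w' := by ext i; fin_cases i <;> rfl
  map_smul' c w := by ext i; fin_cases i <;> rfl
  left_inv w := rfl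
  right_inv v := by ext i; fin_cases i <;> rfl

theorem coordEquiv_apply (w : ℂ × ℂ × ℂ) : coordEquiv w = ![w.1, w.2.1, w.2.2] := rfl

theorem coordEquiv_symm_apply (v : Fin 3 → ℂ) : coordEquiv.symm v = (v 0, v 1, v 2) := rfl

/-- The linear map `H ↦ Pᵀ H Q` on symmetric matrices, read off from the upper triangle. -/
def sandwich (P Q : Matrix (Fin 2) (Fin 2) ℂ) : (ℂ × ℂ × ℂ) →ₗ[ℂ] (ℂ × ℂ × ℂ) :=
  coordEquiv.symm.toLinearMap ∘ₗ Matrix.toLin' !![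
    P 0 0 * Q 0 0, P 0 0 * Q 1 0 + P 1 0 * Q 0 0, P 1 0 * Q 1 0;
    P 0 0 * Q 0 1, P 0 0 * Q 1 1 + P 1 0 * Q 0 1, P 1 0 * Q 1 1;
    P 0 1 * Q 0 1, P 0 1 * Q 1 1 + P 1 1 * Q 0 1, P 1 1 * Q 1 1] ∘ₗ coordEquiv.toLinearMap

theorem sandwich_apply (P Q : Matrix (Fin 2) (Fin 2) ℂ) (w : ℂ × ℂ × ℂ) : sandwich P Q w =
    ((Pᵀ * ofCoords w * Q) 0 0, (Pᵀ * ofCoords w * Q) 0 1, (Pᵀ * ofCoords w * Q) 1 1) := by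
  simp only [sandwich, LinearMap.comp_apply, LinearEquiv.coe_coe, coordEquiv_apply,
    coordEquiv_symm_apply, Matrix.toLin'_apply]
  refine Prod.ext ?_ (Prod.ext ?_ ?_) <;>
    simp [ofCoords, Matrix.mul_apply, Matrix.mulVec, dotProduct, Fin.sum_univ_three,
      Fin.sum_univ_two] <;> ring

/-- H ↦ PᵀHP is the symmetric square of a map of a plane, whose determinant is the cube of the
original one. -/
theorem det_sandwich (P : Matrix (Fin 2) (Fin 2) ℂ) :
    LinearMap.det (sandwich P P) = P.det ^ 3 := by
  have h := LinearMap.det_conj (Matrix.toLin' !![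
    P 0 0 * P 0 0, P 0 0 * P 1 0 + P 1 0 * P 0 0, P 1 0 * P 1 0;
    P 0 0 * P 0 1, P 0 0 * P 1 1 + P 1 0 * P 0 1, P 1 0 * P 1 1;
    P 0 1 * P 0 1, P 0 1 * P 1 1 + P 1 1 * P 0 1, P 1 1 * P 1 1]) coordEquiv.symm
  rw [LinearMap.det_toLin'] at h
  refine Eq.trans h ?_
  rw [Matrix.det_fin_three, Matrix.det_fin_two]
  simp
  ring

/-- The action in coordinates. -/
def actCoords (g : GSp) (w : ℂ × ℂ × ℂ) : ℂ × ℂ × ℂ :=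
  ((g.num (ofCoords w) * (g.den (ofCoords w))⁻¹) 0 0,
    (g.num (ofCoords w) * (g.den (ofCoords w))⁻¹) 0 1,
    (g.num (ofCoords w) * (g.den (ofCoords w))⁻¹) 1 1)

theorem coords_smul (g : GSp) (Z : H2) : coords (g • Z) = actCoords g (coords Z) := by
  unfold actCoords
  rw [ofCoords_coords]
  rfl

theorem actCoords_sub (g : GSp) (Z W : H2) : actCoords g (coords W) - actCoords g (coords Z) =
    ((g.simil : ℂ) • sandwich (g.den Z.mat)⁻¹ (g.den W.mat)⁻¹) (coords W - coords Z) := by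
  have h := smul_sub_smul g Z W
  have h1 : ofCoords (coords W - coords Z) = W.mat - Z.mat := by
    rw [← ofCoords_coords, ← ofCoords_coords]
    ext i j
    fin_cases i <;> fin_cases j <;> rfl
  rw [← coords_smul, ← coords_smul, LinearMap.smul_apply, sandwich_apply, h1]
  exact Prod.ext (congrFun (congrFun h 0) 0) (Prod.ext (congrFun (congrFun h 0) 1)
    (congrFun (congrFun h 1) 1))

theorem continuous_ofCoords : Continuous ofCoords := by
  unfold ofCoords
  refine continuous_matrix fun i j => ?_
  fin_cases i <;> fin_cases j <;> simp <;> fun_prop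

theorem continuous_den_ofCoords (g : GSp) : Continuous fun w => g.den (ofCoords w) := by
  unfold GSp.den
  have := continuous_ofCoords
  fun_prop

theorem continuousAt_den_inv (g : GSp) (Z : H2) :
    ContinuousAt (fun w => (g.den (ofCoords w))⁻¹) (coords Z) := by
  have hne : (g.den (ofCoords (coords Z))).det ≠ 0 := by
    rw [ofCoords_coords]
    exact g.den_det_ne_zero Z
  have hc := (continuous_den_ofCoords g)
  simp only [Matrix.inv_def, Ring.inverse_eq_inv']
  have h1 : ContinuousAt (fun w => ((g.den (ofCoords w)).det)⁻¹) (coords Z) :=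
    (hc.matrix_det.continuousAt).inv₀ hne
  exact h1.smul hc.matrix_adjugate.continuousAt

/-- Carathéodory's criterion: a difference quotient given by linear maps continuous at the base
point has their value there as derivative. -/
theorem hasFDerivWithinAt_of_eq {E : Type} [NormedAddCommGroup E] [NormedSpace ℝ E] {f : E → E}
    {A : E → E →L[ℝ] E} {s : Set E} {x : E} (hA : ContinuousWithinAt A s x)
    (h : ∀ y ∈ s, f y - f x = A y (y - x)) : HasFDerivWithinAt f (A x) s x := by
  rw [hasFDerivWithinAt_iff_isLittleO, Asymptotics.isLittleO_iff]
  intro c hc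
  have h1 : Filter.Tendsto (fun y => ‖A y - A x‖) (nhdsWithin x s) (nhds 0) := by
    have := (hA.sub (continuousWithinAt_const (b := A x))).norm
    simpa [ContinuousWithinAt] using this
  filter_upwards [h1.eventually (gt_mem_nhds hc), self_mem_nhdsWithin] with y hy hys
  rw [h y hys, ← _root_.sub_apply]
  exact (ContinuousLinearMap.le_opNorm _ _).trans (by gcongr)

/-- The derivative of the action, as a real linear map. -/
def actDeriv (g : GSp) (P Q : Matrix (Fin 2) (Fin 2) ℂ) : (ℂ × ℂ × ℂ) →L[ℝ] (ℂ × ℂ × ℂ) :=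
  LinearMap.toContinuousLinearMap (((g.simil : ℂ) • sandwich P Q).restrictScalars ℝ)

theorem continuous_actDeriv (g : GSp) (P : Matrix (Fin 2) (Fin 2) ℂ) :
    Continuous (actDeriv g P) := by
  refine continuous_clm_apply.mpr fun w => ?_
  change Continuous fun Q => (g.simil : ℂ) • sandwich P Q w
  simp only [sandwich_apply]
  have hc : Continuous fun Q : Matrix (Fin 2) (Fin 2) ℂ => Pᵀ * ofCoords w * Q :=
    continuous_const.matrix_mul continuous_id
  exact ((hc.matrix_elem 0 0).prodMk ((hc.matrix_elem 0 1).prodMk (hc.matrix_elem 1 1))).const_smul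
    (g.simil : ℂ)

theorem hasFDerivWithinAt_actCoords (g : GSp) (Z : H2) :
    HasFDerivWithinAt (actCoords g) (actDeriv g (g.den Z.mat)⁻¹ (g.den Z.mat)⁻¹)
      (Set.range coords) (coords Z) := by
  have h := hasFDerivWithinAt_of_eq (f := actCoords g) (s := Set.range coords) (x := coords Z)
    (A := fun w => actDeriv g (g.den Z.mat)⁻¹ (g.den (ofCoords w))⁻¹) ?_ ?_
  · rwa [ofCoords_coords] at h
  · exact ((continuous_actDeriv g _).continuousAt.comp
      (continuousAt_den_inv g Z)).continuousWithinAt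
  · rintro _ ⟨W, rfl⟩
    rw [actCoords_sub, ofCoords_coords]
    rfl

/-- The real determinant of a complex linear map is the squared modulus of its complex determinant,
here r³ det(P)³. -/
theorem abs_det_actDeriv (g : GSp) (P : Matrix (Fin 2) (Fin 2) ℂ) :
    |(actDeriv g P P).det| = g.simil ^ 6 * ‖P.det‖ ^ 6 := by
  have h1 : (actDeriv g P P).det =
      LinearMap.det (((g.simil : ℂ) • sandwich P P).restrictScalars ℝ) := rfl
  have h2 : Module.finrank ℂ (ℂ × ℂ × ℂ) = 3 := by simp
  rw [h1, LinearMap.det_restrictScalars, LinearMap.det_smul, det_sandwich, h2,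
    Algebra.norm_complex_apply, Complex.normSq_eq_norm_sq, norm_mul, norm_pow, norm_pow,
    Complex.norm_real, Real.norm_of_nonneg g.simil_pos.le, abs_of_nonneg (by positivity)]
  ring

/-! ### Invariance of the measure -/

theorem measurable_smul (g : GSp) : Measurable fun Z : H2 => g • Z := by
  rw [measurable_comap_iff]
  have h1 : coords ∘ (fun Z : H2 => g • Z) = actCoords g ∘ coords := funext fun Z => coords_smul g Z
  rw [h1]
  refine measurable_comp_coords ?_
  rintro _ ⟨Z, rfl⟩
  exact (hasFDerivWithinAt_actCoords g Z).continuousWithinAt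

theorem im_smul_form (g : GSp) (Z : H2) :
    (g.den Z.mat)ᴴ * (g • Z).im.map Complex.ofRealHom * g.den Z.mat =
      (g.simil : ℂ) • Z.im.map Complex.ofRealHom := by
  have hW := (g.den_det_ne_zero Z).isUnit
  have hV : g.num Z.mat = (g • Z).mat * g.den Z.mat := by
    rw [smul_mat, Matrix.mul_assoc, nonsing_inv_mul _ hW, Matrix.mul_one]
  have hform := GSp.den_form g Z
  have h1 : (g.den Z.mat)ᴴ * ((g • Z).mat - (g • Z).matᴴ) * g.den Z.mat =
      (2 * Complex.I * g.simil) • Z.im.map Complex.ofRealHom := by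
    rw [← hform, hV, conjTranspose_mul]
    noncomm_ring
  rw [GSp.sub_conj, Matrix.mul_smul, Matrix.smul_mul,
    mul_smul (2 * Complex.I) (g.simil : ℂ)] at h1
  have hI : (2 * Complex.I : ℂ) ≠ 0 := by simp [Complex.I_ne_zero]
  exact smul_right_injective _ hI h1

theorem detIm_smul (g : GSp) (Z : H2) :
    detIm (coords (g • Z)) * ‖(g.den Z.mat).det‖ ^ 2 = g.simil ^ 2 * detIm (coords Z) := by
  have h := congrArg Matrix.det (im_smul_form g Z)
  have hmap : ∀ Y : Matrix (Fin 2) (Fin 2) ℝ, (Y.map Complex.ofRealHom).det = (Y.det : ℂ) :=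
    fun Y => (Complex.ofRealHom.map_det Y).symm
  rw [det_mul, det_mul, det_smul, hmap, hmap, det_conjTranspose, im_det, im_det,
    Fintype.card_fin] at h
  have h2 : star (g.den Z.mat).det * (g.den Z.mat).det = ((‖(g.den Z.mat).det‖ ^ 2 : ℝ) : ℂ) := by
    rw [← Complex.normSq_eq_norm_sq]
    exact Complex.normSq_eq_conj_mul_self.symm
  apply Complex.ofReal_injective
  rw [Complex.ofReal_mul, ← h2]
  push_cast
  rw [← h]
  ring

/-- The Jacobian r⁶ |det(CZ + D)|^(-6) cancels the change of det(Y)^(-3), because `detIm_smul` says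
that det(Y) is multiplied by r² |det(CZ + D)|^(-2). -/
theorem muH2_smul (g : GSp) {s : Set H2} (hs : MeasurableSet s) : muH2 (g • s) = muH2 s := by
  have hgs : MeasurableSet (g • s) := by
    rw [← Set.preimage_smul_inv]
    exact measurable_smul g⁻¹ hs
  have himg : coords '' (g • s) = actCoords g '' (coords '' s) := by
    rw [← Set.image_smul, Set.image_image, Set.image_image]
    simp only [coords_smul]
  have hinj : Set.InjOn (actCoords g) (coords '' s) := by
    rintro _ ⟨Z, -, rfl⟩ _ ⟨W, -, rfl⟩ h
    rw [← coords_smul, ← coords_smul] at h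
    rw [MulAction.injective g (coords_injective h)]
  have key := lintegral_image_eq_lintegral_abs_det_fderiv_mul volume
    (measurableEmbedding_coords.measurableSet_image.mpr hs) (f := actCoords g)
    (f' := fun w => actDeriv g (g.den (ofCoords w))⁻¹ (g.den (ofCoords w))⁻¹) (by
      rintro _ ⟨Z, -, rfl⟩
      rw [ofCoords_coords]
      exact (hasFDerivWithinAt_actCoords g Z).mono (Set.image_subset_range _ _)) hinj muDensity
  rw [muH2_apply hgs, muH2_apply hs, himg, key]
  refine setLIntegral_congr_fun (measurableEmbedding_coords.measurableSet_image.mpr hs) ?_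
  rintro _ ⟨Z, -, rfl⟩
  have h1 := detIm_smul g Z
  have hd := detIm_pos Z
  have hd' := detIm_pos (g • Z)
  have hr := g.simil_pos
  have hn : 0 < ‖(g.den Z.mat).det‖ := norm_pos_iff.mpr (g.den_det_ne_zero Z)
  simp only
  rw [abs_det_actDeriv, ofCoords_coords, muDensity, muDensity, ← ENNReal.ofReal_mul (by positivity),
    ← coords_smul, Matrix.det_nonsing_inv, Ring.inverse_eq_inv', norm_inv]
  congr 1
  have h2 : detIm (coords (g • Z)) =
      g.simil ^ 2 * detIm (coords Z) / ‖(g.den Z.mat).det‖ ^ 2 := by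
    rw [← h1]
    field_simp
  rw [h2]
  simp only [_root_.zpow_neg]
  norm_cast
  field_simp

end

section

/-! ### Reduction theory -/

/-- A value within a factor 2 of the infimum always exists when the infimum is positive. Using it in
place of a true minimum removes the need for discreteness arguments and only weakens the constants
of the Siegel set. -/
theorem exists_le_two_mul {X : Type} {S : Set X} (hS : S.Nonempty) {f : X → ℝ} {ε : ℝ} (hε : 0 < ε)
    (h : ∀ s ∈ S, ε ≤ f s) : ∃ s ∈ S, ∀ t ∈ S, f s ≤ 2 * f t := by
  have hb : BddBelow (f '' S) := ⟨ε, by rintro _ ⟨s, hs, rfl⟩; exact h s hs⟩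
  have hm : ε ≤ sInf (f '' S) :=
    le_csInf (hS.image f) (by rintro _ ⟨s, hs, rfl⟩; exact h s hs)
  obtain ⟨_, ⟨s, hs, rfl⟩, hlt⟩ := exists_lt_of_csInf_lt (hS.image f)
    (show sInf (f '' S) < 2 * sInf (f '' S) by linarith)
  refine ⟨s, hs, fun t ht => ?_⟩
  have := csInf_le hb (Set.mem_image_of_mem f ht)
  linarith

theorem trace_mul_form (a b c x y : ℝ) : (a + c) * (a * x ^ 2 + 2 * b * x * y + c * y ^ 2) =
    (a * c - b ^ 2) * (x ^ 2 + y ^ 2) + (a * x + b * y) ^ 2 + (b * x + c * y) ^ 2 := by ring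

theorem one_le_sq_add_sq {x y : ℤ} (h : ¬(x = 0 ∧ y = 0)) : (1 : ℝ) ≤ (x : ℝ) ^ 2 + (y : ℝ) ^ 2 := by
  have h1 : 1 ≤ x ^ 2 + y ^ 2 := by
    by_contra hlt
    have h2 : x ^ 2 + y ^ 2 ≤ 0 := by omega
    have hx : x ^ 2 = 0 := by nlinarith [sq_nonneg x, sq_nonneg y]
    have hy : y ^ 2 = 0 := by nlinarith [sq_nonneg x, sq_nonneg y]
    exact h ⟨by simpa using hx, by simpa using hy⟩
  exact_mod_cast h1

/-- Gauss reduction: (p, q) is a coprime vector nearly minimising the form, completed to a matrix of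
determinant 1 whose second row is shifted by a multiple of the first to make the middle coefficient
small. Coprimality of the second row gives the last inequality. -/
theorem exists_reduced_form {a b c : ℝ} (ha : 0 < a) (hd : 0 < a * c - b ^ 2) :
    ∃ p q r s : ℤ, p * s - q * r = 1 ∧
      2 * |a * p * r + b * (p * s + q * r) + c * q * s| ≤
        a * p ^ 2 + 2 * b * p * q + c * q ^ 2 ∧
      a * p ^ 2 + 2 * b * p * q + c * q ^ 2 ≤ 2 * (a * r ^ 2 + 2 * b * r * s + c * s ^ 2) := by
  have hc : 0 < c := by
    by_contra hc
    nlinarith [sq_nonneg b]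
  obtain ⟨⟨p, q⟩, hpq, hmin⟩ := exists_le_two_mul (S := {v : ℤ × ℤ | IsCoprime v.1 v.2})
    (f := fun v => a * v.1 ^ 2 + 2 * b * v.1 * v.2 + c * v.2 ^ 2)
    (ε := (a * c - b ^ 2) / (a + c)) ⟨(1, 0), isCoprime_one_left⟩ (by positivity) (by
      rintro ⟨x, y⟩ hxy
      rw [div_le_iff₀' (by positivity), trace_mul_form]
      have h1 : (1 : ℝ) ≤ (x : ℝ) ^ 2 + (y : ℝ) ^ 2 := one_le_sq_add_sq (by
        rintro ⟨rfl, rfl⟩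
        exact not_isCoprime_zero_zero hxy)
      nlinarith [sq_nonneg (a * x + b * y), sq_nonneg (b * x + c * y)])
  obtain ⟨u, v, huv⟩ := hpq
  simp only at hmin huv
  set Q : ℝ := a * p ^ 2 + 2 * b * p * q + c * q ^ 2 with hQ
  have hQ0 : 0 < Q := by
    have h1 : (1 : ℝ) ≤ (p : ℝ) ^ 2 + (q : ℝ) ^ 2 := one_le_sq_add_sq (by
      rintro ⟨rfl, rfl⟩
      simp at huv)
    have h2 := trace_mul_form a b c p q
    have h3 : 0 < (a + c) * Q := by
      rw [hQ, h2]
      nlinarith [sq_nonneg (a * p + b * q), sq_nonneg (b * p + c * q)]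
    exact pos_of_mul_pos_right h3 (by positivity)
  set B : ℝ := a * p * (-v) + b * (p * u + q * (-v)) + c * q * u with hB
  -- Adding n times the first row to the second changes the middle coefficient from B to B + nQ, and
  -- rounding makes this at most Q/2 in absolute value.
  set n : ℤ := round (-B / Q) with hn
  refine ⟨p, q, -v + n * p, u + n * q, by linear_combination huv, ?_, ?_⟩
  · have h1 : a * p * ((-v + n * p : ℤ) : ℝ) + b * (p * ((u + n * q : ℤ) : ℝ) +
        q * ((-v + n * p : ℤ) : ℝ)) + c * q * ((u + n * q : ℤ) : ℝ) = B + n * Q := by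
      push_cast
      rw [hB, hQ]
      ring
    rw [h1]
    have h2 := abs_sub_round (-B / Q)
    rw [← hn] at h2
    have h3 : B + n * Q = -((-B / Q - n) * Q) := by
      field_simp
      ring
    rw [h3, abs_neg, abs_mul, abs_of_pos hQ0]
    nlinarith
  · exact hmin (-v + n * p, u + n * q) ⟨-q, p, by linear_combination huv⟩

theorem smul_mat_of_num_eq {g : GSp} {Z : H2} {V : Matrix (Fin 2) (Fin 2) ℂ}
    (h : g.num Z.mat = V * g.den Z.mat) : (g • Z).mat = V := by
  rw [smul_mat, h, Matrix.mul_assoc, mul_nonsing_inv _ (g.den_det_ne_zero Z).isUnit, Matrix.mul_one]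

theorem H2.mat_eq (Z : H2) : Z.mat = !![Z.mat 0 0, Z.mat 0 1; Z.mat 0 1, Z.mat 1 1] :=
  (ofCoords_coords Z).symm

theorem H2.mat_one_zero (Z : H2) : Z.mat 1 0 = Z.mat 0 1 := congrFun (congrFun Z.symm 0) 1

theorem num_den_of_mat_eq {g : GSp} {a b c d e f g' h i j k l m n o q : ℝ}
    (hg : g.mat = fromBlocks !![a, b; c, d] !![e, f; g', h] !![i, j; k, l] !![m, n; o, q])
    (Z : H2) :
    g.num Z.mat = !![a * Z.mat 0 0 + b * Z.mat 0 1 + e, a * Z.mat 0 1 + b * Z.mat 1 1 + f;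
      c * Z.mat 0 0 + d * Z.mat 0 1 + g', c * Z.mat 0 1 + d * Z.mat 1 1 + h] ∧
    g.den Z.mat = !![i * Z.mat 0 0 + j * Z.mat 0 1 + m, i * Z.mat 0 1 + j * Z.mat 1 1 + n;
      k * Z.mat 0 0 + l * Z.mat 0 1 + o, k * Z.mat 0 1 + l * Z.mat 1 1 + q] := by
  simp only [GSp.num, GSp.den, GSp.blkA, GSp.blkB, GSp.blkC, GSp.blkD, hg, toBlocks_fromBlocks₁₁,
    toBlocks_fromBlocks₁₂, toBlocks_fromBlocks₂₁, toBlocks_fromBlocks₂₂]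
  constructor <;> ext i j <;> fin_cases i <;> fin_cases j <;>
    simp [Matrix.mul_apply, Fin.sum_univ_two, Z.mat_one_zero]

theorem nU_smul_mat (x y z : ℝ) (Z : H2) : (nU x y z • Z).mat =
    !![Z.mat 0 0 + x, Z.mat 0 1 + y; Z.mat 0 1 + y, Z.mat 1 1 + z] := by
  obtain ⟨h1, h2⟩ := num_den_of_mat_eq (mat_nU x y z) Z
  refine smul_mat_of_num_eq ?_
  rw [h1, h2]
  simp

theorem mU_smul_mat (a b c d : ℝ) (h : a * d - b * c = 1) (Z : H2) : (mU a b c d h • Z).mat =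
    !![(a : ℂ), b; c, d] * Z.mat * !![(a : ℂ), c; b, d] := by
  obtain ⟨h1, h2⟩ := num_den_of_mat_eq (mat_mU a b c d h) Z
  have h' : (a : ℂ) * d - b * c = 1 := by exact_mod_cast h
  refine smul_mat_of_num_eq ?_
  have h3 : !![(a : ℂ), c; b, d] * !![(d : ℂ), -c; -b, a] = 1 := by
    rw [Matrix.mul_fin_two, Matrix.one_fin_two]
    ext i j
    fin_cases i <;> fin_cases j <;> simp <;> first | ring1 | linear_combination h'
  have h4 : (mU a b c d h).den Z.mat = !![(d : ℂ), -c; -b, a] := by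
    rw [h2]
    simp
  rw [h1, h4, Matrix.mul_assoc, h3, Matrix.mul_one, Z.mat_eq]
  simp

theorem detIm_smul_of_det_den {g : GSp} {Z : H2} (hg : g.simil = 1)
    (hd : (g.den Z.mat).det = 1) : detIm (coords (g • Z)) = detIm (coords Z) := by
  have h := detIm_smul g Z
  simpa [hg, hd] using h

theorem det_den_nU (x y z : ℝ) (Z : H2) : ((nU x y z).den Z.mat).det = 1 := by
  rw [(num_den_of_mat_eq (mat_nU x y z) Z).2, Matrix.det_fin_two]
  simp

theorem det_den_mU (a b c d : ℝ) (h : a * d - b * c = 1) (Z : H2) :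
    ((mU a b c d h).den Z.mat).det = 1 := by
  have h' : (a : ℂ) * d - b * c = 1 := by exact_mod_cast h
  rw [(num_den_of_mat_eq (mat_mU a b c d h) Z).2, Matrix.det_fin_two]
  simp
  linear_combination h'

/-- A Levi element reduces the imaginary part and an integral translation then rounds the real part;
both have det(CZ + D) = 1, so det(Y) is kept. -/
theorem exists_reduced (Z : H2) : ∃ γ ∈ Gamma0 1, detIm (coords (γ • Z)) = detIm (coords Z) ∧
    (|(coords (γ • Z)).1.re| ≤ 1 / 2 ∧ |(coords (γ • Z)).2.1.re| ≤ 1 / 2 ∧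
      |(coords (γ • Z)).2.2.re| ≤ 1 / 2) ∧
    2 * |(coords (γ • Z)).2.1.im| ≤ (coords (γ • Z)).1.im ∧
    (coords (γ • Z)).1.im ≤ 2 * (coords (γ • Z)).2.2.im := by
  obtain ⟨p, q, r, s, hdet, hB, hQ⟩ := exists_reduced_form Z.im_zero_zero_pos (detIm_pos Z)
  have hdet' : (p : ℝ) * s - q * r = 1 := by exact_mod_cast hdet
  set W := mU p q r s hdet' • Z with hW
  set T := nU ((-round (W.mat 0 0).re : ℤ) : ℝ) ((-round (W.mat 0 1).re : ℤ) : ℝ)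
    ((-round (W.mat 1 1).re : ℤ) : ℝ) with hT
  have hTW := nU_smul_mat ((-round (W.mat 0 0).re : ℤ) : ℝ) ((-round (W.mat 0 1).re : ℤ) : ℝ)
    ((-round (W.mat 1 1).re : ℤ) : ℝ) W
  rw [← hT] at hTW
  have hWm : W.mat = _ := mU_smul_mat p q r s hdet' Z
  have him : (W.mat 0 0).im = (coords Z).1.im * p ^ 2 + 2 * (coords Z).2.1.im * p * q +
        (coords Z).2.2.im * q ^ 2 ∧
      (W.mat 0 1).im = (coords Z).1.im * p * r + (coords Z).2.1.im * (p * s + q * r) +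
        (coords Z).2.2.im * q * s ∧
      (W.mat 1 1).im = (coords Z).1.im * r ^ 2 + 2 * (coords Z).2.1.im * r * s +
        (coords Z).2.2.im * s ^ 2 := by
    rw [hWm, Z.mat_eq]
    refine ⟨?_, ?_, ?_⟩ <;> simp [coords] <;> ring
  have hc : coords (T • W) = (W.mat 0 0 + (-round (W.mat 0 0).re : ℤ),
      W.mat 0 1 + (-round (W.mat 0 1).re : ℤ), W.mat 1 1 + (-round (W.mat 1 1).re : ℤ)) := by
    rw [coords, hTW]
    simp
  refine ⟨T * mU p q r s hdet', mul_mem (nU_mem 1 _ _ _) (mU_mem 1 p q r s hdet'), ?_⟩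
  rw [mul_smul, ← hW]
  refine ⟨?_, ?_⟩
  · rw [hT, detIm_smul_of_det_den (simil_nU _ _ _) (det_den_nU _ _ _ _), hW,
      detIm_smul_of_det_den (simil_mU _ _ _ _ _) (det_den_mU _ _ _ _ _ _)]
  · rw [hc]
    refine ⟨⟨?_, ?_, ?_⟩, ?_, ?_⟩
    · simpa [sub_eq_add_neg] using abs_sub_round (W.mat 0 0).re
    · simpa [sub_eq_add_neg] using abs_sub_round (W.mat 0 1).re
    · simpa [sub_eq_add_neg] using abs_sub_round (W.mat 1 1).re
    · simpa [him, coords] using hB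
    · simpa [him, coords] using hQ

end

/-! ### Every orbit meets the Siegel set -/

section

/-- Passing to adjugates inverts the relation W* Im(gZ) W = r Im(Z), where W = CZ + D, and expresses
Im(gZ) through the rows of W without dividing. -/
theorem adjugate_im_smul (g : GSp) (Z : H2) :
    ((‖(g.den Z.mat).det‖ ^ 2 : ℝ) : ℂ) • ((g • Z).im.map Complex.ofRealHom).adjugate =
      (g.simil : ℂ) • (g.den Z.mat * (Z.im.map Complex.ofRealHom).adjugate * (g.den Z.mat)ᴴ) := by
  set W := g.den Z.mat with hW
  have h := congrArg Matrix.adjugate (im_smul_form g Z)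
  rw [← hW, adjugate_mul_distrib, adjugate_mul_distrib, adjugate_smul, Fintype.card_fin,
    pow_one] at h
  have h1 : W * (W.adjugate * (((g • Z).im.map Complex.ofRealHom).adjugate * Wᴴ.adjugate)) * Wᴴ =
      (W.det * Wᴴ.det) • ((g • Z).im.map Complex.ofRealHom).adjugate := by
    calc _ = (W * W.adjugate) * ((g • Z).im.map Complex.ofRealHom).adjugate *
        (Wᴴ.adjugate * Wᴴ) := by simp only [Matrix.mul_assoc]
      _ = _ := by
        rw [mul_adjugate, adjugate_mul, Matrix.smul_mul, Matrix.one_mul, Matrix.mul_smul,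
          Matrix.mul_one, smul_smul, mul_comm]
  have h2 : W.det * Wᴴ.det = ((‖W.det‖ ^ 2 : ℝ) : ℂ) := by
    rw [det_conjTranspose, ← Complex.normSq_eq_norm_sq]
    exact Complex.mul_conj _
  rw [← h2, ← h1, h, Matrix.mul_smul, Matrix.smul_mul]

theorem det_form_identity (a b c x y : ℝ) :
    c * (a * x + b * y) ^ 2 - 2 * b * (a * x + b * y) * (b * x + c * y) + a * (b * x + c * y) ^ 2 =
      (a * c - b ^ 2) * (a * x ^ 2 + 2 * b * x * y + c * y ^ 2) := by ring

theorem norm_det_den_mul_im (g : GSp) (Z : H2) (i : Fin 2) :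
    ‖(g.den Z.mat).det‖ ^ 2 * ((g • Z).mat (1 - i) (1 - i)).im = g.simil *
      ((Z.mat 1 1).im * (g.den Z.mat i 0).re ^ 2 -
          2 * (Z.mat 0 1).im * (g.den Z.mat i 0).re * (g.den Z.mat i 1).re +
          (Z.mat 0 0).im * (g.den Z.mat i 1).re ^ 2 +
        ((Z.mat 1 1).im * (g.den Z.mat i 0).im ^ 2 -
          2 * (Z.mat 0 1).im * (g.den Z.mat i 0).im * (g.den Z.mat i 1).im +
          (Z.mat 0 0).im * (g.den Z.mat i 1).im ^ 2)) := by
  have h := congrArg Complex.re (congrFun (congrFun (adjugate_im_smul g Z) i) i)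
  have h1 : ((g • Z).im.map Complex.ofRealHom).adjugate i i =
      (((g • Z).mat (1 - i) (1 - i)).im : ℂ) := by
    fin_cases i <;> simp [adjugate_fin_two, H2.im]
  rw [Matrix.smul_apply, Matrix.smul_apply, h1, smul_eq_mul, smul_eq_mul, Complex.re_ofReal_mul,
    Complex.re_ofReal_mul, Complex.ofReal_re] at h
  rw [h]
  congr 1
  simp [Matrix.mul_apply, Fin.sum_univ_two, adjugate_fin_two, H2.im, Z.mat_one_zero,
    conjTranspose_apply]
  ring

theorem row_ne_zero (g : GSp) (i : Fin 2) : ∃ j, g.mat (Sum.inr i) j ≠ 0 := by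
  by_contra! h
  have h1 := congrFun (congrFun g.mul_J_mul (Sum.inr i)) (Sum.inl i)
  rw [Matrix.mul_assoc, Matrix.mul_apply] at h1
  have h2 := g.simil_pos.ne'
  simp [h, Matrix.J] at h1
  exact h2 h1.symm

/-- Multiplied by |det(CZ + D)|², the right side becomes a positive definite form in a nonzero
integral row (c, d) of γ, hence is bounded below, while the determinant on the left becomes the
fixed number det(Im Z). -/
theorem exists_mul_detIm_le (Z : H2) : ∃ ε : ℝ, 0 < ε ∧ ∀ γ ∈ Gamma0 1, ∀ i : Fin 2,
    ε * detIm (coords (γ • Z)) ≤ ((γ • Z).mat i i).im := by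
  have ha := Z.im_zero_zero_pos
  have hc := Z.im_one_one_pos
  have hd := detIm_pos Z
  have hdZ : detIm (coords Z) = (Z.mat 0 0).im * (Z.mat 1 1).im - (Z.mat 0 1).im ^ 2 := rfl
  set a := (Z.mat 0 0).im with ha'
  set b := (Z.mat 0 1).im with hb'
  set c := (Z.mat 1 1).im with hc'
  set d := detIm (coords Z) with hd'
  refine ⟨min d 1 / (a + c), by positivity, fun γ hγ i => ?_⟩
  have hs := simil_of_mem_Gamma0 hγ
  have h1 := detIm_smul γ Z
  have h2 := norm_det_den_mul_im γ Z (1 - i)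
  rw [sub_sub_cancel, hs, one_mul] at h2
  rw [hs, one_pow, one_mul] at h1
  have hn : 0 < ‖(γ.den Z.mat).det‖ ^ 2 := by
    have := norm_pos_iff.mpr (γ.den_det_ne_zero Z)
    positivity
  obtain ⟨A, B, C, D, hm, -, -⟩ := mem_Gamma0_iff.mp hγ
  set l := 1 - i
  have hden : ∀ j, γ.den Z.mat l j = C l 0 * Z.mat 0 j + C l 1 * Z.mat 1 j + D l j := by
    intro j
    simp [GSp.den, GSp.blkC, GSp.blkD, hm, Matrix.mul_apply, Fin.sum_univ_two]
  have him0 : (γ.den Z.mat l 0).im = a * C l 0 + b * C l 1 := by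
    rw [hden, Z.mat_one_zero]
    simp [ha', hb']
    ring
  have him1 : (γ.den Z.mat l 1).im = b * C l 0 + c * C l 1 := by
    rw [hden]
    simp [hc', hb']
    ring
  rw [← ha', ← hb', ← hc', him0, him1, det_form_identity, ← hdZ] at h2
  set u := (γ.den Z.mat l 0).re with hu
  set v := (γ.den Z.mat l 1).re with hv
  have key : min d 1 * d ≤ (a + c) * (c * u ^ 2 - 2 * b * u * v + a * v ^ 2 +
      d * (a * C l 0 ^ 2 + 2 * b * C l 0 * C l 1 + c * C l 1 ^ 2)) := by
    have e1 := trace_mul_form a b c (C l 0) (C l 1)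
    have e2 := trace_mul_form c (-b) a u v
    have e3 : (a + c) * (c * u ^ 2 - 2 * b * u * v + a * v ^ 2 +
        d * (a * C l 0 ^ 2 + 2 * b * C l 0 * C l 1 + c * C l 1 ^ 2)) =
        (d * (u ^ 2 + v ^ 2) + ((c * u + -b * v) ^ 2 + (-b * u + a * v) ^ 2)) +
        d * (d * ((C l 0 : ℝ) ^ 2 + (C l 1 : ℝ) ^ 2) +
          ((a * C l 0 + b * C l 1) ^ 2 + (b * C l 0 + c * C l 1) ^ 2)) := by
      rw [mul_add, mul_left_comm (a + c) d, e1, hdZ]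
      linear_combination e2
    rw [e3]
    -- If the c-part vanishes, u and v are the integers of the d-part, not both zero, and the real
    -- part of the form gives d; otherwise the imaginary part gives d². This explains the minimum in
    -- ε.
    by_cases hC : C l 0 = 0 ∧ C l 1 = 0
    · have hu' : u = D l 0 := by rw [hu, hden, hC.1, hC.2]; simp
      have hv' : v = D l 1 := by rw [hv, hden, hC.1, hC.2]; simp
      have hD : ¬(D l 0 = 0 ∧ D l 1 = 0) := by
        rintro ⟨h3, h4⟩
        obtain ⟨j, hj⟩ := row_ne_zero γ l
        apply hj
        rw [hm]
        have hl : ∀ E : Matrix (Fin 2) (Fin 2) ℤ, E l 0 = 0 ∧ E l 1 = 0 → ∀ j, E l j = 0 := by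
          rintro E ⟨h5, h6⟩ j
          fin_cases j <;> assumption
        rcases j with j | j
        · simp [hl C hC j]
        · simp [hl D ⟨h3, h4⟩ j]
      have h5 := one_le_sq_add_sq hD
      rw [← hu', ← hv'] at h5
      have h6 : min d 1 * d ≤ 1 * d := by gcongr; exact min_le_right _ _
      have h7 : d * 1 ≤ d * (u ^ 2 + v ^ 2) := by gcongr
      have h8 : 0 ≤ d * (d * ((C l 0 : ℝ) ^ 2 + (C l 1 : ℝ) ^ 2) +
          ((a * C l 0 + b * C l 1) ^ 2 + (b * C l 0 + c * C l 1) ^ 2)) := by positivity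
      nlinarith [sq_nonneg (c * u + -b * v), sq_nonneg (-b * u + a * v)]
    · have h5 := one_le_sq_add_sq hC
      have h6 : min d 1 * d ≤ d * d := by gcongr; exact min_le_left _ _
      have h7 : d * (d * 1 + 0) ≤ d * (d * ((C l 0 : ℝ) ^ 2 + (C l 1 : ℝ) ^ 2) +
          ((a * C l 0 + b * C l 1) ^ 2 + (b * C l 0 + c * C l 1) ^ 2)) := by
        gcongr
        positivity
      have h8 : 0 ≤ d * (u ^ 2 + v ^ 2) + ((c * u + -b * v) ^ 2 + (-b * u + a * v) ^ 2) := by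
        positivity
      linarith
  rw [← h2] at key
  rw [div_mul_eq_mul_div, div_le_iff₀ (by positivity)]
  refine le_of_mul_le_mul_right ?_ hn
  calc min d 1 * detIm (coords (γ • Z)) * ‖(γ.den Z.mat).det‖ ^ 2 = min d 1 * d := by
        rw [mul_assoc, h1]
    _ ≤ _ := key
    _ = _ := by ring

/-- A Siegel set for `Sp_2(ℤ)`. -/
def siegelSet : Set H2 := {Z | (|(coords Z).1.re| ≤ 1 / 2 ∧ |(coords Z).2.1.re| ≤ 1 / 2 ∧
  |(coords Z).2.2.re| ≤ 1 / 2) ∧ 1 / 2 ≤ (coords Z).1.im ∧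
  2 * |(coords Z).2.1.im| ≤ (coords Z).1.im ∧ (coords Z).1.im ≤ 2 * (coords Z).2.2.im}

theorem half_mul_le_detIm {w : ℂ × ℂ × ℂ} (h1 : 2 * |w.2.1.im| ≤ w.1.im)
    (h2 : w.1.im ≤ 2 * w.2.2.im) : w.1.im * w.2.2.im ≤ 2 * detIm w := by
  have h3 : (2 * |w.2.1.im|) ^ 2 ≤ w.1.im * (2 * w.2.2.im) := by
    have h0 : 0 ≤ 2 * |w.2.1.im| := by positivity
    nlinarith
  rw [mul_pow, sq_abs] at h3
  unfold detIm
  linarith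

/-- Among the translates of Z one is chosen whose det(Y) is at least half the supremum, and it is
then reduced. The partial inversion τ ↦ -1/τ cannot more than double det(Y), which forces |τ|² ≥ 1/2
and, as |Re τ| ≤ 1/2, also Im τ ≥ 1/2. -/
theorem exists_smul_mem_siegelSet (Z : H2) : ∃ γ ∈ Gamma0 1, γ • Z ∈ siegelSet := by
  obtain ⟨ε, hε, hbound⟩ := exists_mul_detIm_le Z
  -- After reduction both diagonal entries of Y are at least ε det(Y), while their product is at
  -- most 2 det(Y); hence det(Y) ≤ 2/ε².
  have hsup : ∀ γ ∈ Gamma0 1, ε ^ 2 / 2 ≤ (detIm (coords (γ • Z)))⁻¹ := by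
    intro γ hγ
    obtain ⟨δ, hδ, hdet, -, h1, h2⟩ := exists_reduced (γ • Z)
    have h3 := half_mul_le_detIm h1 h2
    have h4 := hbound (δ * γ) (mul_mem hδ hγ) 0
    have h5 := hbound (δ * γ) (mul_mem hδ hγ) 1
    rw [mul_smul, hdet] at h4 h5
    have h0 := detIm_pos (γ • Z)
    rw [hdet] at h3
    have h6 : (ε * detIm (coords (γ • Z))) * (ε * detIm (coords (γ • Z))) ≤
        2 * detIm (coords (γ • Z)) := (mul_le_mul h4 h5 (by positivity)
          ((by positivity : (0 : ℝ) ≤ _).trans h4)).trans h3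
    rw [le_inv_comm₀ (by positivity) h0, inv_div, le_div_iff₀ (by positivity)]
    have h7 : (detIm (coords (γ • Z)) * ε ^ 2) * detIm (coords (γ • Z)) ≤
        2 * detIm (coords (γ • Z)) := by linarith [h6]
    exact le_of_mul_le_mul_right h7 h0
  obtain ⟨γ, hγ, hmax⟩ := exists_le_two_mul (S := (Gamma0 1 : Set GSp)) ⟨1, one_mem _⟩
    (f := fun γ => (detIm (coords (γ • Z)))⁻¹) (by positivity) hsup
  obtain ⟨δ, hδ, hdet, hre, h1, h2⟩ := exists_reduced (γ • Z)
  refine ⟨δ * γ, mul_mem hδ hγ, ?_⟩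
  rw [mul_smul]
  refine ⟨hre, ?_, h1, h2⟩
  set W := δ • γ • Z with hW
  have hprop : (0 : ℝ) * 0 - (-1) * 1 = 1 := by norm_num
  have hprop' : (1 : ℝ) * 1 - 0 * 0 = 1 := by norm_num
  -- For this element det(CZ + D) is the entry τ of Z.
  set J := pr 0 (-1) 1 0 1 0 0 1 1 one_pos hprop hprop' with hJ
  have hJmem : J ∈ Gamma0 1 :=
    mem_of_mat_eq (simil_pr _ _ _ _ _ _ _ _ _ _ _ _) 0 0 0 1 (-1) 0 0 0 1 0 0 0 0 0 0 1
      (by rw [hJ, mat_pr]; simp) (by simp)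
  have h3 := hmax (J * (δ * γ)) (mul_mem hJmem (mul_mem hδ hγ))
  simp only [mul_smul, ← hW] at h3
  have h4 := detIm_smul J W
  have h5 : (J.den W.mat).det = W.mat 0 0 := by
    rw [(num_den_of_mat_eq (mat_pr 0 (-1) 1 0 1 0 0 1 1 one_pos hprop hprop') W).2,
      Matrix.det_fin_two]
    simp
  rw [h5, simil_of_mem_Gamma0 hJmem, one_pow, one_mul] at h4
  have h6 := detIm_pos (J • W)
  have h7 := detIm_pos (γ • Z)
  rw [hdet] at h4
  have h8 : detIm (coords (J • W)) ≤ 2 * detIm (coords (γ • Z)) := by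
    rw [inv_le_iff_one_le_mul₀ h7] at h3
    have h9 : 2 * (detIm (coords (J • W)))⁻¹ * detIm (coords (γ • Z)) * detIm (coords (J • W)) =
        2 * detIm (coords (γ • Z)) := by
      field_simp
    nlinarith
  have h9 : 1 / 2 ≤ ‖W.mat 0 0‖ ^ 2 := by
    rw [← h4] at h8
    have h10 : detIm (coords (J • W)) * 1 ≤ detIm (coords (J • W)) * (2 * ‖W.mat 0 0‖ ^ 2) := by
      linarith
    linarith [le_of_mul_le_mul_left h10 h6]
  rw [← Complex.normSq_eq_norm_sq, Complex.normSq_apply] at h9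
  have h10 := hre.1
  have h11 := abs_le.mp h10
  have h12 := W.im_zero_zero_pos
  change 1 / 2 ≤ (W.mat 0 0).im
  change -(1 / 2) ≤ (W.mat 0 0).re ∧ (W.mat 0 0).re ≤ 1 / 2 at h11
  by_contra! hlt
  nlinarith

end

section

/-! ### Growth of cusp forms -/

theorem IsHolomorphic.measurable {F : H2 → ℂ} (hF : IsHolomorphic F) : Measurable F := by
  obtain ⟨f, hf, hfF⟩ := hF
  have h := measurable_comp_coords hf.continuousOn
  rwa [show f ∘ coords = F from funext hfF] at h

theorem measurable_det_den (g : GSp) : Measurable fun Z : H2 => (g.den Z.mat).det := by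
  have h := measurable_comp_coords (f := fun w => (g.den (ofCoords w)).det)
    (continuous_den_ofCoords g).matrix_det.continuousOn
  have h1 : (fun w => (g.den (ofCoords w)).det) ∘ coords = fun Z => (g.den Z.mat).det :=
    funext fun Z => by simp only [Function.comp, ofCoords_coords]
  rwa [h1] at h

theorem measurable_slash {k : ℤ} (g : GSp) {F : H2 → ℂ} (hF : Measurable F) :
    Measurable (slash k g F) := by
  unfold slash
  exact ((measurable_det_den g).pow_const (-k) |>.const_mul _).mul (hF.comp (measurable_smul g))

/-- The integrand of the Petersson product. -/
def pet (k : ℤ) (A B : H2 → ℂ) : H2 → ℂ := fun Z =>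
  A Z * (starRingEnd ℂ) (B Z) * ((Z.im.det : ℝ) : ℂ) ^ k

/-- The factors r^k det(CZ + D)^(-k) of the two functions combine into the factor by which det(Y)^k
changes under g. -/
theorem pet_slash (k : ℤ) (g : GSp) (A B : H2 → ℂ) (Z : H2) :
    pet k (slash k g A) (slash k g B) Z = pet k A B (g • Z) := by
  have h := detIm_smul g Z
  have hd := g.den_det_ne_zero Z
  have hr := g.simil_pos.ne'
  have h1 : ((detIm (coords (g • Z)) : ℝ) : ℂ) ^ k * ((g.den Z.mat).det ^ k *
      (starRingEnd ℂ) (g.den Z.mat).det ^ k) =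
      ((g.simil : ℂ) ^ k * (g.simil : ℂ) ^ k) * ((detIm (coords Z) : ℝ) : ℂ) ^ k := by
    rw [← mul_zpow, ← mul_zpow, ← mul_zpow, ← mul_zpow, Complex.mul_conj,
      Complex.normSq_eq_norm_sq, ← Complex.ofReal_mul, h]
    push_cast
    ring_nf
  have hd' : (starRingEnd ℂ) (g.den Z.mat).det ≠ 0 := (map_ne_zero _).mpr hd
  simp only [pet, slash, im_det, map_mul, map_zpow₀, Complex.conj_ofReal]
  have h2 : (g.den Z.mat).det ^ k ≠ 0 := zpow_ne_zero _ hd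
  have h3 : (starRingEnd ℂ) (g.den Z.mat).det ^ k ≠ 0 := zpow_ne_zero _ hd'
  rw [_root_.zpow_neg, _root_.zpow_neg]
  field_simp
  linear_combination (-(A (g • Z) * (starRingEnd ℂ) (B (g • Z)))) * h1

theorem measurable_pet {k : ℤ} {A B : H2 → ℂ} (hA : Measurable A) (hB : Measurable B) :
    Measurable (pet k A B) := by
  have h : Measurable fun Z : H2 => Z.im.det := by
    simp only [im_det]
    exact continuous_detIm.measurable.comp (comap_measurable coords)
  unfold pet
  have hB' : Measurable fun Z => (starRingEnd ℂ) (B Z) :=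
    Complex.continuous_conj.measurable.comp hB
  exact (hA.mul hB').mul ((Complex.measurable_ofReal.comp h).pow_const k)

theorem norm_pet_self (k : ℤ) (A : H2 → ℂ) (Z : H2) :
    ‖pet k A A Z‖ = ‖A Z‖ ^ 2 * detIm (coords Z) ^ k := by
  rw [pet, im_det, norm_mul, norm_mul, norm_zpow, Complex.norm_real,
    Real.norm_of_nonneg (detIm_pos Z).le, RCLike.norm_conj]
  ring

theorem norm_pet_le (k : ℤ) (A B : H2 → ℂ) (Z : H2) :
    ‖pet k A B Z‖ ≤ ‖pet k A A Z‖ + ‖pet k B B Z‖ := by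
  have h : ‖pet k A B Z‖ = ‖A Z‖ * ‖B Z‖ * detIm (coords Z) ^ k := by
    rw [pet, im_det, norm_mul, norm_mul, norm_zpow, Complex.norm_real,
      Real.norm_of_nonneg (detIm_pos Z).le, RCLike.norm_conj]
  have hd : 0 < detIm (coords Z) ^ k := zpow_pos (detIm_pos Z) k
  rw [h, norm_pet_self, norm_pet_self, ← add_mul]
  gcongr
  nlinarith [sq_nonneg (‖A Z‖ - ‖B Z‖), sq_nonneg (‖A Z‖), sq_nonneg ‖B Z‖]

/-- The functions `A` for which `‖A‖² det(Y)^k` is bounded. -/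
def IsPetBounded (k : ℤ) (A : H2 → ℂ) : Prop := ∃ C : ℝ, ∀ Z, ‖pet k A A Z‖ ≤ C

theorem IsPetBounded.slash {k : ℤ} {A : H2 → ℂ} (h : IsPetBounded k A) (g : GSp) :
    IsPetBounded k (slash k g A) := by
  obtain ⟨C, hC⟩ := h
  exact ⟨C, fun Z => by rw [pet_slash]; exact hC _⟩

theorem IsPetBounded.add {k : ℤ} {A B : H2 → ℂ} (hA : IsPetBounded k A) (hB : IsPetBounded k B) :
    IsPetBounded k (A + B) := by
  obtain ⟨C, hC⟩ := hA
  obtain ⟨C', hC'⟩ := hB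
  refine ⟨2 * C + 2 * C', fun Z => ?_⟩
  have h1 := hC Z
  have h2 := hC' Z
  rw [norm_pet_self] at h1 h2 ⊢
  have hd : 0 < detIm (coords Z) ^ k := zpow_pos (detIm_pos Z) k
  have h3 : ‖(A + B) Z‖ ^ 2 ≤ 2 * ‖A Z‖ ^ 2 + 2 * ‖B Z‖ ^ 2 := by
    have := norm_add_le (A Z) (B Z)
    rw [Pi.add_apply]
    nlinarith [sq_nonneg (‖A Z‖ - ‖B Z‖), norm_nonneg (A Z + B Z)]
  calc ‖(A + B) Z‖ ^ 2 * detIm (coords Z) ^ k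
      ≤ (2 * ‖A Z‖ ^ 2 + 2 * ‖B Z‖ ^ 2) * detIm (coords Z) ^ k := by gcongr
    _ ≤ _ := by linarith

theorem IsPetBounded.smul {k : ℤ} {A : H2 → ℂ} (hA : IsPetBounded k A) (c : ℂ) :
    IsPetBounded k (c • A) := by
  obtain ⟨C, hC⟩ := hA
  refine ⟨‖c‖ ^ 2 * C, fun Z => ?_⟩
  have h1 := hC Z
  rw [norm_pet_self] at h1 ⊢
  rw [Pi.smul_apply, norm_smul, mul_pow, mul_assoc]
  gcongr

/-- On the Siegel set the mixed term is dominated by the diagonal ones. Half of what remains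
supplies decay in Z, and the other half a term in n + m that makes the Fourier series summable. -/
theorem form_lower_bound {n r m : ℤ} (hn : 0 < n) (hdisc : 0 < 4 * n * m - r ^ 2)
    {w : ℂ × ℂ × ℂ} (h0 : 1 / 2 ≤ w.1.im) (h1 : 2 * |w.2.1.im| ≤ w.1.im)
    (h2 : w.1.im ≤ 2 * w.2.2.im) :
    (w.1.im + w.2.2.im) / 8 + ((n : ℝ) + m) / 32 ≤ n * w.1.im + r * w.2.1.im + m * w.2.2.im := by
  have hm : 0 < m := by
    by_contra hm
    nlinarith [sq_nonneg r]
  have hn' : (1 : ℝ) ≤ n := by exact_mod_cast hn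
  have hm' : (1 : ℝ) ≤ m := by exact_mod_cast hm
  have hd : (r : ℝ) ^ 2 ≤ 4 * n * m := by exact_mod_cast (by linarith : r ^ 2 ≤ 4 * n * m)
  set y1 := w.1.im
  set y := w.2.1.im
  set y2 := w.2.2.im
  have hy2 : 1 / 4 ≤ y2 := by linarith
  have hy : y ^ 2 ≤ y1 * y2 / 2 := by
    have h3 : (2 * |y|) ^ 2 ≤ y1 * (2 * y2) := by
      have h4 : 0 ≤ 2 * |y| := by positivity
      nlinarith
    rw [mul_pow, sq_abs] at h3
    linarith
  -- From r² < 4nm and y² ≤ y₁y₂/2 one has (ry)² ≤ 2(ny₁)(my₂) ≤ (ny₁ + my₂)²/2, and 1/2 ≤ 9/16.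
  have hry : |r * y| ≤ 3 / 4 * (n * y1 + m * y2) := by
    refine abs_le_of_sq_le_sq ?_ (by positivity)
    have h3 : (r * y) ^ 2 ≤ 4 * n * m * (y1 * y2 / 2) := by
      rw [mul_pow]
      gcongr
    have h4 : 0 ≤ n * y1 * (m * y2) := by positivity
    nlinarith [sq_nonneg (n * y1 - m * y2)]
  have h3 := neg_le_of_abs_le hry
  have h4 : y1 ≤ n * y1 := by nlinarith
  have h5 : y2 ≤ m * y2 := by nlinarith
  have h6 : n / 2 ≤ n * y1 := by nlinarith
  have h7 : m / 4 ≤ m * y2 := by nlinarith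
  linarith

theorem exists_H2_of_im {t : ℝ} (ht : 0 < t) : ∃ Z : H2, Z.mat 0 0 = t * Complex.I ∧
    Z.mat 0 1 = 0 ∧ Z.mat 1 1 = t * Complex.I := by
  have h : ((t * Complex.I : ℂ), ((0 : ℂ), (t * Complex.I : ℂ))) ∈ Set.range coords := by
    rw [range_coords]
    constructor
    · simpa using ht
    · simp [detIm, ht.ne']
  obtain ⟨Z, hZ⟩ := h
  simp only [coords, Prod.mk.injEq] at hZ
  exact ⟨Z, hZ.1, hZ.2.1, hZ.2.2⟩

theorem norm_exp_term (N : ℕ) (T : ℤ × ℤ × ℤ) (Z : H2) :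
    ‖Complex.exp (2 * Real.pi * Complex.I *
      (T.1 * Z.mat 0 0 + T.2.1 * Z.mat 0 1 + T.2.2 * Z.mat 1 1) / N)‖ =
    Real.exp (-(2 * Real.pi / N) * (T.1 * (Z.mat 0 0).im + T.2.1 * (Z.mat 0 1).im +
      T.2.2 * (Z.mat 1 1).im)) := by
  rw [Complex.norm_exp]
  congr 1
  rw [Complex.div_natCast_re]
  simp
  ring

/-- The Fourier series converges absolutely at Z₀ = (i/32)·1₂, and the summand (n + m)/32 of
`form_lower_bound` is exactly the exponent there. Every term at Z is thus bounded by its norm at Z₀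
times a common exponential factor. -/
theorem IsCuspForm.exists_norm_slash_le {N : ℕ} [NeZero N] {k : ℤ} {F : H2 → ℂ}
    (hF : IsCuspForm N k F) {γ : GSp} (hγ : γ ∈ Gamma0 1) :
    ∃ C : ℝ, ∀ Z ∈ siegelSet, ‖slash k γ F Z‖ ≤
      C * Real.exp (-(Real.pi / (4 * N)) * ((Z.mat 0 0).im + (Z.mat 1 1).im)) := by
  obtain ⟨a, ha, hsum⟩ := hF.cusp γ hγ
  obtain ⟨Z₀, h00, h01, h11⟩ := exists_H2_of_im (t := 1 / 32) (by norm_num)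
  have hN : (0 : ℝ) < N := by exact_mod_cast NeZero.pos N
  have hs0 := (hsum Z₀).summable.norm
  refine ⟨∑' T, ‖a T * Complex.exp (2 * Real.pi * Complex.I *
    (T.1 * Z₀.mat 0 0 + T.2.1 * Z₀.mat 0 1 + T.2.2 * Z₀.mat 1 1) / N)‖, fun Z hZ => ?_⟩
  rw [← (hsum Z).tsum_eq, ← tsum_mul_right]
  refine (norm_tsum_le_tsum_norm (hsum Z).summable.norm).trans
    ((hsum Z).summable.norm.tsum_le_tsum ?_ (hs0.mul_right _))
  rintro ⟨n, r, m⟩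
  by_cases h0 : a (n, r, m) = 0
  · simp [h0]
  obtain ⟨hn, hdisc⟩ := ha n r m h0
  have hb := form_lower_bound hn hdisc hZ.2.1 hZ.2.2.1 hZ.2.2.2
  rw [norm_mul, norm_mul, norm_exp_term, norm_exp_term, mul_assoc, ← Real.exp_add]
  gcongr
  simp only [h00, h01, h11, coords] at hb ⊢
  have hc : 0 < 2 * Real.pi / N := by positivity
  have h1 := mul_le_mul_of_nonneg_left hb hc.le
  have h2 : -(Real.pi / (4 * N)) = -(2 * Real.pi / N) / 8 := by
    field_simp
    norm_num
  rw [h2]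
  simp
  nlinarith

theorem exists_pow_mul_exp_le (n : ℕ) {c : ℝ} (hc : 0 < c) :
    ∃ C : ℝ, ∀ s : ℝ, 0 ≤ s → (1 + s) ^ n * Real.exp (-c * s) ≤ C := by
  refine ⟨n.factorial * Real.exp c / c ^ n, fun s hs => ?_⟩
  have h := Real.pow_div_factorial_le_exp (c * (1 + s)) (by positivity) n
  rw [div_le_iff₀ (by positivity), mul_pow] at h
  rw [le_div_iff₀ (by positivity)]
  calc (1 + s) ^ n * Real.exp (-c * s) * c ^ n = c ^ n * (1 + s) ^ n * Real.exp (-c * s) := by ring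
    _ ≤ Real.exp (c * (1 + s)) * n.factorial * Real.exp (-c * s) := by gcongr
    _ = n.factorial * (Real.exp (c * (1 + s)) * Real.exp (-c * s)) := by ring
    _ = _ := by
      rw [← Real.exp_add]
      ring_nf

/-- The weight may be negative, so the lower bound det(Y) ≥ 1/16 on the Siegel set is needed as well
as the polynomial upper bound. -/
theorem zpow_detIm_le {Z : H2} (hZ : Z ∈ siegelSet) (k : ℤ) : detIm (coords Z) ^ k ≤
    16 ^ k.natAbs * (1 + ((Z.mat 0 0).im + (Z.mat 1 1).im)) ^ (2 * k.natAbs) := by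
  obtain ⟨-, h0, h1, h2⟩ := hZ
  have hd := half_mul_le_detIm h1 h2
  have hpos := detIm_pos Z
  have h3 : detIm (coords Z) ≤ (Z.mat 0 0).im * (Z.mat 1 1).im := by
    change (Z.mat 0 0).im * (Z.mat 1 1).im - (Z.mat 0 1).im ^ 2 ≤ _
    nlinarith [sq_nonneg (Z.mat 0 1).im]
  change 1 / 2 ≤ (Z.mat 0 0).im at h0
  change (Z.mat 0 0).im ≤ 2 * (Z.mat 1 1).im at h2
  change (Z.mat 0 0).im * (Z.mat 1 1).im ≤ _ at hd
  set y1 := (Z.mat 0 0).im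
  set y2 := (Z.mat 1 1).im
  set d := detIm (coords Z)
  have h4 : 1 / 16 ≤ d := by nlinarith
  have h5 : d ≤ (1 + (y1 + y2)) ^ 2 := by nlinarith [sq_nonneg (y1 - y2)]
  have h6 : 1 ≤ 1 + (y1 + y2) := by linarith
  rcases Int.natAbs_eq k with hk | hk
  · conv_lhs => rw [hk]
    rw [zpow_natCast, pow_mul]
    calc d ^ k.natAbs ≤ ((1 + (y1 + y2)) ^ 2) ^ k.natAbs := by gcongr
      _ ≤ _ := le_mul_of_one_le_left (by positivity) (one_le_pow₀ (by norm_num))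
  · conv_lhs => rw [hk]
    rw [_root_.zpow_neg, zpow_natCast, ← inv_pow]
    calc d⁻¹ ^ k.natAbs ≤ 16 ^ k.natAbs := by
          gcongr
          rw [inv_le_comm₀ hpos (by norm_num)]
          linarith
      _ ≤ _ := le_mul_of_one_le_right (by positivity) (one_le_pow₀ h6)

/-- The quantity at Z equals that of F|γ⁻¹ at a point γZ of the Siegel set, and F|γ⁻¹ is one of
finitely many functions because Γ₀(N) has finite index. Exponential decay beats the power of det(Y).
-/
theorem IsCuspForm.isPetBounded {N : ℕ} [NeZero N] {k : ℤ} {F : H2 → ℂ}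
    (hF : IsCuspForm N k F) : IsPetBounded k F := by
  obtain ⟨a, ha⟩ := exists_isTransversal (Gamma0_relIndex_ne_zero (N := N) 1)
  have hN : (0 : ℝ) < N := by exact_mod_cast NeZero.pos N
  have hloc : ∀ i, ∃ C : ℝ, ∀ Z ∈ siegelSet,
      ‖pet k (SiegelTwo.slash k (a i) F) (SiegelTwo.slash k (a i) F) Z‖ ≤ C := by
    intro i
    obtain ⟨C, hC⟩ := hF.exists_norm_slash_le (ha.mem i)
    obtain ⟨C', hC'⟩ := exists_pow_mul_exp_le (2 * k.natAbs)
      (c := 2 * (Real.pi / (4 * N))) (by positivity)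
    refine ⟨C ^ 2 * 16 ^ k.natAbs * C', fun Z hZ => ?_⟩
    have h1 := hC Z hZ
    have h2 := zpow_detIm_le hZ k
    have hs : 0 ≤ (Z.mat 0 0).im + (Z.mat 1 1).im := by
      have := Z.im_zero_zero_pos
      have := Z.im_one_one_pos
      positivity
    have h3 := hC' _ hs
    rw [norm_pet_self]
    set s := (Z.mat 0 0).im + (Z.mat 1 1).im
    have hd := detIm_pos Z
    calc _ ≤ (C * Real.exp (-(Real.pi / (4 * N)) * s)) ^ 2 *
          (16 ^ k.natAbs * (1 + s) ^ (2 * k.natAbs)) := by gcongr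
      _ = C ^ 2 * 16 ^ k.natAbs * ((1 + s) ^ (2 * k.natAbs) *
          Real.exp (-(2 * (Real.pi / (4 * N))) * s)) := by
        rw [mul_pow, ← Real.exp_nat_mul]
        push_cast
        ring_nf
      _ ≤ _ := by gcongr
  choose C hC using hloc
  refine ⟨∑ i, |C i|, fun Z => ?_⟩
  obtain ⟨γ, hγ, hZ⟩ := exists_smul_mem_siegelSet Z
  obtain ⟨i, hi⟩ := ha.cover γ⁻¹ (inv_mem hγ)
  have h1 : SiegelTwo.slash k γ⁻¹ F = SiegelTwo.slash k (a i) F := by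
    rw [← slash_mul_left hF.slash_eq hi (a i), inv_mul_cancel_right]
  have h2 := hC i _ hZ
  rw [← h1, pet_slash, inv_smul_smul] at h2
  exact h2.trans ((le_abs_self _).trans
    (Finset.single_le_sum (f := fun i => |C i|) (fun _ _ => abs_nonneg _) (Finset.mem_univ i)))

end

section

/-! ### Finiteness of the volume -/

theorem measurableSet_siegelSet : MeasurableSet siegelSet := by
  have h : IsClosed {w : ℂ × ℂ × ℂ | (|w.1.re| ≤ 1 / 2 ∧ |w.2.1.re| ≤ 1 / 2 ∧
      |w.2.2.re| ≤ 1 / 2) ∧ 1 / 2 ≤ w.1.im ∧ 2 * |w.2.1.im| ≤ w.1.im ∧ w.1.im ≤ 2 * w.2.2.im} := by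
    have c1 : Continuous fun w : ℂ × ℂ × ℂ => w.1.re := Complex.continuous_re.comp continuous_fst
    have c2 : Continuous fun w : ℂ × ℂ × ℂ => w.2.1.re :=
      Complex.continuous_re.comp (continuous_fst.comp continuous_snd)
    have c3 : Continuous fun w : ℂ × ℂ × ℂ => w.2.2.re :=
      Complex.continuous_re.comp (continuous_snd.comp continuous_snd)
    have d1 : Continuous fun w : ℂ × ℂ × ℂ => w.1.im := Complex.continuous_im.comp continuous_fst
    have d2 : Continuous fun w : ℂ × ℂ × ℂ => w.2.1.im :=
      Complex.continuous_im.comp (continuous_fst.comp continuous_snd)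
    have d3 : Continuous fun w : ℂ × ℂ × ℂ => w.2.2.im :=
      Complex.continuous_im.comp (continuous_snd.comp continuous_snd)
    exact ((isClosed_le c1.abs continuous_const).inter ((isClosed_le c2.abs continuous_const).inter
      (isClosed_le c3.abs continuous_const))).inter ((isClosed_le continuous_const d1).inter
      ((isClosed_le (continuous_const.mul d2.abs) d1).inter
        (isClosed_le d1 (continuous_const.mul d3))))
  exact comap_measurable coords h.measurableSet

/-- An integrable comparison function on `ℂ`. -/
def cauchyDensity (z : ℂ) : ℝ := (1 + z.re ^ 2)⁻¹ * (1 + z.im ^ 2)⁻¹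

theorem integrable_cauchyDensity : Integrable cauchyDensity := by
  have h := (integrable_inv_one_add_sq.mul_prod integrable_inv_one_add_sq :
    Integrable (fun z : ℝ × ℝ => (1 + z.1 ^ 2)⁻¹ * (1 + z.2 ^ 2)⁻¹) (volume.prod volume))
  exact Complex.volume_preserving_equiv_real_prod.integrable_comp_of_integrable h

/-- On the Siegel set |y| ≤ y₁/2 and y₁ ≤ 2y₂, so (1 + y₁²)(1 + y²)(1 + y₂²) is at most a constant
times y₁⁴y₂², hence times (y₁y₂)³ and so times det(Y)³. This bounds the density by an integrable
product. -/
theorem zpow_neg_three_detIm_le {Z : H2} (hZ : Z ∈ siegelSet) : detIm (coords Z) ^ (-3 : ℤ) ≤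
    20000 * (cauchyDensity (coords Z).1 *
      (cauchyDensity (coords Z).2.1 * cauchyDensity (coords Z).2.2)) := by
  obtain ⟨⟨hx1, hx2, hx3⟩, h0, h1, h2⟩ := hZ
  have hd := half_mul_le_detIm h1 h2
  have hpos := detIm_pos Z
  generalize coords Z = w at hx1 hx2 hx3 h0 h1 h2 hd hpos ⊢
  obtain ⟨⟨x1, y1⟩, ⟨x, y⟩, ⟨x2, y2⟩⟩ := w
  simp only at *
  have hx : ∀ t : ℝ, |t| ≤ 1 / 2 → 1 + t ^ 2 ≤ 5 / 4 := by
    intro t ht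
    have := sq_le_sq' (neg_le_of_abs_le ht) (le_of_abs_le ht)
    linarith
  have hx1' := hx x1 hx1
  have hx2' := hx x hx2
  have hx3' := hx x2 hx3
  have hy1 : 1 + y1 ^ 2 ≤ 5 * y1 ^ 2 := by nlinarith
  have hy : 1 + y ^ 2 ≤ 17 / 4 * y1 ^ 2 := by
    have h3 := pow_le_pow_left₀ (by positivity) h1 2
    rw [mul_pow, sq_abs] at h3
    nlinarith
  have hy2 : 1 + y2 ^ 2 ≤ 17 * y2 ^ 2 := by nlinarith
  have hy1pos : 0 < y1 := by linarith
  have hy2pos : 0 < y2 := by linarith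
  have hprod : (1 + x1 ^ 2) * (1 + y1 ^ 2) * ((1 + x ^ 2) * (1 + y ^ 2) *
      ((1 + x2 ^ 2) * (1 + y2 ^ 2))) ≤ 20000 * detIm (⟨x1, y1⟩, ⟨x, y⟩, ⟨x2, y2⟩) ^ 3 := by
    calc _ ≤ 5 / 4 * (5 * y1 ^ 2) * (5 / 4 * (17 / 4 * y1 ^ 2) * (5 / 4 * (17 * y2 ^ 2))) := by
          gcongr
      _ ≤ 2500 * (y1 * y2) ^ 3 := by
        have h3 : y1 ^ 3 * y2 ^ 2 * y1 ≤ y1 ^ 3 * y2 ^ 2 * (2 * y2) := by gcongr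
        have h4 : 0 < y1 ^ 3 * y2 ^ 3 := by positivity
        nlinarith
      _ ≤ 2500 * (2 * detIm (⟨x1, y1⟩, ⟨x, y⟩, ⟨x2, y2⟩)) ^ 3 := by gcongr
      _ = _ := by ring
  simp only [cauchyDensity, ← mul_inv]
  rw [_root_.zpow_neg, ← div_eq_mul_inv, inv_le_comm₀ (by positivity) (by positivity), inv_div,
    div_le_iff₀ (by norm_num)]
  rw [mul_comm 20000] at hprod
  exact_mod_cast hprod

theorem integrable_cauchyDensity_mul : Integrable (fun w : ℂ × ℂ × ℂ =>
    cauchyDensity w.1 * (cauchyDensity w.2.1 * cauchyDensity w.2.2)) :=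
  integrable_cauchyDensity.mul_prod
    (g := fun w : ℂ × ℂ => cauchyDensity w.1 * cauchyDensity w.2)
    (integrable_cauchyDensity.mul_prod integrable_cauchyDensity)

theorem muH2_siegelSet_lt_top : muH2 siegelSet < ⊤ := by
  obtain ⟨C, hC⟩ : ∃ C : ℝ, ∀ Z ∈ siegelSet, detIm (coords Z) ^ (-3 : ℤ) ≤
      C * (cauchyDensity (coords Z).1 *
        (cauchyDensity (coords Z).2.1 * cauchyDensity (coords Z).2.2)) :=
    ⟨_, fun Z hZ => zpow_neg_three_detIm_le hZ⟩
  have hint := (integrable_cauchyDensity_mul.const_mul C).lintegral_lt_top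
  have hmeas := measurableEmbedding_coords.measurableSet_image.mpr measurableSet_siegelSet
  rw [muH2_apply measurableSet_siegelSet]
  refine lt_of_le_of_lt (setLIntegral_mono' hmeas ?_)
    ((setLIntegral_le_lintegral (coords '' siegelSet) _).trans_lt hint)
  rintro _ ⟨Z, hZ, rfl⟩
  exact ENNReal.ofReal_le_ofReal (hC Z hZ)

/-! ### Groups of transformations -/

theorem measurePreserving_smul_muH2 (g : GSp) : MeasurePreserving (fun Z : H2 => g • Z) muH2 muH2 := by
  refine ⟨measurable_smul g, Measure.ext fun s hs => ?_⟩
  rw [Measure.map_apply (measurable_smul g) hs, Set.preimage_smul]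
  exact muH2_smul g⁻¹ hs

/-- The transformations of `H2` given by elements of `GSp`. -/
abbrev allTransformations : Subgroup (Equiv.Perm H2) := (MulAction.toPermHom GSp H2).range

theorem transformations_le (K : Subgroup GSp) : transformations K ≤ allTransformations := by
  rintro _ ⟨g, -, rfl⟩
  exact ⟨g, rfl⟩

theorem measurePreserving_of_mem {σ : Equiv.Perm H2} (h : σ ∈ allTransformations) :
    MeasurePreserving σ muH2 muH2 := by
  obtain ⟨g, rfl⟩ := h
  exact measurePreserving_smul_muH2 g

theorem measurableConstSMul_of_le {K : Subgroup (Equiv.Perm H2)} (h : K ≤ allTransformations) :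
    MeasurableConstSMul K H2 := ⟨fun σ => (measurePreserving_of_mem (h σ.2)).measurable⟩

theorem smulInvariantMeasure_of_le {K : Subgroup (Equiv.Perm H2)} (h : K ≤ allTransformations) :
    SMulInvariantMeasure K H2 muH2 :=
  ⟨fun σ _ hs => (measurePreserving_of_mem (h σ.2)).measure_preimage hs.nullMeasurableSet⟩

instance (N : ℕ) : Countable (transformations (Gamma0 N)) := by
  have h0 : Countable (Matrix I4 I4 ℤ) := inferInstanceAs (Countable (I4 → I4 → ℤ))
  have h1 : Countable (symplecticGroup (Fin 2) ℤ) := inferInstanceAs (Countable (Subtype _))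
  have h2 : ((Gamma0 N : Subgroup GSp) : Set GSp).Countable := by
    rw [Gamma0, Subgroup.coe_map]
    exact (Set.to_countable _).image _
  have h3 : ((transformations (Gamma0 N) : Subgroup (Equiv.Perm H2)) :
      Set (Equiv.Perm H2)).Countable := by
    rw [transformations, Subgroup.coe_map]
    exact h2.image _
  exact h3.to_subtype

/-- Finitely many translates of the Siegel set form a set S of finite volume that meets every orbit
of Γ₀(N). The translates of S cover D, and the volumes of their intersections with D add up to that
of S. -/
theorem IsFundDomain.measure_lt_top {N : ℕ} [NeZero N] {D : Set H2} (hD : IsFundDomain N D) :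
    muH2 D < ⊤ := by
  have i1 := measurableConstSMul_of_le (transformations_le (Gamma0 N))
  have i2 := smulInvariantMeasure_of_le (transformations_le (Gamma0 N))
  obtain ⟨a, ha⟩ := exists_isTransversal (Gamma0_relIndex_ne_zero (N := N) 1)
  set S : Set H2 := ⋃ i, a i • siegelSet with hS
  have hSfin : muH2 S < ⊤ := by
    refine (measure_iUnion_le _).trans_lt ?_
    simp only [muH2_smul _ measurableSet_siegelSet, tsum_fintype, Finset.sum_const]
    rw [nsmul_eq_mul]
    exact ENNReal.mul_lt_top (ENNReal.natCast_lt_top _) muH2_siegelSet_lt_top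
  have hcov : ⋃ σ : transformations (Gamma0 N), (σ • S ∩ D) = D := by
    rw [← Set.iUnion_inter]
    refine Set.inter_eq_right.mpr fun Z _ => ?_
    obtain ⟨γ, hγ, hZ⟩ := exists_smul_mem_siegelSet Z
    obtain ⟨i, hi⟩ := ha.cover γ⁻¹ (inv_mem hγ)
    refine Set.mem_iUnion.mpr ⟨⟨_, _, hi, rfl⟩, a i • γ • Z,
      Set.mem_iUnion.mpr ⟨i, Set.smul_mem_smul_set hZ⟩, ?_⟩
    change (γ⁻¹ * (a i)⁻¹) • a i • γ • Z = Z
    rw [mul_smul, inv_smul_smul, inv_smul_smul]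
  rw [hD.measure_eq_tsum S] at hSfin
  rw [← hcov]
  exact (measure_iUnion_le _).trans_lt hSfin

end

section

/-! ### Fundamental domains of commensurable groups and mean values -/

theorem measurableEmbedding_of_mem {σ : Equiv.Perm H2} (h : σ ∈ allTransformations) :
    MeasurableEmbedding σ :=
  (MeasurableEquiv.mk σ (measurePreserving_of_mem h).measurable
    (measurePreserving_of_mem (inv_mem h)).measurable).measurableEmbedding

/-- The invariant function `φ` has mean value `m` on the fundamental domain `E` of `𝒦`. -/
structure HasMeanOn (𝒦 : Subgroup (Equiv.Perm H2)) (E : Set H2) (φ : H2 → ℂ) (m : ℂ) : Prop where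
  le : 𝒦 ≤ allTransformations
  countable : Countable 𝒦
  fd : IsFundamentalDomain 𝒦 E muH2
  ne_zero : muH2 E ≠ 0
  ne_top : muH2 E ≠ ⊤
  inv : ∀ σ ∈ 𝒦, ∀ Z, φ (σ Z) = φ Z
  integrable : IntegrableOn φ E muH2
  eq : ∫ Z in E, φ Z ∂muH2 = m * (muH2 E).toReal

variable {𝒦 ℒ : Subgroup (Equiv.Perm H2)} {E E' : Set H2} {φ ψ : H2 → ℂ} {m m' : ℂ}

theorem HasMeanOn.congr_domain (h : HasMeanOn 𝒦 E φ m) (hE' : IsFundamentalDomain 𝒦 E' muH2) :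
    HasMeanOn 𝒦 E' φ m := by
  have i1 := measurableConstSMul_of_le h.le
  have i2 := smulInvariantMeasure_of_le h.le
  have i3 := h.countable
  have hinv : ∀ (g : 𝒦) (x : H2), φ (g • x) = φ x := fun g x => h.inv g g.2 x
  have hvol := h.fd.measure_eq hE'
  exact ⟨h.le, h.countable, hE', hvol ▸ h.ne_zero, hvol ▸ h.ne_top, h.inv,
    (h.fd.integrableOn_iff hE' hinv).mp h.integrable,
    by rw [← h.fd.setIntegral_eq hE' hinv, ← hvol, h.eq]⟩

theorem HasMeanOn.unique (h : HasMeanOn 𝒦 E φ m) (h' : HasMeanOn 𝒦 E' φ m') : m = m' := by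
  have h1 := (h.congr_domain h'.fd).eq
  rw [h'.eq] at h1
  have h2 : ((muH2 E').toReal : ℂ) ≠ 0 := by
    exact_mod_cast (ENNReal.toReal_pos h'.ne_zero h'.ne_top).ne'
  exact (mul_right_cancel₀ h2 h1).symm

/-- The union of the translates of E by coset representatives is a fundamental domain of the
subgroup. Integral and volume are both multiplied by the index, so the mean stays the same. -/
theorem HasMeanOn.exists_of_le (h : HasMeanOn 𝒦 E φ m) (hle : ℒ ≤ 𝒦) (hind : ℒ.relIndex 𝒦 ≠ 0) :
    ∃ E', HasMeanOn ℒ E' φ m := by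
  have i1 := measurableConstSMul_of_le h.le
  have i2 := smulInvariantMeasure_of_le h.le
  obtain ⟨r, hr⟩ := exists_isTransversal hind
  set s : Fin (ℒ.relIndex 𝒦) → Set H2 := fun i => (⟨r i, hr.mem i⟩ : 𝒦) • E with hs
  have hnull : ∀ i, NullMeasurableSet (s i) muH2 := fun i => h.fd.nullMeasurableSet_smul _
  have hdisj : Pairwise (Function.onFun (AEDisjoint muH2) s) := by
    intro i j hij
    refine h.fd.aedisjoint fun h1 => hij (hr.inj i j ?_)
    have h2 : r i = r j := congrArg Subtype.val h1
    rw [h2, mul_inv_cancel]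
    exact one_mem _
  have i3 := h.countable
  have hfd : ∀ i, IsFundamentalDomain 𝒦 (s i) muH2 := fun i => h.fd.smul _
  have hmean : ∀ i, HasMeanOn 𝒦 (s i) φ m := fun i => h.congr_domain (hfd i)
  have hvol : ∀ i, muH2 (s i) = muH2 E := fun i => (hfd i).measure_eq h.fd
  have hint : IntegrableOn φ (⋃ i, s i) muH2 :=
    integrableOn_finite_iUnion.mpr fun i => (hmean i).integrable
  have hvolU : muH2 (⋃ i, s i) = (ℒ.relIndex 𝒦 : ENNReal) * muH2 E := by
    rw [measure_iUnion₀ hdisj hnull]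
    simp only [hvol, tsum_fintype, Finset.sum_const, Finset.card_univ, Fintype.card_fin,
      nsmul_eq_mul]
  have hn : (ℒ.relIndex 𝒦 : ENNReal) ≠ 0 := by exact_mod_cast hind
  refine ⟨⋃ i, s i, hle.trans h.le, ?_, ⟨NullMeasurableSet.iUnion hnull, ?_, ?_⟩, ?_, ?_,
    fun σ hσ => h.inv σ (hle hσ), hint, ?_⟩
  · exact (Subgroup.inclusion_injective hle).countable
  · filter_upwards [h.fd.ae_covers] with x hx
    obtain ⟨σ, hσ⟩ := hx
    obtain ⟨i, hi⟩ := hr.cover _ (inv_mem σ.2)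
    refine ⟨⟨_, inv_mem hi⟩, Set.mem_iUnion.mpr ⟨i, σ • x, hσ, ?_⟩⟩
    change r i ((σ : Equiv.Perm H2) x) = ((σ : Equiv.Perm H2)⁻¹ * (r i)⁻¹)⁻¹ x
    rw [_root_.mul_inv_rev, inv_inv, inv_inv]
    rfl
  · intro τ τ' hne
    simp only [Function.onFun, Set.smul_set_iUnion]
    rw [AEDisjoint.iUnion_left_iff]
    refine fun i => AEDisjoint.iUnion_right_iff.mpr fun j => ?_
    have h1 : ∀ (t : ℒ) l, t • s l =
        ((⟨t, hle t.2⟩ : 𝒦) * (⟨r l, hr.mem l⟩ : 𝒦)) • E := fun t l => by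
      rw [mul_smul]
      rfl
    rw [h1, h1]
    refine h.fd.aedisjoint fun h2 => hne ?_
    have h3 : (τ : Equiv.Perm H2) * r i = τ' * r j := congrArg Subtype.val h2
    have h4 : r i * (r j)⁻¹ = (τ : Equiv.Perm H2)⁻¹ * τ' := by
      rw [eq_inv_mul_iff_mul_eq, ← mul_assoc, h3, mul_inv_cancel_right]
    have h5 := hr.inj i j (h4 ▸ mul_mem (inv_mem τ.2) τ'.2)
    rw [h5] at h3
    exact Subtype.ext (mul_right_cancel h3)
  · rw [hvolU]
    exact mul_ne_zero hn h.ne_zero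
  · rw [hvolU]
    exact ENNReal.mul_ne_top (ENNReal.natCast_ne_top _) h.ne_top
  · rw [integral_iUnion_ae hnull hdisj hint, tsum_fintype, hvolU, ENNReal.toReal_mul,
      Finset.sum_congr rfl fun i _ => (hmean i).eq]
    simp only [hvol, Finset.sum_const, Finset.card_univ, Fintype.card_fin, nsmul_eq_mul,
      ENNReal.toReal_natCast]
    push_cast
    ring

theorem HasMeanOn.add (h : HasMeanOn 𝒦 E φ m) (h' : HasMeanOn 𝒦 E' ψ m') :
    HasMeanOn 𝒦 E (φ + ψ) (m + m') := by
  have h'' := h'.congr_domain h.fd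
  refine ⟨h.le, h.countable, h.fd, h.ne_zero, h.ne_top, fun σ hσ Z => ?_,
    h.integrable.add h''.integrable, ?_⟩
  · rw [Pi.add_apply, Pi.add_apply, h.inv σ hσ, h'.inv σ hσ]
  · simp only [Pi.add_apply]
    rw [integral_add h.integrable h''.integrable, h.eq, h''.eq, add_mul]

theorem HasMeanOn.const_mul (h : HasMeanOn 𝒦 E φ m) (c : ℂ) :
    HasMeanOn 𝒦 E (fun Z => c * φ Z) (c * m) := by
  refine ⟨h.le, h.countable, h.fd, h.ne_zero, h.ne_top, fun σ hσ Z => ?_,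
    h.integrable.const_mul c, ?_⟩
  · simp only [h.inv σ hσ]
  · rw [integral_const_mul, h.eq, mul_assoc]

theorem HasMeanOn.conj (h : HasMeanOn 𝒦 E φ m) :
    HasMeanOn 𝒦 E (fun Z => (starRingEnd ℂ) (φ Z)) ((starRingEnd ℂ) m) := by
  refine ⟨h.le, h.countable, h.fd, h.ne_zero, h.ne_top, fun σ hσ Z => ?_, ?_, ?_⟩
  · simp only [h.inv σ hσ]
  · exact (LinearIsometryEquiv.integrable_comp_iff Complex.conjLIE).mpr h.integrable
  · rw [integral_conj, h.eq, map_mul, Complex.conj_ofReal]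

/-- The preimage σ⁻¹E is a fundamental domain of σ⁻¹𝒦σ, under which φ ∘ σ is invariant, and σ
preserves the measure. -/
theorem HasMeanOn.comp (h : HasMeanOn 𝒦 E φ m) {σ : Equiv.Perm H2} (hσ : σ ∈ allTransformations) :
    HasMeanOn (ConjAct.toConjAct σ⁻¹ • 𝒦) (σ ⁻¹' E) (φ ∘ σ) m := by
  have hmem : ∀ τ : Equiv.Perm H2, τ ∈ ConjAct.toConjAct σ⁻¹ • 𝒦 ↔ σ * τ * σ⁻¹ ∈ 𝒦 := fun τ => by
    rw [Subgroup.mem_pointwise_smul_iff_inv_smul_mem, ← map_inv, ConjAct.smul_def,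
      ConjAct.ofConjAct_toConjAct, inv_inv]
  have hmp := measurePreserving_of_mem hσ
  have hvol : muH2 (σ ⁻¹' E) = muH2 E := hmp.measure_preimage h.fd.nullMeasurableSet
  have e := 𝒦.equivSMul (ConjAct.toConjAct σ⁻¹)
  refine ⟨fun τ hτ => ?_, ?_, ?_, hvol ▸ h.ne_zero, hvol ▸ h.ne_top, fun τ hτ Z => ?_, ?_, ?_⟩
  · have h1 := mul_mem (mul_mem (inv_mem hσ) (h.le ((hmem τ).mp hτ))) hσ
    convert h1 using 1
    group
  · have := h.countable
    exact e.symm.toEquiv.injective.countable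
  · refine h.fd.preimage_of_equiv hmp.quasiMeasurePreserving
      (𝒦.equivSMul (ConjAct.toConjAct σ⁻¹)).bijective fun g x => ?_
    have h1 : ((𝒦.equivSMul (ConjAct.toConjAct σ⁻¹) g : _) : Equiv.Perm H2) = σ⁻¹ * g * σ := by
      rw [Subgroup.equivSMul_apply_coe, ConjAct.smul_def, ConjAct.ofConjAct_toConjAct, inv_inv]
    change σ (((𝒦.equivSMul (ConjAct.toConjAct σ⁻¹) g : _) : Equiv.Perm H2) x) =
      (g : Equiv.Perm H2) (σ x)
    rw [h1]
    simp
  · have h1 := h.inv _ ((hmem τ).mp hτ) (σ Z)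
    simpa using h1
  · exact (hmp.integrableOn_comp_preimage (measurableEmbedding_of_mem hσ)).mpr h.integrable
  · have h1 := hmp.setIntegral_preimage_emb (measurableEmbedding_of_mem hσ) φ E
    simp only [Function.comp]
    rw [h1, h.eq, hvol]

/-- `φ` is invariant under a group commensurable with `ℋ`, with mean value `m` on a fundamental
domain. -/
def HasMean (ℋ : Subgroup (Equiv.Perm H2)) (φ : H2 → ℂ) (m : ℂ) : Prop :=
  ∃ 𝒦 E, 𝒦.Commensurable ℋ ∧ HasMeanOn 𝒦 E φ m

theorem commensurable_inf {G : Type} [Group G] {K L H : Subgroup G} (hK : K.Commensurable H)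
    (hL : L.Commensurable H) :
    (K ⊓ L).Commensurable H ∧ (K ⊓ L).relIndex K ≠ 0 ∧ (K ⊓ L).relIndex L ≠ 0 := by
  have hKL := hK.trans hL.symm
  have h1 : (K ⊓ L).relIndex K ≠ 0 := by
    rw [Subgroup.inf_relIndex_left]
    exact hKL.2
  have h2 : (K ⊓ L).relIndex L ≠ 0 := by
    rw [Subgroup.inf_relIndex_right]
    exact hKL.1
  refine ⟨Subgroup.Commensurable.trans ⟨h1, ?_⟩ hK, h1, h2⟩
  rw [Subgroup.relIndex_eq_one.mpr inf_le_left]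
  exact one_ne_zero

variable {ℋ : Subgroup (Equiv.Perm H2)}

/-- Two groups commensurable with ℋ have an intersection of finite index in both, to which both
means descend by `HasMeanOn.exists_of_le`. -/
theorem HasMean.common (h : HasMean ℋ φ m) (h' : HasMean ℋ ψ m') : ∃ 𝒦 E E',
    𝒦.Commensurable ℋ ∧ HasMeanOn 𝒦 E φ m ∧ HasMeanOn 𝒦 E' ψ m' := by
  obtain ⟨K, E, hK, hE⟩ := h
  obtain ⟨L, E', hL, hE'⟩ := h'
  obtain ⟨h1, h2, h3⟩ := commensurable_inf hK hL
  obtain ⟨E₁, hE₁⟩ := hE.exists_of_le inf_le_left h2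
  obtain ⟨E₂, hE₂⟩ := hE'.exists_of_le inf_le_right h3
  exact ⟨K ⊓ L, E₁, E₂, h1, hE₁, hE₂⟩

theorem HasMean.unique (h : HasMean ℋ φ m) (h' : HasMean ℋ φ m') : m = m' := by
  obtain ⟨𝒦, E, E', -, hE, hE'⟩ := h.common h'
  exact hE.unique hE'

theorem HasMean.add (h : HasMean ℋ φ m) (h' : HasMean ℋ ψ m') : HasMean ℋ (φ + ψ) (m + m') := by
  obtain ⟨𝒦, E, E', hc, hE, hE'⟩ := h.common h'
  exact ⟨𝒦, E, hc, hE.add hE'⟩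

theorem HasMean.const_mul (h : HasMean ℋ φ m) (c : ℂ) :
    HasMean ℋ (fun Z => c * φ Z) (c * m) := by
  obtain ⟨𝒦, E, hc, hE⟩ := h
  exact ⟨𝒦, E, hc, hE.const_mul c⟩

theorem HasMean.conj (h : HasMean ℋ φ m) :
    HasMean ℋ (fun Z => (starRingEnd ℂ) (φ Z)) ((starRingEnd ℂ) m) := by
  obtain ⟨𝒦, E, hc, hE⟩ := h
  exact ⟨𝒦, E, hc, hE.conj⟩

theorem HasMean.comp (h : HasMean ℋ φ m) {σ : Equiv.Perm H2} (hσ : σ ∈ allTransformations)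
    (hcomm : σ ∈ Subgroup.Commensurable.commensurator ℋ) : HasMean ℋ (φ ∘ σ) m := by
  obtain ⟨𝒦, E, hc, hE⟩ := h
  refine ⟨_, _, (hc.conj _).trans ?_, hE.comp hσ⟩
  exact (Subgroup.Commensurable.commensurator_mem_iff _ _).mp (inv_mem hcomm)

end

section

/-! ### The normalised Petersson product -/

theorem relIndex_map_ne_zero {G G' : Type} [Group G] [Group G'] (f : G →* G') {K L : Subgroup G}
    (h : K.relIndex L ≠ 0) : (K.map f).relIndex (L.map f) ≠ 0 := by
  rw [← Subgroup.relIndex_comap]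
  exact fun h0 => h (Subgroup.relIndex_eq_zero_of_le_left (Subgroup.le_comap_map f K) h0)

/-- Fundamental domains belong to the group of transformations, in which scalars such as -1 become
trivial, so commensurability has to be carried to the image. -/
theorem map_mem_commensurator {G G' : Type} [Group G] [Group G'] (f : G →* G') {K : Subgroup G}
    {g : G} (hg : g ∈ Subgroup.Commensurable.commensurator K) :
    f g ∈ Subgroup.Commensurable.commensurator (K.map f) := by
  rw [Subgroup.Commensurable.commensurator_mem_iff] at hg ⊢
  have h1 : ConjAct.toConjAct (f g) • K.map f = (ConjAct.toConjAct g • K).map f := by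
    ext x
    rw [Subgroup.mem_pointwise_smul_iff_inv_smul_mem, ← map_inv, ConjAct.smul_def,
      ConjAct.ofConjAct_toConjAct, Subgroup.mem_map, Subgroup.mem_map]
    constructor
    · rintro ⟨y, hy, hyx⟩
      refine ⟨g * y * g⁻¹, ?_, ?_⟩
      · rw [Subgroup.mem_pointwise_smul_iff_inv_smul_mem, ← map_inv, ConjAct.smul_def,
          ConjAct.ofConjAct_toConjAct]
        convert hy using 1
        group
      · rw [map_mul, map_mul, hyx, map_inv]
        group
    · rintro ⟨y, hy, rfl⟩
      rw [Subgroup.mem_pointwise_smul_iff_inv_smul_mem, ← map_inv, ConjAct.smul_def,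
        ConjAct.ofConjAct_toConjAct] at hy
      refine ⟨_, hy, ?_⟩
      simp only [map_mul, map_inv]
  rw [h1]
  exact ⟨relIndex_map_ne_zero f hg.1, relIndex_map_ne_zero f hg.2⟩

/-- Measurable functions of bounded Petersson norm, invariant in weight `k` under a group
commensurable with `Γ_0(M)`. -/
def petSpace (M : ℕ) (k : ℤ) : Submodule ℂ (H2 → ℂ) where
  carrier := {A | Measurable A ∧ IsPetBounded k A ∧
    ∃ K : Subgroup GSp, K.Commensurable (Gamma0 M) ∧ ∀ γ ∈ K, slash k γ A = A}
  zero_mem' := ⟨measurable_zero, ⟨0, fun Z => by simp [pet]⟩, Gamma0 M, Subgroup.Commensurable.refl _,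
    fun γ _ => by funext Z; simp [slash]⟩
  add_mem' := by
    rintro A B ⟨hA, hA', K, hK, hKA⟩ ⟨hB, hB', L, hL, hLB⟩
    refine ⟨hA.add hB, hA'.add hB', K ⊓ L, (commensurable_inf hK hL).1, fun γ hγ => ?_⟩
    rw [slash_add, hKA γ hγ.1, hLB γ hγ.2]
  smul_mem' := by
    rintro c A ⟨hA, hA', K, hK, hKA⟩
    exact ⟨hA.const_smul c, hA'.smul c, K, hK, fun γ hγ => by rw [slash_smul, hKA γ hγ]⟩

variable {M : ℕ} {k : ℤ} {A B : H2 → ℂ}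

theorem slash_mem_petSpace (hA : A ∈ petSpace M k) {g : GSp} (hg : g ∈ Comm M) :
    slash k g A ∈ petSpace M k := by
  obtain ⟨hA, hA', K, hK, hKA⟩ := hA
  refine ⟨measurable_slash g hA, hA'.slash g, ConjAct.toConjAct g⁻¹ • K,
    (hK.conj _).trans ((Subgroup.Commensurable.commensurator_mem_iff _ _).mp (inv_mem hg)),
    fun γ hγ => ?_⟩
  rw [Subgroup.mem_pointwise_smul_iff_inv_smul_mem, ← map_inv, ConjAct.smul_def,
    ConjAct.ofConjAct_toConjAct, inv_inv] at hγ
  have h1 : g * γ = g * γ * g⁻¹ * g := by group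
  rw [← slash_mul, h1, slash_mul, hKA _ hγ]

theorem IsCuspForm.mem_petSpace {N : ℕ} [NeZero N] [NeZero M] {F : H2 → ℂ} (hF : IsCuspForm N k F) :
    F ∈ petSpace M k :=
  ⟨hF.holo.measurable, hF.isPetBounded, Gamma0 N,
    ⟨Gamma0_relIndex_ne_zero M, Gamma0_relIndex_ne_zero N⟩, hF.slash_eq⟩

/-- The mean value of `A(Z) conj(B(Z)) det(Y)^k` over a fundamental domain. -/
def normPet (M : ℕ) (k : ℤ) (A B : H2 → ℂ) : ℂ :=
  open Classical in
  -- The default 0 does not occur on `petSpace` as soon as Γ₀(M) has a fundamental domain of nonzero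
  -- volume, by `hasMean_normPet`.
  if h : ∃ m, HasMean (transformations (Gamma0 M)) (pet k A B) m then h.choose else 0

theorem HasMean.normPet_eq {m : ℂ} (h : HasMean (transformations (Gamma0 M)) (pet k A B) m) :
    normPet M k A B = m := by
  have h' : ∃ m, HasMean (transformations (Gamma0 M)) (pet k A B) m := ⟨m, h⟩
  rw [normPet, dif_pos h']
  exact h'.choose_spec.unique h

theorem pet_invariant {K : Subgroup GSp} (hA : ∀ γ ∈ K, slash k γ A = A)
    (hB : ∀ γ ∈ K, slash k γ B = B) : ∀ σ ∈ transformations K, ∀ Z, pet k A B (σ Z) = pet k A B Z := by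
  rintro _ ⟨γ, hγ, rfl⟩ Z
  change pet k A B (γ • Z) = _
  rw [← pet_slash, hA γ hγ, hB γ hγ]

theorem integrableOn_pet (hA : A ∈ petSpace M k) (hB : B ∈ petSpace M k) {E : Set H2}
    (hE : muH2 E ≠ ⊤) : IntegrableOn (pet k A B) E muH2 := by
  obtain ⟨hA, ⟨C, hC⟩, -⟩ := hA
  obtain ⟨hB, ⟨C', hC'⟩, -⟩ := hB
  refine Measure.integrableOn_of_bounded hE (measurable_pet hA hB).aestronglyMeasurable
    (M := C + C') (ae_of_all _ fun Z => ?_)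
  exact (norm_pet_le k A B Z).trans (add_le_add (hC Z) (hC' Z))

section Mean

variable [NeZero M] {D : Set H2}

/-- A bounded integrand on a set of finite volume is integrable; what has to be found is a
fundamental domain of a group that fixes both functions. -/
theorem hasMean_normPet (hD : IsFundDomain M D) (hD0 : muH2 D ≠ 0) (hA : A ∈ petSpace M k)
    (hB : B ∈ petSpace M k) :
    HasMean (transformations (Gamma0 M)) (pet k A B) (normPet M k A B) := by
  suffices h : ∃ m, HasMean (transformations (Gamma0 M)) (pet k A B) m by
    obtain ⟨m, hm⟩ := h
    rwa [hm.normPet_eq]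
  obtain ⟨-, -, K, hK, hKA⟩ := id hA
  obtain ⟨-, -, L, hL, hLB⟩ := id hB
  -- The constant function is used only to obtain, from D, a fundamental domain of the smaller group
  -- R with finite nonzero volume.
  have h1 : HasMeanOn (transformations (Gamma0 M)) D (fun _ => 1) 1 :=
    ⟨transformations_le _, inferInstance, hD, hD0, hD.measure_lt_top.ne, fun _ _ _ => rfl,
      integrableOn_const hD.measure_lt_top.ne, by simp [Measure.real]⟩
  obtain ⟨hKL, -, -⟩ := commensurable_inf hK hL
  obtain ⟨h2, -, h3⟩ := commensurable_inf hKL (Subgroup.Commensurable.refl (Gamma0 M))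
  set R := K ⊓ L ⊓ Gamma0 M with hR
  obtain ⟨E, hE⟩ := h1.exists_of_le (ℒ := transformations R)
    (Subgroup.map_mono inf_le_right) (relIndex_map_ne_zero _ h3)
  have hvol : ((muH2 E).toReal : ℂ) ≠ 0 := by
    exact_mod_cast (ENNReal.toReal_pos hE.ne_zero hE.ne_top).ne'
  refine ⟨(∫ Z in E, pet k A B Z ∂muH2) / (muH2 E).toReal, transformations R, E,
    ⟨relIndex_map_ne_zero _ h2.1, relIndex_map_ne_zero _ h2.2⟩, hE.le, hE.countable, hE.fd,
    hE.ne_zero, hE.ne_top, ?_, integrableOn_pet hA hB hE.ne_top, (div_mul_cancel₀ _ hvol).symm⟩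
  exact pet_invariant (fun γ hγ => hKA γ hγ.1.1) (fun γ hγ => hLB γ hγ.1.2)

theorem petersson_eq_mul_normPet (hD : IsFundDomain M D) (hD0 : muH2 D ≠ 0)
    (hA : A ∈ petSpace M k) (hB : B ∈ petSpace M k)
    (hA' : ∀ γ ∈ Gamma0 M, slash k γ A = A) (hB' : ∀ γ ∈ Gamma0 M, slash k γ B = B) :
    petersson D k A B = (muH2 D).toReal * normPet M k A B := by
  have hvol : ((muH2 D).toReal : ℂ) ≠ 0 := by
    exact_mod_cast (ENNReal.toReal_pos hD0 hD.measure_lt_top.ne).ne'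
  have h : HasMean (transformations (Gamma0 M)) (pet k A B)
      (petersson D k A B / (muH2 D).toReal) :=
    ⟨transformations (Gamma0 M), D, Subgroup.Commensurable.refl _, transformations_le _,
      inferInstance, hD, hD0, hD.measure_lt_top.ne, pet_invariant hA' hB',
      integrableOn_pet hA hB hD.measure_lt_top.ne, (div_mul_cancel₀ _ hvol).symm⟩
  rw [h.normPet_eq, mul_div_cancel₀ _ hvol]

theorem normPet_conj (hD : IsFundDomain M D) (hD0 : muH2 D ≠ 0) (hA : A ∈ petSpace M k)
    (hB : B ∈ petSpace M k) : (starRingEnd ℂ) (normPet M k A B) = normPet M k B A := by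
  have h := (hasMean_normPet hD hD0 hA hB).conj
  have h1 : (fun Z => (starRingEnd ℂ) (pet k A B Z)) = pet k B A := by
    funext Z
    simp only [pet, map_mul, map_zpow₀, Complex.conj_conj, Complex.conj_ofReal]
    ring
  rw [h1] at h
  exact h.normPet_eq.symm

theorem normPet_add_left (hD : IsFundDomain M D) (hD0 : muH2 D ≠ 0) {A' : H2 → ℂ}
    (hA : A ∈ petSpace M k) (hA' : A' ∈ petSpace M k) (hB : B ∈ petSpace M k) :
    normPet M k (A + A') B = normPet M k A B + normPet M k A' B := by
  have h := (hasMean_normPet hD hD0 hA hB).add (hasMean_normPet hD hD0 hA' hB)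
  have h1 : pet k A B + pet k A' B = pet k (A + A') B := by
    funext Z
    simp only [pet, Pi.add_apply]
    ring
  rw [h1] at h
  exact h.normPet_eq

theorem normPet_smul_left (hD : IsFundDomain M D) (hD0 : muH2 D ≠ 0) (c : ℂ)
    (hA : A ∈ petSpace M k) (hB : B ∈ petSpace M k) :
    normPet M k (c • A) B = c * normPet M k A B := by
  have h := (hasMean_normPet hD hD0 hA hB).const_mul c
  have h1 : (fun Z => c * pet k A B Z) = pet k (c • A) B := by
    funext Z
    simp only [pet, Pi.smul_apply, smul_eq_mul]
    ring
  rw [h1] at h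
  exact h.normPet_eq

theorem normPet_sum_left (hD : IsFundDomain M D) (hD0 : muH2 D ≠ 0) {ι : Type} [Fintype ι]
    {A : ι → H2 → ℂ} (hA : ∀ i, A i ∈ petSpace M k) (hB : B ∈ petSpace M k) {c : ℂ}
    (h : ∀ i, normPet M k (A i) B = c) :
    normPet M k (∑ i, A i) B = Fintype.card ι * c := by
  have h0 : normPet M k 0 B = 0 := by
    have := normPet_smul_left hD hD0 0 (Submodule.zero_mem (petSpace M k)) hB
    simpa using this
  have key : ∀ s : Finset ι, normPet M k (∑ i ∈ s, A i) B = s.card * c := by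
    intro s
    induction s using Finset.cons_induction with
    | empty => simpa using h0
    | cons i s hi ih =>
      rw [Finset.sum_cons, normPet_add_left hD hD0 (hA i) (Submodule.sum_mem _ fun j _ => hA j) hB,
        h i, ih, Finset.card_cons]
      push_cast
      ring
  exact key Finset.univ

/-- Slashing both functions by g composes the integrand with g. The mean is the same over the
conjugate group, which is commensurable with the original one. -/
theorem normPet_slash (hD : IsFundDomain M D) (hD0 : muH2 D ≠ 0) (hA : A ∈ petSpace M k)
    (hB : B ∈ petSpace M k) {g : GSp} (hg : g ∈ Comm M) :
    normPet M k (slash k g A) (slash k g B) = normPet M k A B := by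
  have h := (hasMean_normPet hD hD0 hA hB).comp
    (σ := MulAction.toPermHom GSp H2 g) ⟨g, rfl⟩ (map_mem_commensurator _ hg)
  have h1 : pet k A B ∘ (MulAction.toPermHom GSp H2 g) = pet k (slash k g A) (slash k g B) :=
    funext fun Z => (pet_slash k g A B Z).symm
  rw [h1] at h
  exact h.normPet_eq

theorem normPet_slash_left (hD : IsFundDomain M D) (hD0 : muH2 D ≠ 0) (hA : A ∈ petSpace M k)
    (hB : B ∈ petSpace M k) {g g' : GSp} (hg : g ∈ Comm M) (hg' : g' ∈ Comm M)
    (h : slash k (g * g') A = A) :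
    normPet M k (slash k g A) B = normPet M k A (slash k g' B) := by
  rw [← normPet_slash hD hD0 (slash_mem_petSpace hA hg) hB hg', ← slash_mul, h]

theorem normPet_slash_left_of_invariant (hD : IsFundDomain M D) (hD0 : muH2 D ≠ 0)
    (hA : A ∈ petSpace M k) (hB : B ∈ petSpace M k) {g : GSp} (hg : g ∈ Comm M)
    (h : slash k g B = B) : normPet M k (slash k g A) B = normPet M k A B := by
  rw [← normPet_slash hD hD0 hA hB hg, h]

end Mean

end

section

/-! ### The Petersson products -/

section Elements

variable {N p : ℕ} [NeZero N] [Fact p.Prime]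

theorem diagP_upper_mul_lower : diagP p 1 1 0 0 rfl * diagP p 0 0 1 1 rfl =
    scal ((p : ℝ) ^ 1) (pow_ne_zero _ (prime_cast_ne_zero p)) :=
  (diagP_mul_diagP p 1 1 0 0 rfl 0 0 1 1 rfl).trans (diagP_scal p 1)

theorem diagP_lower_mul_upper : diagP p 0 0 1 1 rfl * diagP p 1 1 0 0 rfl =
    scal ((p : ℝ) ^ 1) (pow_ne_zero _ (prime_cast_ne_zero p)) :=
  (diagP_mul_diagP p 0 0 1 1 rfl 1 1 0 0 rfl).trans (diagP_scal p 1)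

theorem diagP_upper_conj (γ : GSp) :
    diagP p 1 1 0 0 rfl * γ * (diagP p 1 1 0 0 rfl)⁻¹ =
      (diagP p 0 0 1 1 rfl)⁻¹ * γ * diagP p 0 0 1 1 rfl := by
  have h1 := (diagP_lower_mul_upper (p := p))
  have h2 : scal ((p : ℝ) ^ 1) (pow_ne_zero _ (prime_cast_ne_zero p)) * γ *
      (scal ((p : ℝ) ^ 1) (pow_ne_zero _ (prime_cast_ne_zero p)))⁻¹ = γ := by
    rw [scal_comm, mul_inv_cancel_right]
  rw [← h1] at h2
  conv_rhs => rw [← h2]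
  group

theorem mem_Gamma0_mul_iff {γ : GSp} : γ ∈ Gamma0 (N * p) ↔ γ ∈ Gamma0 N ∧
    diagP p 1 1 0 0 rfl * γ * (diagP p 1 1 0 0 rfl)⁻¹ ∈ Gamma0 N := by
  rw [← mem_stabIn, stabIn_diagP_upper, pow_one]

variable (α β : ℤ) (h : (p : ℤ) * α - N * β = 1)

/-- Together with `Wp_eq_lower_mul` this writes W_p as γ d' and as d γ' with γ, γ' in Γ₀(N). The
first form gives its action at level N; both are needed to see that it normalises Γ₀(Np). -/
theorem Wp_eq_mul_upper : Wp N p α β h = gOpp N p α β h * diagP p 1 1 0 0 rfl := by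
  apply GSp.ext_mat
  rw [GSp.mat_mul, mat_diagP, gOpp, mat_Wp, mat_pr, mul_fromBlocks_fin_two]
  apply fromBlocks_fin_two_eq <;> refine ⟨?_, ?_, ?_, ?_⟩ <;> push_cast <;> ring

theorem Wp_eq_lower_mul : Wp N p α β h = diagP p 0 0 1 1 rfl * gOpp' N p α β h := by
  apply GSp.ext_mat
  rw [GSp.mat_mul, mat_diagP, gOpp', mat_Wp, mat_pr, mul_fromBlocks_fin_two]
  apply fromBlocks_fin_two_eq <;> refine ⟨?_, ?_, ?_, ?_⟩ <;> push_cast <;> ring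

theorem Wp_mem_Comm : Wp N p α β h ∈ Comm N := by
  rw [Wp_eq_mul_upper]
  exact mul_mem (Gamma0_le_Comm N (gOpp_mem α β h)) (diagP_mem_Comm N p _ _ _ _ _)

/-- Γ₀(Np) consists of the γ such that γ and d'γd'⁻¹ both lie in Γ₀(N), and conjugation by W_p
exchanges the two conditions. -/
theorem Wp_conj_mem {γ : GSp} (hγ : γ ∈ Gamma0 (N * p)) :
    Wp N p α β h * γ * (Wp N p α β h)⁻¹ ∈ Gamma0 (N * p) := by
  obtain ⟨h1, h2⟩ := mem_Gamma0_mul_iff.mp hγ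
  refine mem_Gamma0_mul_iff.mpr ⟨?_, ?_⟩
  · rw [Wp_eq_mul_upper]
    have := mul_mem (mul_mem (gOpp_mem α β h) h2) (inv_mem (gOpp_mem α β h))
    convert this using 1
    group
  · rw [diagP_upper_conj, Wp_eq_lower_mul]
    have := mul_mem (mul_mem (gOpp'_mem α β h) h1) (inv_mem (gOpp'_mem α β h))
    convert this using 1
    group

theorem Wp_inv_conj_mem {γ : GSp} (hγ : γ ∈ Gamma0 (N * p)) :
    (Wp N p α β h)⁻¹ * γ * Wp N p α β h ∈ Gamma0 (N * p) := by
  obtain ⟨h1, h2⟩ := mem_Gamma0_mul_iff.mp hγ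
  refine mem_Gamma0_mul_iff.mpr ⟨?_, ?_⟩
  · rw [diagP_upper_conj] at h2
    rw [Wp_eq_lower_mul]
    have := mul_mem (mul_mem (inv_mem (gOpp'_mem α β h)) h2) (gOpp'_mem α β h)
    convert this using 1
    group
  · rw [Wp_eq_mul_upper]
    have := mul_mem (mul_mem (inv_mem (gOpp_mem α β h)) h1) (gOpp_mem α β h)
    convert this using 1
    group

theorem lower_mul_Wp : ∃ g ∈ Gamma0 N, ∃ g' ∈ Gamma0 (N * p),
    diagP p 0 0 1 1 rfl * Wp N p α β h = g * diagP p 2 2 0 0 rfl * g' := by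
  have h1 : (p : ℝ) * α - N * β = 1 := by exact_mod_cast h
  -- As Nβ = pα - 1, this is (pα)² - (pα - 1)(pα + 1) = 1. The factor (α², 1; Nβ(1 + pα), p²) and a
  -- lower unipotent element of level Np bring d W_p to diag(p²,p²,1,1).
  have h2 : ((α ^ 2 : ℤ) : ℝ) * ((p ^ 2 : ℤ) : ℝ) - ((1 : ℤ) : ℝ) *
      ((N * (β * (1 + p * α)) : ℤ) : ℝ) = 1 := by
    push_cast
    linear_combination (p * α + 1) * h1
  refine ⟨_, pr_mem (N := N) h2 h2 (dvd_mul_right _ _) (dvd_mul_right _ _),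
    _, nL_mem (N := N * p) (x := (N * p : ℕ) * (-(α * β))) (y := 0) (z := (N * p : ℕ) * (-(α * β)))
      (dvd_mul_right _ _) (dvd_zero _) (dvd_mul_right _ _), ?_⟩
  apply GSp.ext_mat
  rw [GSp.mat_mul, GSp.mat_mul, GSp.mat_mul, mat_diagP, mat_diagP, mat_Wp, mat_pr, mat_nL,
    mul_fromBlocks_fin_two, mul_fromBlocks_fin_two, mul_fromBlocks_fin_two]
  apply fromBlocks_fin_two_eq <;> refine ⟨?_, ?_, ?_, ?_⟩ <;> push_cast <;>
    first | ring1 | linear_combination (p * α) * h1 | linear_combination (-(p * α)) * h1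

end Elements

section Products

variable {N p : ℕ} [NeZero N] [Fact p.Prime] {k : ℤ} {A B F F' : H2 → ℂ} {D : Set H2}

/-- The integrand for A with itself is nonnegative, so a zero integral makes A vanish almost
everywhere on D. -/
theorem petersson_eq_zero_of_self {M : ℕ} [NeZero M] (hD : IsFundDomain M D) (hA : A ∈ petSpace M k)
    (h : petersson D k A A = 0) : petersson D k A B = 0 := by
  have h1 : ∀ Z, pet k A A Z = ((‖pet k A A Z‖ : ℝ) : ℂ) := fun Z => by
    rw [norm_pet_self, pet, Complex.mul_conj, Complex.normSq_eq_norm_sq, im_det]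
    push_cast
    rfl
  have hint := (integrableOn_pet hA hA hD.measure_lt_top.ne).norm
  have h2 : ∫ Z in D, ‖pet k A A Z‖ ∂muH2 = 0 := by
    have h3 : petersson D k A A = ∫ Z in D, ((‖pet k A A Z‖ : ℝ) : ℂ) ∂muH2 :=
      integral_congr_ae (ae_of_all _ h1)
    have h4 := h3.symm.trans h
    have h5 := integral_ofReal (𝕜 := ℂ) (μ := muH2.restrict D) (f := fun Z => ‖pet k A A Z‖)
    exact Complex.ofReal_eq_zero.mp (h5.symm.trans h4)
  rw [integral_eq_zero_iff_of_nonneg (fun Z => norm_nonneg _) hint] at h2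
  refine (integral_congr_ae ?_).trans (integral_zero H2 ℂ)
  filter_upwards [h2] with Z hZ
  have h3 : ‖A Z‖ ^ 2 * detIm (coords Z) ^ k = 0 := by
    rw [← norm_pet_self]
    exact hZ
  have h4 : A Z = 0 := by
    have := (zpow_pos (detIm_pos Z) k).ne'
    simpa [this] using h3
  rw [h4]
  simp

/-- Slashing by an element of Γ₀(N) fixes B and preserves the product, so all the terms F|g a_i have
the same product with B, namely that of their average. -/
theorem normPet_slash_eq_avg (hD : IsFundDomain (N * p) D) (hD0 : muH2 D ≠ 0)
    (hF : F ∈ petSpace (N * p) k) (hB : B ∈ petSpace (N * p) k)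
    (hFG : ∀ γ ∈ Gamma0 N, slash k γ F = F) (hBG : ∀ γ ∈ Gamma0 N, slash k γ B = B) {g : GSp}
    (hg : g ∈ Comm N) {c : ℂ} (h : avg k (Gamma0 N) F g = c • F) :
    normPet (N * p) k (slash k g F) B = c * normPet (N * p) k F B := by
  have hC : Comm (N * p) = Comm N := Comm_eq
  obtain ⟨a, ha⟩ := exists_isTransversal (mem_commensurator_iff.mp hg).1
  have hcard : (Fintype.card (Fin ((stabIn (Gamma0 N) g (Gamma0 N)).relIndex (Gamma0 N))) : ℂ) ≠ 0 := by
    rw [Fintype.card_fin]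
    exact_mod_cast (mem_commensurator_iff.mp hg).1
  have hmem : ∀ i, slash k (g * a i) F ∈ petSpace (N * p) k := fun i =>
    slash_mem_petSpace hF (hC ▸ mul_mem hg (Gamma0_le_Comm N (ha.mem i)))
  rw [avg_eq hFG le_rfl ha] at h
  rw [← normPet_smul_left hD hD0 c hF hB, ← h, normPet_smul_left hD hD0 _
    (Submodule.sum_mem _ fun i _ => hmem i) hB, normPet_sum_left hD hD0 hmem hB (c := normPet (N * p) k (slash k g F) B),
    inv_mul_cancel_left₀ hcard]
  intro i
  rw [slash_mul, normPet_slash_left_of_invariant hD hD0 (slash_mem_petSpace hF (hC ▸ hg)) hB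
    (hC ▸ Gamma0_le_Comm N (ha.mem i)) (hBG _ (ha.mem i))]

theorem lower_mul_nU_mem_Comm (S : ZMod p × ZMod p × ZMod p) :
    diagP p 0 0 1 1 rfl * nU S.1.val S.2.1.val S.2.2.val ∈ Comm (N * p) :=
  mul_mem (diagP_mem_Comm _ p _ _ _ _ _) (Gamma0_le_Comm _ (nU_natCast_mem _ _ _ _))

theorem US_mem_petSpace (hF : F ∈ petSpace (N * p) k)
    (hFH : ∀ γ ∈ Gamma0 (N * p), slash k γ F = F) : US N p k F ∈ petSpace (N * p) k := by
  rw [US, US_eq_sum (dvd_mul_left p N) hFH]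
  exact Submodule.smul_mem _ _ (Submodule.sum_mem _ fun S _ =>
    slash_mem_petSpace hF (lower_mul_nU_mem_Comm S))

theorem slash_US (hFH : ∀ γ ∈ Gamma0 (N * p), slash k γ F = F) {γ : GSp} (hγ : γ ∈ Gamma0 (N * p)) :
    slash k γ (US N p k F) = US N p k F := by
  rw [US, US_eq_sum (dvd_mul_left p N) hFH, slash_smul, slash_US_sum (dvd_mul_left p N) hFH hγ]

theorem prime_zpow_mul_card (k : ℤ) : (p : ℂ) ^ (k - 3) *
    (Fintype.card (ZMod p × ZMod p × ZMod p) : ℂ) = (p : ℂ) ^ k := by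
  have hp : (p : ℂ) ≠ 0 := Nat.cast_ne_zero.mpr (Fact.out : p.Prime).ne_zero
  have h1 : (Fintype.card (ZMod p × ZMod p × ZMod p) : ℂ) = (p : ℂ) ^ (3 : ℤ) := by
    simp only [Fintype.card_prod, ZMod.card]
    push_cast
    norm_cast
    ring
  rw [h1, ← zpow_add₀ hp, sub_add_cancel]

/-- The p³ translations in U_S(p) do not change the product with B, and p^(k-3)·p³ = p^k. -/
theorem normPet_US_left (hD : IsFundDomain (N * p) D) (hD0 : muH2 D ≠ 0)
    (hF : F ∈ petSpace (N * p) k) (hFH : ∀ γ ∈ Gamma0 (N * p), slash k γ F = F)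
    (hB : B ∈ petSpace (N * p) k) (hBU : ∀ x y z : ℕ, slash k (nU x y z) B = B) :
    normPet (N * p) k (US N p k F) B =
      (p : ℂ) ^ k * normPet (N * p) k (slash k (diagP p 0 0 1 1 rfl) F) B := by
  have hmem := fun S => slash_mem_petSpace hF (lower_mul_nU_mem_Comm (N := N) (p := p) S)
  rw [US, US_eq_sum (dvd_mul_left p N) hFH, normPet_smul_left hD hD0 _
    (Submodule.sum_mem _ fun S _ => hmem S) hB, normPet_sum_left hD hD0 hmem hB
    (c := normPet (N * p) k (slash k (diagP p 0 0 1 1 rfl) F) B), ← mul_assoc, prime_zpow_mul_card]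
  intro S
  rw [slash_mul, normPet_slash_left_of_invariant hD hD0
    (slash_mem_petSpace hF (diagP_mem_Comm _ p _ _ _ _ _)) hB
    (Gamma0_le_Comm _ (nU_natCast_mem _ _ _ _)) (hBU _ _ _)]

theorem normPet_US_right (hD : IsFundDomain (N * p) D) (hD0 : muH2 D ≠ 0)
    (hF : F ∈ petSpace (N * p) k) (hFH : ∀ γ ∈ Gamma0 (N * p), slash k γ F = F)
    (hB : B ∈ petSpace (N * p) k) (hBU : ∀ x y z : ℕ, slash k (nU x y z) B = B) :
    normPet (N * p) k B (US N p k F) =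
      (p : ℂ) ^ k * normPet (N * p) k B (slash k (diagP p 0 0 1 1 rfl) F) := by
  rw [← normPet_conj hD hD0 (US_mem_petSpace hF hFH) hB, normPet_US_left hD hD0 hF hFH hB hBU,
    map_mul, normPet_conj hD hD0 (slash_mem_petSpace hF (diagP_mem_Comm _ p _ _ _ _ _)) hB,
    map_zpow₀, Complex.conj_natCast]

end Products

end

/-! ### Adjoint operators and reality of eigenvalues -/

section

section Adjoint

variable {N p : ℕ} [NeZero N] [Fact p.Prime] {k : ℤ} {A B F F' : H2 → ℂ} {D : Set H2}

theorem lower_mem_petSpace (hA : A ∈ petSpace (N * p) k) (j : ℕ) :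
    slash k (diagP p 0 0 j j rfl) A ∈ petSpace (N * p) k :=
  slash_mem_petSpace hA (diagP_mem_Comm _ p _ _ _ _ _)

theorem upper_mem_petSpace (hA : A ∈ petSpace (N * p) k) (j : ℕ) :
    slash k (diagP p j j 0 0 rfl) A ∈ petSpace (N * p) k :=
  slash_mem_petSpace hA (diagP_mem_Comm _ p _ _ _ _ _)

theorem normPet_lower_left (hD : IsFundDomain (N * p) D) (hD0 : muH2 D ≠ 0)
    (hA : A ∈ petSpace (N * p) k) (hB : B ∈ petSpace (N * p) k) :
    normPet (N * p) k (slash k (diagP p 0 0 1 1 rfl) A) B =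
      normPet (N * p) k A (slash k (diagP p 1 1 0 0 rfl) B) := by
  refine normPet_slash_left hD hD0 hA hB (diagP_mem_Comm _ p _ _ _ _ _)
    (diagP_mem_Comm _ p _ _ _ _ _) ?_
  rw [diagP_lower_mul_upper, slash_scal]

theorem normPet_upper_left (hD : IsFundDomain (N * p) D) (hD0 : muH2 D ≠ 0)
    (hA : A ∈ petSpace (N * p) k) (hB : B ∈ petSpace (N * p) k) :
    normPet (N * p) k (slash k (diagP p 1 1 0 0 rfl) A) B =
      normPet (N * p) k A (slash k (diagP p 0 0 1 1 rfl) B) := by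
  refine normPet_slash_left hD hD0 hA hB (diagP_mem_Comm _ p _ _ _ _ _)
    (diagP_mem_Comm _ p _ _ _ _ _) ?_
  rw [diagP_upper_mul_lower, slash_scal]

theorem slash_of_le (hF : ∀ γ ∈ Gamma0 N, slash k γ F = F) :
    ∀ γ ∈ Gamma0 (N * p), slash k γ F = F := fun γ hγ => hF γ (Gamma0_le (dvd_mul_right N p) hγ)

/-- An eigenvalue of the average over the double coset of `diag(1, 1, p, p)` is real unless the
eigenfunction is zero. -/
theorem conj_mul_normPet (hD : IsFundDomain (N * p) D) (hD0 : muH2 D ≠ 0) (hpN : ¬ p ∣ N)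
    (hF : F ∈ petSpace (N * p) k) (hFG : ∀ γ ∈ Gamma0 N, slash k γ F = F)
    (hB : B ∈ petSpace (N * p) k) (hBH : ∀ γ ∈ Gamma0 (N * p), slash k γ B = B) {c : ℂ}
    (h : avg k (Gamma0 N) F (diagP p 0 0 1 1 rfl) = c • F) :
    (starRingEnd ℂ) c * normPet (N * p) k F B = c * normPet (N * p) k F B := by
  have h' := (avg_of_doubleCoset_eq (k := k) (F := F) (doubleCoset_upper hpN 1)).trans h
  have h1 := normPet_slash_eq_avg hD hD0 hF hF hFG hFG (diagP_mem_Comm N p _ _ _ _ _) h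
  have h2 := normPet_slash_eq_avg hD hD0 hF hF hFG hFG (diagP_mem_Comm N p _ _ _ _ _) h'
  -- The elements d and d' are adjoint and share a double coset, so c⟨F,F⟩ = ⟨F|d',F⟩ = ⟨F,F|d⟩,
  -- which is conj(c)⟨F,F⟩.
  rw [normPet_upper_left hD hD0 hF hF, ← normPet_conj hD hD0 (lower_mem_petSpace hF 1) hF, h1,
    map_mul, normPet_conj hD hD0 hF hF] at h2
  rcases eq_or_ne (normPet (N * p) k F F) 0 with h0 | h0
  -- If F has norm zero the eigenvalue need not be real, but then every product with F vanishes.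
  · have hH := slash_of_le (p := p) hFG
    have h3 := petersson_eq_zero_of_self (B := B) hD hF
      (by rw [petersson_eq_mul_normPet hD hD0 hF hF hH hH, h0, mul_zero])
    rw [petersson_eq_mul_normPet hD hD0 hF hB hH hBH] at h3
    have hvol : ((muH2 D).toReal : ℂ) ≠ 0 := by
      exact_mod_cast (ENNReal.toReal_pos hD0 hD.measure_lt_top.ne).ne'
    rw [(mul_eq_zero.mp h3).resolve_left hvol, mul_zero, mul_zero]
  · rw [mul_right_cancel₀ h0 h2]

theorem slash_Wp (α β : ℤ) (h : (p : ℤ) * α - N * β = 1) (hFG : ∀ γ ∈ Gamma0 N, slash k γ F = F) :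
    slash k (Wp N p α β h) F = slash k (diagP p 1 1 0 0 rfl) F := by
  rw [Wp_eq_mul_upper, slash_mul_left hFG (gOpp_mem α β h)]

theorem slash_slash_Wp (α β : ℤ) (h : (p : ℤ) * α - N * β = 1)
    (hA : ∀ γ ∈ Gamma0 (N * p), slash k γ A = A) :
    ∀ γ ∈ Gamma0 (N * p), slash k γ (slash k (Wp N p α β h) A) = slash k (Wp N p α β h) A := by
  intro γ hγ
  have h1 : Wp N p α β h * γ = Wp N p α β h * γ * (Wp N p α β h)⁻¹ * Wp N p α β h := by group
  rw [← slash_mul, h1, slash_mul_left hA (Wp_conj_mem α β h hγ)]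

theorem Wp_mem_Comm_mul (α β : ℤ) (h : (p : ℤ) * α - N * β = 1) :
    Wp N p α β h ∈ Comm (N * p) := by
  have hC : Comm (N * p) = Comm N := Comm_eq
  exact hC ▸ Wp_mem_Comm α β h

/-! ### The six products -/

theorem normPet_US_of_avg (hD : IsFundDomain (N * p) D) (hD0 : muH2 D ≠ 0)
    (hF : F ∈ petSpace (N * p) k) (hFG : ∀ γ ∈ Gamma0 N, slash k γ F = F)
    (hF' : F' ∈ petSpace (N * p) k) (hFG' : ∀ γ ∈ Gamma0 N, slash k γ F' = F') {c : ℂ}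
    (h : avg k (Gamma0 N) F (diagP p 0 0 1 1 rfl) = c • F) :
    normPet (N * p) k (US N p k F) F' = (p : ℂ) ^ k * (c * normPet (N * p) k F F') := by
  rw [normPet_US_left hD hD0 hF (slash_of_le hFG) hF' fun x y z => hFG' _ (nU_natCast_mem N x y z),
    normPet_slash_eq_avg hD hD0 hF hF' hFG hFG' (diagP_mem_Comm N p _ _ _ _ _) h]

/-- The eigenform stands in the conjugate-linear slot, so the constant comes out conjugated;
`conj_mul_normPet` removes the conjugation. -/
theorem normPet_Wp_of_avg (hD : IsFundDomain (N * p) D) (hD0 : muH2 D ≠ 0) (hpN : ¬ p ∣ N)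
    (α β : ℤ) (hαβ : (p : ℤ) * α - N * β = 1)
    (hF : F ∈ petSpace (N * p) k) (hFG : ∀ γ ∈ Gamma0 N, slash k γ F = F)
    (hF' : F' ∈ petSpace (N * p) k) (hFG' : ∀ γ ∈ Gamma0 N, slash k γ F' = F') {c : ℂ}
    (h : avg k (Gamma0 N) F (diagP p 0 0 1 1 rfl) = c • F) :
    normPet (N * p) k F' (slash k (Wp N p α β hαβ) F) = c * normPet (N * p) k F' F := by
  have h' := (avg_of_doubleCoset_eq (k := k) (F := F) (doubleCoset_upper hpN 1)).trans h
  rw [slash_Wp α β hαβ hFG, ← normPet_conj hD hD0 (upper_mem_petSpace hF 1) hF',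
    normPet_slash_eq_avg hD hD0 hF hF' hFG hFG' (diagP_mem_Comm N p _ _ _ _ _) h',
    ← conj_mul_normPet hD hD0 hpN hF hFG hF' (slash_of_le hFG') h, map_mul, Complex.conj_conj,
    normPet_conj hD hD0 hF hF']

/-- U_S(p) contributes d on the left and W_p contributes d' on the right. Moving d' across turns it
into a second d, whence diag(1,1,p²,p²). -/
theorem normPet_US_Wp_of_avg (hD : IsFundDomain (N * p) D) (hD0 : muH2 D ≠ 0)
    (α β : ℤ) (hαβ : (p : ℤ) * α - N * β = 1)
    (hF : F ∈ petSpace (N * p) k) (hFG : ∀ γ ∈ Gamma0 N, slash k γ F = F)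
    (hF' : F' ∈ petSpace (N * p) k) (hFG' : ∀ γ ∈ Gamma0 N, slash k γ F' = F') {c : ℂ}
    (h : avg k (Gamma0 N) F (diagP p 0 0 2 2 rfl) = c • F) :
    normPet (N * p) k (US N p k F) (slash k (Wp N p α β hαβ) F') =
      (p : ℂ) ^ k * (c * normPet (N * p) k F F') := by
  rw [normPet_US_left hD hD0 hF (slash_of_le hFG)
    (slash_mem_petSpace hF' (Wp_mem_Comm_mul α β hαβ)) fun x y z =>
      slash_slash_Wp α β hαβ (slash_of_le hFG') _ (nU_natCast_mem _ x y z), slash_Wp α β hαβ hFG',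
    ← normPet_lower_left hD hD0 (lower_mem_petSpace hF 1) hF', ← slash_mul, diagP_mul_diagP,
    normPet_slash_eq_avg hD hD0 hF hF' hFG hFG' (diagP_mem_Comm N p _ _ _ _ _) h]

/-- Conjugating the translations by W_p keeps them in Γ₀(Np), so they may be moved to the right of
W_p and absorbed by B. -/
theorem normPet_Wp_US_left (hD : IsFundDomain (N * p) D) (hD0 : muH2 D ≠ 0)
    (α β : ℤ) (hαβ : (p : ℤ) * α - N * β = 1)
    (hF : F ∈ petSpace (N * p) k) (hFH : ∀ γ ∈ Gamma0 (N * p), slash k γ F = F)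
    (hB : B ∈ petSpace (N * p) k) (hBH : ∀ γ ∈ Gamma0 (N * p), slash k γ B = B) :
    normPet (N * p) k (slash k (Wp N p α β hαβ) (US N p k F)) B =
      (p : ℂ) ^ k * normPet (N * p) k (slash k (diagP p 0 0 1 1 rfl * Wp N p α β hαβ) F) B := by
  have hW := Wp_mem_Comm_mul (N := N) (p := p) α β hαβ
  have hdW : diagP p 0 0 1 1 rfl * Wp N p α β hαβ ∈ Comm (N * p) :=
    mul_mem (diagP_mem_Comm _ p _ _ _ _ _) hW
  have hmem : ∀ S : ZMod p × ZMod p × ZMod p, slash k (Wp N p α β hαβ)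
      (slash k (diagP p 0 0 1 1 rfl * nU S.1.val S.2.1.val S.2.2.val) F) ∈ petSpace (N * p) k :=
    fun S => slash_mem_petSpace (slash_mem_petSpace hF (lower_mul_nU_mem_Comm S)) hW
  rw [US, US_eq_sum (dvd_mul_left p N) hFH, slash_smul, slash_sum, normPet_smul_left hD hD0 _
    (Submodule.sum_mem _ fun S _ => hmem S) hB, normPet_sum_left hD hD0 hmem hB
    (c := normPet (N * p) k (slash k (diagP p 0 0 1 1 rfl * Wp N p α β hαβ) F) B), ← mul_assoc,
    prime_zpow_mul_card]
  intro S
  have h1 := Wp_inv_conj_mem α β hαβ (nU_natCast_mem (N * p) S.1.val S.2.1.val S.2.2.val)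
  have h2 : diagP p 0 0 1 1 rfl * nU S.1.val S.2.1.val S.2.2.val * Wp N p α β hαβ =
      diagP p 0 0 1 1 rfl * Wp N p α β hαβ *
        ((Wp N p α β hαβ)⁻¹ * nU S.1.val S.2.1.val S.2.2.val * Wp N p α β hαβ) := by group
  rw [← slash_mul, h2, slash_mul, normPet_slash_left_of_invariant hD hD0
    (slash_mem_petSpace hF hdW) hB (Gamma0_le_Comm _ h1) (hBH _ h1)]

/-- The left side contributes d W_p, hence diag(p²,p²,1,1) up to factors that F and F'|U_S(p)
absorb. The resulting function is fixed by integral translations, so U_S(p) on the right contributes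
d, and its adjoint d' completes diag(p³,p³,1,1). -/
theorem normPet_US_Wp_US_of_avg (hD : IsFundDomain (N * p) D) (hD0 : muH2 D ≠ 0) (hpN : ¬ p ∣ N)
    (α β : ℤ) (hαβ : (p : ℤ) * α - N * β = 1)
    (hF : F ∈ petSpace (N * p) k) (hFG : ∀ γ ∈ Gamma0 N, slash k γ F = F)
    (hF' : F' ∈ petSpace (N * p) k) (hFG' : ∀ γ ∈ Gamma0 N, slash k γ F' = F') {c : ℂ}
    (h : avg k (Gamma0 N) F (diagP p 0 0 3 3 rfl) = c • F) :
    normPet (N * p) k (slash k (Wp N p α β hαβ) (US N p k F)) (US N p k F') =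
      (p : ℂ) ^ k * ((p : ℂ) ^ k * (c * normPet (N * p) k F F')) := by
  have h' := (avg_of_doubleCoset_eq (k := k) (F := F) (doubleCoset_upper hpN 3)).trans h
  have hFH := slash_of_le (p := p) hFG
  have hFH' := slash_of_le (p := p) hFG'
  have hU := US_mem_petSpace hF' hFH'
  obtain ⟨g, hg, g', hg', hgg⟩ := lower_mul_Wp (N := N) (p := p) α β hαβ
  rw [normPet_Wp_US_left hD hD0 α β hαβ hF hFH hU fun γ hγ => slash_US hFH' hγ, hgg, slash_mul,
    slash_mul_left hFG hg, normPet_slash_left_of_invariant hD hD0 (upper_mem_petSpace hF 2) hU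
      (Gamma0_le_Comm _ hg') (slash_US hFH' hg'),
    normPet_US_right hD hD0 hF' hFH' (upper_mem_petSpace hF 2) fun x y z =>
      slash_stabIn hFG (Γ₂ := Gamma0 N) (by rw [stabIn_diagP_upper]; exact nU_natCast_mem _ x y z),
    ← normPet_upper_left hD hD0 (upper_mem_petSpace hF 2) hF', ← slash_mul, diagP_mul_diagP,
    normPet_slash_eq_avg hD hD0 hF hF' hFG hFG' (diagP_mem_Comm N p _ _ _ _ _) h']

theorem upper_mul_nL_mem_Comm (x : ZMod p × ZMod p × ZMod p) :
    diagP p 1 1 0 0 rfl * nL (((N * p : ℕ) * x.1.val : ℤ) : ℝ)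
      (((N * p : ℕ) * x.2.1.val : ℤ) : ℝ) (((N * p : ℕ) * x.2.2.val : ℤ) : ℝ) ∈ Comm (N * p) :=
  mul_mem (diagP_mem_Comm _ p _ _ _ _ _) (Gamma0_le_Comm _
    (nL_mem (dvd_mul_right _ _) (dvd_mul_right _ _) (dvd_mul_right _ _)))

theorem USstar_mem_petSpace (hA : A ∈ petSpace (N * p) k)
    (hAH : ∀ γ ∈ Gamma0 (N * p), slash k γ A = A) : USstar N p k A ∈ petSpace (N * p) k := by
  rw [USstar, dcOp_eq hAH (isTransversal_USstar (N * p) (dvd_mul_left p N))]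
  exact Submodule.smul_mem _ _ (Submodule.sum_mem _ fun x _ =>
    slash_mem_petSpace hA (upper_mul_nL_mem_Comm x))

theorem normPet_USstar_left (hD : IsFundDomain (N * p) D) (hD0 : muH2 D ≠ 0)
    (hA : A ∈ petSpace (N * p) k) (hAH : ∀ γ ∈ Gamma0 (N * p), slash k γ A = A)
    (hB : B ∈ petSpace (N * p) k) (hBH : ∀ γ ∈ Gamma0 (N * p), slash k γ B = B) :
    normPet (N * p) k (USstar N p k A) B =
      (p : ℂ) ^ k * normPet (N * p) k (slash k (diagP p 1 1 0 0 rfl) A) B := by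
  have hmem := fun x => slash_mem_petSpace hA (upper_mul_nL_mem_Comm (N := N) (p := p) x)
  rw [USstar, dcOp_eq hAH (isTransversal_USstar (N * p) (dvd_mul_left p N)),
    normPet_smul_left hD hD0 _ (Submodule.sum_mem _ fun x _ => hmem x) hB,
    normPet_sum_left hD hD0 hmem hB
      (c := normPet (N * p) k (slash k (diagP p 1 1 0 0 rfl) A) B), ← mul_assoc, simil_diagP,
    ← prime_zpow_mul_card (p := p) k]
  · simp
  intro x
  have hx : nL (((N * p : ℕ) * x.1.val : ℤ) : ℝ) (((N * p : ℕ) * x.2.1.val : ℤ) : ℝ)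
      (((N * p : ℕ) * x.2.2.val : ℤ) : ℝ) ∈ Gamma0 (N * p) :=
    nL_mem (dvd_mul_right _ _) (dvd_mul_right _ _) (dvd_mul_right _ _)
  rw [slash_mul, normPet_slash_left_of_invariant hD hD0 (upper_mem_petSpace hA 1) hB
    (Gamma0_le_Comm _ hx) (hBH _ hx)]

theorem normPet_Tr_left (hD : IsFundDomain (N * p) D) (hD0 : muH2 D ≠ 0) (hpN : ¬ p ∣ N)
    (hA : A ∈ petSpace (N * p) k) (hAH : ∀ γ ∈ Gamma0 (N * p), slash k γ A = A)
    (hB : B ∈ petSpace (N * p) k) (hBG : ∀ γ ∈ Gamma0 N, slash k γ B = B) :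
    normPet (N * p) k (Tr N p k A) B = muIndex N p * normPet (N * p) k A B := by
  obtain ⟨α, β, h⟩ := exists_bezout (p := p) hpN 1
  rw [pow_one] at h
  have hC : Comm (N * p) = Comm N := Comm_eq
  have hmem : ∀ i, lagRep N p α β h i ∈ Comm (N * p) := fun i =>
    hC ▸ Gamma0_le_Comm N (lagRep_mem α β h i)
  rw [dcOp_one_eq_sum hAH α β h hpN, normPet_sum_left hD hD0
    (fun i => slash_mem_petSpace hA (hmem i)) hB (c := normPet (N * p) k A B), card_lagIdx,
    ← muIndex_eq hpN]
  exact fun i => normPet_slash_left_of_invariant hD hD0 hA hB (hmem i) (hBG _ (lagRep_mem α β h i))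

theorem muIndex_ne_zero (hpN : ¬ p ∣ N) : (muIndex N p : ℂ) ≠ 0 := by
  rw [muIndex_eq hpN]
  exact_mod_cast (by positivity : 1 + ((p + 1) * p + p ^ 3) ≠ 0)

/-- Since (p-1)μ(p) = p⁴ - 1, the coefficient of T_S(p,p,p,p) collapses to p²μ(p), and that operator
is multiplication by p^(2k-6). -/
theorem Tr_USstar_US_of_TS_eigen (hF : ∀ γ ∈ Gamma0 N, slash k γ F = F) (hpN : ¬ p ∣ N) {lam : ℂ}
    (hl : TS N p k F = lam • F) : Tr N p k (USstar N p k (US N p k F)) =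
      ((p : ℂ) ^ 2 * ((p : ℂ) - 1) * lam ^ 2 + (p : ℂ) ^ (2 * k - 4) * muIndex N p) • F := by
  have hp : (p : ℂ) ≠ 0 := Nat.cast_ne_zero.mpr (Fact.out : p.Prime).ne_zero
  have h1 : TS N p k (lam • F) = lam • TS N p k F := by
    rw [TS_eq_avg (fun γ hγ => by rw [slash_smul, hF γ hγ]) hpN, TS_eq_avg hF hpN,
      avg_smul hF (diagP_mem_Comm N p _ _ _ _ _), smul_comm]
  have h2 : (p : ℂ) ^ (2 * k - 4) = (p : ℂ) ^ 2 * ((p : ℂ) ^ (k - 3)) ^ 2 := by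
    rw [← zpow_natCast, ← zpow_natCast, ← _root_.zpow_mul, ← zpow_add₀ hp]
    congr 1
    push_cast
    ring
  have hμ : (muIndex N p : ℂ) = 1 + ((p + 1) * p + p ^ 3) := by
    rw [muIndex_eq hpN]
    push_cast
    ring
  rw [Tr_USstar_US_eq_TS hF hpN, hl, h1, hl, TSdiag_scal_eq hF, h2, hμ]
  module

/-- Against a form of level N the trace is multiplication by the index, and U_S(p)^* is the adjoint
of U_S(p) because d' is the adjoint of d and both have p³ cosets. -/
theorem normPet_US_US (hD : IsFundDomain (N * p) D) (hD0 : muH2 D ≠ 0) (hpN : ¬ p ∣ N)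
    (hF : F ∈ petSpace (N * p) k) (hFG : ∀ γ ∈ Gamma0 N, slash k γ F = F)
    (hF' : F' ∈ petSpace (N * p) k) (hFG' : ∀ γ ∈ Gamma0 N, slash k γ F' = F') :
    muIndex N p * normPet (N * p) k (US N p k F') (US N p k F) =
      normPet (N * p) k (Tr N p k (USstar N p k (US N p k F'))) F := by
  have hFH := slash_of_le (p := p) hFG
  have hFH' := slash_of_le (p := p) hFG'
  have hU := US_mem_petSpace hF' hFH'
  have hUH := fun γ hγ => slash_US hFH' (γ := γ) hγ
  have h1 := isTransversal_USstar (p := p) (N * p) (dvd_mul_left p N)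
  have hinv : ∀ γ ∈ Gamma0 (N * p), slash k γ (USstar N p k (US N p k F')) =
      USstar N p k (US N p k F') := fun γ hγ => by
    rw [USstar, dcOp_eq hUH h1, slash_smul, slash_sum_doubleCoset hUH h1 hγ]
  rw [normPet_Tr_left hD hD0 hpN (USstar_mem_petSpace hU hUH) hinv hF hFG,
    normPet_USstar_left hD hD0 hU hUH hF hFH, normPet_upper_left hD hD0 hU hF,
    normPet_US_right hD hD0 hF hFH hU fun x y z => hUH _ (nU_natCast_mem _ x y z)]

theorem normPet_US_US_of_TS_eigen (hD : IsFundDomain (N * p) D) (hD0 : muH2 D ≠ 0) (hpN : ¬ p ∣ N)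
    (hF : F ∈ petSpace (N * p) k) (hFG : ∀ γ ∈ Gamma0 N, slash k γ F = F)
    (hF' : F' ∈ petSpace (N * p) k) (hFG' : ∀ γ ∈ Gamma0 N, slash k γ F' = F') {lam : ℂ}
    (hl : TS N p k F' = lam • F') :
    normPet (N * p) k (US N p k F) (US N p k F') = (muIndex N p : ℂ)⁻¹ *
      ((p : ℂ) ^ 2 * ((p : ℂ) - 1) * lam ^ 2 + (p : ℂ) ^ (2 * k - 4) * muIndex N p) *
      normPet (N * p) k F F' := by
  have hp : (p : ℂ) ≠ 0 := Nat.cast_ne_zero.mpr (Fact.out : p.Prime).ne_zero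
  have hq : (p : ℂ) ^ (k - 3) ≠ 0 := zpow_ne_zero _ hp
  have hμ := muIndex_ne_zero (N := N) (p := p) hpN
  have hFH := slash_of_le (p := p) hFG
  have hFH' := slash_of_le (p := p) hFG'
  have h1 := normPet_US_US hD hD0 hpN hF hFG hF' hFG'
  rw [Tr_USstar_US_of_TS_eigen hFG' hpN hl, normPet_smul_left hD hD0 _ hF' hF] at h1
  have h2 := conj_mul_normPet hD hD0 hpN hF' hFG' hF hFH (avg_of_TS_eigen hFG' hpN hl)
  have h3 : (starRingEnd ℂ) lam * normPet (N * p) k F' F = lam * normPet (N * p) k F' F := by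
    simp only [map_div₀, map_mul, map_zpow₀, Complex.conj_natCast] at h2
    field_simp at h2
    linear_combination h2
  have h4 := congrArg (starRingEnd ℂ) h1
  have h5 := congrArg (starRingEnd ℂ) h3
  simp only [map_mul, map_add, map_sub, map_pow, map_zpow₀, map_one, Complex.conj_natCast,
    Complex.conj_conj] at h4 h5
  rw [normPet_conj hD hD0 hF' hF] at h4 h5
  rw [normPet_conj hD hD0 (US_mem_petSpace hF' hFH') (US_mem_petSpace hF hFH)] at h4
  rw [mul_assoc, eq_inv_mul_iff_mul_eq₀ hμ, h4]
  -- The square of conj(λ) is replaced by λ² through the factorisation of their difference, one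
  -- factor of which annihilates the product.
  linear_combination (-(p : ℂ) ^ 2 * ((p : ℂ) - 1) * (lam + (starRingEnd ℂ) lam)) * h5

end Adjoint

end

end

end SiegelTwo

/-! ### The Petersson products and operator identities for cusp forms -/

theorem mainTheorem10 (N p : ℕ) [NeZero N] [Fact p.Prime] (hpN : ¬ p ∣ N) (k : ℤ)
    (α β : ℤ) (hαβ : p * α - N * β = 1)
    (D : Set H2) (hD : IsFundDomain (N * p) D)
    (F F' : H2 → ℂ) (hF : IsCuspForm N k F) (hF' : IsCuspForm N k F') :
    -- the product of `F | U_S(p)` and `F' | U_S(p)`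
    (∀ lam : ℂ, TS N p k F' = lam • F' →
      petersson D k (US N p k F) (US N p k F') =
        (muIndex N p : ℂ)⁻¹ *
          ((p : ℂ) ^ 2 * ((p : ℂ) - 1) * lam ^ 2 + (p : ℂ) ^ (2 * k - 4) * muIndex N p) *
          petersson D k F F') ∧
    -- the product of `F'` and `F | W_p`
    (∀ lam : ℂ, TS N p k F = lam • F →
      petersson D k F' (slash k (Wp N p α β hαβ) F) =
        (p : ℂ) ^ (3 - k) * lam * (muIndex N p : ℂ)⁻¹ * petersson D k F' F) ∧
    -- the product of `F | U_S(p)` and `F'`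
    (∀ lam : ℂ, TS N p k F = lam • F →
      petersson D k (US N p k F) F' =
        (p : ℂ) ^ 3 * lam * (muIndex N p : ℂ)⁻¹ * petersson D k F F') ∧
    -- the product of `F | U_S(p)` and `F' | W_p`
    (∀ lam lam' : ℂ, TS N p k F = lam • F → TS' N p k F = lam' • F →
      petersson D k (US N p k F) (slash k (Wp N p α β hαβ) F') =
        (p : ℂ) ^ (3 - k) * (muIndex N p : ℂ)⁻¹ *
          (lam ^ 2 - (1 + 1 / (p : ℂ)) * lam' + (p : ℂ) ^ (2 * k - 5) * ((p : ℂ) + 1)) *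
          petersson D k F F') ∧
    -- the product of `F | U_S(p) | W_p` and `F' | U_S(p)`
    (∀ lam lam' : ℂ, TS N p k F = lam • F → TS' N p k F = lam' • F →
      petersson D k (slash k (Wp N p α β hαβ) (US N p k F)) (US N p k F') =
        lam / ((p : ℂ) ^ (k - 3) * muIndex N p) *
          (lam ^ 2 - (2 + 1 / (p : ℂ)) * lam' +
            (p : ℂ) ^ (2 * k - 5) * ((p : ℂ) + 1) * ((p : ℂ) + 2)) *
          petersson D k F F') ∧
    -- the operator `U_S(p) U_S(p)^* Tr` in terms of double cosets of level `N`
    Tr N p k (USstar N p k (US N p k F)) =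
      ((p : ℂ) ^ 2 * ((p : ℂ) ^ 2 - 1)) • TSdiag N p k 0 1 2 1 rfl F +
      ((p : ℂ) ^ 2 * ((p : ℂ) - 1)) • TSdiag N p k 0 0 2 2 rfl F +
      ((p : ℂ) ^ 3 * muIndex N p) • TSdiag N p k 1 1 1 1 rfl F ∧
    Tr N p k (USstar N p k (US N p k F)) =
      ((p : ℂ) ^ 2 * ((p : ℂ) - 1)) • TS N p k (TS N p k F) +
      (-((p : ℂ) ^ 2 * ((p : ℂ) ^ 4 - 1)) + (p : ℂ) ^ 3 * muIndex N p) •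
        TSdiag N p k 1 1 1 1 rfl F := by
  have hp : (p : ℂ) ≠ 0 := Nat.cast_ne_zero.mpr (Fact.out : p.Prime).ne_zero
  have hμ := muIndex_ne_zero (N := N) (p := p) hpN
  have hA : F ∈ petSpace (N * p) k := hF.mem_petSpace
  have hA' : F' ∈ petSpace (N * p) k := hF'.mem_petSpace
  have hG := hF.slash_eq
  have hG' := hF'.slash_eq
  have hH := slash_of_le (p := p) hG
  have hH' := slash_of_le (p := p) hG'
  have hUA := US_mem_petSpace hA hH
  have hUA' := US_mem_petSpace hA' hH'
  have hUH := fun γ hγ => slash_US hH (γ := γ) hγ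
  have hUH' := fun γ hγ => slash_US hH' (γ := γ) hγ
  have hW := Wp_mem_Comm_mul (N := N) (p := p) α β hαβ
  have hk : (p : ℂ) ^ k = (p : ℂ) ^ 3 * (p : ℂ) ^ (k - 3) := by
    rw [← zpow_natCast, ← zpow_add₀ hp]
    congr 1
    push_cast
    ring
  have hk3 : (p : ℂ) ^ (3 - k) = ((p : ℂ) ^ (k - 3))⁻¹ := by
    rw [← _root_.zpow_neg, neg_sub]
  have hk5 : (p : ℂ) ^ (2 * k - 5) = p * ((p : ℂ) ^ (k - 3)) ^ 2 := by
    rw [← zpow_natCast, ← _root_.zpow_mul, ← zpow_one_add₀ hp]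
    congr 1
    push_cast
    ring
  have hq : (p : ℂ) ^ (k - 3) ≠ 0 := zpow_ne_zero _ hp
  rw [← and_assoc, ← and_assoc, ← and_assoc, ← and_assoc]
  refine ⟨?_, Tr_USstar_US_eq_TSdiag hG hpN, Tr_USstar_US_eq_TS hG hpN⟩
  rw [and_assoc, and_assoc, and_assoc]
  -- For a null set D all the integrals vanish, so positivity of the covolume need not be proved.
  by_cases hD0 : muH2 D = 0
  · have h0 : ∀ A B, petersson D k A B = 0 := fun A B => MeasureTheory.setIntegral_measure_zero _ hD0
    simp only [h0, mul_zero, implies_true, and_self]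
  -- All functions here are fixed by Γ₀(Np), so each integral is the volume of D times the mean and
  -- the volume cancels between the two sides.
  have key := fun {A B : H2 → ℂ} => petersson_eq_mul_normPet (A := A) (B := B) (k := k) hD hD0
  refine ⟨fun lam hl => ?_, fun lam hl => ?_, fun lam hl => ?_, fun lam lam' hl hl' => ?_,
    fun lam lam' hl hl' => ?_⟩
  · rw [key hUA hUA' hUH hUH', key hA hA' hH hH',
      normPet_US_US_of_TS_eigen hD hD0 hpN hA hG hA' hG' hl]
    ring
  · rw [key hA' (slash_mem_petSpace hA hW) hH' (slash_slash_Wp α β hαβ hH), key hA' hA hH' hH,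
      normPet_Wp_of_avg hD hD0 hpN α β hαβ hA hG hA' hG' (avg_of_TS_eigen hG hpN hl), hk3]
    field_simp
  · rw [key hUA hA' hUH hH', key hA hA' hH hH',
      normPet_US_of_avg hD hD0 hA hG hA' hG' (avg_of_TS_eigen hG hpN hl), hk]
    field_simp
  · rw [key hUA (slash_mem_petSpace hA' hW) hUH (slash_slash_Wp α β hαβ hH'), key hA hA' hH hH',
      normPet_US_Wp_of_avg hD hD0 α β hαβ hA hG hA' hG' (avg_of_TS'_eigen hG hpN hl hl').1, hk, hk3,
      hk5]
    field_simp
  · rw [key (slash_mem_petSpace hUA hW) hUA' (slash_slash_Wp α β hαβ hUH) hUH', key hA hA' hH hH',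
      normPet_US_Wp_US_of_avg hD hD0 hpN α β hαβ hA hG hA' hG' (avg_of_TS'_eigen hG hpN hl hl').2,
      hk, hk5]
    field_simp
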